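/- **Theorem 3.5.** Let $d\ge 2$, write points of $\mathbb R^d$ as $(x,z)\in\mathbb R^{d-1}\times\mathbb R$, let $1<R\le\infty$, $F\in\mathbb R$, and let $g>0$, $\cos\theta_{Y_p},\cos\theta_{Y_c}\in\mathbb R$, $\mu_\pm\ge 0$ be constants with $|\cos\theta_{Y_c}|<1$ and $[\cos\theta_{Y_p}-\mu_+,\cos\theta_{Y_p}+\mu_-]\subset(-1,1)$. Put $C_R=\{1<|x|<R\}$, $C_{R,a}=C_R\cap\{z\le a\}$, $\Gamma_r=\{|x|=r\}$ and $\Gamma_{r,a}=\Gamma_r\cap\{z\le a\}$ ($\Gamma_\infty=\emptyset$); $\Gamma_1$ is the plate and $\Gamma_R$ the container. *Admissible profiles.* For a set $L\subset\overline{C_R}$ of locally finite perimeter let $\Sigma_L$ be its reduced boundary in $C_R$ with outward unit normal $\nu_L$, and let $W_L\subset\Gamma_1$, $V_L\subset\Gamma_R$ be its $BV$-traces. Areas $|\cdot|$ are $(d-1)$-dimensional, and $|S|_T:=|S\setminus T|-|T\setminus S|$. If $R<\infty$, the set $L$ is admissible if it has locally finite perimeter in $\mathbb R^d$, $\mathrm{Vol}(L\setminus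 C_{R,F})=\mathrm{Vol}(C_{R,F}\setminus L)<\infty$, and $|W_L\triangle\Gamma_{1,0}|$, $|V_L\triangle\Gamma_{R,F}|$ are finite; if $R=\infty$, it is admissible if it has locally finite perimeter in $C_\infty$ and $|W_L\triangle\Gamma_{1,0}|<\infty$. *Energy, dissipation, stability.* Set $$\mathcal E[L]=\mathcal S_R(L)-\cos\theta_{Y_p}\,|W_L|_{\Gamma_{1,0}}-\cos\theta_{Y_c}\,|V_L|_{\Gamma_{R,F}}+\int_{L\triangle C_{R,F}}g|z-F|,$$ where $\mathcal S_R(L)=|\Sigma_L|$ if $R<\infty$ and $\mathcal S_\infty(L)=\int_{\Sigma_L}(1-e_z\cdot\nu_L)\,d\mathcal H^{d-1}$, the container term being absent if $R=\infty$; and $$\mathrm{Diss}(L,L')=\mu_+|W_{L'}\setminus W_L|+\mu_-|W_L\setminus W_{L'}|.$$ An admissible $L$ is globally stable if $\mathcal E[L]\le\mathcal E[L']+\mathrm{Diss}(L,L')$ for every admissible $L'$. Let $L$ be globally stable and normalized on null sets so that $L$ has positive volume near each point of $\overline{L\cap C_R}$, and $C_R\setminus L$ has positive volume near each point of $\overline{C_R\setminus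 L}$. *Viscosity solutions.* Let $L^*=\overline{L\cap C_R}$ and $L_*=\overline{C_R}\setminus\overline{C_R\setminus L}$. A test region $\Phi$ is the subgraph $\{y_d<\varphi(y')\}$ of a smooth function $\varphi:\mathbb R^{d-1}\to\mathbb R$ in some Cartesian coordinates $y=(y',y_d)$; its outward normal is $\nu_\Phi$, and $H_\Phi=\nabla\cdot\big(\nabla\varphi/\sqrt{1+|\nabla\varphi|^2}\big)$. Its contact angle is given by $\cos\theta_\Phi=-\nu_\Phi\cdot\nu$, with $\nu$ the outward normal of $C_R$ ($\nu=-(x/|x|,0)$ on $\Gamma_1$, $\nu=(x/|x|,0)$ on $\Gamma_R$). Boundaries of $L^*$ and $L_*$ are taken relative to $\overline{C_R}$. $\Phi$ touches $L$ from outside (inside) at $p$ if $p\in\partial\Phi$, $p$ lies on the boundary of $L^*$ (of $L_*$), and in some ball around $p$ one has $L^*\subset\overline\Phi$ (respectively $\Phi\cap\overline{C_R}\subset L_*$). **Conclusion.** There is $\lambda\in\mathbb R$, with $\lambda=0$ if $R=\infty$, which is the Lagrange multiplier of $L$, i.e. $$\int_{\Sigma_L}\big(\nabla\cdot\xi-\nu_L\cdot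 D\xi\,\nu_L+g(z-F)\,\xi\cdot\nu_L\big)\,d\mathcal H^{d-1}=\lambda\int_{\Sigma_L}\xi\cdot\nu_L\,d\mathcal H^{d-1}\qquad\text{for all }\xi\in C_c^\infty(C_R;\mathbb R^d),$$ such that $L$ is a viscosity solution of $$-H+g(z-F)=\lambda\ \text{ on the free surface},\qquad \cos\theta\in[\cos\theta_{Y_p}-\mu_+,\cos\theta_{Y_p}+\mu_-]\ \text{ on the plate},\qquad \cos\theta=\cos\theta_{Y_c}\ \text{ on the container},$$ in the following sense. For every test region $\Phi$: * if $\Phi$ touches $L$ from outside at $p=(x_0,z_0)$, then $-H_\Phi(p)+g(z_0-F)\le\lambda$, or $p\in\Gamma_1$ and $\cos\theta_\Phi(p)\le\cos\theta_{Y_p}+\mu_-$, or $p\in\Gamma_R$ and $\cos\theta_\Phi(p)\le\cos\theta_{Y_c}$; * if $\Phi$ touches $L$ from inside at $p=(x_0,z_0)$, then $-H_\Phi(p)+g(z_0-F)\ge\lambda$, or $p\in\Gamma_1$ and $\cos\theta_\Phi(p)\ge\cos\theta_{Y_p}-\mu_+$, or $p\in\Gamma_R$ and $\cos\theta_\Phi(p)\ge\cos\theta_{Y_c}$.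 -/

import Mathlib

namespace Capillary

open MeasureTheory Set Filter Topology
open scoped ENNReal ContDiff RealInnerProductSpace

noncomputable section

/-! ### Ambient space

The ambient space is `ℝ^d` with `d = n + 1`; its points are written `(x, z) ∈ ℝ^n × ℝ`. -/

/-- The horizontal space `ℝ^(d-1)`. -/
abbrev Horiz (n : ℕ) : Type := EuclideanSpace ℝ (Fin n)

/-- The ambient space `ℝ^d`, `d = n + 1`, with its Euclidean norm. -/
abbrev Space (n : ℕ) : Type := EuclideanSpace ℝ (Fin (n + 1))

/-- The horizontal component `x` of `(x, z)`. -/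
def horiz {n : ℕ} (p : Space n) : Horiz n := WithLp.toLp 2 (fun i => p i.castSucc)

/-- The vertical component `z` of `(x, z)`. -/
def height {n : ℕ} (p : Space n) : ℝ := p (Fin.last n)

/-- The point `(x, z)`. -/
def join {n : ℕ} (x : Horiz n) (z : ℝ) : Space n :=
  WithLp.toLp 2 (Fin.snoc (α := fun _ => ℝ) (fun i => x i) z)

/-- The divergence of a vector field on a Euclidean space. -/
def divergence {m : ℕ} (X : EuclideanSpace ℝ (Fin m) → EuclideanSpace ℝ (Fin m))
    (x : EuclideanSpace ℝ (Fin m)) : ℝ :=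
  ∑ i, (fderiv ℝ X x (EuclideanSpace.single i 1)) i

/-! ### Geometry of the plate and the container

`R : EReal` is the container radius, `1 < R ≤ ∞`; the plate has radius `1`. -/

/-- The open region `(B_R × ℝ) \ closure (B_1 × ℝ)` which the liquid may occupy. -/
def region {n : ℕ} (R : EReal) : Set (Space n) :=
  {p | 1 < ‖horiz p‖ ∧ ((‖horiz p‖ : ℝ) : EReal) < R}

/-- The part of the region with `z ≤ a`. -/
def regionBelow {n : ℕ} (R : EReal) (a : ℝ) : Set (Space n) :=
  {p | p ∈ region R ∧ height p ≤ a}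

/-- The lateral surface `∂B_R × ℝ` (empty for `R = ∞`); the surface of the plate is
`thinCyl 1`. -/
def thinCyl {n : ℕ} (R : EReal) : Set (Space n) :=
  {p | ((‖horiz p‖ : ℝ) : EReal) = R}

/-- The part of the lateral surface with `z ≤ a`. -/
def thinCylBelow {n : ℕ} (R : EReal) (a : ℝ) : Set (Space n) :=
  {p | p ∈ thinCyl R ∧ height p ≤ a}

/-! ### Sets of locally finite perimeter, traces -/

/-- The perimeter of `L` in the open set `U`: the supremum of `∫_L div φ` over
`φ ∈ C^1_c(U; ℝ^d)` with `|φ| ≤ 1`. -/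
def perimeter {n : ℕ} (L U : Set (Space n)) : ℝ≥0∞ :=
  ⨆ (φ : Space n → Space n) (_ : ContDiff ℝ 1 φ) (_ : HasCompactSupport φ)
    (_ : tsupport φ ⊆ U) (_ : ∀ x, ‖φ x‖ ≤ 1),
    ENNReal.ofReal (∫ x in L, divergence φ x)

/-- `L` is locally Caccioppoli in the open set `U`. -/
def LocallyCaccioppoli {n : ℕ} (L U : Set (Space n)) : Prop :=
  ∀ V : Set (Space n), IsOpen V → IsCompact (closure V) → closure V ⊆ U → perimeter L V < ⊤

/-- `σ` is the surface measure of the (reduced) boundary of `L` in the open set `U`, and `ν` the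
outward unit normal along it: `∫_L div φ = ∫ φ · ν dσ` for all `φ ∈ C^1_c(U; ℝ^d)`. For a locally
Caccioppoli set this polar decomposition of the distributional gradient of the indicator exists,
and `σ` and (`σ`-almost everywhere) `ν` are unique. -/
structure IsGaussGreen {n : ℕ} (L U : Set (Space n)) (σ : Measure (Space n))
    (ν : Space n → Space n) : Prop where
  null_compl : σ Uᶜ = 0
  finite_on_compacts : ∀ K : Set (Space n), IsCompact K → K ⊆ U → σ K < ⊤
  measurable_normal : Measurable ν
  norm_normal : ∀ᵐ x ∂σ, ‖ν x‖ = 1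
  gauss_green : ∀ φ : Space n → Space n, ContDiff ℝ 1 φ → HasCompactSupport φ → tsupport φ ⊆ U →
    ∫ x in L, divergence φ x = ∫ x, ⟪φ x, ν x⟫ ∂σ

/-- The trace of `L` on a lateral surface `S` of the region: the points of `S` at which `L` has
density one relative to the region. (The `BV` trace of the indicator of `L` takes the values `0`
and `1` almost everywhere, and is the limit of the averages over `B_r(y) ∩ region`.) -/
def trace {n : ℕ} (R : EReal) (S L : Set (Space n)) : Set (Space n) :=
  {y | y ∈ S ∧ Tendsto (fun r : ℝ =>
      volume (L ∩ region R ∩ Metric.ball y r) / volume (region R ∩ Metric.ball y r))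
    (𝓝[>] 0) (𝓝 1)}

/-- The liquid-plate contact set. -/
def plateContact {n : ℕ} (R : EReal) (L : Set (Space n)) : Set (Space n) :=
  trace R (thinCyl 1) L

/-- The liquid-container contact set. -/
def containerContact {n : ℕ} (R : EReal) (L : Set (Space n)) : Set (Space n) :=
  trace R (thinCyl R) L

/-- The `(d-1)`-dimensional area (Hausdorff measure with the Euclidean normalization). -/
def area {n : ℕ} (S : Set (Space n)) : ℝ≥0∞ := μHE[n] S

/-- The area of `S` relative to the reference surface `T`, i.e. `|S \ T| - |T \ S|`. -/
def relArea {n : ℕ} (S T : Set (Space n)) : ℝ := (area (S \ T)).toReal - (area (T \ S)).toReal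

/-! ### Energy, dissipation, global stability -/

/-- The constants of the model: the Bond number, the cosines of the Young angles of the plate and
of the container, and the friction coefficients. -/
structure Parameters where
  g : ℝ
  cosYp : ℝ
  cosYc : ℝ
  muPlus : ℝ
  muMinus : ℝ

/-- The standing (ellipticity) assumptions on the constants. -/
structure Parameters.Elliptic (P : Parameters) : Prop where
  g_pos : 0 < P.g
  cosYc_mem : |P.cosYc| < 1
  muPlus_nonneg : 0 ≤ P.muPlus
  muMinus_nonneg : 0 ≤ P.muMinus
  lower : -1 < P.cosYp - P.muPlus
  upper : P.cosYp + P.muMinus < 1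

/-- The energy of the free surface: its area if `R < ∞`, and the integral of `1 - e_z · ν` over it
if `R = ∞`. (The pair `(σ, ν)` being unique, the infimum is just the common value.) -/
def surfaceEnergy {n : ℕ} (R : EReal) (L : Set (Space n)) : ℝ≥0∞ :=
  open Classical in
  if R = ⊤ then
    ⨅ (σ : Measure (Space n)) (ν : Space n → Space n) (_ : IsGaussGreen L (region R) σ ν),
      ∫⁻ x, ENNReal.ofReal (1 - height (ν x)) ∂σ
  else perimeter L (region R)

/-- The gravitational energy relative to the flat profile `{z ≤ F}`. -/
def gravityEnergy {n : ℕ} (g : ℝ) (R : EReal) (F : ℝ) (L : Set (Space n)) : ℝ≥0∞ :=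
  ∫⁻ p in symmDiff L (regionBelow R F), ENNReal.ofReal (g * |height p - F|)

/-- The total energy. For `R = ∞` the container surface is empty and the container term is `0`. -/
def energy {n : ℕ} (P : Parameters) (R : EReal) (F : ℝ) (L : Set (Space n)) : EReal :=
  ((surfaceEnergy R L + gravityEnergy P.g R F L : ℝ≥0∞) : EReal) +
    ((-P.cosYp * relArea (plateContact R L) (thinCylBelow 1 0)
      - P.cosYc * relArea (containerContact R L) (thinCylBelow R F) : ℝ) : EReal)

/-- The dissipation distance from `L₀` to `L₁`. -/
def dissipation {n : ℕ} (P : Parameters) (R : EReal) (L₀ L₁ : Set (Space n)) : ℝ≥0∞ :=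
  ENNReal.ofReal P.muPlus * area (plateContact R L₁ \ plateContact R L₀) +
    ENNReal.ofReal P.muMinus * area (plateContact R L₀ \ plateContact R L₁)

/-- Admissible liquid profiles for the container radius `R ∈ (1, ∞]` and the forcing `F`. The
volume constraint is imposed only if `R < ∞`. -/
structure Admissible {n : ℕ} (R : EReal) (F : ℝ) (L : Set (Space n)) : Prop where
  measurable : NullMeasurableSet L volume
  subset : L ⊆ closure (region R)
  caccioppoli : R ≠ ⊤ → LocallyCaccioppoli L univ
  caccioppoli_top : R = ⊤ → LocallyCaccioppoli L (region R)
  volume_finite : R ≠ ⊤ → volume (L \ regionBelow R F) < ⊤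
  volume_constraint : R ≠ ⊤ → volume (L \ regionBelow R F) = volume (regionBelow R F \ L)
  plate_above : area (plateContact R L \ thinCylBelow 1 0) < ⊤
  plate_below : area (thinCylBelow 1 0 \ plateContact R L) < ⊤
  container_above : area (containerContact R L \ thinCylBelow R F) < ⊤
  container_below : area (thinCylBelow R F \ containerContact R L) < ⊤

/-- Global stability of an admissible profile. -/
def GloballyStable {n : ℕ} (P : Parameters) (R : EReal) (F : ℝ) (L : Set (Space n)) : Prop :=
  Admissible R F L ∧
    ∀ L' : Set (Space n), Admissible R F L' →
      energy P R F L ≤ energy P R F L' + (dissipation P R L L' : EReal)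

/-- The usual choice of a representative up to null sets: near each point of the closure of `L`
the set `L` has positive volume, and likewise for the complement of `L` in the region. -/
def IsNormalized {n : ℕ} (R : EReal) (L : Set (Space n)) : Prop :=
  (∀ x ∈ closure (L ∩ region R), ∀ r > 0, 0 < volume (L ∩ region R ∩ Metric.ball x r)) ∧
    ∀ x ∈ closure (region R \ L), ∀ r > 0, 0 < volume ((region R \ L) ∩ Metric.ball x r)

/-- `lam` is the Lagrange multiplier of `L`: the first variation of area plus gravity along the
free surface is `lam` times the first variation of volume, i.e. `-H + g (z - F) = lam` in the sense
of distributions. -/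
def IsLagrangeMultiplier {n : ℕ} (P : Parameters) (R : EReal) (F : ℝ) (L : Set (Space n))
    (lam : ℝ) : Prop :=
  ∃ (σ : Measure (Space n)) (ν : Space n → Space n), IsGaussGreen L (region R) σ ν ∧
    ∀ ξ : Space n → Space n, ContDiff ℝ ∞ ξ → HasCompactSupport ξ → tsupport ξ ⊆ region R →
      ∫ p, (divergence ξ p - ⟪ν p, fderiv ℝ ξ p (ν p)⟫
          + P.g * (height p - F) * ⟪ξ p, ν p⟫) ∂σ
        = lam * ∫ p, ⟪ξ p, ν p⟫ ∂σ

/-! ### Test regions -/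

/-- A test region: in suitable Cartesian coordinates, the subgraph of a smooth function. -/
structure TestRegion (n : ℕ) where
  chart : Space n ≃ᵃⁱ[ℝ] Space n
  graph : Horiz n → ℝ
  smooth : ContDiff ℝ ∞ graph

/-- The test region as a set. -/
def TestRegion.carrier {n : ℕ} (Φ : TestRegion n) : Set (Space n) :=
  {p | height (Φ.chart p) < Φ.graph (horiz (Φ.chart p))}

/-- The mean curvature `∇ · (∇φ / √(1 + |∇φ|²))` of the boundary of the subgraph of `φ`
(negative for convex subgraphs). -/
def graphMeanCurvature {n : ℕ} (φ : Horiz n → ℝ) (x : Horiz n) : ℝ :=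
  divergence (fun y => (1 / √(1 + ‖gradient φ y‖ ^ 2)) • gradient φ y) x

/-- The mean curvature of the boundary of a test region at its point `p`. -/
def TestRegion.meanCurvature {n : ℕ} (Φ : TestRegion n) (p : Space n) : ℝ :=
  graphMeanCurvature Φ.graph (horiz (Φ.chart p))

/-- The outward unit normal of a test region at its boundary point `p`: the vector
`(-∇φ, 1) / √(1 + |∇φ|²)` in the coordinates of the graph. -/
def TestRegion.normal {n : ℕ} (Φ : TestRegion n) (p : Space n) : Space n :=
  Φ.chart.linearIsometryEquiv.symm
    ((1 / √(1 + ‖gradient Φ.graph (horiz (Φ.chart p))‖ ^ 2)) •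
      join (-gradient Φ.graph (horiz (Φ.chart p))) 1)

/-- The horizontal unit vector pointing away from the axis. -/
def radial {n : ℕ} (p : Space n) : Space n := join (‖horiz p‖⁻¹ • horiz p) 0

/-- The cosine of the contact angle, measured inside the test region, with the plate: minus the
product of the normal of the test region with the outward normal `-radial` of the region. -/
def TestRegion.cosPlate {n : ℕ} (Φ : TestRegion n) (p : Space n) : ℝ :=
  -⟪Φ.normal p, -radial p⟫

/-- The cosine of the contact angle, measured inside the test region, with the container: minus the
product of the normal of the test region with the outward normal `radial` of the region. -/
def TestRegion.cosContainer {n : ℕ} (Φ : TestRegion n) (p : Space n) : ℝ :=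
  -⟪Φ.normal p, radial p⟫

/-! ### Viscosity solutions

All topological notions for profiles are relative to the closure of the region, so that the wetted
parts of the plate and of the container do not count as boundary of the liquid. -/

/-- The upper semicontinuous envelope `L^*`. -/
def upperEnvelope {n : ℕ} (R : EReal) (L : Set (Space n)) : Set (Space n) :=
  closure (L ∩ region R)

/-- The lower semicontinuous envelope `L_*`. -/
def lowerEnvelope {n : ℕ} (R : EReal) (L : Set (Space n)) : Set (Space n) :=
  closure (region R) \ closure (region R \ L)

/-- `Φ` touches `L` from outside at `p`: near `p` the set `L^*` is contained in (the closure of)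
`Φ`, and `p` lies on the boundary of both. -/
def TouchesFromOutside {n : ℕ} (R : EReal) (L : Set (Space n)) (Φ : TestRegion n)
    (p : Space n) : Prop :=
  p ∈ frontier Φ.carrier ∧
    p ∈ upperEnvelope R L ∧ p ∈ closure (region R \ upperEnvelope R L) ∧
    ∃ r > 0, upperEnvelope R L ∩ Metric.ball p r ⊆ closure Φ.carrier

/-- `Φ` touches `L` from inside at `p`: near `p`, inside the closed region, `Φ` is contained in
`L_*`, and `p` lies on the boundary of both. -/
def TouchesFromInside {n : ℕ} (R : EReal) (L : Set (Space n)) (Φ : TestRegion n)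
    (p : Space n) : Prop :=
  p ∈ frontier Φ.carrier ∧
    p ∈ closure (lowerEnvelope R L) ∧ p ∉ lowerEnvelope R L ∧
    ∃ r > 0, Φ.carrier ∩ closure (region R) ∩ Metric.ball p r ⊆ lowerEnvelope R L

/-- Viscosity subsolutions of the Euler–Lagrange system: at a point of touching from outside
`-H + g (z - F) ≤ lam`, or the point is on a lateral surface and the contact angle condition holds
in the corresponding direction. -/
def IsViscositySubsolution {n : ℕ} (P : Parameters) (R : EReal) (F lam : ℝ)
    (L : Set (Space n)) : Prop :=
  ∀ (Φ : TestRegion n) (p : Space n), TouchesFromOutside R L Φ p →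
    -Φ.meanCurvature p + P.g * (height p - F) ≤ lam ∨
      (p ∈ thinCyl 1 ∧ Φ.cosPlate p ≤ P.cosYp + P.muMinus) ∨
      (p ∈ thinCyl R ∧ Φ.cosContainer p ≤ P.cosYc)

/-- Viscosity supersolutions of the Euler–Lagrange system. -/
def IsViscositySupersolution {n : ℕ} (P : Parameters) (R : EReal) (F lam : ℝ)
    (L : Set (Space n)) : Prop :=
  ∀ (Φ : TestRegion n) (p : Space n), TouchesFromInside R L Φ p →
    lam ≤ -Φ.meanCurvature p + P.g * (height p - F) ∨
      (p ∈ thinCyl 1 ∧ P.cosYp - P.muPlus ≤ Φ.cosPlate p) ∨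
      (p ∈ thinCyl R ∧ P.cosYc ≤ Φ.cosContainer p)

/-- Viscosity solutions of the Euler–Lagrange system. -/
def IsViscositySolution {n : ℕ} (P : Parameters) (R : EReal) (F lam : ℝ)
    (L : Set (Space n)) : Prop :=
  IsViscositySubsolution P R F lam L ∧ IsViscositySupersolution P R F lam L

end

end Capillary

/-!
A stable profile `L` is compared with two kinds of competitors. Since `σ` and the perimeter are only
known through test fields, all areas are estimated by duality: the area of a competitor is tested
against a field `φ`, and from `φ` a field is built which is admissible for `L`
(`IsStable.comparison`).

*Multiplier.* The shears `x ↦ x + s f(x) e` change the volume by an amount exactly linear in `s`.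
The Piola transform of a test field bounds the area of the sheared profile up to `O(s²)`
(`IsShear.integral_image_divergence_le`), so the first variation vanishes along shears preserving
the volume, and it is a multiple `lam` of the variation of the volume
(`IsStable.exists_multiplier`). For `R = ∞` there is no volume constraint, and `lam = 0`.

*Viscosity property.* Suppose that a test region touches `L` from outside at `p` and that all
alternatives fail. Bending its defining function by `‖· - p‖ ^ 4` gives a function `u` with
`L ⊆ {u ≤ -‖· - p‖ ^ 4}` near `p`, with unit normal field `X = ∇u/|∇u|`
(`TestRegion.exists_isTouching`). Cut off the small cap `D = L ∩ {u > -δ}`. The field `X` calibrates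
the level surface: the free surface loses at least `∫_D div X` plus the flux of `X` through the part
of the walls wetted by `D` (`IsTouching.integral_div_sdiff_cap_le`). As the contact angle condition
fails strictly, this flux exceeds the change of the wetting energy and the dissipation
(`IsStable.hasGain_plate`, `IsStable.hasGain_container`); as `div X(p) = -H`, the failure of the curvature condition leaves a gain of order `|D|` after the volume `|D|` has been
restored far from `p`, at the cost `lam |D| + O(|D|²)` (`IsStable.false_of_touching`). Touching from
inside is the same argument for the air `region R \ L`; the sign `sideSign` treats both at once.

*Measure theory.* Three facts are proved from scratch: the existence of `(σ, ν)` for locally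
Caccioppoli sets; the zero-one law, by which almost every point of the walls has density zero or one
relative to `L`, from the relative isoperimetric inequality in half balls and the mutual singularity
of `σ` and the area of the walls (`zero_one_of_decay`, `WallChart.ae_trace`); and the convergence of
the flux of the cutoffs of the region to the area of the trace
(`WallChart.tendsto_lintegral_wallFlux`).
-/

namespace Capillary

open MeasureTheory Set Filter Topology Metric
open scoped ENNReal ContDiff RealInnerProductSpace

noncomputable section

/-! ### Test fields and the divergence -/

/-- The `C¹` vector fields with compact support in `U`, the test fields of the perimeter. -/
structure IsTest {n : ℕ} (U : Set (Space n)) (φ : Space n → Space n) : Prop where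
  contDiff : ContDiff ℝ 1 φ
  compact : HasCompactSupport φ
  supp : tsupport φ ⊆ U

section Divergence

variable {n m : ℕ} {X Y : EuclideanSpace ℝ (Fin m) → EuclideanSpace ℝ (Fin m)}
  {f : EuclideanSpace ℝ (Fin m) → ℝ} {x v : EuclideanSpace ℝ (Fin m)}

lemma divergence_eq_trace (X : EuclideanSpace ℝ (Fin m) → EuclideanSpace ℝ (Fin m))
    (x : EuclideanSpace ℝ (Fin m)) :
    divergence X x = LinearMap.trace ℝ _ (fderiv ℝ X x : EuclideanSpace ℝ (Fin m) →ₗ[ℝ] _) := by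
  rw [LinearMap.trace_eq_matrix_trace ℝ (EuclideanSpace.basisFun (Fin m) ℝ).toBasis, Matrix.trace]
  simp [divergence, LinearMap.toMatrix_apply]

lemma divergence_add (hX : DifferentiableAt ℝ X x) (hY : DifferentiableAt ℝ Y x) :
    divergence (fun y => X y + Y y) x = divergence X x + divergence Y x := by
  simp [divergence, fderiv_fun_add hX hY, Finset.sum_add_distrib]

lemma divergence_sub (hX : DifferentiableAt ℝ X x) (hY : DifferentiableAt ℝ Y x) :
    divergence (fun y => X y - Y y) x = divergence X x - divergence Y x := by
  simp [divergence, fderiv_fun_sub hX hY, Finset.sum_sub_distrib]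

lemma divergence_neg (X : EuclideanSpace ℝ (Fin m) → EuclideanSpace ℝ (Fin m))
    (x : EuclideanSpace ℝ (Fin m)) : divergence (fun y => -X y) x = -divergence X x := by
  simp [divergence, fderiv_fun_neg, Finset.sum_neg_distrib]

lemma divergence_const_smul (c : ℝ) (hX : DifferentiableAt ℝ X x) :
    divergence (fun y => c • X y) x = c * divergence X x := by
  simp [divergence, fderiv_fun_const_smul hX, Finset.mul_sum]

lemma sum_coord_fderiv (f : EuclideanSpace ℝ (Fin m) → ℝ) (x v : EuclideanSpace ℝ (Fin m)) :
    ∑ i, fderiv ℝ f x (EuclideanSpace.single i 1) * v i = fderiv ℝ f x v := by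
  conv_rhs => rw [← (EuclideanSpace.basisFun (Fin m) ℝ).sum_repr v, map_sum]
  simp [mul_comm]

lemma divergence_smul (hf : DifferentiableAt ℝ f x) (hX : DifferentiableAt ℝ X x) :
    divergence (fun y => f y • X y) x = f x * divergence X x + fderiv ℝ f x (X x) := by
  simp [divergence, fderiv_fun_smul hf hX, Finset.sum_add_distrib, Finset.mul_sum,
    ← sum_coord_fderiv f x (X x)]

lemma divergence_smul_const (hf : DifferentiableAt ℝ f x) (e : EuclideanSpace ℝ (Fin m)) :
    divergence (fun y => f y • e) x = fderiv ℝ f x e := by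
  rw [divergence_smul hf (differentiableAt_const e)]
  simp [divergence]

lemma divergence_eq_zero_of_notMem (h : x ∉ tsupport X) : divergence X x = 0 := by
  simp [divergence, fderiv_of_notMem_tsupport (𝕜 := ℝ) h]

lemma support_divergence_subset (X : EuclideanSpace ℝ (Fin m) → EuclideanSpace ℝ (Fin m)) :
    Function.support (divergence X) ⊆ tsupport X := by
  intro x hx
  by_contra h
  exact hx (divergence_eq_zero_of_notMem h)

lemma continuous_divergence (hX : ContDiff ℝ 1 X) : Continuous (divergence X) := by
  have : Continuous (fderiv ℝ X) := hX.continuous_fderiv one_ne_zero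
  unfold divergence
  fun_prop

lemma hasCompactSupport_divergence (hX : HasCompactSupport X) :
    HasCompactSupport (divergence X) :=
  hX.mono' (support_divergence_subset X)

lemma integrable_divergence (hX : ContDiff ℝ 1 X) (hc : HasCompactSupport X) :
    Integrable (divergence X) :=
  (continuous_divergence hX).integrable_of_hasCompactSupport (hasCompactSupport_divergence hc)

lemma integral_fderiv_eq_zero (hf : ContDiff ℝ 1 f) (hc : HasCompactSupport f)
    (v : EuclideanSpace ℝ (Fin m)) : ∫ x, fderiv ℝ f x v = 0 := by
  have hcont : Continuous fun x => fderiv ℝ f x v :=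
    (hf.continuous_fderiv one_ne_zero).clm_apply continuous_const
  have hsupp : HasCompactSupport fun x => fderiv ℝ f x v := hc.fderiv_apply (𝕜 := ℝ) v
  have h := integral_mul_fderiv_eq_neg_fderiv_mul_of_integrable (μ := volume)
    (f := fun _ : EuclideanSpace ℝ (Fin m) => (1 : ℝ)) (g := f) (v := v) (by simp)
    (by simpa using hcont.integrable_of_hasCompactSupport hsupp)
    (by simpa using hf.continuous.integrable_of_hasCompactSupport hc)
    (fun x _ => differentiableAt_const _)
    (fun x _ => (hf.differentiable one_ne_zero) x)
  simpa using h

lemma fderiv_coord (hX : DifferentiableAt ℝ X x) (i : Fin m) (v : EuclideanSpace ℝ (Fin m)) :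
    fderiv ℝ (fun y => X y i) x v = fderiv ℝ X x v i := by
  have h : HasFDerivAt (fun y => X y i) _ x :=
    (EuclideanSpace.proj i : EuclideanSpace ℝ (Fin m) →L[ℝ] ℝ).hasFDerivAt.comp x hX.hasFDerivAt
  rw [h.fderiv]
  rfl

lemma integral_divergence_eq_zero (hX : ContDiff ℝ 1 X) (hc : HasCompactSupport X) :
    ∫ x, divergence X x = 0 := by
  have hsm : ∀ i, ContDiff ℝ 1 fun y => X y i := fun i => by fun_prop
  have hcs : ∀ i, HasCompactSupport fun y => X y i := fun i =>
    hc.comp_left (g := fun v : EuclideanSpace ℝ (Fin m) => v i) rfl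
  unfold divergence
  simp_rw [← fderiv_coord (hX.differentiable one_ne_zero _)]
  rw [integral_finsetSum]
  · simp [integral_fderiv_eq_zero (hsm _) (hcs _)]
  · intro i _
    refine Continuous.integrable_of_hasCompactSupport ?_ ((hcs i).fderiv_apply (𝕜 := ℝ) _)
    exact ((hsm i).continuous_fderiv one_ne_zero).clm_apply continuous_const

end Divergence

section Test

variable {n : ℕ} {U V : Set (Space n)} {φ ψ : Space n → Space n}

lemma IsTest.neg (h : IsTest U φ) : IsTest U (fun x => -φ x) :=
  ⟨h.1.neg, h.2.neg, by
    have : (fun x => -φ x) = -φ := rfl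
    rw [this, tsupport_neg]; exact h.3⟩

lemma IsTest.of_support (h : ContDiff ℝ 1 φ) {K : Set (Space n)} (hK : IsCompact K) (hKU : K ⊆ U)
    (hs : Function.support φ ⊆ K) : IsTest U φ :=
  have ht : tsupport φ ⊆ K := closure_minimal hs hK.isClosed
  ⟨h, hK.of_isClosed_subset (isClosed_tsupport _) ht, ht.trans hKU⟩

lemma IsTest.smul_left {f : Space n → ℝ} (h : IsTest U φ) (hf : ContDiff ℝ 1 f) :
    IsTest U (fun x => f x • φ x) :=
  .of_support (hf.smul h.1) h.2.isCompact h.3 (by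
    intro x hx
    by_contra hn
    exact hx (by simp [image_eq_zero_of_notMem_tsupport hn]))

lemma IsTest.of_smul {f : Space n → ℝ} (hf : ContDiff ℝ 1 f) (hc : HasCompactSupport f)
    (hs : tsupport f ⊆ U) (h : ContDiff ℝ 1 φ) : IsTest U (fun x => f x • φ x) :=
  .of_support (hf.smul h) hc.isCompact hs (by
    intro x hx
    by_contra hn
    exact hx (by simp [image_eq_zero_of_notMem_tsupport hn]))

lemma IsTest.integrable_div (h : IsTest U φ) : Integrable (divergence φ) :=
  integrable_divergence h.1 h.2

lemma IsTest.differentiable (h : IsTest U φ) : Differentiable ℝ φ :=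
  h.1.differentiable one_ne_zero

lemma integral_div_le_perimeter {L : Set (Space n)} (h : IsTest U φ) (h1 : ∀ x, ‖φ x‖ ≤ 1)
    (hfin : perimeter L U ≠ ⊤) : ∫ x in L, divergence φ x ≤ (perimeter L U).toReal := by
  rw [← ENNReal.ofReal_le_iff_le_toReal hfin]
  unfold perimeter
  exact le_iSup_of_le φ <| le_iSup_of_le h.1 <| le_iSup_of_le h.2 <| le_iSup_of_le h.3 <|
    le_iSup_of_le h1 le_rfl

lemma integral_div_le_mul_perimeter {L : Set (Space n)} (h : IsTest U φ) {C : ℝ} (hC : 0 ≤ C)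
    (h1 : ∀ x, ‖φ x‖ ≤ C) (hfin : perimeter L U ≠ ⊤) :
    ∫ x in L, divergence φ x ≤ C * (perimeter L U).toReal := by
  rcases hC.eq_or_lt with rfl | hC
  · have : φ = fun _ => 0 := by
      ext1 x; simpa using h1 x
    simp [this, divergence]
  · have h2 := integral_div_le_perimeter (φ := fun x => C⁻¹ • φ x) (L := L)
      (h.smul_left contDiff_const) (fun x => by
        rw [norm_smul, norm_inv, Real.norm_of_nonneg hC.le, inv_mul_le_iff₀ hC]
        simpa using h1 x) hfin
    simp_rw [divergence_const_smul _ (h.differentiable _)] at h2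
    rw [integral_const_mul, inv_mul_le_iff₀ hC] at h2
    exact h2

lemma perimeter_le {L : Set (Space n)} {B : ℝ}
    (h : ∀ φ, IsTest U φ → (∀ x, ‖φ x‖ ≤ 1) → ∫ x in L, divergence φ x ≤ B) :
    perimeter L U ≤ ENNReal.ofReal B :=
  iSup_le fun φ => iSup_le fun h1 => iSup_le fun h2 => iSup_le fun h3 => iSup_le fun h4 =>
    ENNReal.ofReal_le_ofReal (h φ ⟨h1, h2, h3⟩ h4)

lemma perimeter_congr {L L' : Set (Space n)} (h : L =ᵐ[volume] L') :
    perimeter L U = perimeter L' U := by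
  unfold perimeter
  simp_rw [setIntegral_congr_set h]

lemma isGaussGreen_congr {L L' : Set (Space n)} (h : L =ᵐ[volume] L') {σ : Measure (Space n)}
    {ν : Space n → Space n} (hG : IsGaussGreen L U σ ν) : IsGaussGreen L' U σ ν :=
  ⟨hG.1, hG.2, hG.3, hG.4, fun φ h1 h2 h3 => by
    rw [← setIntegral_congr_set h]; exact hG.5 φ h1 h2 h3⟩

end Test

/-! ### Geometry of the region -/

section Region

variable {n : ℕ}

@[fun_prop] lemma contDiff_horiz {k : WithTop ℕ∞} : ContDiff ℝ k (horiz : Space n → Horiz n) := by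
  unfold horiz
  rw [contDiff_euclidean]
  intro i
  simp only
  fun_prop

@[fun_prop] lemma contDiff_height {k : WithTop ℕ∞} :
    ContDiff ℝ k (height : Space n → ℝ) := by
  unfold height
  fun_prop

@[fun_prop] lemma continuous_horiz : Continuous (horiz : Space n → Horiz n) :=
  contDiff_horiz (k := 0).continuous

@[fun_prop] lemma continuous_height : Continuous (height : Space n → ℝ) :=
  contDiff_height (k := 0).continuous

@[simp] lemma horiz_join (x : Horiz n) (z : ℝ) : horiz (join x z) = x := by
  ext i; simp [horiz, join]

@[simp] lemma height_join (x : Horiz n) (z : ℝ) : height (join x z) = z := by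
  simp [height, join]

lemma join_horiz_height (p : Space n) : join (horiz p) (height p) = p := by
  ext i
  refine Fin.lastCases ?_ (fun j => ?_) i
  · simp [join, height]
  · simp [join, horiz]

lemma inner_space (p q : Space n) :
    ⟪p, q⟫ = ⟪horiz p, horiz q⟫ + height p * height q := by
  simp only [PiLp.inner_apply, Fin.sum_univ_castSucc, horiz, height]
  simp [mul_comm]

lemma norm_sq_space (p : Space n) : ‖p‖ ^ 2 = ‖horiz p‖ ^ 2 + height p ^ 2 := by
  rw [← real_inner_self_eq_norm_sq, inner_space, real_inner_self_eq_norm_sq, sq (height p)]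

lemma norm_horiz_le (p : Space n) : ‖horiz p‖ ≤ ‖p‖ := by
  have := norm_sq_space p
  exact le_of_sq_le_sq (by nlinarith [sq_nonneg (height p)]) (norm_nonneg _)

lemma abs_height_le (p : Space n) : |height p| ≤ ‖p‖ := by
  have := norm_sq_space p
  rw [← Real.sqrt_sq (norm_nonneg p), this]
  exact Real.abs_le_sqrt (by nlinarith [sq_nonneg (‖horiz p‖)])

@[simp] lemma horiz_add (p q : Space n) : horiz (p + q) = horiz p + horiz q := by
  ext i; simp [horiz]
@[simp] lemma horiz_sub (p q : Space n) : horiz (p - q) = horiz p - horiz q := by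
  ext i; simp [horiz]
@[simp] lemma horiz_smul (c : ℝ) (q : Space n) : horiz (c • q) = c • horiz q := by
  ext i; simp [horiz]
@[simp] lemma height_add (p q : Space n) : height (p + q) = height p + height q := by
  simp [height]
@[simp] lemma height_sub (p q : Space n) : height (p - q) = height p - height q := by
  simp [height]
@[simp] lemma height_smul (c : ℝ) (q : Space n) : height (c • q) = c * height q := by
  simp [height]
lemma isOpen_region (R : EReal) : IsOpen (region R : Set (Space n)) := by
  unfold region
  refine IsOpen.inter ?_ ?_
  · exact isOpen_lt continuous_const continuous_horiz.norm
  · exact isOpen_lt (continuous_coe_real_ereal.comp continuous_horiz.norm) continuous_const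

lemma measurableSet_region (R : EReal) : MeasurableSet (region R : Set (Space n)) :=
  (isOpen_region R).measurableSet

/-- The vertical unit vector `e_z`. -/
def ez : Space n := EuclideanSpace.single (Fin.last n) 1

@[simp] lemma horiz_ez : horiz (ez : Space n) = 0 := by
  ext i; simp [horiz, ez]
@[simp] lemma height_ez : height (ez : Space n) = 1 := by
  simp [height, ez]
@[simp] lemma norm_ez : ‖(ez : Space n)‖ = 1 := by simp [ez]
lemma inner_ez (p : Space n) : ⟪p, ez⟫ = height p := by simp [inner_space]

lemma fderiv_height (p v : Space n) : fderiv ℝ (height : Space n → ℝ) p v = height v := by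
  have : (height : Space n → ℝ) = EuclideanSpace.proj (𝕜 := ℝ) (Fin.last n) := rfl
  rw [this, ContinuousLinearMap.fderiv]

lemma hasFDerivAt_horiz (p : Space n) : ∃ A : Space n →L[ℝ] Horiz n,
    HasFDerivAt horiz A p ∧ ∀ v, A v = horiz v := by
  let A : Space n →ₗ[ℝ] Horiz n :=
    { toFun := horiz, map_add' := horiz_add, map_smul' := horiz_smul }
  exact ⟨A.toContinuousLinearMap, A.toContinuousLinearMap.hasFDerivAt, fun v => rfl⟩

end Region

/-! ### Deformations in a fixed direction -/

/-- The deformation `x ↦ x + s f(x) e` with a fixed direction `e`. It moves volume by an amount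
which is exactly linear in `s`, so that volume constraints can be met without composing flows. -/
def shear {n : ℕ} (f : Space n → ℝ) (e : Space n) (s : ℝ) (x : Space n) : Space n :=
  x + (s * f x) • e

/-- The Piola transform of `φ` under `shear f e s`, that is `cof(DΨ)ᵀ (φ ∘ Ψ)`. -/
def piola {n : ℕ} (f : Space n → ℝ) (e : Space n) (s : ℝ) (φ : Space n → Space n)
    (x : Space n) : Space n :=
  (1 + s * fderiv ℝ f x e) • φ (shear f e s x) - (s * fderiv ℝ f x (φ (shear f e s x))) • e

/-- Conditions on `f`, `e`, `s` under which `shear f e s` is a diffeomorphism. -/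
structure IsShear {n : ℕ} (f : Space n → ℝ) (e : Space n) (s : ℝ) : Prop where
  smooth : ContDiff ℝ ∞ f
  compact : HasCompactSupport f
  small : ∀ x, |s| * (‖fderiv ℝ f x‖ * ‖e‖) ≤ 1 / 2

lemma exists_isShear {n : ℕ} {f : Space n → ℝ} (e : Space n) (hf : ContDiff ℝ ∞ f)
    (hc : HasCompactSupport f) : ∃ s₀ > 0, ∀ s, |s| ≤ s₀ → IsShear f e s := by
  obtain ⟨C, hC⟩ := (hf.continuous_fderiv (by simp)).bounded_above_of_compact_support
    (hc.fderiv (𝕜 := ℝ))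
  have hC0 : 0 ≤ C := (norm_nonneg _).trans (hC 0)
  have hpos : 0 < 2 * (C * ‖e‖ + 1) := by positivity
  refine ⟨1 / (2 * (C * ‖e‖ + 1)), by positivity, fun s hs => ⟨hf, hc, fun x => ?_⟩⟩
  calc |s| * (‖fderiv ℝ f x‖ * ‖e‖) ≤ 1 / (2 * (C * ‖e‖ + 1)) * (C * ‖e‖ + 1) := by
        have := mul_le_mul_of_nonneg_right (hC x) (norm_nonneg e)
        gcongr
        linarith
    _ = 1 / 2 := by field_simp

section Shear

variable {n : ℕ} {f : Space n → ℝ} {e : Space n} {s : ℝ}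

lemma IsShear.differentiable (h : IsShear f e s) : Differentiable ℝ f :=
  h.smooth.differentiable (by simp)

lemma IsShear.contDiff_fderiv (h : IsShear f e s) : ContDiff ℝ 1 (fderiv ℝ f) :=
  h.smooth.fderiv_right (m := 1) (by norm_cast)

lemma IsShear.abs_mul_fderiv_le (h : IsShear f e s) (x : Space n) :
    |s * fderiv ℝ f x e| ≤ 1 / 2 := by
  refine le_trans ?_ (h.small x)
  rw [abs_mul]
  gcongr
  simpa using (fderiv ℝ f x).le_opNorm e

lemma IsShear.det_pos (h : IsShear f e s) (x : Space n) : 0 < 1 + s * fderiv ℝ f x e := by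
  have := abs_le.1 (h.abs_mul_fderiv_le x)
  linarith

lemma IsShear.contDiff_shear (h : IsShear f e s) : ContDiff ℝ 1 (shear f e s) := by
  have := h.smooth.of_le (m := 1) (by norm_cast)
  unfold shear
  fun_prop

lemma IsShear.hasFDerivAt (h : IsShear f e s) (x : Space n) :
    HasFDerivAt (shear f e s)
      (ContinuousLinearMap.id ℝ _ + (s • fderiv ℝ f x).smulRight e) x := by
  have h1 := (h.differentiable x).hasFDerivAt
  exact (hasFDerivAt_id x).add ((h1.const_mul s).smul_const e)

lemma IsShear.det_fderiv (_ : IsShear f e s) (x : Space n) :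
    (ContinuousLinearMap.id ℝ (Space n) + (s • fderiv ℝ f x).smulRight e).det
      = 1 + s * fderiv ℝ f x e := by
  have := LinearMap.transvection.det (s • fderiv ℝ f x : Space n →ₗ[ℝ] ℝ) e
  rw [ContinuousLinearMap.det]
  have e1 : (ContinuousLinearMap.id ℝ (Space n) + (s • fderiv ℝ f x).smulRight e :
      Space n →L[ℝ] Space n).toLinearMap
      = LinearMap.transvection (s • fderiv ℝ f x : Space n →ₗ[ℝ] ℝ) e := by
    ext1 v
    simp [LinearMap.transvection]
  rw [e1, this]
  simp

lemma IsShear.injective (h : IsShear f e s) : Function.Injective (shear f e s) := by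
  intro x y hxy
  have hlip : ∀ x y, |s| * (‖f x - f y‖ * ‖e‖) ≤ 1 / 2 * ‖x - y‖ := by
    intro x y
    rcases (norm_nonneg e).eq_or_lt with he | he
    · rw [← he]; simp
    rcases (abs_nonneg s).eq_or_lt with hs | hs
    · rw [← hs]; simp
    have hb : ∀ z, ‖fderiv ℝ f z‖ ≤ 1 / 2 / (|s| * ‖e‖) := fun z => by
      rw [le_div_iff₀ (by positivity)]
      linarith [h.small z]
    have := Convex.norm_image_sub_le_of_norm_fderiv_le (𝕜 := ℝ) (fun z _ => h.differentiable z)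
      (fun z _ => hb z) convex_univ (mem_univ y) (mem_univ x)
    calc |s| * (‖f x - f y‖ * ‖e‖) ≤ |s| * ((1 / 2 / (|s| * ‖e‖) * ‖x - y‖) * ‖e‖) := by gcongr
      _ = 1 / 2 * ‖x - y‖ := by field_simp
  have h1 : x - y = -((s * (f x - f y)) • e) := by
    simp only [shear] at hxy
    rw [mul_sub, sub_smul]
    rw [neg_sub, sub_eq_sub_iff_add_eq_add, hxy]
    abel
  have h2 := congrArg norm h1
  rw [norm_neg, norm_smul, norm_mul, Real.norm_eq_abs] at h2
  have := hlip x y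
  have h0 : ‖x - y‖ = 0 := le_antisymm (by nlinarith [norm_nonneg (x - y)]) (norm_nonneg _)
  exact sub_eq_zero.1 (norm_eq_zero.1 h0)

lemma shear_of_eq_zero {x : Space n} (h : f x = 0) : shear f e s x = x := by simp [shear, h]

lemma IsShear.eq_zero_of_shear (h : IsShear f e s) {x : Space n}
    (hx : f (shear f e s x) = 0) : shear f e s x = x :=
  h.injective (shear_of_eq_zero hx)

/-- The deformation maps the support of `f` to itself and its complement identically. -/
lemma IsShear.image_diff (h : IsShear f e s) {A B : Set (Space n)}
    (hB : ∀ x, f x ≠ 0 → x ∉ B) : shear f e s '' A ∩ B = A ∩ B := by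
  ext y
  constructor
  · rintro ⟨⟨x, hx, rfl⟩, hy⟩
    have : f (shear f e s x) = 0 := by
      by_contra hc
      exact hB _ hc hy
    rw [h.eq_zero_of_shear this] at hy ⊢
    exact ⟨hx, hy⟩
  · rintro ⟨hA, hyB⟩
    have : f y = 0 := by
      by_contra hc
      exact hB _ hc hyB
    exact ⟨⟨y, hA, shear_of_eq_zero this⟩, hyB⟩

lemma IsShear.image_subset (h : IsShear f e s) {A B : Set (Space n)} (hAB : A ⊆ B)
    (hB : ∀ x, f x ≠ 0 → x ∈ B) : shear f e s '' A ⊆ B := by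
  rintro _ ⟨x, hx, rfl⟩
  by_cases hc : f (shear f e s x) = 0
  · rw [h.eq_zero_of_shear hc]; exact hAB hx
  · exact hB _ hc

lemma IsShear.image_inter (h : IsShear f e s) {A B : Set (Space n)}
    (hB : ∀ x, f x ≠ 0 → x ∈ B) : shear f e s '' A ∩ B = shear f e s '' (A ∩ B) := by
  ext y
  constructor
  · rintro ⟨⟨x, hx, rfl⟩, hy⟩
    refine ⟨x, ⟨hx, ?_⟩, rfl⟩
    by_cases hc : f x = 0
    · rwa [shear_of_eq_zero hc] at hy
    · exact hB _ hc
  · rintro ⟨x, ⟨hx, hxB⟩, rfl⟩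
    exact ⟨⟨x, hx, rfl⟩, h.image_subset (A := B) subset_rfl hB ⟨x, hxB, rfl⟩⟩

lemma IsShear.measurableSet_image (h : IsShear f e s) {A : Set (Space n)}
    (hA : MeasurableSet A) : MeasurableSet (shear f e s '' A) :=
  hA.image_of_continuousOn_injOn h.contDiff_shear.continuous.continuousOn h.injective.injOn

lemma IsShear.integral_image (h : IsShear f e s) {A : Set (Space n)}
    (hA : MeasurableSet A) (g : Space n → ℝ) :
    ∫ x in shear f e s '' A, g x
      = ∫ x in A, (1 + s * fderiv ℝ f x e) * g (shear f e s x) := by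
  rw [integral_image_eq_integral_abs_det_fderiv_smul volume hA
    (fun x _ => (h.hasFDerivAt x).hasFDerivWithinAt) h.injective.injOn]
  simp_rw [h.det_fderiv, abs_of_pos (h.det_pos _), smul_eq_mul]

lemma IsShear.contDiff_piola (h : IsShear f e s) {φ : Space n → Space n} (hφ : ContDiff ℝ 1 φ) :
    ContDiff ℝ 1 (piola f e s φ) := by
  have h1 := h.contDiff_fderiv
  have h2 := hφ.comp h.contDiff_shear
  exact ((contDiff_const.add (contDiff_const.mul (h1.clm_apply contDiff_const))).smul h2).sub
    ((contDiff_const.mul (h1.clm_apply h2)).smul contDiff_const)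

/-- The Piola identity, `div (cof(DΨ)ᵀ (φ ∘ Ψ)) = det DΨ · (div φ) ∘ Ψ`. -/
lemma IsShear.divergence_piola (h : IsShear f e s) {φ : Space n → Space n} (hφ : ContDiff ℝ 1 φ)
    (x : Space n) : divergence (piola f e s φ) x
      = (1 + s * fderiv ℝ f x e) * divergence φ (shear f e s x) := by
  have h1 := h.contDiff_fderiv
  have hcomp : ContDiff ℝ 1 (fun y => φ (shear f e s y)) := hφ.comp h.contDiff_shear
  have hd1 : Differentiable ℝ (fun y => φ (shear f e s y)) := hcomp.differentiable one_ne_zero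
  have hfd : Differentiable ℝ (fderiv ℝ f) := h1.differentiable one_ne_zero
  set w := φ (shear f e s x) with hw
  set D := fderiv ℝ φ (shear f e s x) with hD
  set G := fderiv ℝ f x with hG
  have hDφ : HasFDerivAt (fun y => φ (shear f e s y))
      (D.comp (ContinuousLinearMap.id ℝ _ + (s • G).smulRight e)) x :=
    ((hφ.differentiable one_ne_zero) _).hasFDerivAt.comp x (h.hasFDerivAt x)
  have hA : HasFDerivAt (fun y => 1 + s * fderiv ℝ f y e)
      (s • (fderiv ℝ (fderiv ℝ f) x).flip e) x := by
    have := ((hfd x).hasFDerivAt.clm_apply (hasFDerivAt_const e x)).const_mul s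
    refine (this.const_add 1).congr_fderiv ?_
    ext v; simp
  have hB : HasFDerivAt (fun y => s * fderiv ℝ f y (φ (shear f e s y)))
      (s • ((fderiv ℝ (fderiv ℝ f) x).flip w +
        G.comp (D.comp (ContinuousLinearMap.id ℝ _ + (s • G).smulRight e)))) x := by
    have := ((hfd x).hasFDerivAt.clm_apply hDφ).const_mul s
    refine this.congr_fderiv ?_
    ext v; simp [hw]; ring
  have hsymm : fderiv ℝ (fderiv ℝ f) x w e = fderiv ℝ (fderiv ℝ f) x e w := by
    have : IsSymmSndFDerivAt ℝ f x :=
      (h.smooth.contDiffAt).isSymmSndFDerivAt (by simp; norm_cast)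
    exact this w e
  have htr : divergence (fun y => φ (shear f e s y)) x
      = divergence φ (shear f e s x) + s * G (D e) := by
    rw [divergence, hDφ.fderiv, divergence, ← hD, ← sum_coord_fderiv f x, ← hG, Finset.mul_sum,
      ← Finset.sum_add_distrib]
    refine Finset.sum_congr rfl fun i _ => ?_
    simp
    ring
  have e1 : divergence (piola f e s φ) x = divergence (fun y => (1 + s * fderiv ℝ f y e) •
      φ (shear f e s y)) x - divergence (fun y => (s * fderiv ℝ f y (φ (shear f e s y))) • e) x :=
    divergence_sub (hA.differentiableAt.smul (hd1 x)) (hB.differentiableAt.smul_const e)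
  rw [e1, divergence_smul hA.differentiableAt (hd1 x), divergence_smul_const hB.differentiableAt,
    hA.fderiv, hB.fderiv, htr]
  simp [← hw, ← hG, hsymm]
  ring

lemma IsShear.integral_image_divergence (h : IsShear f e s) {A : Set (Space n)}
    (hA : MeasurableSet A) {φ : Space n → Space n} (hφ : ContDiff ℝ 1 φ) :
    ∫ x in shear f e s '' A, divergence φ x = ∫ x in A, divergence (piola f e s φ) x := by
  rw [h.integral_image hA]
  simp_rw [h.divergence_piola hφ]

lemma piola_of_notMem {φ : Space n → Space n} {x : Space n} (hx : x ∉ tsupport f) :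
    piola f e s φ x = φ x := by
  simp [piola, fderiv_of_notMem_tsupport (𝕜 := ℝ) hx,
    shear_of_eq_zero (image_eq_zero_of_notMem_tsupport hx)]

lemma IsShear.isTest_piola (h : IsShear f e s) {U K : Set (Space n)} (hK : IsCompact K)
    (hKU : K ⊆ U) (hf : tsupport f ⊆ K) {φ : Space n → Space n} (hφ : ContDiff ℝ 1 φ)
    (hφK : tsupport φ ⊆ K) : IsTest U (piola f e s φ) :=
  .of_support (h.contDiff_piola hφ) hK hKU (by
    intro x hx
    by_contra hn
    rw [Function.mem_support, piola_of_notMem fun hc => hn (hf hc)] at hx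
    exact hn (hφK (subset_tsupport _ hx)))

lemma IsShear.norm_piola_le (h : IsShear f e s) (φ : Space n → Space n) (x : Space n) :
    ‖piola f e s φ x‖ ≤ 2 * ‖φ (shear f e s x)‖ := by
  have h1 := abs_le.1 (h.abs_mul_fderiv_le x)
  calc ‖piola f e s φ x‖ ≤ ‖(1 + s * fderiv ℝ f x e) • φ (shear f e s x)‖
        + ‖(s * fderiv ℝ f x (φ (shear f e s x))) • e‖ := norm_sub_le _ _
    _ ≤ (3 / 2) * ‖φ (shear f e s x)‖ + (|s| * (‖fderiv ℝ f x‖ * ‖e‖)) * ‖φ (shear f e s x)‖ := by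
        rw [norm_smul, norm_smul, Real.norm_eq_abs, Real.norm_eq_abs, abs_mul s]
        refine add_le_add ?_ ?_
        · gcongr
          rw [abs_le]; constructor <;> linarith
        · have := (fderiv ℝ f x).le_opNorm (φ (shear f e s x))
          rw [Real.norm_eq_abs] at this
          calc |s| * |fderiv ℝ f x (φ (shear f e s x))| * ‖e‖
              ≤ |s| * (‖fderiv ℝ f x‖ * ‖φ (shear f e s x)‖) * ‖e‖ := by gcongr
            _ = _ := by ring
    _ ≤ 2 * ‖φ (shear f e s x)‖ := by
        have := mul_le_mul_of_nonneg_right (h.small x) (norm_nonneg (φ (shear f e s x)))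
        linarith

lemma IsShear.locallyCaccioppoli (h : IsShear f e s) {U A : Set (Space n)} (hU : IsOpen U)
    (hA : MeasurableSet A) (hf : tsupport f ⊆ U) (hC : LocallyCaccioppoli A U) :
    LocallyCaccioppoli (shear f e s '' A) U := by
  intro V hV hVc hVU
  set K := closure V ∪ tsupport f
  have hK : IsCompact K := hVc.union h.compact.isCompact
  obtain ⟨W, hWo, hKW, hWU, hWc⟩ := exists_open_between_and_isCompact_closure hK hU
    (union_subset hVU hf)
  have hfin : perimeter A W < ⊤ := hC W hWo hWc hWU
  refine lt_of_le_of_lt (perimeter_le (B := 2 * (perimeter A W).toReal) fun φ hφ h1 => ?_)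
    ENNReal.ofReal_lt_top
  rw [h.integral_image_divergence hA hφ.1]
  refine integral_div_le_mul_perimeter (h.isTest_piola hK hKW subset_union_right hφ.1
    ((hφ.3.trans subset_closure).trans subset_union_left)) zero_le_two (fun x => ?_) hfin.ne
  exact (h.norm_piola_le φ x).trans (by linarith [h1 (shear f e s x)])

end Shear

/-! ### Translations of sets of finite perimeter and the Poincaré inequality -/

lemma exists_cutoff {n : ℕ} {K U : Set (Space n)} (hK : IsCompact K) (hU : IsOpen U)
    (hKU : K ⊆ U) : ∃ η : Space n → ℝ, ContDiff ℝ ∞ η ∧ HasCompactSupport η ∧ tsupport η ⊆ U ∧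
      (∀ x, η x ∈ Icc (0 : ℝ) 1) ∧ ∀ᶠ x in 𝓝ˢ K, η x = 1 := by
  obtain ⟨W, hWo, hKW, hWU, hWc⟩ := exists_open_between_and_isCompact_closure hK hU hKU
  obtain ⟨η, h0, h1, h01⟩ := exists_contMDiffMap_zero_one_nhds_of_isClosed (n := ⊤)
    (modelWithCornersSelf ℝ (Space n)) (s := Wᶜ) (t := K) hWo.isClosed_compl hK.isClosed
    (disjoint_left.2 fun x hx hxK => hx (hKW hxK))
  have hs : tsupport η ⊆ closure W := by
    refine closure_mono fun x hx => ?_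
    by_contra hc
    exact hx (h0.self_of_nhdsSet x hc)
  exact ⟨η, η.contMDiff.contDiff, hWc.of_isClosed_subset (isClosed_tsupport _) hs,
    hs.trans hWU, h01, h1⟩

section Translation

variable {n : ℕ} {L U V : Set (Space n)}

lemma hasDerivAt_integral_translate (L : Set (Space n)) (h : Space n) {η : Space n → ℝ}
    (hη : ContDiff ℝ 1 η) (hc : HasCompactSupport η) (t : ℝ) :
    HasDerivAt (fun t : ℝ => ∫ x in L, η (x - t • h))
      (∫ x in L, fderiv ℝ η (x - t • h) (-h)) t := by
  obtain ⟨r, hr⟩ := hc.isCompact.isBounded.subset_closedBall 0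
  have hηd : Differentiable ℝ η := hη.differentiable one_ne_zero
  have hfc : Continuous (fderiv ℝ η) := hη.continuous_fderiv one_ne_zero
  obtain ⟨C, hC⟩ := hfc.bounded_above_of_compact_support (hc.fderiv (𝕜 := ℝ))
  have hC0 : 0 ≤ C := (norm_nonneg _).trans (hC 0)
  have hint : ∀ t : ℝ, Integrable fun x => η (x - t • h) := fun t =>
    (hη.continuous.integrable_of_hasCompactSupport hc).comp_sub_right _
  set M := r + (|t| + 1) * ‖h‖
  refine (hasDerivAt_integral_of_dominated_loc_of_deriv_le (μ := volume.restrict L)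
    (F := fun t x => η (x - t • h)) (F' := fun t x => fderiv ℝ η (x - t • h) (-h))
    (bound := (closedBall (0 : Space n) M).indicator fun _ => C * ‖h‖)
    (s := Ioo (t - 1) (t + 1)) (Ioo_mem_nhds (by linarith) (by linarith)) ?_ ?_ ?_ ?_ ?_ ?_).2
  · exact .of_forall fun t => (hint t).aestronglyMeasurable.restrict
  · exact (hint t).integrableOn
  · exact ((hfc.comp (by fun_prop)).clm_apply continuous_const).aestronglyMeasurable
  · refine .of_forall fun x t' ht => ?_
    by_cases hx : x ∈ closedBall (0 : Space n) M
    · rw [indicator_of_mem hx]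
      calc _ ≤ ‖fderiv ℝ η (x - t' • h)‖ * ‖-h‖ := ContinuousLinearMap.le_opNorm _ _
        _ ≤ C * ‖h‖ := by rw [norm_neg]; gcongr; exact hC _
    · rw [indicator_of_notMem hx]
      have : x - t' • h ∉ tsupport η := by
        intro hc
        have h2 := hr hc
        rw [mem_closedBall, dist_zero_right] at h2 hx
        have h3 : ‖t' • h‖ ≤ (|t| + 1) * ‖h‖ := by
          rw [norm_smul, Real.norm_eq_abs]
          gcongr
          have := neg_abs_le t
          have := le_abs_self t
          rw [abs_le]; constructor <;> linarith [ht.1, ht.2]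
        have h4 : ‖x‖ ≤ ‖x - t' • h‖ + ‖t' • h‖ := by
          simpa using norm_add_le (x - t' • h) (t' • h)
        exact hx (by simp only [M]; linarith)
      rw [fderiv_of_notMem_tsupport (𝕜 := ℝ) this]
      simp
  · exact ((integrable_indicator_iff measurableSet_closedBall).2
      (integrableOn_const (isCompact_closedBall (0 : Space n) _).measure_lt_top.ne)).integrableOn
  · refine .of_forall fun x t _ => ?_
    have h2 : HasDerivAt (fun t : ℝ => x - t • h) (-h) t := by
      simpa using ((hasDerivAt_id t).smul_const h).const_sub x
    exact (hηd _).hasFDerivAt.comp_hasDerivAt t h2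

/-- The difference quotients of the indicator function of a set of finite perimeter, tested
against a smooth function. -/
lemma abs_integral_translate_sub_le {h : Space n} {η : Space n → ℝ}
    (hη : ContDiff ℝ 1 η) (hc : HasCompactSupport η)
    (h1 : ∀ x, |η x| ≤ 1) (hV : ∀ x ∈ tsupport η, ∀ t ∈ Icc (0 : ℝ) 1, x + t • h ∈ V)
    (hfin : perimeter L V ≠ ⊤) :
    |∫ x in L, (η (x - h) - η x)| ≤ ‖h‖ * (perimeter L V).toReal := by
  have hηd : Differentiable ℝ η := hη.differentiable one_ne_zero
  have hint : ∀ t : ℝ, Integrable fun x => η (x - t • h) := fun t =>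
    (hη.continuous.integrable_of_hasCompactSupport hc).comp_sub_right _
  set g : ℝ → ℝ := fun t => ∫ x in L, η (x - t • h) with hg
  have hder : ∀ t, HasDerivAt g (∫ x in L, fderiv ℝ η (x - t • h) (-h)) t :=
    hasDerivAt_integral_translate L h hη hc
  have hbound : ∀ t ∈ Icc (0 : ℝ) 1,
      ‖∫ x in L, fderiv ℝ η (x - t • h) (-h)‖ ≤ ‖h‖ * (perimeter L V).toReal := by
    intro t ht
    have hts : ∀ c : ℝ, IsTest V fun x => η (x - t • h) • (c • h) := by
      intro c
      refine .of_support ((hη.comp (by fun_prop)).smul contDiff_const)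
        (K := (fun x => x + t • h) '' tsupport η) (hc.isCompact.image (by fun_prop)) ?_ ?_
      · rintro _ ⟨x, hx, rfl⟩
        exact hV x hx t ht
      · intro x hx
        refine ⟨x - t • h, subset_tsupport _ fun hc => hx (by simp [hc]), by simp⟩
    have hdiv : ∀ c : ℝ, ∀ x, divergence (fun x => η (x - t • h) • (c • h)) x
        = fderiv ℝ η (x - t • h) (c • h) := by
      intro c x
      have h2 : HasFDerivAt (fun x => η (x - t • h)) (fderiv ℝ η (x - t • h)) x :=
        (hηd (x - t • h)).hasFDerivAt.comp x ((hasFDerivAt_id x).sub_const (t • h))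
      rw [divergence_smul_const h2.differentiableAt, h2.fderiv]
    have hle : ∀ c : ℝ, |c| = 1 →
        ∫ x in L, fderiv ℝ η (x - t • h) (c • h) ≤ ‖h‖ * (perimeter L V).toReal := by
      intro c hc1
      simp_rw [← hdiv c]
      refine integral_div_le_mul_perimeter (hts c) (norm_nonneg _) (fun x => ?_) hfin
      rw [norm_smul, norm_smul, Real.norm_eq_abs, Real.norm_eq_abs, hc1, one_mul]
      exact mul_le_of_le_one_left (norm_nonneg _) (h1 _)
    have ha := hle 1 (by simp)
    have hb := hle (-1) (by simp)
    simp only [one_smul, neg_smul, map_neg, integral_neg] at ha hb ⊢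
    rw [norm_neg, Real.norm_eq_abs, abs_le]
    constructor <;> linarith
  have := norm_image_sub_le_of_norm_deriv_le_segment_01' (f := g)
    (fun t _ => (hder t).hasDerivWithinAt) fun t ht => hbound t ⟨ht.1, ht.2.le⟩
  simp only [hg, one_smul, zero_smul, sub_zero] at this
  rw [integral_sub]
  · exact this
  · simpa using (hint 1).restrict
  · simpa using (hint 0).restrict

/-- A set of finite perimeter `P` moves by at most `‖h‖ P` in measure under the translation by
`h`. The sign `c = ±1` selects the points which enter or leave. -/
lemma volume_translate_le {h : Space n} (hL : MeasurableSet L) (hU : IsOpen U)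
    (hV : ∀ x ∈ U, ∀ t ∈ Icc (0 : ℝ) 1, x + t • h ∈ V) (hfin : perimeter L V ≠ ⊤)
    {P : Set (Space n)} (hP : MeasurableSet P) (hPU : P ⊆ U) {c : ℝ} (hc : |c| = 1)
    (hPc : ∀ x ∈ P, c * (L.indicator 1 (x + h) - L.indicator 1 x) = 1) :
    volume P ≤ ENNReal.ofReal (‖h‖ * (perimeter L V).toReal) := by
  rw [hP.measure_eq_iSup_isCompact]
  refine iSup_le fun K => iSup_le fun hKP => iSup_le fun hK => ?_
  refine ENNReal.le_of_forall_pos_le_add fun ε hε _ => ?_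
  obtain ⟨O', hKO', hO', hvol'⟩ := K.exists_isOpen_lt_add (μ := volume) hK.measure_lt_top.ne
    (ε := (ε : ℝ≥0∞)) (by simpa using hε.ne')
  set O := O' ∩ U
  have hO : IsOpen O := hO'.inter hU
  have hKO : K ⊆ O := subset_inter hKO' (hKP.trans hPU)
  have hvol : volume O < volume K + ε := (measure_mono inter_subset_left).trans_lt hvol'
  have hOfin : volume O ≠ ⊤ := hvol.ne_top
  have hKm : MeasurableSet K := hK.isClosed.measurableSet
  obtain ⟨η, hη, hηc, hηO, h01, hη1⟩ := exists_cutoff hK hO hKO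
  have hη' : ContDiff ℝ 1 η := hη.of_le (by norm_cast)
  have habs : ∀ x, |η x| ≤ 1 := fun x => by rw [abs_of_nonneg (h01 x).1]; exact (h01 x).2
  have hle := abs_integral_translate_sub_le hη' hηc habs
    (fun x hx => hV x (hηO hx).2) hfin
  set d : Space n → ℝ := fun x => L.indicator 1 (x + h) - L.indicator 1 x with hd
  have hdm : Measurable d := by
    have : Measurable (L.indicator (1 : Space n → ℝ)) := measurable_one.indicator hL
    exact (this.comp (measurable_add_const h)).sub this
  have hd1 : ∀ x, |d x| ≤ 1 := by
    intro x
    simp only [hd, indicator, Pi.one_apply]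
    split_ifs <;> simp
  have hηi : Integrable η := hη.continuous.integrable_of_hasCompactSupport hηc
  have hint1 : Integrable fun x => L.indicator 1 (x + h) * η x :=
    hηi.bdd_mul (((measurable_one.indicator hL).comp (measurable_add_const h)).aestronglyMeasurable)
      (c := 1) (.of_forall fun x => by
        simp only [indicator, Pi.one_apply]; split_ifs <;> simp)
  have hint2 : Integrable fun x => L.indicator 1 x * η x :=
    hηi.bdd_mul ((measurable_one.indicator hL).aestronglyMeasurable)
      (c := 1) (.of_forall fun x => by
        simp only [indicator, Pi.one_apply]; split_ifs <;> simp)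
  have hdη : ∫ x, d x * η x = ∫ x in L, (η (x - h) - η x) := by
    have e1 : ∫ x, L.indicator 1 (x + h) * η x = ∫ x in L, η (x - h) := by
      rw [← integral_indicator hL,
        ← integral_add_right_eq_self (L.indicator fun x => η (x - h)) h]
      refine integral_congr_ae (.of_forall fun x => ?_)
      by_cases hx : x + h ∈ L <;> simp [hx]
    have e2 : ∫ x, L.indicator 1 x * η x = ∫ x in L, η x := by
      rw [← integral_indicator hL]
      refine integral_congr_ae (.of_forall fun x => ?_)
      by_cases hx : x ∈ L <;> simp [hx]
    rw [integral_sub (hηi.comp_sub_right h).integrableOn hηi.integrableOn, ← e1, ← e2,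
      ← integral_sub hint1 hint2]
    simp only [hd, sub_mul]
  have hdint : Integrable fun x => d x * η x := by
    simp only [hd, sub_mul]
    exact hint1.sub hint2
  have hlow : volume.real K - volume.real (O \ K) ≤ c * ∫ x, d x * η x := by
    have i1 : Integrable (K.indicator (1 : Space n → ℝ)) :=
      (integrable_indicator_iff hKm).2 (integrableOn_const hK.measure_lt_top.ne)
    have i2 : Integrable ((O \ K).indicator (1 : Space n → ℝ)) :=
      (integrable_indicator_iff (hO.measurableSet.diff hKm)).2
        (integrableOn_const ((measure_mono sdiff_subset).trans_lt hOfin.lt_top).ne)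
    rw [← integral_indicator_one hKm, ← integral_indicator_one (hO.measurableSet.diff hKm),
      ← integral_sub i1 i2, ← integral_const_mul]
    refine integral_mono (i1.sub i2) (hdint.const_mul c) fun x => ?_
    by_cases hxK : x ∈ K
    · have e1 : η x = 1 := hη1.self_of_nhdsSet x hxK
      have e2 := hPc x (hKP hxK)
      simp [hxK, hd, e1, e2]
    · by_cases hxO : x ∈ O
      · simp only [indicator_of_notMem hxK, indicator_of_mem (show x ∈ O \ K from ⟨hxO, hxK⟩),
          Pi.one_apply, zero_sub]
        have : |c * (d x * η x)| ≤ 1 := by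
          rw [abs_mul, hc, one_mul, abs_mul]
          exact mul_le_one₀ (hd1 x) (abs_nonneg _) (habs x)
        exact (abs_le.1 this).1
      · have e0 : η x = 0 := image_eq_zero_of_notMem_tsupport fun hc => hxO (hηO hc)
        simp [hxK, hxO, e0]
  have hup : c * ∫ x, d x * η x ≤ ‖h‖ * (perimeter L V).toReal := by
    rw [hdη]
    refine (le_abs_self _).trans ?_
    rwa [abs_mul, hc, one_mul]
  have hOK : volume.real (O \ K) ≤ ε := by
    have := measure_sdiff hKO hKm.nullMeasurableSet hK.measure_lt_top.ne (μ := volume)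
    rw [Measure.real, this]
    refine ENNReal.toReal_le_of_le_ofReal ε.2 ?_
    rw [tsub_le_iff_left]
    refine hvol.le.trans (le_of_eq ?_)
    congr 1
    exact (ENNReal.ofReal_coe_nnreal).symm
  have hfinal : volume.real K ≤ ‖h‖ * (perimeter L V).toReal + ε := by linarith
  have := ENNReal.ofReal_le_ofReal hfinal
  rw [ofReal_measureReal hK.measure_lt_top.ne, ENNReal.ofReal_add (by positivity) ε.coe_nonneg,
    ENNReal.ofReal_coe_nnreal] at this
  exact this

/-- A relative isoperimetric inequality on convex open sets. -/
lemma volume_mul_volume_le {K : Set (Space n)} (hL : MeasurableSet L) (hK : IsOpen K)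
    (hKc : Convex ℝ K) {y : Space n} {ρ : ℝ} (hKρ : K ⊆ ball y ρ)
    (hfin : perimeter L K ≠ ⊤) :
    volume (L ∩ K) * volume (K \ L) ≤
      ENNReal.ofReal (2 * ρ * (perimeter L K).toReal) * volume (ball (0 : Space n) (2 * ρ))
      := by
  rcases le_or_gt ρ 0 with hρ | hρ
  · have : K = ∅ := by simpa [ball_eq_empty.2 hρ] using hKρ
    simp [this]
  have hm1 : MeasurableSet (L ∩ K) := hL.inter hK.measurableSet
  have hm2 : MeasurableSet (K \ L) := hK.measurableSet.diff hL
  have hmeas : Measurable fun z : Space n × Space n =>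
      (K \ L).indicator (1 : Space n → ℝ≥0∞) z.2 * (L ∩ K).indicator 1 (z.2 + z.1) :=
    ((measurable_one.indicator hm2).comp measurable_snd).mul
      ((measurable_one.indicator hm1).comp (measurable_snd.add measurable_fst))
  have e1 : volume (L ∩ K) * volume (K \ L)
      = ∫⁻ h, ∫⁻ q, (K \ L).indicator (1 : Space n → ℝ≥0∞) q * (L ∩ K).indicator 1 (q + h) := by
    rw [lintegral_lintegral_swap hmeas.aemeasurable]
    have : ∀ q, ∫⁻ h, (K \ L).indicator (1 : Space n → ℝ≥0∞) q * (L ∩ K).indicator 1 (q + h)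
        = volume (L ∩ K) * (K \ L).indicator (1 : Space n → ℝ≥0∞) q := by
      intro q
      rw [lintegral_const_mul, lintegral_add_left_eq_self (f := (L ∩ K).indicator 1) q,
        lintegral_indicator_one hm1, mul_comm]
      exact (measurable_one.indicator hm1).comp (measurable_const_add q)
    simp_rw [this]
    rw [lintegral_const_mul _ (measurable_one.indicator hm2), lintegral_indicator_one hm2]
  rw [e1]
  have hb : ∀ h, ∫⁻ q, (K \ L).indicator (1 : Space n → ℝ≥0∞) q * (L ∩ K).indicator 1 (q + h)
      ≤ (ball (0 : Space n) (2 * ρ)).indicator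
        (fun _ => ENNReal.ofReal (2 * ρ * (perimeter L K).toReal)) h := by
    intro h
    set P := {q | q ∈ K \ L ∧ q + h ∈ L ∩ K} with hP
    have hPm : MeasurableSet P := hm2.inter (measurable_add_const h hm1)
    have e2 : ∫⁻ q, (K \ L).indicator (1 : Space n → ℝ≥0∞) q * (L ∩ K).indicator 1 (q + h)
        = volume P := by
      rw [← lintegral_indicator_one hPm]
      refine lintegral_congr fun q => ?_
      have hq : q ∈ P ↔ q ∈ K \ L ∧ q + h ∈ L ∩ K := Iff.rfl
      classical
      simp only [indicator_apply, Pi.one_apply, hq]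
      split_ifs <;> simp_all
    rw [e2]
    by_cases hh : h ∈ ball (0 : Space n) (2 * ρ)
    · rw [indicator_of_mem hh]
      have h2 : ‖h‖ ≤ 2 * ρ := by simpa using (mem_ball.1 hh).le
      refine (volume_translate_le (h := h) (U := K ∩ (fun q => q + h) ⁻¹' K) hL
        (hK.inter (hK.preimage (by fun_prop))) (fun x hx t ht => ?_) hfin hPm
        (fun q hq => ⟨hq.1.1, hq.2.2⟩) (c := 1) (by simp) (fun q hq => ?_)).trans
        (ENNReal.ofReal_le_ofReal (by gcongr))
      · have := hKc hx.1 hx.2 (sub_nonneg.2 ht.2) ht.1 (by ring)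
        convert this using 1
        simp only [smul_add, sub_smul, one_smul]
        abel
      · simp [hq.1.2, hq.2.1]
    · rw [indicator_of_notMem hh]
      have : P = ∅ := by
        refine eq_empty_iff_forall_notMem.2 fun q hq => hh ?_
        have a := hKρ hq.1.1
        have b := hKρ hq.2.2
        rw [mem_ball] at a b
        rw [mem_ball_zero_iff]
        have : ‖h‖ = dist (q + h) q := by simp
        rw [this]
        calc dist (q + h) q ≤ dist (q + h) y + dist q y := dist_triangle_right _ _ _
          _ < 2 * ρ := by linarith
      simp [this]
  refine (lintegral_mono hb).trans ?_
  rw [lintegral_indicator_const measurableSet_ball]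

end Translation

/-! ### Existence of the surface measure and the normal -/

section Vague

variable {X : Type*} [TopologicalSpace X] [T2Space X] [LocallyCompactSpace X]
  [MeasurableSpace X] [BorelSpace X]

/-- Vague compactness of measures which are eventually bounded on compact sets; an ultrafilter
replaces the extraction of a subsequence. -/
lemma exists_vague_limit (ρ : ℕ → Measure X) (𝒰 : Ultrafilter ℕ) (hU : (𝒰 : Filter ℕ) ≤ atTop)
    [∀ m, IsFiniteMeasureOnCompacts (ρ m)]
    (hb : ∀ K : Set X, IsCompact K → ∃ C : ℝ, ∀ᶠ m in atTop, ρ m K ≤ ENNReal.ofReal C) :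
    ∃ μ : Measure X, IsFiniteMeasureOnCompacts μ ∧ ∀ f : X → ℝ, Continuous f →
      HasCompactSupport f → Tendsto (fun m => ∫ x, f x ∂(ρ m)) 𝒰 (𝓝 (∫ x, f x ∂μ)) := by
  have hint : ∀ m, ∀ f : CompactlySupportedContinuousMap X ℝ, Integrable f (ρ m) := fun m f =>
    f.continuous.integrable_of_hasCompactSupport f.hasCompactSupport
  have hlim : ∀ f : CompactlySupportedContinuousMap X ℝ,
      ∃ l : ℝ, Tendsto (fun m => ∫ x, f x ∂(ρ m)) 𝒰 (𝓝 l) := by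
    intro f
    obtain ⟨C, hC⟩ := hb _ f.hasCompactSupport.isCompact
    obtain ⟨M, hM⟩ := f.continuous.bounded_above_of_compact_support f.hasCompactSupport
    have hM0 : 0 ≤ max M 0 := le_max_right _ _
    have hev : ∀ᶠ m in (𝒰 : Filter ℕ),
        ∫ x, f x ∂(ρ m) ∈ closedBall (0 : ℝ) (max M 0 * max C 0) := by
      refine (hC.filter_mono hU).mono fun m hm => ?_
      have hKlt : ρ m (tsupport f) < ⊤ := hm.trans_lt ENNReal.ofReal_lt_top
      rw [mem_closedBall_zero_iff, ← setIntegral_tsupport (F := f)]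
      refine (norm_setIntegral_le_of_norm_le_const hKlt
        (C := max M 0) fun x _ => (hM x).trans (le_max_left _ _)).trans ?_
      gcongr
      refine ENNReal.toReal_le_of_le_ofReal (le_max_right _ _) (hm.trans ?_)
      exact ENNReal.ofReal_le_ofReal (le_max_left _ _)
    obtain ⟨l, -, hl⟩ := (isCompact_closedBall (0 : ℝ) (max M 0 * max C 0)).ultrafilter_le_nhds
      (𝒰.map fun m => ∫ x, f x ∂(ρ m)) (le_principal_iff.2 hev)
    exact ⟨l, hl⟩
  choose Λ hΛ using hlim
  let Λl : CompactlySupportedContinuousMap X ℝ →ₗ[ℝ] ℝ :=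
    { toFun := Λ
      map_add' := fun f g => by
        refine tendsto_nhds_unique (hΛ (f + g)) (((hΛ f).add (hΛ g)).congr fun m => ?_)
        rw [← integral_add (hint m f) (hint m g)]
        rfl
      map_smul' := fun c f => by
        refine tendsto_nhds_unique (hΛ (c • f)) (((hΛ f).const_mul c).congr fun m => ?_)
        rw [← integral_const_mul]
        rfl }
  have hpos : ∀ f : CompactlySupportedContinuousMap X ℝ, 0 ≤ f → 0 ≤ Λl f := fun f hf =>
    ge_of_tendsto' (hΛ f) fun m => integral_nonneg fun x => hf x
  refine ⟨RealRMK.rieszMeasure (PositiveLinearMap.mk₀ Λl hpos), inferInstance, fun f hf hc => ?_⟩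
  have := RealRMK.integral_rieszMeasure (PositiveLinearMap.mk₀ Λl hpos) ⟨⟨f, hf⟩, hc⟩
  have h2 : ∫ x, f x ∂(RealRMK.rieszMeasure (PositiveLinearMap.mk₀ Λl hpos))
      = Λ ⟨⟨f, hf⟩, hc⟩ := this
  rw [h2]
  exact hΛ ⟨⟨f, hf⟩, hc⟩

end Vague

section Riesz

variable {n : ℕ} {L U : Set (Space n)}

/-- The distributional derivative of the indicator function of a locally Caccioppoli set in a
fixed direction is a difference of two Radon measures on the open set `U`. -/
lemma exists_directional_measures (hU : IsOpen U) (hL : MeasurableSet L)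
    (hC : LocallyCaccioppoli L U) (e : Space n) (he : ‖e‖ = 1) :
    ∃ μ₁ μ₂ : Measure U, IsFiniteMeasureOnCompacts μ₁ ∧ IsFiniteMeasureOnCompacts μ₂ ∧
      ∀ f : Space n → ℝ, ContDiff ℝ 1 f → HasCompactSupport f → tsupport f ⊆ U →
        ∫ x in L, fderiv ℝ f x e = ∫ x : U, f x ∂μ₁ - ∫ x : U, f x ∂μ₂ := by
  classical
  have : LocallyCompactSpace U := hU.locallyCompactSpace
  set t : ℕ → ℝ := fun m => 1 / ((m : ℝ) + 1) with ht
  have htpos : ∀ m, 0 < t m := fun m => by positivity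
  have htlim : Tendsto t atTop (𝓝 0) := tendsto_one_div_add_atTop_nhds_zero_nat
  -- the points which leave (`c = 1`) or enter (`c = -1`) under the translation by `-t m • e`
  set P : ℝ → ℕ → Set (Space n) := fun c m =>
    {x | c * (L.indicator 1 (x + t m • e) - L.indicator 1 x) = 1} with hPdef
  have hind : Measurable (L.indicator (1 : Space n → ℝ)) := measurable_one.indicator hL
  have hPm : ∀ c m, MeasurableSet (P c m) := fun c m =>
    (((hind.comp (measurable_add_const _)).sub hind).const_mul c) (measurableSet_singleton 1)
  set ρ : ℝ → ℕ → Measure U := fun c m =>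
    (ENNReal.ofReal (t m)⁻¹ • volume.restrict (P c m)).comap Subtype.val with hρ
  have hemb : MeasurableEmbedding (Subtype.val : U → Space n) :=
    MeasurableEmbedding.subtype_coe hU.measurableSet
  have hρK : ∀ c m (K : Set U), IsCompact K → ρ c m K
      = ENNReal.ofReal (t m)⁻¹ * volume (Subtype.val '' K ∩ P c m) := by
    intro c m K hK
    rw [hρ, hemb.comap_apply, Measure.smul_apply, smul_eq_mul,
      Measure.restrict_apply (hK.image continuous_subtype_val).isClosed.measurableSet]
  have hfin : ∀ c m, IsFiniteMeasureOnCompacts (ρ c m) := fun c m => ⟨fun K hK => by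
    rw [hρK c m K hK]
    exact ENNReal.mul_lt_top ENNReal.ofReal_lt_top ((measure_mono inter_subset_left).trans_lt
      (hK.image continuous_subtype_val).measure_lt_top)⟩
  have hbound : ∀ c, |c| = 1 → ∀ K : Set U, IsCompact K →
      ∃ C : ℝ, ∀ᶠ m in atTop, ρ c m K ≤ ENNReal.ofReal C := by
    intro c hc K hK
    have hK' : IsCompact (Subtype.val '' K : Set (Space n)) := hK.image continuous_subtype_val
    obtain ⟨W, hWo, hKW, hWU, hWc⟩ := exists_open_between_and_isCompact_closure hK' hU
      (by rintro _ ⟨x, -, rfl⟩; exact x.2)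
    obtain ⟨V, hVo, hWV, hVU, hVc⟩ := exists_open_between_and_isCompact_closure hWc hU hWU
    obtain ⟨δ, hδ, hδV⟩ := hWc.exists_thickening_subset_open hVo hWV
    have hper : perimeter L V < ⊤ := hC V hVo hVc hVU
    refine ⟨(perimeter L V).toReal, ?_⟩
    filter_upwards [htlim.eventually (gt_mem_nhds hδ)] with m hm
    have hnorm : ‖t m • e‖ = t m := by rw [norm_smul, he, mul_one, Real.norm_of_nonneg (htpos m).le]
    have h1 := volume_translate_le (h := t m • e) hL hWo (V := V) (fun x hx s hs => ?_) hper.ne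
      (P := W ∩ P c m) (hWo.measurableSet.inter (hPm c m)) inter_subset_left hc (fun x hx => hx.2)
    · rw [hρK c m K hK]
      calc _ ≤ ENNReal.ofReal (t m)⁻¹ * ENNReal.ofReal (‖t m • e‖ * (perimeter L V).toReal) := by
            gcongr
            exact (measure_mono (inter_subset_inter_left _ hKW)).trans h1
        _ = ENNReal.ofReal (perimeter L V).toReal := by
            rw [← ENNReal.ofReal_mul (by have := htpos m; positivity), hnorm,
              inv_mul_cancel_left₀ (htpos m).ne']
    · refine hδV (mem_thickening_iff.2 ⟨x, subset_closure hx, ?_⟩)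
      rw [dist_eq_norm, add_sub_cancel_left, norm_smul, hnorm, Real.norm_of_nonneg hs.1]
      exact (mul_le_of_le_one_left (htpos m).le hs.2).trans_lt hm
  obtain ⟨μ₁, h1, hμ₁⟩ := exists_vague_limit (ρ (-1)) (hyperfilter ℕ)
    Nat.hyperfilter_le_atTop (hbound (-1) (by simp))
  obtain ⟨μ₂, h2, hμ₂⟩ := exists_vague_limit (ρ 1) (hyperfilter ℕ)
    Nat.hyperfilter_le_atTop (hbound 1 (by simp))
  refine ⟨μ₁, μ₂, h1, h2, fun f hf hfc hfU => ?_⟩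
  have hfU' : HasCompactSupport fun x : U => f x := by
    refine HasCompactSupport.of_support_subset_isCompact
      (K := Subtype.val ⁻¹' tsupport f) ?_ ?_
    · exact (Topology.IsInducing.subtypeVal.isCompact_preimage_iff
        (by simpa using hfU)).2 hfc.isCompact
    · intro x hx
      exact subset_tsupport f hx
  have hl := (hμ₁ _ (hf.continuous.comp continuous_subtype_val) hfU').sub
    (hμ₂ _ (hf.continuous.comp continuous_subtype_val) hfU')
  refine tendsto_nhds_unique ?_ hl
  have hρf : ∀ c m, ∫ x : U, f x ∂(ρ c m) = (t m)⁻¹ * ∫ x in P c m, f x := by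
    intro c m
    rw [hρ, ← hemb.integral_map, hemb.map_comap, Measure.restrict_smul, integral_smul_measure,
      ENNReal.toReal_ofReal (by have := htpos m; positivity), smul_eq_mul]
    congr 1
    rw [setIntegral_eq_integral_of_forall_compl_eq_zero]
    intro x hx
    exact image_eq_zero_of_notMem_tsupport fun hc => hx (by simpa using hfU hc)
  have hfi : Integrable f := hf.continuous.integrable_of_hasCompactSupport hfc
  have key : ∀ m, (∫ x in P 1 m, f x) - ∫ x in P (-1) m, f x
      = (∫ x in L, f (x - t m • e)) - ∫ x in L, f x := by
    intro m
    have e1 : ∫ x in L, f (x - t m • e) = ∫ x, L.indicator 1 (x + t m • e) * f x := by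
      rw [← integral_indicator hL,
        ← integral_add_right_eq_self (L.indicator fun x => f (x - t m • e)) (t m • e)]
      refine integral_congr_ae (.of_forall fun x => ?_)
      by_cases hx : x + t m • e ∈ L <;> simp [hx]
    have e2 : ∫ x in L, f x = ∫ x, L.indicator 1 x * f x := by
      rw [← integral_indicator hL]
      refine integral_congr_ae (.of_forall fun x => ?_)
      by_cases hx : x ∈ L <;> simp [hx]
    have hi1 : Integrable fun x => L.indicator 1 (x + t m • e) * f x :=
      hfi.bdd_mul ((hind.comp (measurable_add_const _)).aestronglyMeasurable)
        (c := 1) (.of_forall fun x => by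
          simp only [indicator, Pi.one_apply]; split_ifs <;> simp)
    have hi2 : Integrable fun x => L.indicator 1 x * f x :=
      hfi.bdd_mul hind.aestronglyMeasurable
        (c := 1) (.of_forall fun x => by
          simp only [indicator, Pi.one_apply]; split_ifs <;> simp)
    rw [e1, e2, ← integral_sub hi1 hi2, ← integral_indicator (hPm _ _),
      ← integral_indicator (hPm _ _),
      ← integral_sub (hfi.indicator (hPm _ _)) (hfi.indicator (hPm _ _))]
    refine integral_congr_ae (.of_forall fun x => ?_)
    simp only [hPdef, indicator_apply, mem_ofPred_eq, Pi.one_apply]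
    by_cases h1 : x + t m • e ∈ L <;> by_cases h2 : x ∈ L <;> simp [h1, h2] <;> norm_num
  have hder := hasDerivAt_integral_translate L e hf hfc 0
  have hslope := (hasDerivAt_iff_tendsto_slope_zero.1 hder).comp
    (tendsto_nhdsWithin_iff.2 ⟨htlim, .of_forall fun m => (htpos m).ne'⟩)
  have hneg := (hslope.neg).mono_left Nat.hyperfilter_le_atTop
  simp only [zero_smul, sub_zero, map_neg, integral_neg, neg_neg] at hneg
  refine hneg.congr fun m => ?_
  simp only [Function.comp, zero_add, smul_eq_mul, hρf, ← mul_sub]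
  rw [← mul_neg, ← key m, neg_sub]

/-- De Giorgi's structure theorem in the weak form which is needed here: a locally Caccioppoli set
has a surface measure and a normal. -/
theorem LocallyCaccioppoli.exists_isGaussGreen (hU : IsOpen U) (hL : MeasurableSet L)
    (hC : LocallyCaccioppoli L U) : ∃ σ ν, IsGaussGreen L U σ ν := by
  classical
  have hlc : LocallyCompactSpace U := hU.locallyCompactSpace
  choose μ₁ μ₂ h₁ h₂ hμ using fun i : Fin (n + 1) =>
    exists_directional_measures hU hL hC (EuclideanSpace.single i 1) (by simp)
  -- the vector measure `(μ₁ i - μ₂ i)` has the density `v` with respect to the dominating `σ₀`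
  set σ₀ : Measure U := ∑ i, (μ₁ i + μ₂ i) with hσ₀
  have hle : ∀ i, μ₁ i ≤ σ₀ ∧ μ₂ i ≤ σ₀ := by
    intro i
    have : μ₁ i + μ₂ i ≤ σ₀ :=
      Finset.single_le_sum (f := fun i => μ₁ i + μ₂ i) (fun i _ => Measure.zero_le _)
        (Finset.mem_univ i)
    exact ⟨(Measure.le_add_right le_rfl).trans this, (Measure.le_add_left le_rfl).trans this⟩
  have hfin : IsFiniteMeasureOnCompacts σ₀ := ⟨fun K hK => by
    rw [hσ₀, Measure.finsetSum_apply]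
    exact ENNReal.sum_lt_top.2 fun i _ =>
      ENNReal.add_lt_top.2 ⟨hK.measure_lt_top, hK.measure_lt_top⟩⟩
  have ac₁ : ∀ i, μ₁ i ≪ σ₀ := fun i => Measure.absolutelyContinuous_of_le (hle i).1
  have ac₂ : ∀ i, μ₂ i ≪ σ₀ := fun i => Measure.absolutelyContinuous_of_le (hle i).2
  set v : U → Space n := fun x => WithLp.toLp 2 fun i =>
    ((μ₁ i).rnDeriv σ₀ x).toReal - ((μ₂ i).rnDeriv σ₀ x).toReal with hv
  have hvm : Measurable v := by
    refine (WithLp.measurable_toLp 2 _).comp (measurable_pi_lambda _ fun i => ?_)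
    exact ((Measure.measurable_rnDeriv _ _).ennreal_toReal).sub
      ((Measure.measurable_rnDeriv _ _).ennreal_toReal)
  have hvn : Measurable fun x => ‖v x‖₊ := hvm.nnnorm
  set σ' : Measure U := σ₀.withDensity fun x => (‖v x‖₊ : ℝ≥0∞) with hσ'
  have hemb : MeasurableEmbedding (Subtype.val : U → Space n) :=
    MeasurableEmbedding.subtype_coe hU.measurableSet
  set ν' : U → Space n := fun x => ‖v x‖⁻¹ • v x with hν'
  have hν'm : Measurable ν' := hvm.norm.inv.smul hvm
  set ν : Space n → Space n := Function.extend Subtype.val ν' 0 with hν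
  have hνv : ∀ x : U, ν x = ν' x := fun x => Subtype.val_injective.extend_apply _ _ x
  refine ⟨σ'.map Subtype.val, ν, ?_, ?_, hemb.measurable_extend hν'm measurable_zero, ?_, ?_⟩
  · rw [hemb.map_apply]
    have : (Subtype.val ⁻¹' Uᶜ : Set U) = ∅ := by ext x; simp
    simp [this]
  · intro K hK hKU
    rw [hemb.map_apply]
    have hK' : IsCompact (Subtype.val ⁻¹' K : Set U) :=
      (Topology.IsInducing.subtypeVal.isCompact_preimage_iff (by simpa using hKU)).2 hK
    have hvle : ∀ᵐ x ∂σ₀, (‖v x‖₊ : ℝ≥0∞)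
        ≤ ∑ i, ((μ₁ i).rnDeriv σ₀ x + (μ₂ i).rnDeriv σ₀ x) := by
      have f1 : ∀ᵐ x ∂σ₀, ∀ i, (μ₁ i).rnDeriv σ₀ x < ⊤ :=
        ae_all_iff.2 fun i => Measure.rnDeriv_lt_top _ _
      have f2 : ∀ᵐ x ∂σ₀, ∀ i, (μ₂ i).rnDeriv σ₀ x < ⊤ :=
        ae_all_iff.2 fun i => Measure.rnDeriv_lt_top _ _
      filter_upwards [f1, f2] with x g1 g2
      have hsum : v x = ∑ i, EuclideanSpace.single i (v x i) := by
        conv_lhs => rw [← (EuclideanSpace.basisFun (Fin (n + 1)) ℝ).sum_repr (v x)]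
        refine Finset.sum_congr rfl fun i _ => ?_
        ext j; simp [PiLp.single_apply]
      have hn : ‖v x‖ ≤ ∑ i, |v x i| := by
        conv_lhs => rw [hsum]
        refine (norm_sum_le _ _).trans (le_of_eq ?_)
        simp
      have hn2 : ‖v x‖ ≤ (∑ i, ((μ₁ i).rnDeriv σ₀ x + (μ₂ i).rnDeriv σ₀ x)).toReal := by
        refine hn.trans ?_
        rw [ENNReal.toReal_sum fun i _ => ENNReal.add_ne_top.2 ⟨(g1 i).ne, (g2 i).ne⟩]
        refine Finset.sum_le_sum fun i _ => ?_
        rw [ENNReal.toReal_add (g1 i).ne (g2 i).ne]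
        refine (abs_sub _ _).trans (le_of_eq ?_)
        rw [abs_of_nonneg ENNReal.toReal_nonneg, abs_of_nonneg ENNReal.toReal_nonneg]
      have := ENNReal.ofReal_le_of_le_toReal hn2
      rwa [← enorm_eq_nnnorm, ← ofReal_norm]
    rw [hσ', withDensity_apply _ hK'.isClosed.measurableSet]
    refine (lintegral_mono_ae (ae_restrict_of_ae hvle)).trans_lt ?_
    have hms : ∀ i, Measurable fun a => (μ₁ i).rnDeriv σ₀ a + (μ₂ i).rnDeriv σ₀ a := fun i =>
      (Measure.measurable_rnDeriv _ _).add (Measure.measurable_rnDeriv _ _)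
    rw [lintegral_finsetSum _ fun i _ => hms i]
    refine ENNReal.sum_lt_top.2 fun i _ => ?_
    rw [lintegral_add_left (Measure.measurable_rnDeriv _ _)]
    exact ENNReal.add_lt_top.2
      ⟨(Measure.setLIntegral_rnDeriv_le _).trans_lt hK'.measure_lt_top,
        (Measure.setLIntegral_rnDeriv_le _).trans_lt hK'.measure_lt_top⟩
  · rw [hemb.ae_map_iff, hσ', ae_withDensity_iff hvn.coe_nnreal_ennreal]
    refine .of_forall fun x hx => ?_
    have : ‖v x‖ ≠ 0 := by simpa using hx
    rw [hνv, hν', norm_smul, norm_inv, norm_norm, inv_mul_cancel₀ this]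
  · intro φ hφ hφc hφU
    have hcomp : ∀ x i, (fderiv ℝ φ x (EuclideanSpace.single i 1)) i
        = fderiv ℝ (fun y => φ y i) x (EuclideanSpace.single i 1) := fun x i =>
      (fderiv_coord (hφ.differentiable one_ne_zero x) i _).symm
    have hsm : ∀ i, ContDiff ℝ 1 fun y => φ y i := fun i => by fun_prop
    have hcs : ∀ i, HasCompactSupport fun y => φ y i := fun i =>
      hφc.comp_left (g := fun v : Space n => v i) rfl
    have hts : ∀ i, tsupport (fun y => φ y i) ⊆ U := fun i =>
      (closure_mono fun x hx => by
        intro h0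
        exact hx (by simp [h0])).trans hφU
    have hcU : ∀ i, HasCompactSupport fun x : U => φ x i := by
      intro i
      refine HasCompactSupport.of_support_subset_isCompact
        (K := Subtype.val ⁻¹' tsupport (fun y => φ y i)) ?_ ?_
      · exact (Topology.IsInducing.subtypeVal.isCompact_preimage_iff
          (by simpa using hts i)).2 (hcs i).isCompact
      · intro x hx
        exact subset_tsupport (fun y => φ y i) hx
    have hcont : ∀ i, Continuous fun x : U => φ x i := fun i =>
      (hsm i).continuous.comp continuous_subtype_val
    have i₁ : ∀ i, Integrable (fun x : U => φ x i) (μ₁ i) := fun i =>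
      (hcont i).integrable_of_hasCompactSupport (hcU i)
    have i₂ : ∀ i, Integrable (fun x : U => φ x i) (μ₂ i) := fun i =>
      (hcont i).integrable_of_hasCompactSupport (hcU i)
    calc ∫ x in L, divergence φ x
        = ∑ i, ∫ x in L, fderiv ℝ (fun y => φ y i) x (EuclideanSpace.single i 1) := by
          unfold divergence
          simp_rw [hcomp]
          refine integral_finsetSum _ fun i _ => Integrable.integrableOn ?_
          exact Continuous.integrable_of_hasCompactSupport
            (((hsm i).continuous_fderiv one_ne_zero).clm_apply continuous_const)
            ((hcs i).fderiv_apply (𝕜 := ℝ) _)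
      _ = ∑ i, (∫ x : U, φ x i ∂(μ₁ i) - ∫ x : U, φ x i ∂(μ₂ i)) :=
          Finset.sum_congr rfl fun i _ => hμ i _ (hsm i) (hcs i) (hts i)
      _ = ∑ i, ∫ x : U, φ x i * v x i ∂σ₀ := by
          refine Finset.sum_congr rfl fun i _ => ?_
          rw [← integral_rnDeriv_smul (ac₁ i), ← integral_rnDeriv_smul (ac₂ i), ← integral_sub
            ((integrable_rnDeriv_smul_iff (ac₁ i)).2 (i₁ i))
            ((integrable_rnDeriv_smul_iff (ac₂ i)).2 (i₂ i))]
          refine integral_congr_ae (.of_forall fun x => ?_)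
          simp only [hv, smul_eq_mul]
          ring
      _ = ∫ x : U, ⟪φ x, v x⟫ ∂σ₀ := by
          rw [← integral_finsetSum]
          · refine integral_congr_ae (.of_forall fun x => ?_)
            simp [PiLp.inner_apply, mul_comm]
          · intro i _
            refine (((integrable_rnDeriv_smul_iff (ac₁ i)).2 (i₁ i)).sub
              ((integrable_rnDeriv_smul_iff (ac₂ i)).2 (i₂ i))).congr
              (.of_forall fun x => ?_)
            simp only [hv, smul_eq_mul, Pi.sub_apply]
            ring
      _ = ∫ x, ⟪φ x, ν x⟫ ∂(σ'.map Subtype.val) := by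
          rw [hemb.integral_map, hσ', integral_withDensity_eq_integral_smul hvn]
          refine integral_congr_ae (.of_forall fun x => ?_)
          simp only [hνv, hν', inner_smul_right, NNReal.smul_def, coe_nnnorm, smul_eq_mul]
          by_cases h0 : v x = 0
          · simp [h0]
          · rw [mul_inv_cancel_left₀ (norm_ne_zero_iff.2 h0)]

end Riesz

/-! ### The surface measure as a variation -/

section Variation

variable {n : ℕ} {L U : Set (Space n)} {σ : Measure (Space n)} {ν : Space n → Space n}

lemma IsGaussGreen.integrable (hG : IsGaussGreen L U σ ν) {f : Space n → ℝ}
    (hf : AEStronglyMeasurable f σ) {C : ℝ} (hC : ∀ᵐ x ∂σ, ‖f x‖ ≤ C) {K : Set (Space n)}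
    (hK : IsCompact K) (hKU : K ⊆ U) (hs : Function.support f ⊆ K) : Integrable f σ := by
  refine (integrableOn_iff_integrable_of_support_subset hs).1 ?_
  exact Measure.integrableOn_of_bounded (hG.finite_on_compacts K hK hKU).ne hf
    (ae_restrict_of_ae hC)

lemma IsGaussGreen.integrable_of_continuous (hG : IsGaussGreen L U σ ν) {f : Space n → ℝ}
    (hf : Continuous f) (hc : HasCompactSupport f) (hs : tsupport f ⊆ U) : Integrable f σ := by
  obtain ⟨C, hC⟩ := hf.bounded_above_of_compact_support hc
  exact hG.integrable hf.aestronglyMeasurable (.of_forall hC) hc.isCompact hs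
    (subset_tsupport f)

lemma IsGaussGreen.integrable_mul (hG : IsGaussGreen L U σ ν) {f g : Space n → ℝ}
    (hf : Continuous f) (hc : HasCompactSupport f) (hs : tsupport f ⊆ U)
    (hg : AEStronglyMeasurable g σ) {C : ℝ} (hC : ∀ᵐ x ∂σ, ‖g x‖ ≤ C) :
    Integrable (fun x => f x * g x) σ :=
  (hG.integrable_of_continuous hf hc hs).mul_bdd hg hC

lemma IsGaussGreen.integrable_inner (hG : IsGaussGreen L U σ ν) {φ : Space n → Space n}
    (hφ : IsTest U φ) : Integrable (fun x => ⟪φ x, ν x⟫) σ := by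
  obtain ⟨C, hC⟩ := hφ.1.continuous.bounded_above_of_compact_support hφ.2
  refine hG.integrable (C := C) ?_ ?_ hφ.2.isCompact hφ.3 ?_
  · exact (hφ.1.continuous.measurable.inner hG.measurable_normal).aestronglyMeasurable
  · filter_upwards [hG.norm_normal] with x hx
    refine (norm_inner_le_norm _ _).trans ?_
    rw [hx, mul_one]
    exact hC x
  · intro x hx
    refine subset_tsupport φ fun h0 => hx ?_
    simp [h0]

lemma IsGaussGreen.measurable_height (hG : IsGaussGreen L U σ ν) :
    Measurable fun x => height (ν x) :=
  continuous_height.measurable.comp hG.measurable_normal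

lemma IsGaussGreen.abs_height_le (hG : IsGaussGreen L U σ ν) :
    ∀ᵐ x ∂σ, ‖height (ν x)‖ ≤ 1 := by
  filter_upwards [hG.norm_normal] with x hx
  rw [← hx]
  exact Capillary.abs_height_le _

lemma IsGaussGreen.integral_fderiv (hG : IsGaussGreen L U σ ν) {f : Space n → ℝ}
    (hf : ContDiff ℝ 1 f) (hc : HasCompactSupport f) (hs : tsupport f ⊆ U) (e : Space n) :
    ∫ x in L, fderiv ℝ f x e = ∫ x, f x * ⟪e, ν x⟫ ∂σ := by
  have ht : IsTest U fun x => f x • e := IsTest.of_smul hf hc hs contDiff_const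
  have := hG.gauss_green _ ht.1 ht.2 ht.3
  simp_rw [divergence_smul_const ((hf.differentiable one_ne_zero) _), inner_smul_left] at this
  simpa using this

lemma IsGaussGreen.integral_fderiv_ez (hG : IsGaussGreen L U σ ν) {f : Space n → ℝ}
    (hf : ContDiff ℝ 1 f) (hc : HasCompactSupport f) (hs : tsupport f ⊆ U) :
    ∫ x in L, fderiv ℝ f x ez = ∫ x, f x * height (ν x) ∂σ := by
  rw [hG.integral_fderiv hf hc hs]
  simp_rw [real_inner_comm, inner_ez]

lemma IsGaussGreen.integral_div_le (hG : IsGaussGreen L U σ ν) {η : Space n → ℝ}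
    (hη : Continuous η) (hc : HasCompactSupport η) (hs : tsupport η ⊆ U)
    {φ : Space n → Space n} (hφ : ContDiff ℝ 1 φ) (hle : ∀ x, ‖φ x‖ ≤ η x) :
    ∫ x in L, divergence φ x ≤ ∫ x, η x ∂σ := by
  have ht : IsTest U φ := .of_support hφ hc.isCompact hs fun x hx => by
    refine subset_tsupport η fun h0 => hx ?_
    have := hle x
    rw [h0] at this
    simpa using this
  rw [hG.gauss_green φ ht.1 ht.2 ht.3]
  refine integral_mono_ae (hG.integrable_inner ht) (hG.integrable_of_continuous hη hc hs) ?_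
  filter_upwards [hG.norm_normal] with x hx
  refine (real_inner_le_norm _ _).trans ?_
  rw [hx, mul_one]
  exact hle x

/-- The surface measure is the variation of the distributional gradient: smooth fields nearly
attain `∫ η dσ`. The map `v ↦ 2v/(1+|v|²)` is a smooth substitute for the projection to the unit
ball which fixes the unit sphere. -/
lemma IsGaussGreen.integral_le (hG : IsGaussGreen L U σ ν) {η : Space n → ℝ}
    (hη : ContDiff ℝ 1 η) (hc : HasCompactSupport η) (hs : tsupport η ⊆ U) (h0 : ∀ x, 0 ≤ η x)
    {B : ℝ} (hB : ∀ φ, ContDiff ℝ 1 φ → (∀ x, ‖φ x‖ ≤ η x) → ∫ x in L, divergence φ x ≤ B) :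
    ∫ x, η x ∂σ ≤ B := by
  set K := tsupport η
  have hK : IsCompact K := hc.isCompact
  have hKf : σ K < ⊤ := hG.finite_on_compacts K hK hs
  have : IsFiniteMeasure (σ.restrict K) := ⟨by simpa using hKf⟩
  obtain ⟨M, hM⟩ := hη.continuous.bounded_above_of_compact_support hc
  have hM0 : 0 ≤ M := (norm_nonneg _).trans (hM 0)
  have hνK : ∀ᵐ x ∂σ.restrict K, ‖ν x‖ = 1 := ae_restrict_of_ae hG.norm_normal
  have hmem : MemLp ν 1 (σ.restrict K) :=
    MemLp.of_bound hG.measurable_normal.aestronglyMeasurable 1 (hνK.mono fun x hx => hx.le)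
  refine le_of_forall_pos_le_add fun ε hε => ?_
  obtain ⟨g, hgc, hg, hle⟩ := hmem.exist_eLpNorm_sub_le (by simp) le_rfl
    (ε := ε / (2 * (M + 1))) (by positivity)
  have hgi : Integrable (fun x => ‖ν x - g x‖) (σ.restrict K) :=
    ((memLp_one_iff_integrable.1 hmem).sub
      (hg.continuous.integrable_of_hasCompactSupport hgc)).norm
  have hgle : ∫ x in K, ‖ν x - g x‖ ∂σ ≤ ε / (2 * (M + 1)) := by
    rw [eLpNorm_one_eq_lintegral_enorm] at hle
    rw [integral_norm_eq_lintegral_enorm (by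
      exact hmem.1.sub hg.continuous.aestronglyMeasurable)]
    exact ENNReal.toReal_le_of_le_ofReal (by positivity) hle
  set b : Space n → Space n := fun x => (2 / (1 + ‖g x‖ ^ 2)) • g x with hb
  have hg1 : ContDiff ℝ 1 g := hg.of_le (by norm_cast)
  have hbs : ContDiff ℝ 1 b :=
    (contDiff_const.div (contDiff_const.add (hg1.norm_sq ℝ)) fun x => by positivity).smul hg1
  have hb1 : ∀ x, ‖b x‖ ≤ 1 := fun x => by
    rw [hb, norm_smul, Real.norm_of_nonneg (by positivity), div_mul_eq_mul_div,
      div_le_one (by positivity)]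
    nlinarith [sq_nonneg (‖g x‖ - 1)]
  have hφ : ContDiff ℝ 1 fun x => η x • b x := hη.smul hbs
  have hφle : ∀ x, ‖η x • b x‖ ≤ η x := fun x => by
    rw [norm_smul, Real.norm_of_nonneg (h0 x)]
    exact mul_le_of_le_one_right (h0 x) (hb1 x)
  have hφt : IsTest U fun x => η x • b x := IsTest.of_smul hη hc hs hbs
  have h1 := hB _ hφ hφle
  rw [hG.gauss_green _ hφt.1 hφt.2 hφt.3] at h1
  have hr1 : ∫ x, η x ∂σ = ∫ x in K, η x ∂σ :=
    (setIntegral_eq_integral_of_forall_compl_eq_zero fun x hx =>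
      image_eq_zero_of_notMem_tsupport hx).symm
  have hr2 : ∫ x, ⟪η x • b x, ν x⟫ ∂σ = ∫ x in K, ⟪η x • b x, ν x⟫ ∂σ :=
    (setIntegral_eq_integral_of_forall_compl_eq_zero fun x hx => by
      simp [image_eq_zero_of_notMem_tsupport hx]).symm
  have hηi : Integrable η (σ.restrict K) :=
    hη.continuous.integrable_of_hasCompactSupport hc
  have hptw : ∀ᵐ x ∂σ.restrict K,
      η x ≤ ⟪η x • b x, ν x⟫ + 2 * M * ‖ν x - g x‖ := by
    filter_upwards [hνK] with x hx
    have e1 : 1 - ⟪b x, ν x⟫ ≤ 2 * ‖ν x - g x‖ := by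
      have e2 : ‖ν x - g x‖ ^ 2 = 1 - 2 * ⟪g x, ν x⟫ + ‖g x‖ ^ 2 := by
        rw [norm_sub_sq_real, hx, real_inner_comm]; ring
      have e3 : ‖ν x - g x‖ ≤ 1 + ‖g x‖ := (norm_sub_le _ _).trans (by rw [hx])
      have e4 : 1 - ⟪b x, ν x⟫ = ‖ν x - g x‖ ^ 2 / (1 + ‖g x‖ ^ 2) := by
        rw [hb, e2, inner_smul_left]
        simp only [RCLike.conj_to_real]
        field_simp
        ring
      rw [e4, div_le_iff₀ (by positivity)]
      have e5 : 1 + ‖g x‖ ≤ 2 * (1 + ‖g x‖ ^ 2) := by nlinarith [sq_nonneg (‖g x‖ - 1)]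
      calc ‖ν x - g x‖ ^ 2 ≤ ‖ν x - g x‖ * (1 + ‖g x‖) := by
            rw [sq]; gcongr
        _ ≤ ‖ν x - g x‖ * (2 * (1 + ‖g x‖ ^ 2)) := by gcongr
        _ = _ := by ring
    rw [inner_smul_left]
    have e6 : η x ≤ M := (le_abs_self _).trans (hM x)
    have e7 : η x * (2 * ‖ν x - g x‖) ≤ M * (2 * ‖ν x - g x‖) := by gcongr
    have e8 := mul_le_mul_of_nonneg_left e1 (h0 x)
    simp only [RCLike.conj_to_real]
    linarith
  have hint : Integrable (fun x => ⟪η x • b x, ν x⟫) (σ.restrict K) :=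
    (hG.integrable_inner hφt).restrict
  have h2 := integral_mono_ae hηi (hint.add (hgi.const_mul (2 * M))) hptw
  simp only [Pi.add_apply] at h2
  rw [integral_add hint (hgi.const_mul _), integral_const_mul, ← hr2, ← hr1] at h2
  have h3 : 2 * M * ∫ x in K, ‖ν x - g x‖ ∂σ ≤ ε := by
    calc _ ≤ 2 * M * (ε / (2 * (M + 1))) := by gcongr
      _ = ε * (M / (M + 1)) := by field_simp
      _ ≤ ε * 1 := by
          gcongr
          rw [div_le_one (by positivity)]
          linarith
      _ = ε := mul_one ε
  linarith

/-- The coefficient of the normal flux in the surface energy: `1` if `R = ∞` and `0` otherwise. -/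
def fluxCoeff (R : EReal) : ℝ := open Classical in if R = ⊤ then 1 else 0

lemma fluxCoeff_top : fluxCoeff ⊤ = 1 := by simp [fluxCoeff]
lemma fluxCoeff_of_ne {R : EReal} (h : R ≠ ⊤) : fluxCoeff R = 0 := by simp [fluxCoeff, h]

/-- The surface energy dominates its truncations, whatever pair represents the boundary. -/
lemma integral_le_surfaceEnergy {R : EReal} (hG : IsGaussGreen L (region R) σ ν)
    (hfin : surfaceEnergy R L ≠ ⊤) {η : Space n → ℝ} (hη : ContDiff ℝ 1 η)
    (hc : HasCompactSupport η) (hs : tsupport η ⊆ region R) (h01 : ∀ x, η x ∈ Icc (0 : ℝ) 1) :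
    ∫ x, η x ∂σ - fluxCoeff R * ∫ x in L, fderiv ℝ η x ez ≤ (surfaceEnergy R L).toReal := by
  by_cases hR : R = ⊤
  · subst hR
    rw [fluxCoeff_top, one_mul, ← ENNReal.ofReal_le_iff_le_toReal hfin]
    simp only [surfaceEnergy, if_true]
    refine le_iInf fun σ' => le_iInf fun ν' => le_iInf fun hG' => ?_
    have h1 : ∫ x, η x ∂σ ≤ ∫ x, η x ∂σ' := hG.integral_le hη hc hs (fun x => (h01 x).1)
      fun φ hφ hle => hG'.integral_div_le hη.continuous hc hs hφ hle
    rw [hG'.integral_fderiv_ez hη hc hs]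
    have i1 := hG'.integrable_of_continuous hη.continuous hc hs
    have i2 := hG'.integrable_mul hη.continuous hc hs hG'.measurable_height.aestronglyMeasurable
      hG'.abs_height_le
    have hnn : ∀ᵐ x ∂σ', 0 ≤ η x - η x * height (ν' x) := by
      filter_upwards [hG'.abs_height_le] with x hx
      have := (abs_le.1 hx).2
      nlinarith [(h01 x).1]
    calc ENNReal.ofReal (∫ x, η x ∂σ - ∫ x, η x * height (ν' x) ∂σ')
        ≤ ENNReal.ofReal (∫ x, (η x - η x * height (ν' x)) ∂σ') := by
          rw [integral_sub i1 i2]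
          exact ENNReal.ofReal_le_ofReal (by linarith)
      _ = ∫⁻ x, ENNReal.ofReal (η x - η x * height (ν' x)) ∂σ' :=
          ofReal_integral_eq_lintegral_ofReal (i1.sub i2) hnn
      _ ≤ ∫⁻ x, ENNReal.ofReal (1 - height (ν' x)) ∂σ' := by
          refine lintegral_mono_ae ?_
          filter_upwards [hG'.abs_height_le] with x hx
          refine ENNReal.ofReal_le_ofReal ?_
          have := (abs_le.1 hx).2
          nlinarith [(h01 x).2]
  · rw [fluxCoeff_of_ne hR, zero_mul, sub_zero]
    simp only [surfaceEnergy, hR, if_false] at hfin ⊢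
    refine hG.integral_le hη hc hs (fun x => (h01 x).1) fun φ hφ hle => ?_
    refine integral_div_le_perimeter (.of_support hφ hc.isCompact hs fun x hx => ?_)
      (fun x => (hle x).trans (h01 x).2) hfin
    refine subset_tsupport η fun h0 => hx ?_
    have := hle x
    rw [h0] at this
    simpa using this

/-- An exhaustion of `U` by smooth cutoff functions. -/
structure IsExhaustion (U : Set (Space n)) (η : ℕ → Space n → ℝ) : Prop where
  smooth : ∀ k, ContDiff ℝ ∞ (η k)
  compact : ∀ k, HasCompactSupport (η k)
  supp : ∀ k, tsupport (η k) ⊆ U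
  mem_Icc : ∀ k x, η k x ∈ Icc (0 : ℝ) 1
  eventually_one : ∀ K : Set (Space n), IsCompact K → K ⊆ U → ∀ᶠ k in atTop, ∀ x ∈ K, η k x = 1

lemma IsExhaustion.contDiff {η : ℕ → Space n → ℝ} (h : IsExhaustion U η) (k : ℕ) :
    ContDiff ℝ 1 (η k) := (h.smooth k).of_le (by norm_cast)

/-- Upper bounds for the surface energy may be checked on test fields dominated by cutoffs. -/
lemma surfaceEnergy_le {R : EReal} (hL : MeasurableSet L) (hC : LocallyCaccioppoli L (region R))
    {η : ℕ → Space n → ℝ} (hη : IsExhaustion (region R) η) {B : ℝ}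
    (hB : ∀ᶠ k in atTop, ∀ φ, ContDiff ℝ 1 φ → (∀ x, ‖φ x‖ ≤ η k x) →
      (∫ x in L, divergence φ x) - fluxCoeff R * (∫ x in L, fderiv ℝ (η k) x ez) ≤ B) :
    surfaceEnergy R L ≤ ENNReal.ofReal B := by
  by_cases hR : R = ⊤
  · subst hR
    obtain ⟨σ, ν, hG⟩ := hC.exists_isGaussGreen (isOpen_region ⊤) hL
    simp only [surfaceEnergy, if_true, fluxCoeff_top, one_mul] at hB ⊢
    refine iInf_le_of_le σ <| iInf_le_of_le ν <| iInf_le_of_le hG ?_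
    have hlim : ∀ᵐ x ∂σ, ENNReal.ofReal (1 - height (ν x))
        ≤ liminf (fun k => ENNReal.ofReal (η k x - η k x * height (ν x))) atTop := by
      have hreg : ∀ᵐ x ∂σ, x ∈ region (⊤ : EReal) := by
        have := hG.null_compl
        rwa [ae_iff]
      filter_upwards [hreg] with x hx
      refine le_liminf_of_le (by isBoundedDefault) ?_
      filter_upwards [hη.eventually_one {x} isCompact_singleton (by simpa using hx)] with k hk
      simp [hk x rfl]
    refine (lintegral_mono_ae hlim).trans ((lintegral_liminf_le fun k => ?_).trans ?_)
    · exact (((hη.smooth k).continuous.measurable.sub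
        ((hη.smooth k).continuous.measurable.mul hG.measurable_height))).ennreal_ofReal
    · refine liminf_le_of_frequently_le' (Eventually.frequently ?_)
      filter_upwards [hB] with k hk
      have i1 := hG.integrable_of_continuous (hη.contDiff k).continuous (hη.compact k) (hη.supp k)
      have i2 := hG.integrable_mul (hη.contDiff k).continuous (hη.compact k) (hη.supp k)
        hG.measurable_height.aestronglyMeasurable hG.abs_height_le
      have hnn : ∀ᵐ x ∂σ, 0 ≤ η k x - η k x * height (ν x) := by
        filter_upwards [hG.abs_height_le] with x hx
        have := (abs_le.1 hx).2
        nlinarith [(hη.mem_Icc k x).1]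
      have i3 : Integrable (fun x => η k x - η k x * height (ν x)) σ := i1.sub i2
      rw [← ofReal_integral_eq_lintegral_ofReal i3 hnn, integral_sub i1 i2,
        ← hG.integral_fderiv_ez (hη.contDiff k) (hη.compact k) (hη.supp k)]
      refine ENNReal.ofReal_le_ofReal ?_
      have := hG.integral_le (hη.contDiff k) (hη.compact k) (hη.supp k)
        (fun x => (hη.mem_Icc k x).1) (B := B + ∫ x in L, fderiv ℝ (η k) x ez)
        fun φ hφ hle => by linarith [hk φ hφ hle]
      linarith
  · simp only [surfaceEnergy, hR, if_false, fluxCoeff_of_ne hR, zero_mul, sub_zero] at hB ⊢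
    refine perimeter_le fun φ hφ h1 => ?_
    obtain ⟨k, hk, hk'⟩ := (hB.and (hη.eventually_one _ hφ.2.isCompact hφ.3)).exists
    refine hk φ hφ.1 fun x => ?_
    by_cases hx : x ∈ tsupport φ
    · rw [hk' x hx]; exact h1 x
    · rw [image_eq_zero_of_notMem_tsupport hx, norm_zero]
      exact (hη.mem_Icc k x).1

end Variation

/-! ### Cutoff functions of the region -/

/-- A smooth monotone step, `0` on `(-∞, 1/2]` and `1` on `[1, ∞)`. -/
def step (t : ℝ) : ℝ := Real.smoothTransition (2 * t - 1)

lemma contDiff_step : ContDiff ℝ ∞ step :=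
  Real.smoothTransition.contDiff.comp ((contDiff_const.mul contDiff_id).sub contDiff_const)

lemma step_mem_Icc (t : ℝ) : step t ∈ Icc (0 : ℝ) 1 :=
  ⟨Real.smoothTransition.nonneg _, Real.smoothTransition.le_one _⟩

lemma step_of_le {t : ℝ} (h : t ≤ 1 / 2) : step t = 0 :=
  Real.smoothTransition.zero_of_nonpos (by linarith)

lemma step_of_ge {t : ℝ} (h : 1 ≤ t) : step t = 1 :=
  Real.smoothTransition.one_of_one_le (by linarith)

lemma monotone_step : Monotone step := fun a b h =>
  Real.smoothTransition.monotone (by linarith)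

lemma deriv_step_nonneg (t : ℝ) : 0 ≤ deriv step t := monotone_step.deriv_nonneg

/-- A defining function of the plate: positive outside, with unit gradient on the plate. -/
def plateFun {n : ℕ} (q : Space n) : ℝ := (‖horiz q‖ ^ 2 - 1) / 2

/-- A defining function of the container: positive inside, with unit gradient on the container.
It is the constant `1` if there is no container. -/
def containerFun {n : ℕ} (R : EReal) (q : Space n) : ℝ := open Classical in
  if R = ⊤ then 1 else (R.toReal ^ 2 - ‖horiz q‖ ^ 2) / (2 * R.toReal)

section Cutoff

variable {n : ℕ} {R : EReal}

lemma toReal_gt_one (hR : 1 < R) (hT : R ≠ ⊤) : 1 < R.toReal := by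
  have : ((1 : ℝ) : EReal) < (R.toReal : EReal) := by
    rw [EReal.coe_toReal hT (ne_bot_of_gt hR)]; exact_mod_cast hR
  exact_mod_cast this

lemma coe_lt_iff (hR : 1 < R) (hT : R ≠ ⊤) (x : ℝ) : (x : EReal) < R ↔ x < R.toReal := by
  conv_lhs => rw [← EReal.coe_toReal hT (ne_bot_of_gt hR)]
  exact EReal.coe_lt_coe_iff

@[fun_prop] lemma contDiff_plateFun {k : WithTop ℕ∞} : ContDiff ℝ k (plateFun : Space n → ℝ) := by
  unfold plateFun
  exact ((contDiff_horiz.norm_sq ℝ).sub contDiff_const).div_const _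

@[fun_prop] lemma contDiff_containerFun {k : WithTop ℕ∞} :
    ContDiff ℝ k (containerFun R : Space n → ℝ) := by
  unfold containerFun
  split_ifs
  · fun_prop
  · exact (contDiff_const.sub (contDiff_horiz.norm_sq ℝ)).div_const _

lemma plateFun_pos_iff (q : Space n) : 0 < plateFun q ↔ 1 < ‖horiz q‖ := by
  rw [plateFun, div_pos_iff_of_pos_right two_pos, sub_pos, one_lt_sq_iff₀ (norm_nonneg _)]

lemma containerFun_pos_iff (hR : 1 < R) (q : Space n) :
    0 < containerFun R q ↔ ((‖horiz q‖ : ℝ) : EReal) < R := by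
  unfold containerFun
  split_ifs with hT
  · subst hT; simp [EReal.coe_lt_top]
  · have h1 := toReal_gt_one hR hT
    rw [coe_lt_iff hR hT, div_pos_iff_of_pos_right (by linarith), sub_pos,
      sq_lt_sq₀ (norm_nonneg _) (by linarith)]

lemma mem_region_iff (hR : 1 < R) (q : Space n) :
    q ∈ region R ↔ 0 < plateFun q ∧ 0 < containerFun R q := by
  rw [plateFun_pos_iff, containerFun_pos_iff hR]; rfl

/-- The standard exhaustion of the region. -/
def cutoff {n : ℕ} (R : EReal) (k : ℕ) (q : Space n) : ℝ :=
  step (k * plateFun q) * step (k * containerFun R q) * step (2 - ‖q‖ ^ 2 / (k : ℝ) ^ 2)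

lemma contDiff_cutoff (k : ℕ) : ContDiff ℝ ∞ (cutoff R k : Space n → ℝ) := by
  unfold cutoff
  have h1 : ContDiff ℝ ∞ fun q : Space n => step (k * plateFun q) :=
    contDiff_step.comp (contDiff_const.mul contDiff_plateFun)
  have h2 : ContDiff ℝ ∞ fun q : Space n => step (k * containerFun R q) :=
    contDiff_step.comp (contDiff_const.mul contDiff_containerFun)
  have h3 : ContDiff ℝ ∞ fun q : Space n => step (2 - ‖q‖ ^ 2 / (k : ℝ) ^ 2) :=
    contDiff_step.comp (contDiff_const.sub ((contDiff_norm_sq ℝ).div_const _))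
  exact (h1.mul h2).mul h3

lemma tendsto_mul_atTop {a : ℝ} (ha : 0 < a) :
    Tendsto (fun k : ℕ => (k : ℝ) * a) atTop atTop :=
  tendsto_natCast_atTop_atTop.atTop_mul_const ha

lemma isExhaustion_cutoff (hR : 1 < R) :
    IsExhaustion (region R : Set (Space n)) (cutoff R) := by
  have hsupp : ∀ k : ℕ, ∃ K : Set (Space n), IsCompact K ∧ K ⊆ region R ∧
      Function.support (cutoff R k) ⊆ K := by
    intro k
    refine ⟨{q | 1 / 2 ≤ k * plateFun q} ∩ {q | 1 / 2 ≤ k * containerFun R q} ∩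
      closedBall 0 (2 * k), ?_, ?_, ?_⟩
    · refine (isCompact_closedBall _ _).inter_left (IsClosed.inter ?_ ?_)
      · exact isClosed_le continuous_const
          (continuous_const.mul (contDiff_plateFun (k := 0)).continuous)
      · exact isClosed_le continuous_const
          (continuous_const.mul (contDiff_containerFun (k := 0)).continuous)
    · rintro q ⟨⟨h1, h2⟩, -⟩
      rw [mem_ofPred_eq] at h1 h2
      have hk : (0 : ℝ) ≤ k := k.cast_nonneg
      exact (mem_region_iff hR q).2 ⟨by by_contra! h; nlinarith, by by_contra! h; nlinarith⟩
    · intro q hq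
      simp only [cutoff, Function.mem_support, mul_ne_zero_iff] at hq
      refine ⟨⟨?_, ?_⟩, ?_⟩
      · by_contra h
        exact hq.1.1 (step_of_le (le_of_lt (not_le.1 h)))
      · by_contra h
        exact hq.1.2 (step_of_le (le_of_lt (not_le.1 h)))
      · rw [mem_closedBall_zero_iff]
        by_contra! h
        have hk0 : (k : ℝ) ≠ 0 := fun h0 => hq.1.1 (step_of_le (by rw [h0]; norm_num))
        have hk : 0 < (k : ℝ) := lt_of_le_of_ne k.cast_nonneg (Ne.symm hk0)
        refine hq.2 (step_of_le ?_)
        have : 2 ≤ ‖q‖ ^ 2 / (k : ℝ) ^ 2 := by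
          rw [le_div_iff₀ (by positivity)]
          nlinarith
        linarith
  refine ⟨contDiff_cutoff, fun k => ?_, fun k => ?_, fun k x => ?_, fun K hK hKU => ?_⟩
  · obtain ⟨K, hK, -, h⟩ := hsupp k
    exact HasCompactSupport.of_support_subset_isCompact hK h
  · obtain ⟨K, hK, hKU, h⟩ := hsupp k
    exact (closure_minimal h hK.isClosed).trans hKU
  · exact ⟨mul_nonneg (mul_nonneg (step_mem_Icc _).1 (step_mem_Icc _).1) (step_mem_Icc _).1,
      mul_le_one₀ (mul_le_one₀ (step_mem_Icc _).2 (step_mem_Icc _).1 (step_mem_Icc _).2)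
        (step_mem_Icc _).1 (step_mem_Icc _).2⟩
  · have hpos : ∀ r : Space n → ℝ, Continuous r → (∀ x ∈ K, 0 < r x) →
        ∀ᶠ k : ℕ in atTop, ∀ x ∈ K, 1 ≤ k * r x := by
      intro r hr h
      rcases K.eq_empty_or_nonempty with rfl | hne
      · simp
      obtain ⟨x₀, hx₀, hmin⟩ := hK.exists_isMinOn hne hr.continuousOn
      filter_upwards [(tendsto_mul_atTop (h x₀ hx₀)).eventually_ge_atTop 1] with k hk x hx
      exact hk.trans (mul_le_mul_of_nonneg_left (hmin hx) k.cast_nonneg)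
    obtain ⟨M, hM⟩ := hK.isBounded.subset_closedBall 0
    filter_upwards [hpos _ (contDiff_plateFun (k := 0)).continuous fun x hx =>
        ((mem_region_iff hR x).1 (hKU hx)).1, hpos _ (contDiff_containerFun (k := 0)).continuous
        fun x hx => ((mem_region_iff hR x).1 (hKU hx)).2,
      tendsto_natCast_atTop_atTop.eventually_ge_atTop M, eventually_gt_atTop 0] with k h1 h2 h3 h4 x
      hx
    have hxM : ‖x‖ ≤ k := (mem_closedBall_zero_iff.1 (hM hx)).trans h3
    have h5 : ‖x‖ ^ 2 / (k : ℝ) ^ 2 ≤ 1 := by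
      have : (0 : ℝ) < k := by exact_mod_cast h4
      rw [div_le_one (by positivity)]
      exact pow_le_pow_left₀ (norm_nonneg _) hxM 2
    rw [cutoff, step_of_ge (h1 x hx), step_of_ge (h2 x hx), step_of_ge (by linarith)]
    norm_num

end Cutoff

/-! ### Compactly supported modifications of a profile -/

section Modification

variable {n : ℕ} {R : EReal} {F g : ℝ} {L M K : Set (Space n)}

lemma measurableSet_regionBelow (R : EReal) (F : ℝ) :
    MeasurableSet (regionBelow R F : Set (Space n)) :=
  (measurableSet_region R).inter (measurableSet_le continuous_height.measurable measurable_const)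

lemma gravityEnergy_modify (hg : 0 ≤ g) (hL : MeasurableSet L) (hM : MeasurableSet M)
    (hLR : L ⊆ region R) (hMR : M ⊆ region R) (hK : IsCompact K) (h : M \ K = L \ K)
    (hfin : gravityEnergy g R F L ≠ ⊤) :
    gravityEnergy g R F M ≠ ⊤ ∧ (gravityEnergy g R F M).toReal
      = (gravityEnergy g R F L).toReal + ((∫ x in M ∩ K, g * (height x - F))
        - ∫ x in L ∩ K, g * (height x - F)) := by
  set B : Set (Space n) := regionBelow R F with hBdef
  have hB : MeasurableSet B := measurableSet_regionBelow R F
  have hKm : MeasurableSet K := hK.isClosed.measurableSet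
  set G : Space n → ℝ := fun x => g * (height x - F) with hG
  have hGc : Continuous G := by fun_prop
  have hGK : IntegrableOn G K := hGc.continuousOn.integrableOn_compact hK
  set w : Space n → ℝ≥0∞ := fun x => ENNReal.ofReal (g * |height x - F|) with hw
  -- inside `K` the gravitational energy is a difference of two integrals of the potential
  have inner : ∀ A : Set (Space n), MeasurableSet A → A ⊆ region R →
      (∫⁻ x in symmDiff A B ∩ K, w x)
        = ENNReal.ofReal ((∫ x in A ∩ K, G x) - ∫ x in B ∩ K, G x) ∧
      0 ≤ (∫ x in A ∩ K, G x) - ∫ x in B ∩ K, G x := by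
    intro A hA hAR
    have habs : ∀ x, g * |height x - F| = |G x| := fun x => by rw [hG, abs_mul, abs_of_nonneg hg]
    have e1 : ∫ x in symmDiff A B ∩ K, |G x| = (∫ x in A ∩ K, G x) - ∫ x in B ∩ K, G x := by
      rw [← integral_indicator (hA.inter hKm), ← integral_indicator (hB.inter hKm),
        ← integral_indicator ((hA.symmDiff hB).inter hKm), ← integral_sub
        ((integrable_indicator_iff (hA.inter hKm)).2 (hGK.mono_set inter_subset_right))
        ((integrable_indicator_iff (hB.inter hKm)).2 (hGK.mono_set inter_subset_right))]
      refine integral_congr_ae (.of_forall fun x => ?_)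
      classical
      simp only [indicator_apply, mem_inter_iff, mem_symmDiff]
      by_cases hxK : x ∈ K <;> by_cases hxA : x ∈ A <;> by_cases hxB : x ∈ B <;>
        simp only [hxK, hxA, hxB, and_self, and_true, and_false, not_true, not_false_iff, or_false,
          or_true, if_true, if_false, sub_zero, zero_sub, sub_self]
      · have : ¬ height x ≤ F := fun hc => hxB ⟨hAR hxA, hc⟩
        exact abs_of_nonneg (mul_nonneg hg (by linarith))
      · have : height x ≤ F := hxB.2
        exact abs_of_nonpos (mul_nonpos_of_nonneg_of_nonpos hg (by linarith))
    have hi : IntegrableOn (fun x => |G x|) (symmDiff A B ∩ K) :=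
      (hGK.mono_set inter_subset_right).abs
    rw [← e1]
    refine ⟨?_, integral_nonneg fun x => abs_nonneg _⟩
    rw [ofReal_integral_eq_lintegral_ofReal hi (.of_forall fun x => abs_nonneg _)]
    simp_rw [hw, habs]
  have split : ∀ A : Set (Space n), gravityEnergy g R F A
      = (∫⁻ x in symmDiff A B ∩ K, w x) + ∫⁻ x in symmDiff A B \ K, w x := fun A => by
    rw [gravityEnergy, ← hBdef, lintegral_inter_add_sdiff _ _ hKm]
  have hout : symmDiff M B \ K = symmDiff L B \ K := by
    ext x
    have := Set.ext_iff.1 h x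
    simp only [Set.mem_sdiff, mem_symmDiff] at this ⊢
    tauto
  have hLs := split L
  have hMs := split M
  rw [(inner L hL hLR).1] at hLs
  rw [(inner M hM hMR).1, hout] at hMs
  have hTfin : ∫⁻ x in symmDiff L B \ K, w x ≠ ⊤ := by
    rw [hLs] at hfin
    exact (ENNReal.add_ne_top.1 hfin).2
  rw [hLs, hMs]
  refine ⟨ENNReal.add_ne_top.2 ⟨ENNReal.ofReal_ne_top, hTfin⟩, ?_⟩
  rw [ENNReal.toReal_add ENNReal.ofReal_ne_top hTfin, ENNReal.toReal_add ENNReal.ofReal_ne_top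
    hTfin, ENNReal.toReal_ofReal (inner L hL hLR).2, ENNReal.toReal_ofReal (inner M hM hMR).2]
  ring

/-- The volume constraint only sees the volume in the compact set where the profile is modified. -/
lemma volume_modify {B : Set (Space n)} (hL : MeasurableSet L) (hM : MeasurableSet M)
    (hB : MeasurableSet B) (hK : IsCompact K) (h : M \ K = L \ K)
    (hvol : volume (M ∩ K) = volume (L ∩ K))
    (h1 : volume (L \ B) < ⊤) (h2 : volume (L \ B) = volume (B \ L)) :
    volume (M \ B) < ⊤ ∧ volume (M \ B) = volume (B \ M) := by
  have hKm : MeasurableSet K := hK.isClosed.measurableSet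
  have hKf : volume K < ⊤ := hK.measure_lt_top
  have out1 : (M \ B) \ K = (L \ B) \ K := by
    ext x; have := Set.ext_iff.1 h x; simp only [Set.mem_sdiff] at this ⊢; tauto
  have out2 : (B \ M) \ K = (B \ L) \ K := by
    ext x; have := Set.ext_iff.1 h x; simp only [Set.mem_sdiff] at this ⊢; tauto
  have fin : ∀ A A' : Set (Space n), A \ K = A' \ K → volume A' < ⊤ → volume A < ⊤ := by
    intro A A' hA hf
    calc volume A ≤ volume (A \ K) + volume K := by
          rw [← measure_inter_add_sdiff A hKm, add_comm]
          gcongr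
          exact inter_subset_right
      _ < ⊤ := by
          rw [hA]
          exact ENNReal.add_lt_top.2 ⟨(measure_mono sdiff_subset).trans_lt hf, hKf⟩
  have f1 := fin _ _ out1 h1
  have f2 := fin _ _ out2 (h2 ▸ h1)
  refine ⟨f1, ?_⟩
  have bal : ∀ A : Set (Space n), MeasurableSet A →
      volume.real ((A \ B) ∩ K) - volume.real ((B \ A) ∩ K)
        = volume.real (A ∩ K) - volume.real (B ∩ K) := by
    intro A hA
    have fK : ∀ S : Set (Space n), S ∩ K ⊆ K := fun S => inter_subset_right
    have e1 := measureReal_inter_add_sdiff (μ := volume) (s := A ∩ K) hB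
      ((measure_mono (fK A)).trans_lt hKf).ne
    have e2 := measureReal_inter_add_sdiff (μ := volume) (s := B ∩ K) hA
      ((measure_mono (fK B)).trans_lt hKf).ne
    have s1 : A ∩ K ∩ B = B ∩ K ∩ A := by ext x; simp only [mem_inter_iff]; tauto
    have s2 : (A ∩ K) \ B = (A \ B) ∩ K := by ext x; simp only [mem_inter_iff, Set.mem_sdiff]; tauto
    have s3 : (B ∩ K) \ A = (B \ A) ∩ K := by ext x; simp only [mem_inter_iff, Set.mem_sdiff]; tauto
    rw [s1, s2] at e1
    rw [s3] at e2
    linarith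
  have sp : ∀ A : Set (Space n), volume A < ⊤ →
      volume.real A = volume.real (A ∩ K) + volume.real (A \ K) := fun A hA =>
    (measureReal_inter_add_sdiff hKm hA.ne).symm
  have q1 := sp _ f1
  have q2 := sp _ f2
  have q3 := sp _ h1
  have q4 := sp _ (h2 ▸ h1 : volume (B \ L) < ⊤)
  have q5 : volume.real (L \ B) = volume.real (B \ L) := congrArg ENNReal.toReal h2
  have q6 : volume.real (M ∩ K) = volume.real (L ∩ K) := congrArg ENNReal.toReal hvol
  have b1 := bal L hL
  have b2 := bal M hM
  rw [out1] at q1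
  rw [out2] at q2
  refine (ENNReal.toReal_eq_toReal_iff' f1.ne f2.ne).1 ?_
  change volume.real _ = volume.real _
  linarith

/-- Whether a point belongs to the trace depends only on the germ of the set there. -/
lemma mem_trace_congr {S : Set (Space n)} {y : Space n} {r : ℝ} (hr : 0 < r)
    (h : (L ∩ region R ∩ ball y r : Set (Space n))
      =ᵐ[volume] (M ∩ region R ∩ ball y r : Set (Space n))) :
    y ∈ trace R S L ↔ y ∈ trace R S M := by
  have key : ∀ᶠ ρ in 𝓝[>] (0 : ℝ), volume (L ∩ region R ∩ ball y ρ)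
      = volume (M ∩ region R ∩ ball y ρ) := by
    filter_upwards [Ioo_mem_nhdsGT hr] with ρ hρ
    have e : ∀ A : Set (Space n), A ∩ region R ∩ ball y ρ
        = (A ∩ region R ∩ ball y r) ∩ ball y ρ := by
      intro A
      rw [inter_assoc _ (ball y r), inter_eq_right.2 (ball_subset_ball hρ.2.le)]
    rw [e L, e M]
    exact measure_congr (h.inter ae_eq_rfl)
  simp only [trace, mem_ofPred_eq]
  refine and_congr_right fun _ => tendsto_congr' ?_
  filter_upwards [key] with ρ hρ
  rw [hρ]

lemma trace_congr {S : Set (Space n)} (h : L =ᵐ[volume] M) : trace R S L = trace R S M := by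
  ext y
  exact mem_trace_congr one_pos ((h.inter ae_eq_rfl).inter ae_eq_rfl)

lemma mem_trace_iff_of_diff_eq {S : Set (Space n)} {y : Space n} (hK : IsClosed K) (hy : y ∉ K)
    (h : M \ K = L \ K) : y ∈ trace R S M ↔ y ∈ trace R S L := by
  obtain ⟨r, hr, hb⟩ := isOpen_iff.1 hK.isOpen_compl y hy
  refine mem_trace_congr hr (.of_forall fun x => propext ?_)
  change x ∈ M ∩ region R ∩ ball y r ↔ x ∈ L ∩ region R ∩ ball y r
  have := Set.ext_iff.1 h x
  simp only [mem_inter_iff, Set.mem_sdiff] at this ⊢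
  constructor
  · rintro ⟨⟨h1, h2⟩, h3⟩; exact ⟨⟨(this.1 ⟨h1, hb h3⟩).1, h2⟩, h3⟩
  · rintro ⟨⟨h1, h2⟩, h3⟩; exact ⟨⟨(this.2 ⟨h1, hb h3⟩).1, h2⟩, h3⟩

lemma notMem_region_of_mem_thinCyl_one {q : Space n} (h : q ∈ thinCyl 1) : q ∉ region R := by
  intro hq
  have h1 : ((‖horiz q‖ : ℝ) : EReal) = 1 := h
  have h2 : 1 < ‖horiz q‖ := hq.1
  have h3 : ((‖horiz q‖ : ℝ) : EReal) = ((1 : ℝ) : EReal) := by simpa using h1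
  rw [EReal.coe_eq_coe_iff] at h3
  linarith

lemma notMem_region_of_mem_thinCyl {q : Space n} (h : q ∈ thinCyl R) : q ∉ region R := fun hq =>
  (ne_of_lt hq.2) h

end Modification

/-! ### First variation along shears -/

section FirstVariation

variable {n : ℕ} {L U : Set (Space n)} {σ : Measure (Space n)} {ν : Space n → Space n}
  {f : Space n → ℝ} {e : Space n} {s : ℝ}

/-- The density of the first variation of area under the field `f e`, that is
`div (f e) - ν · D(f e) ν`. -/
def areaDensity (f : Space n → ℝ) (e : Space n) (ν : Space n → Space n) (x : Space n) : ℝ :=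
  fderiv ℝ f x e - ⟪ν x, e⟫ * fderiv ℝ f x (ν x)

lemma areaDensity_of_notMem {x : Space n} (hx : x ∉ tsupport f) : areaDensity f e ν x = 0 := by
  simp [areaDensity, fderiv_of_notMem_tsupport (𝕜 := ℝ) hx]

lemma abs_areaDensity_le {x : Space n} (hx : ‖ν x‖ = 1) :
    |areaDensity f e ν x| ≤ 2 * (‖fderiv ℝ f x‖ * ‖e‖) := by
  have h1 : |fderiv ℝ f x e| ≤ ‖fderiv ℝ f x‖ * ‖e‖ := (fderiv ℝ f x).le_opNorm e
  have h2 : |⟪ν x, e⟫| ≤ ‖e‖ := by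
    have := abs_real_inner_le_norm (ν x) e
    rwa [hx, one_mul] at this
  have h3 : |fderiv ℝ f x (ν x)| ≤ ‖fderiv ℝ f x‖ := by
    have := (fderiv ℝ f x).le_opNorm (ν x)
    rwa [hx, mul_one] at this
  calc |areaDensity f e ν x| ≤ |fderiv ℝ f x e| + |⟪ν x, e⟫ * fderiv ℝ f x (ν x)| := abs_sub _ _
    _ ≤ ‖fderiv ℝ f x‖ * ‖e‖ + ‖e‖ * ‖fderiv ℝ f x‖ := by
        rw [abs_mul]; gcongr
    _ = _ := by ring

lemma IsGaussGreen.measurable_areaDensity (hG : IsGaussGreen L U σ ν) (hf : ContDiff ℝ 1 f) :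
    Measurable (areaDensity f e ν) := by
  have h1 : Measurable (fderiv ℝ f) := (hf.continuous_fderiv one_ne_zero).measurable
  have h2 : Measurable fun x => fderiv ℝ f x (ν x) :=
    (isBoundedBilinearMap_apply (𝕜 := ℝ) (E := Space n) (F := ℝ)).continuous.measurable.comp
      (h1.prodMk hG.measurable_normal)
  have h3 : Measurable fun x => fderiv ℝ f x e :=
    ((hf.continuous_fderiv one_ne_zero).clm_apply continuous_const).measurable
  exact h3.sub ((hG.measurable_normal.inner measurable_const).mul h2)

lemma IsGaussGreen.integrable_areaDensity (hG : IsGaussGreen L U σ ν) (hf : ContDiff ℝ 1 f)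
    (hc : HasCompactSupport f) (hs : tsupport f ⊆ U) : Integrable (areaDensity f e ν) σ := by
  obtain ⟨C, hC⟩ := (hf.continuous_fderiv one_ne_zero).bounded_above_of_compact_support
    (hc.fderiv (𝕜 := ℝ))
  refine hG.integrable (hG.measurable_areaDensity hf).aestronglyMeasurable
    (C := 2 * (C * ‖e‖)) ?_ hc.isCompact hs fun x hx => ?_
  · filter_upwards [hG.norm_normal] with x hx
    refine (abs_areaDensity_le hx).trans ?_
    gcongr
    exact hC x
  · by_contra h
    exact hx (areaDensity_of_notMem h)

/-- The flux of the Piola transform of a field of length at most one. -/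
lemma inner_piola_le {φ : Space n → Space n} {x v : Space n} {K : ℝ}
    (hv : ‖v‖ = 1) (hφ : ‖φ (shear f e s x)‖ ≤ 1) (hK : ‖fderiv ℝ f x‖ * ‖e‖ ≤ K) :
    ⟪piola f e s φ x, v⟫
      ≤ 1 + s * (fderiv ℝ f x e - ⟪v, e⟫ * fderiv ℝ f x v) + 2 * K ^ 2 * s ^ 2 := by
  set G : Space n := gradient f x with hGdef
  have hGi : ∀ w, fderiv ℝ f x w = ⟪G, w⟫ := fun w => by
    rw [hGdef, gradient, InnerProductSpace.toDual_symm_apply]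
  have hGn : ‖G‖ = ‖fderiv ℝ f x‖ := by simp [hGdef, gradient]
  set d := fderiv ℝ f x e with hd
  set m := fderiv ℝ f x v with hm
  set c : ℝ := ⟪v, e⟫ with hc
  set w : Space n := (1 + s * d) • v - (s * c) • G with hw
  have hK0 : 0 ≤ ‖fderiv ℝ f x‖ * ‖e‖ := by positivity
  have e1 : ⟪piola f e s φ x, v⟫ = ⟪φ (shear f e s x), w⟫ := by
    rw [piola, hw, inner_sub_left, inner_sub_right, inner_smul_left, inner_smul_left,
      inner_smul_right, inner_smul_right, hGi (φ _), real_inner_comm v e,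
      real_inner_comm (φ _) G, ← hd, ← hc]
    simp only [RCLike.conj_to_real]
    ring
  have e2 : ⟪φ (shear f e s x), w⟫ ≤ ‖w‖ :=
    (real_inner_le_norm _ _).trans (mul_le_of_le_one_left (norm_nonneg _) hφ)
  have e3 : ‖w‖ ^ 2 = (1 + s * d) ^ 2 - 2 * ((1 + s * d) * (s * c) * m)
      + (s * c) ^ 2 * ‖G‖ ^ 2 := by
    rw [hw, norm_sub_sq_real, norm_smul, norm_smul, inner_smul_left, inner_smul_right,
      mul_pow, mul_pow, hv, Real.norm_eq_abs, Real.norm_eq_abs, sq_abs, sq_abs, hm, hGi,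
      real_inner_comm G v]
    simp only [RCLike.conj_to_real]
    ring
  have hdK : |d| ≤ K := ((fderiv ℝ f x).le_opNorm e).trans hK
  have hce : |c| ≤ ‖e‖ := by
    have := abs_real_inner_le_norm v e
    rwa [hv, one_mul] at this
  have hmG : |m| ≤ ‖fderiv ℝ f x‖ := by
    have := (fderiv ℝ f x).le_opNorm v
    rwa [hv, mul_one] at this
  have hcm : |c * m| ≤ K := by
    rw [abs_mul]
    calc _ ≤ ‖e‖ * ‖fderiv ℝ f x‖ := by gcongr
      _ ≤ K := by linarith
  have hcG : (c * ‖G‖) ^ 2 ≤ K ^ 2 := by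
    rw [← sq_abs (c * ‖G‖), abs_mul, hGn, abs_norm]
    refine pow_le_pow_left₀ (by positivity) ?_ 2
    calc _ ≤ ‖e‖ * ‖fderiv ℝ f x‖ := by gcongr
      _ ≤ K := by linarith
  have hd2 : d ^ 2 ≤ K ^ 2 := by
    rw [← sq_abs]; exact pow_le_pow_left₀ (abs_nonneg _) hdK 2
  have hdcm : -(d * (c * m)) ≤ K ^ 2 := by
    refine (neg_le_abs _).trans ?_
    rw [abs_mul, sq]
    exact mul_le_mul hdK hcm (abs_nonneg _) ((abs_nonneg _).trans hdK)
  have e4 : ‖w‖ ^ 2 ≤ 1 + 2 * (s * (d - c * m)) + 4 * K ^ 2 * s ^ 2 := by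
    rw [e3]
    nlinarith [sq_nonneg s, mul_le_mul_of_nonneg_left hcG (sq_nonneg s),
      mul_le_mul_of_nonneg_left hd2 (sq_nonneg s), mul_le_mul_of_nonneg_left hdcm (sq_nonneg s)]
  rw [e1]
  nlinarith [sq_nonneg (‖w‖ - 1)]

/-- The first variation of area, tested against dominated fields. -/
lemma IsShear.integral_image_divergence_le (h : IsShear f e s) (hG : IsGaussGreen L U σ ν)
    (hL : MeasurableSet L) (hfU : tsupport f ⊆ U) {K : ℝ}
    (hK : ∀ x, ‖fderiv ℝ f x‖ * ‖e‖ ≤ K) {η : Space n → ℝ} (hη : Continuous η)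
    (hηc : HasCompactSupport η) (hηU : tsupport η ⊆ U) (h01 : ∀ x, η x ∈ Icc (0 : ℝ) 1)
    (hη1 : ∀ x ∈ tsupport f, η x = 1) {φ : Space n → Space n} (hφ : ContDiff ℝ 1 φ)
    (hle : ∀ x, ‖φ x‖ ≤ η x) :
    ∫ x in shear f e s '' L, divergence φ x
      ≤ ∫ x, η x ∂σ + s * (∫ x, areaDensity f e ν x ∂σ)
        + 2 * K ^ 2 * s ^ 2 * σ.real (tsupport f) := by
  have hf1 : ContDiff ℝ 1 f := h.smooth.of_le (by norm_cast)
  have hφη : tsupport φ ⊆ tsupport η := closure_mono fun x hx h0 => hx (by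
    have := hle x
    rw [h0] at this
    simpa using this)
  have ht : IsTest U (piola f e s φ) := h.isTest_piola (hηc.isCompact.union h.compact.isCompact)
    (union_subset hηU hfU) subset_union_right hφ (hφη.trans subset_union_left)
  have hKm : MeasurableSet (tsupport f) := (isClosed_tsupport f).measurableSet
  have hKf : σ (tsupport f) < ⊤ := hG.finite_on_compacts _ h.compact.isCompact hfU
  rw [h.integral_image_divergence hL hφ, hG.gauss_green _ ht.1 ht.2 ht.3]
  have i1 := hG.integrable_of_continuous hη hηc hηU
  have i2 : Integrable (fun x => s * areaDensity f e ν x) σ :=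
    (hG.integrable_areaDensity hf1 h.compact hfU).const_mul s
  have i3 : Integrable ((tsupport f).indicator fun _ => 2 * K ^ 2 * s ^ 2) σ :=
    (integrable_indicator_iff hKm).2 (integrableOn_const hKf.ne)
  have key : ∫ x, ⟪piola f e s φ x, ν x⟫ ∂σ ≤ ∫ x, (η x + s * areaDensity f e ν x
      + (tsupport f).indicator (fun _ => 2 * K ^ 2 * s ^ 2) x) ∂σ := by
    refine integral_mono_ae (hG.integrable_inner ht) ((i1.add i2).add i3) ?_
    filter_upwards [hG.norm_normal] with x hx
    by_cases hxf : x ∈ tsupport f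
    · rw [indicator_of_mem hxf, hη1 x hxf]
      exact inner_piola_le hx ((hle _).trans (h01 _).2) (hK x)
    · rw [indicator_of_notMem hxf, piola_of_notMem hxf, areaDensity_of_notMem hxf]
      have := real_inner_le_norm (φ x) (ν x)
      rw [hx, mul_one] at this
      linarith [hle x]
  refine key.trans (le_of_eq ?_)
  rw [integral_add (f := fun x => η x + s * areaDensity f e ν x) (i1.add i2) i3,
    integral_add i1 i2, integral_const_mul, integral_indicator_const _ hKm, smul_eq_mul]
  ring

/-- The change of the volume under a shear is linear in the parameter. -/
lemma IsShear.measureReal_image (h : IsShear f e s) (hL : MeasurableSet L) :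
    volume.real (shear f e s '' L ∩ tsupport f)
      = volume.real (L ∩ tsupport f) + s * ∫ x in L, fderiv ℝ f x e := by
  have hKm : MeasurableSet (tsupport f) := (isClosed_tsupport f).measurableSet
  have hf1 : ContDiff ℝ 1 f := h.smooth.of_le (by norm_cast)
  have hfin : volume (L ∩ tsupport f) < ⊤ :=
    (measure_mono inter_subset_right).trans_lt h.compact.isCompact.measure_lt_top
  have i1 : Integrable fun x => fderiv ℝ f x e :=
    ((hf1.continuous_fderiv one_ne_zero).clm_apply continuous_const).integrable_of_hasCompactSupport
      (h.compact.fderiv_apply (𝕜 := ℝ) e)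
  have e1 := h.integral_image (hL.inter hKm) (fun _ => (1 : ℝ))
  rw [← h.image_inter (fun x hx => subset_tsupport f hx)] at e1
  simp only [integral_const, smul_eq_mul, mul_one, measureReal_restrict_apply_univ] at e1
  rw [e1, integral_add (integrable_const_iff.2 (Or.inr ⟨by simpa using hfin⟩))
    (i1.integrableOn.const_mul s), integral_const_mul]
  congr 1
  · simp
  · congr 1
    rw [inter_comm, ← Measure.restrict_restrict hKm]
    exact setIntegral_eq_integral_of_forall_compl_eq_zero fun x hx => by
      simp [fderiv_of_notMem_tsupport (𝕜 := ℝ) hx]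

/-- The first variation of the gravitational energy. -/
lemma IsShear.integral_gravity_image (h : IsShear f e s) (hG : IsGaussGreen L U σ ν)
    (hL : MeasurableSet L) (hfU : tsupport f ⊆ U) (g F : ℝ) :
    (∫ x in shear f e s '' L ∩ tsupport f, g * (height x - F))
      = (∫ x in L ∩ tsupport f, g * (height x - F))
        + s * (∫ x, g * (height x - F) * f x * ⟪e, ν x⟫ ∂σ)
        + s ^ 2 * ∫ x in L ∩ tsupport f, g * (f x * fderiv ℝ f x e * height e) := by
  have hKm : MeasurableSet (tsupport f) := (isClosed_tsupport f).measurableSet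
  have hf1 : ContDiff ℝ 1 f := h.smooth.of_le (by norm_cast)
  have hder : Continuous fun x => fderiv ℝ f x e :=
    (hf1.continuous_fderiv one_ne_zero).clm_apply continuous_const
  have hfc := hf1.continuous
  have hint : ∀ q : Space n → ℝ, Continuous q → IntegrableOn q (L ∩ tsupport f) := fun q hq =>
    (hq.continuousOn.integrableOn_compact h.compact.isCompact).mono_set inter_subset_right
  rw [h.image_inter (fun x hx => subset_tsupport f hx), h.integral_image (hL.inter hKm)]
  have hGf : ContDiff ℝ 1 fun x : Space n => g * (height x - F) * f x :=
    (contDiff_const.mul (contDiff_height.sub contDiff_const)).mul hf1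
  have hsub : tsupport (fun x : Space n => g * (height x - F) * f x) ⊆ tsupport f :=
    tsupport_mul_subset_right
  have e1 := hG.integral_fderiv hGf (h.compact.of_isClosed_subset (isClosed_tsupport _) hsub)
    (hsub.trans hfU) e
  have e2 : ∀ x, fderiv ℝ (fun x : Space n => g * (height x - F) * f x) x e
      = fderiv ℝ f x e * (g * (height x - F)) + g * f x * height e := by
    intro x
    have d1 : DifferentiableAt ℝ (fun x : Space n => g * (height x - F)) x :=
      (contDiff_const.mul (contDiff_height.sub contDiff_const) :
        ContDiff ℝ 1 fun x : Space n => g * (height x - F)).differentiable one_ne_zero x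
    have d2 : DifferentiableAt ℝ (height : Space n → ℝ) x :=
      (contDiff_height (k := 1)).differentiable one_ne_zero x
    rw [fderiv_fun_mul d1 (h.differentiable x), fderiv_const_mul (d2.sub_const F),
      fderiv_sub_const]
    simp [fderiv_height]
    ring
  simp_rw [e2] at e1
  rw [← e1]
  have e3 : (∫ x in L, (fderiv ℝ f x e * (g * (height x - F)) + g * f x * height e))
      = ∫ x in L ∩ tsupport f, (fderiv ℝ f x e * (g * (height x - F)) + g * f x * height e) := by
    rw [inter_comm, ← Measure.restrict_restrict hKm]
    exact (setIntegral_eq_integral_of_forall_compl_eq_zero fun x hx => by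
      simp [fderiv_of_notMem_tsupport (𝕜 := ℝ) hx, image_eq_zero_of_notMem_tsupport hx]).symm
  rw [e3, ← integral_const_mul, ← integral_const_mul, ← integral_add (hint _ (by fun_prop))
    (hint _ (by fun_prop)), ← integral_add (hint _ (by fun_prop)) (hint _ (by fun_prop))]
  refine integral_congr_ae (.of_forall fun x => ?_)
  simp only [shear, height_add, height_smul]
  ring

end FirstVariation

/-! ### Cutting along a calibrated hypersurface -/

section Cut

variable {n : ℕ} {N : Set (Space n)}

/-- Let the smooth weights `w j` converge on `N` to the indicator of `D`, and let `X` be the unit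
field in the direction of their gradients. Then cutting `D` off `N` changes the variation with
weight `η` by at most `-∫_D div (η X)`: the field `(1 - w) φ + w η X` is a competitor for `N`. -/
lemma integral_div_diff_le (hN : MeasurableSet N) {D : Set (Space n)} (hD : MeasurableSet D)
    (hDN : D ⊆ N) {w : ℕ → Space n → ℝ} (hw : ∀ j, ContDiff ℝ 1 (w j))
    (hw01 : ∀ j x, w j x ∈ Icc (0 : ℝ) 1) {X : Space n → Space n} (hX : ContDiff ℝ 1 X)
    (hX1 : ∀ j x, w j x ≠ 0 → ‖X x‖ ≤ 1)
    (hgrad : ∀ᶠ j in atTop, ∀ x ∈ N, fderiv ℝ (w j) x (X x) = ‖fderiv ℝ (w j) x‖)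
    (hlim : ∀ x ∈ N, Tendsto (fun j => w j x) atTop (𝓝 (D.indicator 1 x)))
    {η : Space n → ℝ} (hη : ContDiff ℝ 1 η) (hηc : HasCompactSupport η) (hη0 : ∀ x, 0 ≤ η x)
    {B : ℝ} (hB : ∀ φ, ContDiff ℝ 1 φ → (∀ x, ‖φ x‖ ≤ η x) → ∫ x in N, divergence φ x ≤ B)
    {φ : Space n → Space n} (hφ : ContDiff ℝ 1 φ) (hle : ∀ x, ‖φ x‖ ≤ η x) :
    ∫ x in N \ D, divergence φ x ≤ B - ∫ x in D, divergence (fun y => η y • X y) x := by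
  have hφc : HasCompactSupport φ := hηc.mono fun x hx h0 => hx (by
    have := hle x
    rw [h0] at this
    simpa using this)
  have hηX : ContDiff ℝ 1 fun y => η y • X y := hη.smul hX
  have hηXc : HasCompactSupport fun y => η y • X y := hηc.smul_right
  have i1 := integrable_divergence hφ hφc
  have i2 := integrable_divergence hηX hηXc
  have main : ∀ᶠ j in atTop, ∫ x in N, ((1 - w j x) * divergence φ x
      + w j x * divergence (fun y => η y • X y) x) ≤ B := by
    filter_upwards [hgrad] with j hj
    have hwj := hw j
    set ψ : Space n → Space n := fun x => (1 - w j x) • φ x + w j x • (η x • X x) with hψ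
    have hψ1 : ContDiff ℝ 1 ψ := ((contDiff_const.sub hwj).smul hφ).add (hwj.smul hηX)
    have hψle : ∀ x, ‖ψ x‖ ≤ η x := fun x => by
      have h01 := hw01 j x
      have a1 : ‖(1 - w j x) • φ x‖ ≤ (1 - w j x) * η x := by
        rw [norm_smul, Real.norm_of_nonneg (by linarith [h01.2])]
        exact mul_le_mul_of_nonneg_left (hle x) (by linarith [h01.2])
      have a2 : ‖w j x • (η x • X x)‖ ≤ w j x * η x := by
        by_cases h0 : w j x = 0
        · simp [h0]
        · rw [norm_smul, norm_smul, Real.norm_of_nonneg h01.1, Real.norm_of_nonneg (hη0 x)]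
          exact mul_le_mul_of_nonneg_left (mul_le_of_le_one_right (hη0 x) (hX1 j x h0)) h01.1
      linarith [norm_add_le ((1 - w j x) • φ x) (w j x • (η x • X x))]
    refine le_trans (setIntegral_mono_on ?_ ?_ hN fun x hx => ?_) (hB ψ hψ1 hψle)
    · refine Integrable.integrableOn (Integrable.add ?_ ?_)
      · refine i1.bdd_mul (c := 1) ?_ (.of_forall fun x => ?_)
        · exact (contDiff_const.sub hwj).continuous.aestronglyMeasurable
        · have := hw01 j x
          rw [Real.norm_of_nonneg (by linarith [this.2])]
          linarith [this.1]
      · refine i2.bdd_mul (c := 1) hwj.continuous.aestronglyMeasurable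
          (.of_forall fun x => ?_)
        have := hw01 j x
        rw [Real.norm_of_nonneg this.1]
        exact this.2
    · have hψc : HasCompactSupport ψ := hηc.mono fun x hx h0 => hx (by
        have := hψle x
        rw [h0] at this
        simpa using this)
      exact (integrable_divergence hψ1 hψc).integrableOn
    · have dw : DifferentiableAt ℝ (w j) x := hwj.differentiable one_ne_zero x
      have dφ := hφ.differentiable one_ne_zero x
      have dη := hηX.differentiable one_ne_zero x
      have dw' : DifferentiableAt ℝ (fun x => 1 - w j x) x := dw.const_sub 1
      have e1 : divergence ψ x = (1 - w j x) * divergence φ x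
          + w j x * divergence (fun y => η y • X y) x
          + (η x * fderiv ℝ (w j) x (X x) - fderiv ℝ (w j) x (φ x)) := by
        rw [hψ, divergence_add (X := fun x => (1 - w j x) • φ x) (dw'.smul dφ)
          (Y := fun x => w j x • (η x • X x)) (dw.smul dη), divergence_smul dw' dφ,
          divergence_smul dw dη, fderiv_const_sub]
        simp
        ring
      have e2 : fderiv ℝ (w j) x (φ x) ≤ η x * ‖fderiv ℝ (w j) x‖ := by
        calc _ ≤ ‖fderiv ℝ (w j) x‖ * ‖φ x‖ :=
              (le_abs_self _).trans ((fderiv ℝ (w j) x).le_opNorm _)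
          _ ≤ _ := by rw [mul_comm]; exact mul_le_mul_of_nonneg_right (hle x) (norm_nonneg _)
      rw [e1, hj x hx]
      linarith
  have hconv : Tendsto (fun j => ∫ x in N, ((1 - w j x) * divergence φ x
      + w j x * divergence (fun y => η y • X y) x)) atTop
      (𝓝 (∫ x in N, ((1 - D.indicator 1 x) * divergence φ x
      + D.indicator 1 x * divergence (fun y => η y • X y) x))) := by
    refine tendsto_integral_of_dominated_convergence
      (fun x => ‖divergence φ x‖ + ‖divergence (fun y => η y • X y) x‖) (fun j => ?_)
      (i1.norm.add i2.norm).integrableOn (fun j => .of_forall fun x => ?_) ?_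
    · exact (((continuous_const.sub (hw j).continuous).mul (continuous_divergence hφ)).add
        ((hw j).continuous.mul (continuous_divergence hηX))).aestronglyMeasurable
    · have := hw01 j x
      refine (norm_add_le _ _).trans (add_le_add ?_ ?_)
      · rw [norm_mul, Real.norm_of_nonneg (by linarith [this.2])]
        exact mul_le_of_le_one_left (norm_nonneg _) (by linarith [this.1])
      · rw [norm_mul, Real.norm_of_nonneg this.1]
        exact mul_le_of_le_one_left (norm_nonneg _) this.2
    · refine (ae_restrict_iff' hN).2 (.of_forall fun x hx => ?_)
      exact ((tendsto_const_nhds.sub (hlim x hx)).mul_const _).add ((hlim x hx).mul_const _)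
  have hle2 := le_of_tendsto hconv main
  have e3 : (∫ x in N, ((1 - D.indicator 1 x) * divergence φ x
      + D.indicator 1 x * divergence (fun y => η y • X y) x))
      = (∫ x in N \ D, divergence φ x) + ∫ x in D, divergence (fun y => η y • X y) x := by
    rw [← integral_indicator (hN.diff hD), ← integral_indicator hD, ← integral_indicator hN,
      ← integral_add ((integrable_indicator_iff (hN.diff hD)).2 i1.integrableOn)
      ((integrable_indicator_iff hD).2 i2.integrableOn)]
    refine integral_congr_ae (.of_forall fun x => ?_)
    by_cases hxD : x ∈ D
    · simp [hxD, hDN hxD]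
    · by_cases hxN : x ∈ N <;> simp [hxD, hxN]
  linarith

end Cut

/-! ### Charts of the lateral surfaces -/

section Coordinates

variable {n : ℕ}

lemma volume_preserving_join :
    MeasurePreserving (fun t : Horiz n × ℝ => (join t.1 t.2 : Space n)) := by
  have h1 := (volume_preserving_piFinSuccAbove (fun _ : Fin (n + 1) => ℝ) (Fin.last n)).symm
  have h2 := (PiLp.volume_preserving_toLp (ι := Fin (n + 1))).comp
    (h1.comp ((MeasurePreserving.id (volume : Measure ℝ)).prod
      (PiLp.volume_preserving_ofLp (ι := Fin n))))
  have h3 := h2.comp (Measure.measurePreserving_swap (μ := (volume : Measure (Horiz n)))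
    (ν := (volume : Measure ℝ)))
  convert h3 using 1
  swap
  · exact Measure.volume_eq_prod _ _
  ext t i
  refine Fin.lastCases ?_ (fun j => ?_) i
  · simp [join, MeasurableEquiv.piFinSuccAbove]
  · simp [join, MeasurableEquiv.piFinSuccAbove]

lemma norm_join_sq (x : Horiz n) (z : ℝ) : ‖(join x z : Space n)‖ ^ 2 = ‖x‖ ^ 2 + z ^ 2 := by
  rw [norm_sq_space, horiz_join, height_join]

lemma continuous_join : Continuous fun t : Horiz n × ℝ => (join t.1 t.2 : Space n) := by
  unfold join
  refine (PiLp.continuous_toLp 2 _).comp (continuous_pi fun i => ?_)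
  refine Fin.lastCases ?_ (fun j => ?_) i
  · simp only [Fin.snoc_last]; fun_prop
  · simp only [Fin.snoc_castSucc]; fun_prop

lemma exists_isometry_eq_ez {e : Space n} (he : ‖e‖ = 1) :
    ∃ A : Space n ≃ₗᵢ[ℝ] Space n, A e = ez := by
  refine ⟨(ℝ ∙ (e - ez))ᗮ.reflection, ?_⟩
  exact Submodule.reflection_sub (by rw [he, norm_ez])

/-- The point with coordinates `t` in the Euclidean frame `A` centred at `p`. -/
def framePoint (A : Space n ≃ₗᵢ[ℝ] Space n) (p : Space n) (t : Horiz n × ℝ) : Space n :=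
  p + A.symm (join t.1 t.2)

/-- The first coordinates in the frame `A` centred at `p`: the projection along `A⁻¹ e_z`. -/
def frameProj (A : Space n ≃ₗᵢ[ℝ] Space n) (p q : Space n) : Horiz n := horiz (A (q - p))

variable (A : Space n ≃ₗᵢ[ℝ] Space n) (p : Space n)

lemma volume_preserving_framePoint : MeasurePreserving (framePoint A p) :=
  ((measurePreserving_add_left volume p).comp
    (A.symm.measurePreserving)).comp volume_preserving_join

lemma continuous_framePoint : Continuous (framePoint A p) :=
  continuous_const.add (A.symm.continuous.comp continuous_join)

lemma continuous_frameProj : Continuous (frameProj A p) :=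
  continuous_horiz.comp (A.continuous.comp (continuous_id.sub continuous_const))

@[simp] lemma frameProj_framePoint (t : Horiz n × ℝ) : frameProj A p (framePoint A p t) = t.1 := by
  simp [frameProj, framePoint]

@[simp] lemma height_framePoint (t : Horiz n × ℝ) : height (A (framePoint A p t - p)) = t.2 := by
  simp [framePoint]

lemma framePoint_frameProj (q : Space n) :
    framePoint A p (frameProj A p q, height (A (q - p))) = q := by
  rw [framePoint, frameProj, join_horiz_height, A.symm_apply_apply, add_sub_cancel]

lemma frameProj_sub (q q' : Space n) :
    frameProj A p q - frameProj A p q' = horiz (A (q - q')) := by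
  rw [frameProj, frameProj, ← horiz_sub, ← map_sub]
  congr 2
  abel

lemma norm_frameProj_sub_le (q q' : Space n) :
    ‖frameProj A p q - frameProj A p q'‖ ≤ ‖q - q'‖ := by
  rw [frameProj_sub, ← A.norm_map (q - q')]
  exact norm_horiz_le _

lemma norm_le_norm_frameProj_add (q q' : Space n) :
    ‖q - q'‖ ≤ ‖frameProj A p q - frameProj A p q'‖ + |height (A (q - q'))| := by
  rw [frameProj_sub, ← A.norm_map (q - q')]
  have := norm_sq_space (A (q - q'))
  refine le_of_sq_le_sq ?_ (by positivity)
  rw [this, ← sq_abs (height _)]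
  nlinarith [norm_nonneg (horiz (A (q - q'))), abs_nonneg (height (A (q - q')))]

end Coordinates

/-- A chart of the lateral surface `S` of the region near `p`. In the ball of radius `ρ` the region
is `{r > 0}` and the surface is `{r = 0}`; up to an error of slope `ε`, the function `r` is the last
coordinate in the frame `A`; and the cutoff functions depend on `r` only. -/
structure WallChart {n : ℕ} (R : EReal) (S : Set (Space n)) (r : Space n → ℝ) (p : Space n)
    (A : Space n ≃ₗᵢ[ℝ] Space n) (ε ρ : ℝ) : Prop where
  radius_pos : 0 < ρ
  eps_pos : 0 < ε
  eps_le : ε ≤ 1 / 4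
  smooth : ContDiff ℝ ∞ r
  center : r p = 0
  approx : ∀ q ∈ ball p ρ, ∀ q' ∈ ball p ρ,
    |r q - r q' - height (A (q - q'))| ≤ ε * ‖q - q'‖
  region_iff : ∀ q ∈ ball p ρ, q ∈ region R ↔ 0 < r q
  wall_iff : ∀ q ∈ ball p ρ, q ∈ S ↔ r q = 0
  cutoff_eq : ∀ᶠ k : ℕ in atTop, ∀ q ∈ ball p ρ, cutoff R k q = step (k * r q)

section WallChart

variable {n : ℕ} {R : EReal} {S : Set (Space n)} {r : Space n → ℝ} {p : Space n}
  {A : Space n ≃ₗᵢ[ℝ] Space n} {ε ρ : ℝ}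

lemma WallChart.norm_fderiv_sub_le (h : WallChart R S r p A ε ρ) {q : Space n}
    (hq : q ∈ ball p ρ) (v : Space n) : |fderiv ℝ r q v - height (A v)| ≤ ε * ‖v‖ := by
  let B : Space n →L[ℝ] ℝ := (EuclideanSpace.proj (𝕜 := ℝ) (Fin.last n)).comp
    (A.toContinuousLinearEquiv : Space n →L[ℝ] Space n)
  have hB : ∀ v, B v = height (A v) := fun v => rfl
  have hd : DifferentiableAt ℝ r q := h.smooth.differentiable (by simp) q
  have e1 : fderiv ℝ (fun x => r x - B x) q = fderiv ℝ r q - B := by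
    rw [fderiv_fun_sub hd B.differentiableAt, B.fderiv]
  have e2 : ‖fderiv ℝ (fun x => r x - B x) q‖ ≤ ε := by
    refine norm_fderiv_le_of_lip' ℝ h.eps_pos.le ?_
    filter_upwards [isOpen_ball.mem_nhds hq] with x hx
    have := h.approx x hx q hq
    rw [map_sub, height_sub, ← hB, ← hB] at this
    rw [Real.norm_eq_abs]
    convert this using 2
    ring
  have e3 := (fderiv ℝ (fun x => r x - B x) q).le_of_opNorm_le e2 v
  rwa [e1, sub_apply, hB, Real.norm_eq_abs] at e3

lemma exists_wallChart (hr : ContDiff ℝ ∞ r) (hp : r p = 0)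
    (hd : ∀ v, fderiv ℝ r p v = height (A v))
    (hreg : ∀ᶠ q in 𝓝 p, q ∈ region R ↔ 0 < r q) (hS : ∀ᶠ q in 𝓝 p, q ∈ S ↔ r q = 0)
    (hcut : ∃ U ∈ 𝓝 p, ∀ᶠ k : ℕ in atTop, ∀ q ∈ U, cutoff R k q = step (k * r q))
    (hε : 0 < ε) (hε' : ε ≤ 1 / 4) {U : Set (Space n)} (hU : U ∈ 𝓝 p) :
    ∃ ρ, ball p ρ ⊆ U ∧ WallChart R S r p A ε ρ := by
  obtain ⟨V, hV, hcut⟩ := hcut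
  have hs : HasStrictFDerivAt r (fderiv ℝ r p) p :=
    hr.contDiffAt.hasStrictFDerivAt (by simp)
  obtain ⟨δ, hδ, hδ'⟩ := Metric.eventually_nhds_iff.1 (hs.isLittleO.def hε)
  obtain ⟨ρ, hρ, hb⟩ := eventually_nhds_iff_ball.1
    ((hreg.and hS).and ((show ∀ᶠ q in 𝓝 p, q ∈ U from hU).and (show ∀ᶠ q in 𝓝 p, q ∈ V from hV)))
  have hb' : ∀ q ∈ ball p (min δ ρ), q ∈ ball p ρ := fun q hq =>
    ball_subset_ball (min_le_right _ _) hq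
  refine ⟨min δ ρ, fun q hq => (hb q (hb' q hq)).2.1, lt_min hδ hρ, hε, hε', hr, hp,
    fun q hq q' hq' => ?_, fun q hq => (hb q (hb' q hq)).1.1, fun q hq => (hb q (hb' q hq)).1.2,
    hcut.mono fun k hk q hq => hk q (hb q (hb' q hq)).2.2⟩
  have := @hδ' (q, q') (by
    rw [Prod.dist_eq]
    exact max_lt (lt_of_lt_of_le hq (min_le_left _ _)) (lt_of_lt_of_le hq' (min_le_left _ _)))
  simpa [hd] using this

lemma fderiv_plateFun (q v : Space n) : fderiv ℝ plateFun q v = ⟪horiz q, horiz v⟫ := by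
  obtain ⟨B, hB, hBv⟩ := hasFDerivAt_horiz q
  have h := ((hB.norm_sq).sub_const 1).mul_const (2 : ℝ)⁻¹
  have e : plateFun = fun q : Space n => (‖horiz q‖ ^ 2 - 1) * 2⁻¹ := by
    ext q; simp [plateFun, div_eq_mul_inv]
  rw [e, h.fderiv]
  simp [hBv]

lemma fderiv_containerFun (hT : R ≠ ⊤) (q v : Space n) :
    fderiv ℝ (containerFun R) q v = -(⟪horiz q, horiz v⟫ / R.toReal) := by
  obtain ⟨B, hB, hBv⟩ := hasFDerivAt_horiz q
  have h := ((hB.norm_sq).const_sub (R.toReal ^ 2)).mul_const (2 * R.toReal)⁻¹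
  have e : containerFun R = fun q : Space n =>
      (R.toReal ^ 2 - ‖horiz q‖ ^ 2) * (2 * R.toReal)⁻¹ := by
    ext q; simp [containerFun, hT, div_eq_mul_inv]
  rw [e, h.fderiv]
  simp [hBv]
  ring

lemma mem_thinCyl_one_iff {q : Space n} : q ∈ thinCyl 1 ↔ ‖horiz q‖ = 1 := by
  change ((‖horiz q‖ : ℝ) : EReal) = ((1 : ℝ) : EReal) ↔ _
  rw [EReal.coe_eq_coe_iff]

lemma mem_thinCyl_one_iff_plateFun {q : Space n} : q ∈ thinCyl 1 ↔ plateFun q = 0 := by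
  rw [mem_thinCyl_one_iff, plateFun, div_eq_zero_iff, or_iff_left two_ne_zero, sub_eq_zero,
    pow_eq_one_iff_of_nonneg (norm_nonneg _) two_ne_zero]

lemma mem_thinCyl_iff (hR : 1 < R) (hT : R ≠ ⊤) {q : Space n} :
    q ∈ thinCyl R ↔ ‖horiz q‖ = R.toReal := by
  rw [thinCyl, mem_ofPred_eq]
  conv_lhs => rw [← EReal.coe_toReal hT (ne_bot_of_gt hR)]
  exact EReal.coe_eq_coe_iff

lemma mem_thinCyl_iff_containerFun (hR : 1 < R) (hT : R ≠ ⊤) {q : Space n} :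
    q ∈ thinCyl R ↔ containerFun R q = 0 := by
  have h1 := toReal_gt_one hR hT
  rw [mem_thinCyl_iff hR hT, containerFun, if_neg hT, div_eq_zero_iff,
    or_iff_left (by positivity), sub_eq_zero, eq_comm, sq_eq_sq₀ (by positivity) (norm_nonneg _)]

lemma thinCyl_top : (thinCyl ⊤ : Set (Space n)) = ∅ := by
  ext q; simp [thinCyl]

@[simp] lemma norm_join_zero (x : Horiz n) : ‖(join x 0 : Space n)‖ = ‖x‖ := by
  have := norm_join_sq x 0
  rw [zero_pow two_ne_zero, add_zero] at this
  exact (sq_eq_sq₀ (norm_nonneg _) (norm_nonneg _)).1 this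

lemma norm_radial {q : Space n} (h : horiz q ≠ 0) : ‖radial q‖ = 1 := by
  rw [radial, norm_join_zero, norm_smul, norm_inv, norm_norm, inv_mul_cancel₀ (by simpa)]

lemma inner_radial (q v : Space n) : ⟪radial q, v⟫ = ‖horiz q‖⁻¹ * ⟪horiz q, horiz v⟫ := by
  rw [inner_space, radial, horiz_join, height_join, zero_mul, add_zero, inner_smul_left]
  simp

lemma exists_frame {e : Space n} (he : ‖e‖ = 1) :
    ∃ A : Space n ≃ₗᵢ[ℝ] Space n, ∀ v, height (A v) = ⟪e, v⟫ := by
  obtain ⟨A, hA⟩ := exists_isometry_eq_ez he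
  refine ⟨A, fun v => ?_⟩
  rw [← A.inner_map_map, hA, real_inner_comm, inner_ez]

/-- A point of the plate or of the container, together with the defining function of the lateral
surface and a frame whose last vector is the inward unit normal `e`. -/
structure IsWallPoint (R : EReal) (S : Set (Space n)) (r : Space n → ℝ) (p : Space n)
    (A : Space n ≃ₗᵢ[ℝ] Space n) (e : Space n) : Prop where
  height_frame : ∀ v, height (A v) = ⟪e, v⟫
  exists_chart : ∀ ε, 0 < ε → ε ≤ 1 / 4 → ∀ U ∈ 𝓝 p,
    ∃ ρ, ball p ρ ⊆ U ∧ WallChart R S r p A ε ρ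

lemma eventually_le_of_pos {f : Space n → ℝ} (hf : Continuous f) (hp : 0 < f p) :
    ∃ U ∈ 𝓝 p, ∀ᶠ k : ℕ in atTop, ∀ q ∈ U, 1 ≤ k * f q := by
  refine ⟨{q | f p / 2 < f q}, hf.continuousAt.eventually (lt_mem_nhds (half_lt_self hp)), ?_⟩
  filter_upwards [(tendsto_mul_atTop (half_pos hp)).eventually_ge_atTop 1] with k hk q hq
  exact hk.trans (mul_le_mul_of_nonneg_left (le_of_lt hq) k.cast_nonneg)

lemma eventually_step_norm (p : Space n) : ∃ U ∈ 𝓝 p, ∀ᶠ k : ℕ in atTop, ∀ q ∈ U,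
    step (2 - ‖q‖ ^ 2 / (k : ℝ) ^ 2) = 1 := by
  refine ⟨ball p 1, ball_mem_nhds _ one_pos, ?_⟩
  filter_upwards [tendsto_natCast_atTop_atTop.eventually_ge_atTop (‖p‖ + 1),
    eventually_gt_atTop 0] with k hk hk0 q hq
  have h0 : (0 : ℝ) < k := by exact_mod_cast hk0
  have h1 : ‖q‖ ≤ k := by
    have : ‖q - p‖ < 1 := by rwa [mem_ball_iff_norm] at hq
    linarith [norm_le_norm_add_norm_sub' q p]
  refine step_of_ge ?_
  have : ‖q‖ ^ 2 / (k : ℝ) ^ 2 ≤ 1 := by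
    rw [div_le_one (by positivity)]
    exact pow_le_pow_left₀ (norm_nonneg _) h1 2
  linarith

lemma exists_isWallPoint_plate (hR : 1 < R) (hp : p ∈ thinCyl 1) :
    ∃ A, IsWallPoint R (thinCyl 1) plateFun p A (radial p) := by
  have hp1 := mem_thinCyl_one_iff.1 hp
  have hp0 : horiz p ≠ 0 := fun h => by simp [h] at hp1
  obtain ⟨A, hA⟩ := exists_frame (norm_radial hp0)
  have hpos : 0 < containerFun R p := (containerFun_pos_iff hR p).2 (by rw [hp1]; exact hR)
  obtain ⟨U₁, hU₁, h₁⟩ := eventually_le_of_pos (contDiff_containerFun (k := 0)).continuous hpos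
  obtain ⟨U₂, hU₂, h₂⟩ := eventually_step_norm p
  refine ⟨A, hA, fun ε h0 h1 U hU => exists_wallChart contDiff_plateFun
    (mem_thinCyl_one_iff_plateFun.1 hp) (fun v => ?_) ?_
    (.of_forall fun q => mem_thinCyl_one_iff_plateFun)
    ⟨U₁ ∩ U₂, inter_mem hU₁ hU₂, ?_⟩ h0 h1 hU⟩
  · rw [fderiv_plateFun, hA, inner_radial, hp1, inv_one, one_mul]
  · filter_upwards [(contDiff_containerFun (R := R) (k := 0)).continuous.continuousAt.eventually
      (lt_mem_nhds hpos)] with q hq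
    rw [mem_region_iff hR, and_iff_left hq]
  · filter_upwards [h₁, h₂] with k h₁ h₂ q hq
    rw [cutoff, step_of_ge (h₁ q hq.1), h₂ q hq.2, mul_one, mul_one]

lemma exists_isWallPoint_container (hR : 1 < R) (hT : R ≠ ⊤) (hp : p ∈ thinCyl R) :
    ∃ A, IsWallPoint R (thinCyl R) (containerFun R) p A (-radial p) := by
  have hp1 := (mem_thinCyl_iff hR hT).1 hp
  have hR1 := toReal_gt_one hR hT
  have hp0 : horiz p ≠ 0 := fun h => by
    rw [h, norm_zero] at hp1
    linarith
  obtain ⟨A, hA⟩ := exists_frame (e := -radial p) (by rw [norm_neg, norm_radial hp0])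
  have hpos : 0 < plateFun p := (plateFun_pos_iff p).2 (by rw [hp1]; exact hR1)
  obtain ⟨U₁, hU₁, h₁⟩ := eventually_le_of_pos (contDiff_plateFun (k := 0)).continuous hpos
  obtain ⟨U₂, hU₂, h₂⟩ := eventually_step_norm p
  refine ⟨A, hA, fun ε h0 h1 U hU => exists_wallChart contDiff_containerFun
    ((mem_thinCyl_iff_containerFun hR hT).1 hp) (fun v => ?_) ?_
    (.of_forall fun q => mem_thinCyl_iff_containerFun hR hT)
    ⟨U₁ ∩ U₂, inter_mem hU₁ hU₂, ?_⟩ h0 h1 hU⟩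
  · rw [fderiv_containerFun hT, hA, inner_neg_left, inner_radial, hp1]
    ring
  · filter_upwards [(contDiff_plateFun (k := 0)).continuous.continuousAt.eventually
      (lt_mem_nhds hpos)] with q hq
    rw [mem_region_iff hR, and_iff_right hq]
  · filter_upwards [h₁, h₂] with k h₁ h₂ q hq
    rw [cutoff, step_of_ge (h₁ q hq.1), h₂ q hq.2, mul_one, one_mul]

/-! ### Area of pieces of the lateral surfaces -/

lemma area_image_le {X Y : ℕ} {K : NNReal} {s : Set (EuclideanSpace ℝ (Fin X))}
    {f : EuclideanSpace ℝ (Fin X) → EuclideanSpace ℝ (Fin Y)} (h : LipschitzOnWith K f s) (m : ℕ) :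
    (μHE[m] : Measure _) (f '' s) ≤ (K : ℝ≥0∞) ^ m * (μHE[m] : Measure _) s := by
  have := h.hausdorffMeasure_image_le (d := m) (by positivity)
  rw [ENNReal.rpow_natCast] at this
  simp only [Measure.euclideanHausdorffMeasure_def, Measure.smul_apply]
  rw [mul_smul_comm]
  gcongr

lemma WallChart.norm_sub_le (h : WallChart R S r p A ε ρ) {q q' : Space n}
    (hq : q ∈ ball p ρ) (hq' : q' ∈ ball p ρ) :
    (1 - ε) * ‖q - q'‖ ≤ ‖frameProj A p q - frameProj A p q'‖ + |r q - r q'| := by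
  have h1 := h.approx q hq q' hq'
  have h2 := norm_le_norm_frameProj_add A p q q'
  have h3 : |height (A (q - q'))| ≤ |r q - r q'| + ε * ‖q - q'‖ := by
    calc _ = |(r q - r q') - (r q - r q' - height (A (q - q')))| := by congr 1; ring
      _ ≤ _ := (abs_sub _ _).trans (by linarith)
  linarith

lemma WallChart.norm_sub_le_of_mem (h : WallChart R S r p A ε ρ) {q q' : Space n}
    (hq : q ∈ S ∩ ball p ρ) (hq' : q' ∈ S ∩ ball p ρ) :
    ‖q - q'‖ ≤ (1 - ε)⁻¹ * ‖frameProj A p q - frameProj A p q'‖ := by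
  have h1 := h.norm_sub_le hq.2 hq'.2
  have h4 := h.eps_le
  rw [(h.wall_iff q hq.2).1 hq.1, (h.wall_iff q' hq'.2).1 hq'.1, sub_zero, abs_zero, add_zero] at h1
  rwa [le_inv_mul_iff₀ (by linarith)]

lemma WallChart.injOn (h : WallChart R S r p A ε ρ) :
    InjOn (frameProj A p) (S ∩ ball p ρ) := by
  intro q hq q' hq' he
  have := h.norm_sub_le_of_mem hq hq'
  rw [he, sub_self, norm_zero, mul_zero] at this
  exact sub_eq_zero.1 (norm_le_zero_iff.1 this)

lemma volume_image_frameProj_le (A : Space n ≃ₗᵢ[ℝ] Space n) (p : Space n) (E : Set (Space n)) :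
    volume (frameProj A p '' E) ≤ area E := by
  have hl : LipschitzOnWith 1 (frameProj A p) E :=
    LipschitzOnWith.of_dist_le_mul fun q _ q' _ => by
      rw [dist_eq_norm, dist_eq_norm, NNReal.coe_one, one_mul]
      exact norm_frameProj_sub_le A p q q'
  have := area_image_le hl n
  rwa [EuclideanSpace.euclideanHausdorffMeasure_eq_volume, ENNReal.coe_one, one_pow,
    one_mul] at this

lemma WallChart.area_le (h : WallChart R S r p A ε ρ) {E : Set (Space n)}
    (hE : E ⊆ S ∩ ball p ρ) :
    area E ≤ ENNReal.ofReal ((1 - ε)⁻¹ ^ n) * volume (frameProj A p '' E) := by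
  have h4 := h.eps_le
  have hpos : 0 ≤ (1 - ε)⁻¹ := inv_nonneg.2 (by linarith)
  have hinj : InjOn (frameProj A p) E := h.injOn.mono hE
  have hl : LipschitzOnWith (Real.toNNReal (1 - ε)⁻¹) (Function.invFunOn (frameProj A p) E)
      (frameProj A p '' E) := by
    refine LipschitzOnWith.of_dist_le_mul ?_
    rintro _ ⟨q, hq, rfl⟩ _ ⟨q', hq', rfl⟩
    rw [hinj.leftInvOn_invFunOn hq, hinj.leftInvOn_invFunOn hq', dist_eq_norm, dist_eq_norm,
      Real.coe_toNNReal _ hpos]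
    exact h.norm_sub_le_of_mem (hE hq) (hE hq')
  have := area_image_le hl n
  rw [hinj.leftInvOn_invFunOn.image_image,
    EuclideanSpace.euclideanHausdorffMeasure_eq_volume] at this
  rwa [ENNReal.ofReal_pow hpos]

lemma WallChart.area_lt_top (h : WallChart R S r p A ε ρ) :
    area (S ∩ ball p ρ) < ⊤ := by
  refine (h.area_le subset_rfl).trans_lt (ENNReal.mul_lt_top ENNReal.ofReal_lt_top ?_)
  refine (measure_mono (t := ball 0 ρ) ?_).trans_lt measure_ball_lt_top
  rintro _ ⟨q, hq, rfl⟩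
  rw [mem_ball_zero_iff]
  have := norm_frameProj_sub_le A p q p
  simp only [frameProj, sub_self, map_zero] at this
  have h0 : horiz (0 : Space n) = 0 := by ext; simp [horiz]
  rw [h0, sub_zero] at this
  exact this.trans_lt (mem_ball_iff_norm.1 hq.2)

/-- Bounded pieces of the lateral surfaces have finite area. -/
lemma area_lt_top_of_isCompact {K : Set (Space n)} (hK : IsCompact K)
    (hS : ∀ p ∈ K, ∃ r A ε ρ, WallChart R S r p A ε ρ) : area (S ∩ K) < ⊤ := by
  refine hK.induction_on (p := fun s => area (S ∩ s) < ⊤) (by simp [area])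
    (fun s t hst ht => (measure_mono (inter_subset_inter_right _ hst)).trans_lt ht)
    (fun s t hs ht => ?_) (fun p hp => ?_)
  · rw [inter_union_distrib_left]
    exact measure_union_lt_top hs ht
  · obtain ⟨r, A, ε, ρ, h⟩ := hS p hp
    exact ⟨_, mem_nhdsWithin_of_mem_nhds (ball_mem_nhds p h.radius_pos), h.area_lt_top⟩

end WallChart

/-! ### The zero-one law for the density at the lateral surfaces -/

section Density

variable {n : ℕ}

/-- The set `E` has `(n+1)`-dimensional density zero at `y`. -/
def HasZeroDensity (E : Set (Space n)) (y : Space n) : Prop :=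
  ∀ δ > 0, ∀ᶠ t in 𝓝[>] (0 : ℝ), volume.real (E ∩ ball y t) ≤ δ * t ^ (n + 1)

lemma HasZeroDensity.mono {E E' : Set (Space n)} {y : Space n} (h : HasZeroDensity E y) {ρ : ℝ}
    (hρ : 0 < ρ) (hE : E' ∩ ball y ρ ⊆ E) : HasZeroDensity E' y := fun δ hδ => by
  filter_upwards [h δ hδ, Ioo_mem_nhdsGT hρ] with t ht htρ
  have hsub : E' ∩ ball y t ⊆ E ∩ ball y t := fun q hq =>
    ⟨hE ⟨hq.1, ball_subset_ball htρ.2.le hq.2⟩, hq.2⟩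
  exact (measureReal_mono hsub
    ((measure_mono inter_subset_right).trans_lt measure_ball_lt_top).ne).trans ht

open scoped Pointwise in
lemma volume_real_scale (y : Space n) {t : ℝ} (ht : 0 < t) (Q : Set (Space n)) :
    volume.real ((fun v => y + t • v) '' Q) = t ^ (n + 1) * volume.real Q := by
  have e : (fun v => y + t • v) '' Q = (fun v => y + v) '' (t • Q) := by
    rw [← image_smul, image_image]
  rw [e, measureReal_def, image_add_left, measure_preimage_add, Measure.addHaar_smul,
    finrank_euclideanSpace_fin, ENNReal.toReal_mul, ENNReal.toReal_ofReal (abs_nonneg _),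
    abs_of_nonneg (by positivity)]
  rfl

lemma volume_real_ball (y : Space n) {t : ℝ} (ht : 0 ≤ t) :
    volume.real (ball y t) = t ^ (n + 1) * volume.real (ball (0 : Space n) 1) := by
  rw [measureReal_def, Measure.addHaar_ball _ _ ht, finrank_euclideanSpace_fin, ENNReal.toReal_mul,
    ENNReal.toReal_ofReal (by positivity)]
  rfl

/-- Balls depend continuously on centre and radius, uniformly in the set that is measured. -/
lemma measureReal_inter_ball_le (E : Set (Space n)) {y y' : Space n} {t t' s : ℝ}
    (h : ball y t ⊆ ball y' s) (h0 : 0 ≤ t') (hs : t' ≤ s) :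
    volume.real (E ∩ ball y t) ≤ volume.real (E ∩ ball y' t')
      + (s ^ (n + 1) - t' ^ (n + 1)) * volume.real (ball (0 : Space n) 1) := by
  have hsub : ball y' t' ⊆ ball y' s := ball_subset_ball hs
  have h1 : E ∩ ball y t
      ⊆ (E ∩ ball y' t') ∪ (ball y' s \ ball y' t') := by
    intro q hq
    by_cases hq' : q ∈ ball y' t'
    · exact Or.inl ⟨hq.1, hq'⟩
    · exact Or.inr ⟨h hq.2, hq'⟩
  have f1 : volume (E ∩ ball y' t') ≠ ⊤ :=
    ((measure_mono inter_subset_right).trans_lt measure_ball_lt_top).ne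
  have f2 : volume (ball y' s \ ball y' t') ≠ ⊤ :=
    ((measure_mono sdiff_subset).trans_lt measure_ball_lt_top).ne
  refine (measureReal_mono h1 (measure_union_lt_top f1.lt_top f2.lt_top).ne).trans
    ((measureReal_union_le _ _).trans ?_)
  rw [measureReal_sdiff hsub measurableSet_ball, volume_real_ball _ (h0.trans hs),
    volume_real_ball _ h0]
  linarith

lemma continuousOn_measureReal_inter_ball (E : Set (Space n)) (y : Space n) :
    ContinuousOn (fun t : ℝ => volume.real (E ∩ ball y t)) (Ioi 0) := by
  set m := volume.real (ball (0 : Space n) 1)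
  have hbd : ∀ s t : ℝ, 0 < s → 0 < t →
      |volume.real (E ∩ ball y t) - volume.real (E ∩ ball y s)|
        ≤ |t ^ (n + 1) - s ^ (n + 1)| * m := by
    have key : ∀ s t : ℝ, 0 < s → s ≤ t →
        |volume.real (E ∩ ball y t) - volume.real (E ∩ ball y s)|
          ≤ |t ^ (n + 1) - s ^ (n + 1)| * m := by
      intro s t hs hst
      have h1 := measureReal_inter_ball_le E (y := y) (y' := y) (t := t) (s := t) subset_rfl hs.le
        hst
      have h2 : volume.real (E ∩ ball y s) ≤ volume.real (E ∩ ball y t) :=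
        measureReal_mono (inter_subset_inter_right _ (ball_subset_ball hst))
          ((measure_mono inter_subset_right).trans_lt measure_ball_lt_top).ne
      have h3 : s ^ (n + 1) ≤ t ^ (n + 1) := pow_le_pow_left₀ hs.le hst _
      rw [abs_of_nonneg (by linarith), abs_of_nonneg (by linarith)]
      linarith
    intro s t hs ht
    rcases le_total s t with h | h
    · exact key s t hs h
    · rw [abs_sub_comm, abs_sub_comm (t ^ (n + 1))]
      exact key t s ht h
  intro s hs
  have hs0 : (0 : ℝ) < s := hs
  have hlim : Tendsto (fun t : ℝ => |t ^ (n + 1) - s ^ (n + 1)| * m) (𝓝[Ioi 0] s) (𝓝 0) := by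
    have : Continuous fun t : ℝ => |t ^ (n + 1) - s ^ (n + 1)| * m := by fun_prop
    have h := this.tendsto s
    simp only [sub_self, abs_zero, zero_mul] at h
    exact h.mono_left nhdsWithin_le_nhds
  refine tendsto_iff_norm_sub_tendsto_zero.2 (squeeze_zero' (.of_forall fun t =>
    norm_nonneg _) ?_ hlim)
  filter_upwards [self_mem_nhdsWithin] with t ht
  exact hbd s t hs0 ht

lemma exists_slab_le {ℓ : Space n →L[ℝ] ℝ} (hℓ : ℓ ≠ 0) {δ : ℝ} (hδ : 0 < δ) :
    ∃ θ > 0, volume.real {v : Space n | v ∈ ball 0 1 ∧ |ℓ v| ≤ θ} ≤ δ := by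
  set Q : ℕ → Set (Space n) := fun j => {v | v ∈ ball 0 1 ∧ |ℓ v| ≤ 1 / ((j : ℝ) + 1)}
  have hQm : ∀ j, MeasurableSet (Q j) := fun j => measurableSet_ball.inter
    (measurableSet_le ℓ.continuous.abs.measurable measurable_const)
  have hanti : Antitone Q := fun i j hij v hv =>
    ⟨hv.1, hv.2.trans (one_div_le_one_div_of_le (by positivity) (by gcongr))⟩
  have h0 : volume (⋂ j, Q j) = 0 := by
    refine measure_mono_null (t := ((LinearMap.ker (ℓ : Space n →ₗ[ℝ] ℝ) :
      Submodule ℝ (Space n)) : Set (Space n))) (fun v hv => ?_)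
      (Measure.addHaar_submodule _ _ fun h => hℓ ?_)
    · have hle : ∀ j : ℕ, |ℓ v| ≤ 1 / ((j : ℝ) + 1) := fun j => (mem_iInter.1 hv j).2
      have := ge_of_tendsto' tendsto_one_div_add_atTop_nhds_zero_nat hle
      exact abs_eq_zero.1 (le_antisymm this (abs_nonneg _))
    · ext v
      have : v ∈ LinearMap.ker (ℓ : Space n →ₗ[ℝ] ℝ) := by rw [h]; trivial
      exact this
  have ht := tendsto_measure_iInter_atTop (μ := volume) (fun j => (hQm j).nullMeasurableSet) hanti
    ⟨0, ((measure_mono fun v hv => hv.1).trans_lt measure_ball_lt_top).ne⟩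
  rw [h0] at ht
  obtain ⟨j, hj⟩ := (ht.eventually (ge_mem_nhds
    (show (0 : ℝ≥0∞) < ENNReal.ofReal δ by simpa using hδ))).exists
  exact ⟨1 / ((j : ℝ) + 1), by positivity, ENNReal.toReal_le_of_le_ofReal hδ.le hj⟩

variable {L Ω : Set (Space n)} {y : Space n} {r : Space n → ℝ} {ℓ : Space n →L[ℝ] ℝ}

/-- Near a boundary point the set `{r > 0}` is squeezed between half balls. -/
lemma eventually_half_ball (hd : HasFDerivAt r ℓ y) (hy : r y = 0)
    (hΩ : ∀ᶠ q in 𝓝 y, q ∈ Ω ↔ 0 < r q) {θ : ℝ} (hθ : 0 < θ) :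
    ∀ᶠ t in 𝓝[>] (0 : ℝ), ∀ q ∈ ball y t,
      (θ * t < ℓ (q - y) → q ∈ Ω) ∧ (q ∈ Ω → -(θ * t) < ℓ (q - y)) := by
  have h1 := hd.isLittleO.def hθ
  obtain ⟨ρ, hρ, hb⟩ := eventually_nhds_iff_ball.1 (h1.and hΩ)
  filter_upwards [Ioo_mem_nhdsGT hρ] with t ht q hq
  obtain ⟨h2, h3⟩ := hb q (ball_subset_ball ht.2.le hq)
  rw [hy, sub_zero, Real.norm_eq_abs] at h2
  have h4 : ‖q - y‖ < t := mem_ball_iff_norm.1 hq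
  have h5 : |r q - ℓ (q - y)| < θ * t := h2.trans_lt (mul_lt_mul_of_pos_left h4 hθ)
  rw [h3]
  constructor <;> intro h <;> linarith [(abs_lt.1 h5).1, (abs_lt.1 h5).2]

lemma half_ball_eq (y : Space n) (ℓ : Space n →L[ℝ] ℝ) {t : ℝ} (ht : 0 < t) (P : ℝ → Prop) :
    {q | q ∈ ball y t ∧ P (t⁻¹ * ℓ (q - y))}
      = (fun v => y + t • v) '' {v | v ∈ ball 0 1 ∧ P (ℓ v)} := by
  ext q
  constructor
  · rintro ⟨hq, hP⟩
    refine ⟨t⁻¹ • (q - y), ⟨?_, by simpa using hP⟩, by simp [smul_smul, ht.ne']⟩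
    rw [mem_ball_zero_iff, norm_smul, norm_inv, Real.norm_of_nonneg ht.le, inv_mul_lt_iff₀ ht,
      mul_one]
    exact mem_ball_iff_norm.1 hq
  · rintro ⟨v, ⟨hv, hP⟩, rfl⟩
    rw [mem_ball_zero_iff] at hv
    refine ⟨?_, by simpa [ht.ne'] using hP⟩
    rw [mem_ball_iff_norm, add_sub_cancel_left, norm_smul, Real.norm_of_nonneg ht.le]
    exact mul_lt_of_lt_one_right ht hv

lemma exists_lower_density (hd : HasFDerivAt r ℓ y) (hℓ : ℓ ≠ 0) (hy : r y = 0)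
    (hΩ : ∀ᶠ q in 𝓝 y, q ∈ Ω ↔ 0 < r q) :
    ∃ c > 0, ∀ᶠ t in 𝓝[>] (0 : ℝ), c * t ^ (n + 1) ≤ volume.real (Ω ∩ ball y t) := by
  obtain ⟨w, hw⟩ : ∃ w, 0 < ℓ w := by
    by_contra! h
    refine hℓ (ContinuousLinearMap.ext fun v => le_antisymm (h v) ?_)
    have := h (-v)
    rw [map_neg] at this
    simpa using this
  set v : Space n := (2 * (‖w‖ + 1))⁻¹ • w with hv
  have hv1 : v ∈ ball (0 : Space n) 1 := by
    rw [mem_ball_zero_iff, hv, norm_smul, norm_inv, Real.norm_of_nonneg (by positivity),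
      inv_mul_lt_iff₀ (by positivity)]
    linarith [norm_nonneg w]
  have hvℓ : 0 < ℓ v := by
    rw [hv, map_smul, smul_eq_mul]; positivity
  set θ := ℓ v / 2 with hθ
  have hθ0 : 0 < θ := half_pos hvℓ
  have hopen : IsOpen {v : Space n | v ∈ ball 0 1 ∧ θ < ℓ v} :=
    isOpen_ball.inter (isOpen_lt continuous_const ℓ.continuous)
  have hpos : 0 < volume.real {v : Space n | v ∈ ball 0 1 ∧ θ < ℓ v} := by
    refine ENNReal.toReal_pos (hopen.measure_pos volume ⟨v, hv1, half_lt_self hvℓ⟩).ne' ?_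
    exact ((measure_mono fun v hv => hv.1).trans_lt measure_ball_lt_top).ne
  refine ⟨_, hpos, ?_⟩
  filter_upwards [eventually_half_ball hd hy hΩ hθ0, self_mem_nhdsWithin] with t ht ht0
  have ht0 : 0 < t := ht0
  rw [mul_comm, ← volume_real_scale y ht0, ← half_ball_eq y ℓ ht0 (fun a => θ < a)]
  refine measureReal_mono (fun q hq => ⟨(ht q hq.1).1 ?_, hq.1⟩)
    ((measure_mono inter_subset_right).trans_lt measure_ball_lt_top).ne
  have := hq.2
  rw [lt_inv_mul_iff₀ ht0] at this
  linarith

/-- The zero-one law at a boundary point where the surface measure decays faster than area: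
by the relative isoperimetric inequality in half balls, the product of the volumes of `L` and of
its complement is `o(t^(2n+2))`, and by continuity one of the two factors wins. -/
lemma zero_one_of_decay (hd : HasFDerivAt r ℓ y) (hℓ : ℓ ≠ 0) (hy : r y = 0)
    (hΩ : ∀ᶠ q in 𝓝 y, q ∈ Ω ↔ 0 < r q) (hL : MeasurableSet L)
    (hLΩ : L ⊆ Ω) {σ : Measure (Space n)}
    (hper : ∀ V, IsOpen V → V ⊆ Ω → perimeter L V ≤ σ V)
    (hdecay : ∀ δ > 0, ∀ᶠ t in 𝓝[>] (0 : ℝ),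
      σ (closedBall y t) ≤ ENNReal.ofReal (δ * t ^ n)) :
    HasZeroDensity (Ω \ L) y ∨ HasZeroDensity L y := by
  set m := volume.real (ball (0 : Space n) 1) with hm
  have hm0 : 0 ≤ m := measureReal_nonneg
  set a : ℝ → ℝ := fun t => volume.real (L ∩ ball y t) with ha
  set b : ℝ → ℝ := fun t => volume.real ((Ω \ L) ∩ ball y t) with hb
  have fin : ∀ (E : Set (Space n)) t, volume (E ∩ ball y t) ≠ ⊤ := fun E t =>
    ((measure_mono inter_subset_right).trans_lt measure_ball_lt_top).ne
  have hle : ∀ (E : Set (Space n)) t, 0 < t → volume.real (E ∩ ball y t) ≤ t ^ (n + 1) * m :=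
    fun E t ht => by
      rw [← volume_real_ball y ht.le]
      exact measureReal_mono inter_subset_right measure_ball_lt_top.ne
  -- the product of the two volumes is of higher order
  have hprod : ∀ δ > 0, ∀ᶠ t in 𝓝[>] (0 : ℝ), a t * b t ≤ δ * (t ^ (n + 1)) ^ 2 := by
    intro δ hδ
    obtain ⟨δ₁, hδ₁, hδ₁'⟩ : ∃ δ₁ > 0,
        2 * δ₁ * m * 2 ^ (n + 1) + 2 * δ₁ * m + δ₁ ^ 2 ≤ δ := by
      have hc : Continuous fun x : ℝ => 2 * x * m * 2 ^ (n + 1) + 2 * x * m + x ^ 2 := by fun_prop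
      have h0 := hc.tendsto 0
      simp only [mul_zero, zero_mul, add_zero, zero_pow two_ne_zero] at h0
      obtain ⟨x, hx, hx'⟩ := ((h0.mono_left nhdsWithin_le_nhds).eventually
        (ge_mem_nhds hδ) |>.and (self_mem_nhdsWithin (s := Ioi (0 : ℝ)))).exists
      exact ⟨x, hx', hx⟩
    obtain ⟨θ, hθ, hslab⟩ := exists_slab_le hℓ hδ₁
    filter_upwards [eventually_half_ball hd hy hΩ hθ, hdecay δ₁ hδ₁, self_mem_nhdsWithin]
      with t ht hσ ht0
    have ht0 : 0 < t := ht0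
    set N := t ^ (n + 1) with hN
    have hN0 : 0 < N := by positivity
    set K : Set (Space n) := {q | q ∈ ball y t ∧ θ * t < ℓ (q - y)} with hK
    have hcont : Continuous fun q : Space n => ℓ (q - y) := by fun_prop
    have hKo : IsOpen K := isOpen_ball.inter (isOpen_lt continuous_const hcont)
    have hKc : Convex ℝ K := by
      refine (convex_ball y t).inter ?_
      have : {q | θ * t < ℓ (q - y)} = {q | θ * t + ℓ y < ℓ q} := by
        ext q; simp only [mem_ofPred_eq, map_sub]; constructor <;> intro h <;> linarith
      change Convex ℝ {q | θ * t < ℓ (q - y)}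
      rw [this]
      exact convex_halfSpace_gt ℓ.isLinear _
    have hKΩ : K ⊆ Ω := fun q hq => (ht q hq.1).1 hq.2
    have hKb : K ⊆ ball y t := fun q hq => hq.1
    have hpK : perimeter L K ≤ ENNReal.ofReal (δ₁ * t ^ n) :=
      ((hper K hKo hKΩ).trans (measure_mono (hKb.trans ball_subset_closedBall))).trans hσ
    have hpt : perimeter L K ≠ ⊤ := (hpK.trans_lt ENNReal.ofReal_lt_top).ne
    have hpr : (perimeter L K).toReal ≤ δ₁ * t ^ n :=
      ENNReal.toReal_le_of_le_ofReal (by positivity) hpK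
    have hpoin := volume_mul_volume_le hL hKo hKc hKb hpt
    have f3 : volume (K \ L) ≠ ⊤ :=
      ((measure_mono (sdiff_subset.trans hKb)).trans_lt measure_ball_lt_top).ne
    have hpoin' : volume.real (L ∩ K) * volume.real (K \ L)
        ≤ 2 * t * (perimeter L K).toReal * ((2 * t) ^ (n + 1) * m) := by
      rw [← volume_real_ball (0 : Space n) (by positivity : (0:ℝ) ≤ 2 * t)]
      have := ENNReal.toReal_mono (ENNReal.mul_ne_top ENNReal.ofReal_ne_top
        measure_ball_lt_top.ne) hpoin
      rwa [ENNReal.toReal_mul, ENNReal.toReal_mul, ENNReal.toReal_ofReal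
        (by positivity)] at this
    have hpoin2 : volume.real (L ∩ K) * volume.real (K \ L)
        ≤ 2 * δ₁ * m * 2 ^ (n + 1) * N ^ 2 := by
      refine hpoin'.trans ?_
      calc _ ≤ 2 * t * (δ₁ * t ^ n) * ((2 * t) ^ (n + 1) * m) := by gcongr
        _ = _ := by rw [hN]; ring
    have hout : ∀ E ⊆ Ω, volume.real (E ∩ ball y t)
        ≤ volume.real (E ∩ K) + N * δ₁ := by
      intro E hE
      have hsub : E ∩ ball y t ⊆ (E ∩ K)
          ∪ {q | q ∈ ball y t ∧ |t⁻¹ * ℓ (q - y)| ≤ θ} := by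
        intro q hq
        by_cases hqK : q ∈ K
        · exact Or.inl ⟨hq.1, hqK⟩
        · refine Or.inr ⟨hq.2, ?_⟩
          have h1 := (ht q hq.2).2 (hE hq.1)
          have h2 : ℓ (q - y) ≤ θ * t := by
            by_contra! h
            exact hqK ⟨hq.2, h⟩
          rw [abs_mul, abs_of_pos (inv_pos.2 ht0), inv_mul_le_iff₀ ht0, abs_le]
          constructor <;> linarith
      have f4 : volume (E ∩ K) ≠ ⊤ :=
        ((measure_mono (inter_subset_right.trans hKb)).trans_lt measure_ball_lt_top).ne
      have f5 : volume {q | q ∈ ball y t ∧ |t⁻¹ * ℓ (q - y)| ≤ θ} ≠ ⊤ :=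
        ((measure_mono fun q hq => hq.1).trans_lt (measure_ball_lt_top (x := y) (r := t))).ne
      refine (measureReal_mono hsub (measure_union_lt_top f4.lt_top f5.lt_top).ne).trans
        ((measureReal_union_le _ _).trans ?_)
      rw [half_ball_eq y ℓ ht0 (fun a => |a| ≤ θ), volume_real_scale y ht0]
      gcongr
    have e1 := hout L hLΩ
    have e2 := hout (Ω \ L) sdiff_subset
    have e3 : (Ω \ L) ∩ K = K \ L := by
      ext q; exact ⟨fun h => ⟨h.2, h.1.2⟩, fun h => ⟨⟨hKΩ h.1, h.2⟩, h.1⟩⟩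
    rw [e3] at e2
    have g1 : volume.real (L ∩ K) ≤ N * m :=
      (measureReal_mono (inter_subset_inter_right _ hKb) (fin L t)).trans (hle L t ht0)
    have g2 : volume.real (K \ L) ≤ N * m := by
      rw [← e3]
      exact (measureReal_mono (inter_subset_inter_right _ hKb) (fin _ t)).trans (hle _ t ht0)
    have hδN : 0 ≤ N * δ₁ := by positivity
    calc a t * b t ≤ (volume.real (L ∩ K) + N * δ₁) * (volume.real (K \ L) + N * δ₁) :=
          mul_le_mul e1 e2 measureReal_nonneg (by positivity)
      _ = volume.real (L ∩ K) * volume.real (K \ L)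
          + N * δ₁ * (volume.real (L ∩ K) + volume.real (K \ L)) + (N * δ₁) ^ 2 := by ring
      _ ≤ 2 * δ₁ * m * 2 ^ (n + 1) * N ^ 2 + N * δ₁ * (N * m + N * m) + (N * δ₁) ^ 2 := by
          gcongr
      _ = (2 * δ₁ * m * 2 ^ (n + 1) + 2 * δ₁ * m + δ₁ ^ 2) * N ^ 2 := by ring
      _ ≤ δ * N ^ 2 := by gcongr
  obtain ⟨c, hc, hlow⟩ := exists_lower_density hd hℓ hy hΩ
  have hsum : ∀ᶠ t in 𝓝[>] (0 : ℝ), c * t ^ (n + 1) ≤ a t + b t := by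
    filter_upwards [hlow] with t ht
    refine ht.trans (le_of_eq ?_)
    have := measureReal_inter_add_sdiff (μ := volume) (s := Ω ∩ ball y t) hL (fin _ _)
    rw [← this, ha, hb]
    congr 2
    · ext q
      exact ⟨fun h => ⟨h.2, h.1.2⟩, fun h => ⟨⟨hLΩ h.1, h.2⟩, h.1⟩⟩
    · ext q
      exact ⟨fun h => ⟨⟨h.1.1, h.2⟩, h.1.2⟩, fun h => ⟨⟨h.1.1, h.2⟩, h.1.2⟩⟩
  -- the two volumes are never equal at small radii
  obtain ⟨t₀, ht₀, hne⟩ : ∃ t₀ > 0, ∀ t ∈ Ioo 0 t₀, a t ≠ b t := by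
    have := hsum.and (hprod (c ^ 2 / 8) (by positivity))
    rw [eventually_nhdsWithin_iff] at this
    obtain ⟨t₀, ht₀, h⟩ := eventually_nhds_iff_ball.1 this
    refine ⟨t₀, ht₀, fun t ht heq => ?_⟩
    obtain ⟨h1, h2⟩ := h t (by rw [Real.ball_eq_Ioo]; constructor <;> linarith [ht.1, ht.2]) ht.1
    have hN0 : 0 < t ^ (n + 1) := pow_pos ht.1 _
    rw [← heq] at h1 h2
    have h3 : c * t ^ (n + 1) / 2 ≤ a t := by linarith
    have h4 : (c * t ^ (n + 1) / 2) * (c * t ^ (n + 1) / 2) ≤ a t * a t :=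
      mul_le_mul h3 h3 (by positivity) (by linarith [mul_pos hc hN0])
    nlinarith [mul_pos hc hN0, sq_nonneg (c * t ^ (n + 1)),
      mul_pos (mul_pos hc hN0) (mul_pos hc hN0)]
  have hcontd : ContinuousOn (fun t => a t - b t) (Ioo 0 t₀) :=
    ((continuousOn_measureReal_inter_ball L y).sub
      (continuousOn_measureReal_inter_ball (Ω \ L) y)).mono fun t ht => ht.1
  have hsign : (∀ t ∈ Ioo 0 t₀, b t ≤ a t) ∨ (∀ t ∈ Ioo 0 t₀, a t ≤ b t) := by
    by_contra! h
    obtain ⟨⟨t₁, ht₁, h₁⟩, t₂, ht₂, h₂⟩ := h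
    obtain ⟨t, ht, h0⟩ := isPreconnected_Ioo.intermediate_value ht₁ ht₂ hcontd
      (show (0 : ℝ) ∈ Icc _ _ from ⟨by linarith, by linarith⟩)
    exact hne t ht (by linarith)
  -- the smaller volume is of higher order
  have win : ∀ a b : ℝ → ℝ, (∀ t, 0 ≤ b t) →
      (∀ δ > 0, ∀ᶠ t in 𝓝[>] (0 : ℝ), a t * b t ≤ δ * (t ^ (n + 1)) ^ 2) →
      (∀ᶠ t in 𝓝[>] (0 : ℝ), c * t ^ (n + 1) ≤ a t + b t) → (∀ t ∈ Ioo 0 t₀, b t ≤ a t) →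
      ∀ δ > 0, ∀ᶠ t in 𝓝[>] (0 : ℝ), b t ≤ δ * t ^ (n + 1) := by
    intro a b hb0 hab hs hba δ hδ
    filter_upwards [hab (δ * (c / 2)) (by positivity), hs, Ioo_mem_nhdsGT ht₀] with t h1 h2 h3
    have hN0 : 0 < t ^ (n + 1) := pow_pos h3.1 _
    have h4 : c / 2 * t ^ (n + 1) ≤ a t := by linarith [hba t h3]
    have h5 : c / 2 * t ^ (n + 1) * b t ≤ a t * b t := mul_le_mul_of_nonneg_right h4 (hb0 t)
    have h6 : c / 2 * t ^ (n + 1) * b t ≤ c / 2 * t ^ (n + 1) * (δ * t ^ (n + 1)) := by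
      refine (h5.trans h1).trans (le_of_eq ?_); ring
    exact le_of_mul_le_mul_left h6 (by positivity)
  rcases hsign with h | h
  · exact Or.inl (win a b (fun _ => measureReal_nonneg) hprod hsum h)
  · refine Or.inr (win b a (fun _ => measureReal_nonneg) (fun δ hδ => ?_) ?_ h)
    · simpa only [mul_comm (b _)] using hprod δ hδ
    · simpa only [add_comm (b _)] using hsum

/-- Points where the complement has density zero belong to the trace, and points where the set has
density zero do not. -/
lemma mem_trace_of_hasZeroDensity {R : EReal} {S : Set (Space n)} (hyS : y ∈ S)
    (hL : MeasurableSet L) {c : ℝ} (hc : 0 < c)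
    (hlow : ∀ᶠ t in 𝓝[>] (0 : ℝ), c * t ^ (n + 1) ≤ volume.real (region R ∩ ball y t))
    (h : HasZeroDensity (region R \ L) y) : y ∈ trace R S L := by
  refine ⟨hyS, ?_⟩
  have key : Tendsto (fun t : ℝ => 1 - volume ((region R \ L) ∩ ball y t)
      / volume (region R ∩ ball y t)) (𝓝[>] 0) (𝓝 1) := by
    have h0 : Tendsto (fun t : ℝ => volume ((region R \ L) ∩ ball y t)
        / volume (region R ∩ ball y t)) (𝓝[>] 0) (𝓝 0) := by
      refine ENNReal.tendsto_nhds_zero.2 fun ε hε => ?_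
      by_cases hεt : ε = ⊤
      · simp [hεt]
      have hεr : 0 < ε.toReal := ENNReal.toReal_pos hε.ne' hεt
      filter_upwards [h (ε.toReal * c) (by positivity), hlow, self_mem_nhdsWithin] with t h1 h2 h3
      have h3 : 0 < t := h3
      refine ENNReal.div_le_of_le_mul ?_
      have f : ∀ E : Set (Space n), volume (E ∩ ball y t) ≠ ⊤ := fun E =>
        ((measure_mono inter_subset_right).trans_lt measure_ball_lt_top).ne
      rw [← ENNReal.toReal_le_toReal (f _) (ENNReal.mul_ne_top hεt (f _)), ENNReal.toReal_mul]
      refine h1.trans ?_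
      rw [mul_assoc]
      exact mul_le_mul_of_nonneg_left h2 hεr.le
    simpa using ENNReal.Tendsto.sub (tendsto_const_nhds (x := (1 : ℝ≥0∞))) h0 (by simp)
  refine key.congr' ?_
  filter_upwards [hlow, self_mem_nhdsWithin] with t h2 h3
  have h3 : 0 < t := h3
  have f : ∀ E : Set (Space n), volume (E ∩ ball y t) ≠ ⊤ := fun E =>
    ((measure_mono inter_subset_right).trans_lt measure_ball_lt_top).ne
  have hpos : volume (region R ∩ ball y t) ≠ 0 := fun h0 => by
    rw [measureReal_def, h0, ENNReal.toReal_zero] at h2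
    exact absurd h2 (not_le.2 (by positivity))
  have e := measure_inter_add_sdiff (μ := volume) (region R ∩ ball y t) hL
  have e1 : region R ∩ ball y t ∩ L = L ∩ region R ∩ ball y t := by
    ext q; simp only [mem_inter_iff]; tauto
  have e2 : (region R ∩ ball y t) \ L = (region R \ L) ∩ ball y t := by
    ext q; simp only [mem_inter_iff, Set.mem_sdiff]; tauto
  rw [e1, e2] at e
  refine ENNReal.sub_eq_of_eq_add (ENNReal.div_ne_top (f _) hpos) ?_
  rw [← ENNReal.add_div, e, ENNReal.div_self hpos (f _)]

lemma notMem_trace_of_hasZeroDensity {R : EReal} {S : Set (Space n)} {c : ℝ} (hc : 0 < c)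
    (hlow : ∀ᶠ t in 𝓝[>] (0 : ℝ), c * t ^ (n + 1) ≤ volume.real (region R ∩ ball y t))
    (h : HasZeroDensity (L ∩ region R) y) : y ∉ trace R S L := by
  rintro ⟨-, ht⟩
  have h1 := ht.eventually (lt_mem_nhds (show (1 / 2 : ℝ≥0∞) < 1 by
    rw [one_div]; exact ENNReal.inv_lt_one.2 ENNReal.one_lt_two))
  obtain ⟨t, h2, h3, h4, h5⟩ := (h1.and (hlow.and ((h (c / 4) (by positivity)).and
    (self_mem_nhdsWithin (s := Ioi (0 : ℝ)))))).exists
  have h5 : 0 < t := h5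
  have f : ∀ E : Set (Space n), volume (E ∩ ball y t) ≠ ⊤ := fun E =>
    ((measure_mono inter_subset_right).trans_lt measure_ball_lt_top).ne
  have hpos : volume (region R ∩ ball y t) ≠ 0 := fun h0 => by
    rw [measureReal_def, h0, ENNReal.toReal_zero] at h3
    exact absurd h3 (not_le.2 (by positivity))
  rw [ENNReal.lt_div_iff_mul_lt (Or.inl hpos) (Or.inl (f _))] at h2
  have h6 := (ENNReal.toReal_lt_toReal (ENNReal.mul_ne_top (by simp) (f _)) (f _)).2 h2
  rw [ENNReal.toReal_mul] at h6
  have h7 : (1 / 2 : ℝ≥0∞).toReal = 1 / 2 := by simp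
  rw [h7] at h6
  change 1 / 2 * volume.real _ < volume.real _ at h6
  have : 0 < c * t ^ (n + 1) := by positivity
  linarith

end Density

/-! ### Traces on the lateral surfaces -/

section Trace

variable {n : ℕ} {R : EReal} {L : Set (Space n)} {σ : Measure (Space n)} {ν : Space n → Space n}

lemma fderiv_eq_zero_of_invariant {f : Space n → ℝ} {x v : Space n} (hf : DifferentiableAt ℝ f x)
    (h : ∀ t : ℝ, f (x + t • v) = f x) : fderiv ℝ f x v = 0 := by
  have h1 := hf.hasFDerivAt.hasLineDerivAt v
  have h2 : HasLineDerivAt ℝ f 0 x v := by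
    unfold HasLineDerivAt
    simp_rw [h]
    exact hasDerivAt_const _ _
  exact h1.unique h2

/-- The cutoff functions do not depend on the height in a large ball. -/
lemma fderiv_cutoff_ez {k : ℕ} {x : Space n} (hk : ‖x‖ < k) : fderiv ℝ (cutoff R k) x ez = 0 := by
  have hk0 : (0 : ℝ) < k := (norm_nonneg x).trans_lt hk
  set f : Space n → ℝ := fun q => step (k * plateFun q) * step (k * containerFun R q)
  have hf : ContDiff ℝ ∞ f := (contDiff_step.comp (contDiff_const.mul contDiff_plateFun)).mul
    (contDiff_step.comp (contDiff_const.mul contDiff_containerFun))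
  have he : cutoff R k =ᶠ[𝓝 x] f := by
    filter_upwards [continuous_norm.continuousAt.eventually (gt_mem_nhds hk)] with q hq
    have : ‖q‖ ^ 2 / (k : ℝ) ^ 2 ≤ 1 := by
      rw [div_le_one (by positivity)]
      exact pow_le_pow_left₀ (norm_nonneg _) hq.le 2
    rw [cutoff, step_of_ge (by linarith : 1 ≤ 2 - ‖q‖ ^ 2 / (k : ℝ) ^ 2), mul_one]
  rw [he.fderiv_eq]
  refine fderiv_eq_zero_of_invariant (hf.differentiable (by simp) x) fun t => ?_
  simp [f, plateFun, containerFun]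

lemma fluxCoeff_nonneg : 0 ≤ fluxCoeff R := by unfold fluxCoeff; split_ifs <;> norm_num

lemma fluxCoeff_le_one : fluxCoeff R ≤ 1 := by unfold fluxCoeff; split_ifs <;> norm_num

/-- The surface measure of a profile of finite energy is finite up to the lateral surfaces. -/
lemma IsGaussGreen.measure_closedBall_lt_top (hR : 1 < R) (hG : IsGaussGreen L (region R) σ ν)
    (hfin : surfaceEnergy R L ≠ ⊤) (M : ℝ) : σ (closedBall 0 M) < ⊤ := by
  obtain ⟨χ, hχ, hχc, -, hχ01, hχ1⟩ := exists_cutoff (isCompact_closedBall (0 : Space n) M)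
    isOpen_univ (subset_univ _)
  have hχ' : ContDiff ℝ 1 χ := hχ.of_le (by norm_cast)
  obtain ⟨M', hM'⟩ := hχc.isCompact.isBounded.subset_ball 0
  have hE := isExhaustion_cutoff (n := n) hR
  have hdχ : Integrable fun x => fderiv ℝ χ x ez :=
    ((hχ'.continuous_fderiv one_ne_zero).clm_apply continuous_const).integrable_of_hasCompactSupport
      (hχc.fderiv_apply (𝕜 := ℝ) ez)
  set C := ∫ x, |fderiv ℝ χ x ez| with hC
  set B := (surfaceEnergy R L).toReal + C with hB
  have hbound : ∀ᶠ k : ℕ in atTop, ∫ x, cutoff R k x * χ x ∂σ ≤ B := by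
    filter_upwards [tendsto_natCast_atTop_atTop.eventually_ge_atTop M'] with k hk
    have hη : ContDiff ℝ 1 fun x => cutoff R k x * χ x := (hE.contDiff k).mul hχ'
    have hs : tsupport (fun x => cutoff R k x * χ x) ⊆ tsupport (cutoff R k) :=
      tsupport_mul_subset_left
    have hc : HasCompactSupport fun x => cutoff R k x * χ x := (hE.compact k).mul_right
    have h := integral_le_surfaceEnergy hG hfin hη hc (hs.trans (hE.supp k)) fun x =>
      ⟨mul_nonneg (hE.mem_Icc k x).1 (hχ01 x).1,
        mul_le_one₀ (hE.mem_Icc k x).2 (hχ01 x).1 (hχ01 x).2⟩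
    have hle : ∫ x in L, fderiv ℝ (fun x => cutoff R k x * χ x) x ez ≤ C := by
      have hi : Integrable fun x => fderiv ℝ (fun x => cutoff R k x * χ x) x ez :=
        ((hη.continuous_fderiv one_ne_zero).clm_apply
          continuous_const).integrable_of_hasCompactSupport (hc.fderiv_apply (𝕜 := ℝ) ez)
      calc _ ≤ ∫ x in L, |fderiv ℝ χ x ez| := by
            refine setIntegral_mono hi.integrableOn hdχ.abs.integrableOn fun x => ?_
            have e : fderiv ℝ (fun x => cutoff R k x * χ x) x ez
                = cutoff R k x * fderiv ℝ χ x ez + χ x * fderiv ℝ (cutoff R k) x ez := by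
              rw [fderiv_fun_mul ((hE.contDiff k).differentiable one_ne_zero x)
                (hχ'.differentiable one_ne_zero x)]
              simp
            have e2 : χ x * fderiv ℝ (cutoff R k) x ez = 0 := by
              by_cases hx : x ∈ tsupport χ
              · rw [fderiv_cutoff_ez ((mem_ball_zero_iff.1 (hM' hx)).trans_le hk), mul_zero]
              · rw [image_eq_zero_of_notMem_tsupport hx, zero_mul]
            simp only
            rw [e, e2, add_zero]
            refine (le_abs_self _).trans ?_
            rw [abs_mul, abs_of_nonneg (hE.mem_Icc k x).1]
            exact mul_le_of_le_one_left (abs_nonneg _) (hE.mem_Icc k x).2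
        _ ≤ C := setIntegral_le_integral hdχ.abs (.of_forall fun x => abs_nonneg _)
    have hC0 : 0 ≤ C := integral_nonneg fun x => abs_nonneg _
    have : fluxCoeff R * ∫ x in L, fderiv ℝ (fun x => cutoff R k x * χ x) x ez ≤ C :=
      (mul_le_mul_of_nonneg_left hle fluxCoeff_nonneg).trans
        (mul_le_of_le_one_left hC0 fluxCoeff_le_one)
    linarith
  have hreg : ∀ᵐ x ∂σ, x ∈ region R := by
    have := hG.null_compl
    rwa [ae_iff]
  have hlim : ∀ᵐ x ∂σ, (closedBall (0 : Space n) M).indicator 1 x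
      ≤ liminf (fun k : ℕ => ENNReal.ofReal (cutoff R k x * χ x)) atTop := by
    filter_upwards [hreg] with x hx
    by_cases hxM : x ∈ closedBall (0 : Space n) M
    · rw [indicator_of_mem hxM]
      refine le_liminf_of_le (by isBoundedDefault) ?_
      filter_upwards [hE.eventually_one {x} isCompact_singleton (by simpa using hx)] with k hk
      rw [hk x rfl, hχ1.self_of_nhdsSet x hxM]
      simp
    · rw [indicator_of_notMem hxM]; exact zero_le
  calc σ (closedBall 0 M) = ∫⁻ x, (closedBall (0 : Space n) M).indicator 1 x ∂σ :=
        (lintegral_indicator_one measurableSet_closedBall).symm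
    _ ≤ ∫⁻ x, liminf (fun k : ℕ => ENNReal.ofReal (cutoff R k x * χ x)) atTop ∂σ :=
        lintegral_mono_ae hlim
    _ ≤ liminf (fun k : ℕ => ∫⁻ x, ENNReal.ofReal (cutoff R k x * χ x) ∂σ) atTop :=
        lintegral_liminf_le fun k =>
          ((hE.smooth k).continuous.mul hχ.continuous).measurable.ennreal_ofReal
    _ ≤ ENNReal.ofReal B := by
        refine liminf_le_of_frequently_le' (Eventually.frequently ?_)
        filter_upwards [hbound] with k hk
        have hs : tsupport (fun x => cutoff R k x * χ x) ⊆ tsupport (cutoff R k) :=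
          tsupport_mul_subset_left
        rw [← ofReal_integral_eq_lintegral_ofReal (f := fun x => cutoff R k x * χ x)
          (hG.integrable_of_continuous ((hE.smooth k).continuous.mul hχ.continuous)
            (hE.compact k).mul_right (hs.trans (hE.supp k)))
          (.of_forall fun x => mul_nonneg (hE.mem_Icc k x).1 (hχ01 x).1)]
        exact ENNReal.ofReal_le_ofReal hk
    _ < ⊤ := ENNReal.ofReal_lt_top

lemma IsGaussGreen.perimeter_le_measure {U : Set (Space n)} (hG : IsGaussGreen L U σ ν)
    {V : Set (Space n)} (hV : V ⊆ U) : perimeter L V ≤ σ V := by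
  refine iSup_le fun φ => iSup_le fun h1 => iSup_le fun h2 => iSup_le fun h3 => iSup_le fun h4 => ?_
  have hK : σ (tsupport φ) < ⊤ := hG.finite_on_compacts _ h2.isCompact (h3.trans hV)
  have hKm : MeasurableSet (tsupport φ) := (isClosed_tsupport φ).measurableSet
  rw [hG.gauss_green φ h1 h2 (h3.trans hV)]
  refine le_trans ?_ (measure_mono h3)
  rw [← ENNReal.ofReal_toReal hK.ne]
  refine ENNReal.ofReal_le_ofReal ?_
  calc ∫ x, ⟪φ x, ν x⟫ ∂σ ≤ ∫ x, (tsupport φ).indicator 1 x ∂σ := by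
        refine integral_mono_ae (hG.integrable_inner ⟨h1, h2, h3.trans hV⟩)
          ((integrable_indicator_iff hKm).2 (integrableOn_const hK.ne)) ?_
        filter_upwards [hG.norm_normal] with x hx
        by_cases hxK : x ∈ tsupport φ
        · rw [indicator_of_mem hxK]
          refine (real_inner_le_norm _ _).trans ?_
          rw [hx, mul_one]
          exact h4 x
        · rw [indicator_of_notMem hxK, image_eq_zero_of_notMem_tsupport hxK, inner_zero_left]
    _ = σ.real (tsupport φ) := integral_indicator_one hKm

variable {S : Set (Space n)} {r : Space n → ℝ} {p : Space n}
  {A : Space n ≃ₗᵢ[ℝ] Space n} {ε ρ : ℝ}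

/-- At almost every point of a lateral surface the surface measure of the free surface decays
faster than area: the two measures are mutually singular. -/
lemma WallChart.ae_decay (h : WallChart R S r p A ε ρ) (hσ : σ (ball p ρ) < ⊤)
    (hσR : σ (region R)ᶜ = 0) :
    ∀ᵐ y ∂(μHE[n] : Measure (Space n)).restrict (S ∩ ball p ρ), y ∈ ball p ρ →
      ∀ δ > 0, ∀ᶠ t in 𝓝[>] (0 : ℝ), σ (closedBall y t) ≤ ENNReal.ofReal (δ * t ^ n) := by
  set μ := (μHE[n] : Measure (Space n)).restrict (S ∩ ball p ρ) with hμ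
  set τ := σ.restrict (ball p ρ) with hτ
  have hμfin : IsFiniteMeasure μ := ⟨by rw [hμ, Measure.restrict_apply_univ]; exact h.area_lt_top⟩
  have hτfin : IsFiniteMeasure τ := ⟨by rw [hτ, Measure.restrict_apply_univ]; exact hσ⟩
  have hsing : τ ⟂ₘ μ := by
    refine ⟨(region R)ᶜ, (measurableSet_region R).compl, ?_, ?_⟩
    · exact le_antisymm ((Measure.restrict_apply_le _ _).trans hσR.le) zero_le
    · rw [compl_compl, hμ, Measure.restrict_apply (measurableSet_region R)]
      have : region R ∩ (S ∩ ball p ρ) = ∅ := by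
        ext q
        simp only [mem_inter_iff, mem_empty_iff_false, iff_false]
        rintro ⟨h1, h2, h3⟩
        have h4 := (h.region_iff q h3).1 h1
        rw [(h.wall_iff q h3).1 h2] at h4
        exact lt_irrefl _ h4
      rw [this, measure_empty]
  filter_upwards [Besicovitch.ae_tendsto_rnDeriv τ μ, hsing.rnDeriv_ae_eq_zero]
    with y hy h0 hyp δ hδ
  rw [h0, Pi.zero_apply] at hy
  obtain ⟨ρ', hρ', hb⟩ := isOpen_iff.1 isOpen_ball y hyp
  set v := volume (closedBall (0 : Horiz n) 1) with hv
  set c := ENNReal.ofReal ((1 - ε)⁻¹ ^ n) * v with hc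
  have hcfin : c ≠ ⊤ := ENNReal.mul_ne_top ENNReal.ofReal_ne_top measure_closedBall_lt_top.ne
  have harea : ∀ t, 0 < t → t < ρ' → μ (closedBall y t) ≤ c * ENNReal.ofReal (t ^ n) := by
    intro t ht htρ
    rw [hμ, Measure.restrict_apply measurableSet_closedBall]
    refine (h.area_le inter_subset_right).trans ?_
    rw [hc, mul_assoc]
    gcongr
    have hsub : frameProj A p '' (closedBall y t ∩ (S ∩ ball p ρ))
        ⊆ closedBall (frameProj A p y) t := by
      rintro _ ⟨q, hq, rfl⟩
      rw [mem_closedBall_iff_norm]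
      exact (norm_frameProj_sub_le A p q y).trans (mem_closedBall_iff_norm.1 hq.1)
    refine (measure_mono hsub).trans (le_of_eq ?_)
    rw [Measure.addHaar_closedBall' _ _ ht.le, finrank_euclideanSpace_fin, mul_comm]
  set κ : ℝ := δ / (c.toReal + 1)
  have hκ : 0 < κ := by positivity
  have hev := (ENNReal.tendsto_nhds_zero.1 hy) (ENNReal.ofReal κ) (by simpa using hκ)
  filter_upwards [hev, Ioo_mem_nhdsGT hρ'] with t ht htρ
  have h1 : τ (closedBall y t) ≤ ENNReal.ofReal κ * μ (closedBall y t) := by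
    rwa [ENNReal.div_le_iff_le_mul (Or.inr ENNReal.ofReal_ne_top)
      (Or.inl (measure_ne_top μ _))] at ht
  have h2 : τ (closedBall y t) = σ (closedBall y t) := by
    rw [hτ, Measure.restrict_apply measurableSet_closedBall, inter_eq_left.2]
    exact fun q hq => hb (lt_of_le_of_lt hq htρ.2)
  rw [← h2]
  refine (h1.trans (mul_le_mul_right (harea t htρ.1 htρ.2) _)).trans ?_
  rw [← ENNReal.ofReal_toReal hcfin, ← ENNReal.ofReal_mul ENNReal.toReal_nonneg,
    ← ENNReal.ofReal_mul hκ.le]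
  refine ENNReal.ofReal_le_ofReal ?_
  rw [← mul_assoc]
  refine mul_le_mul_of_nonneg_right ?_ (pow_nonneg htρ.1.le _)
  have : κ * (c.toReal + 1) = δ := div_mul_cancel₀ _ (by positivity)
  linarith

lemma WallChart.fderiv_frame_pos (h : WallChart R S r p A ε ρ) {q : Space n}
    (hq : q ∈ ball p ρ) : fderiv ℝ r q (A.symm ez) ∈ Icc (1 - ε) (1 + ε) := by
  have := abs_le.1 (h.norm_fderiv_sub_le hq (A.symm ez))
  rw [A.apply_symm_apply, height_ez, A.symm.norm_map, norm_ez, mul_one] at this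
  constructor <;> linarith [this.1, this.2]

/-- The data of a boundary point at which the lateral surface is smooth. -/
lemma WallChart.boundary_data (h : WallChart R S r p A ε ρ) {y : Space n}
    (hy : y ∈ S ∩ ball p ρ) : HasFDerivAt r (fderiv ℝ r y) y ∧ fderiv ℝ r y ≠ 0 ∧ r y = 0 ∧
      ∀ᶠ q in 𝓝 y, q ∈ region R ↔ 0 < r q := by
  refine ⟨(h.smooth.differentiable (by simp) y).hasFDerivAt, fun h0 => ?_,
    (h.wall_iff y hy.2).1 hy.1, ?_⟩
  · have := (h.fderiv_frame_pos hy.2).1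
    rw [h0, zero_apply] at this
    linarith [h.eps_le]
  · filter_upwards [isOpen_ball.mem_nhds hy.2] with q hq using h.region_iff q hq

lemma WallChart.isClosed_relative (h : WallChart R S r p A ε ρ) :
    MeasurableSet (S ∩ ball p ρ) := by
  have : S ∩ ball p ρ = {q | r q = 0} ∩ ball p ρ := by
    ext q
    exact ⟨fun hq => ⟨(h.wall_iff q hq.2).1 hq.1, hq.2⟩,
      fun hq => ⟨(h.wall_iff q hq.2).2 hq.1, hq.2⟩⟩
  rw [this]
  exact (measurableSet_eq_fun h.smooth.continuous.measurable measurable_const).inter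
    measurableSet_ball

/-- The trace of the indicator takes the values `0` and `1` only. -/
lemma WallChart.ae_trace (h : WallChart R S r p A ε ρ) (hL : MeasurableSet L)
    (hLR : L ⊆ region R) (hG : IsGaussGreen L (region R) σ ν) (hσ : σ (ball p ρ) < ⊤) :
    ∀ᵐ y ∂(μHE[n] : Measure (Space n)).restrict (S ∩ ball p ρ),
      (y ∈ trace R S L ∧ HasZeroDensity (region R \ L) y) ∨
        (y ∉ trace R S L ∧ HasZeroDensity L y) := by
  filter_upwards [h.ae_decay hσ hG.null_compl, ae_restrict_mem h.isClosed_relative] with y hy hyS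
  obtain ⟨h1, h2, h3, h4⟩ := h.boundary_data hyS
  obtain ⟨c, hc, hlow⟩ := exists_lower_density h1 h2 h3 h4
  rcases zero_one_of_decay h1 h2 h3 h4 hL hLR
    (fun V _ hV => hG.perimeter_le_measure hV) (hy hyS.2) with h5 | h5
  · exact Or.inl ⟨mem_trace_of_hasZeroDensity hyS.1 hL hc hlow h5, h5⟩
  · refine Or.inr ⟨notMem_trace_of_hasZeroDensity hc hlow ?_, h5⟩
    exact h5.mono one_pos fun q hq => hq.1.1

lemma continuous_measureReal_inter_ball (E : Set (Space n)) {t : ℝ} (ht : 0 ≤ t) :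
    Continuous fun y => volume.real (E ∩ ball y t) := by
  set m := volume.real (ball (0 : Space n) 1)
  have hbd : ∀ y y' : Space n, volume.real (E ∩ ball y t)
      ≤ volume.real (E ∩ ball y' t) + ((t + dist y y') ^ (n + 1) - t ^ (n + 1)) * m :=
    fun y y' => measureReal_inter_ball_le E (ball_subset_ball' (by linarith)) ht
      (by linarith [dist_nonneg (x := y) (y := y')])
  refine continuous_iff_continuousAt.2 fun y => tendsto_iff_norm_sub_tendsto_zero.2 ?_
  have hlim : Tendsto (fun y' => ((t + dist y y') ^ (n + 1) - t ^ (n + 1)) * m) (𝓝 y) (𝓝 0) := by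
    have : Continuous fun y' => ((t + dist y y') ^ (n + 1) - t ^ (n + 1)) * m := by fun_prop
    simpa using this.tendsto y
  refine squeeze_zero (fun _ => norm_nonneg _) (fun y' => ?_) hlim
  have h1 := hbd y y'
  have h2 := hbd y' y
  rw [dist_comm y' y] at h2
  rw [Real.norm_eq_abs, abs_le]
  constructor <;> linarith

/-- The trace is Borel for an arbitrary set `L`, since volumes in balls are continuous in the
centre. -/
lemma measurableSet_trace (hS : IsClosed S) (hSR : S ⊆ closure (region R)) :
    MeasurableSet (trace R S L) := by
  have f : ∀ (E : Set (Space n)) y t, volume (E ∩ ball y t) ≠ ⊤ := fun E y t =>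
    ((measure_mono inter_subset_right).trans_lt measure_ball_lt_top).ne
  set c : ℕ → ℝ := fun m => 1 - 1 / ((m : ℝ) + 1)
  have e : trace R S L = S ∩ ⋂ m : ℕ, ⋃ j : ℕ, ⋂ t ∈ Ioo (0 : ℝ) (1 / ((j : ℝ) + 1)),
      {y | c m * volume.real (region R ∩ ball y t)
        ≤ volume.real (L ∩ region R ∩ ball y t)} := by
    ext y
    simp only [trace, mem_inter_iff, mem_iInter, mem_iUnion, mem_ofPred_eq]
    refine and_congr_right fun hy => ?_
    have hpos : ∀ t, 0 < t → volume (region R ∩ ball y t) ≠ 0 := fun t ht => by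
      refine (((isOpen_region R).inter isOpen_ball).measure_pos volume ?_).ne'
      obtain ⟨q, h1, h2⟩ := mem_closure_iff.1 (hSR hy) t ht
      exact ⟨q, h1, by rwa [mem_ball, dist_comm]⟩
    have hle : ∀ t, volume (L ∩ region R ∩ ball y t) / volume (region R ∩ ball y t)
        ≤ 1 := fun t => ENNReal.div_le_of_le_mul (by
      rw [one_mul]; exact measure_mono (inter_subset_inter_left _ inter_subset_right))
    have hreal : ∀ t, 0 < t → ∀ a : ℝ, (a * volume.real (region R ∩ ball y t)
        ≤ volume.real (L ∩ region R ∩ ball y t) ↔ a ≤ (volume (L ∩ region R ∩ ball y t)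
          / volume (region R ∩ ball y t)).toReal) := fun t ht a => by
      rw [ENNReal.toReal_div, le_div_iff₀ (ENNReal.toReal_pos (hpos t ht) (f _ _ _))]
      rfl
    rw [← ENNReal.tendsto_toReal_iff (fun t => ((hle t).trans_lt ENNReal.one_lt_top).ne)
      ENNReal.one_ne_top, ENNReal.toReal_one]
    constructor
    · intro ht m
      have hm : c m < 1 := by
        have : (0 : ℝ) < 1 / ((m : ℝ) + 1) := by positivity
        simp only [c]; linarith
      have h1 := ht.eventually (lt_mem_nhds hm)
      rw [eventually_nhdsWithin_iff] at h1
      obtain ⟨δ, hδ, h2⟩ := eventually_nhds_iff_ball.1 h1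
      obtain ⟨j, hj⟩ := exists_nat_one_div_lt hδ
      refine ⟨j, fun t ht => (hreal t ht.1 _).2 (h2 t ?_ ht.1).le⟩
      rw [Real.ball_eq_Ioo]
      constructor <;> linarith [ht.1, ht.2]
    · intro h
      refine tendsto_order.2 ⟨fun a ha => ?_, fun a ha => ?_⟩
      · obtain ⟨m, hm⟩ := exists_nat_one_div_lt (sub_pos.2 ha)
        obtain ⟨j, hj⟩ := h m
        filter_upwards [Ioo_mem_nhdsGT (show (0 : ℝ) < 1 / ((j : ℝ) + 1) by positivity)] with t ht
        refine lt_of_lt_of_le ?_ ((hreal t ht.1 _).1 (hj t ht))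
        simp only [c]; linarith
      · refine .of_forall fun t => lt_of_le_of_lt ?_ ha
        have := ENNReal.toReal_mono ENNReal.one_ne_top (hle t)
        rwa [ENNReal.toReal_one] at this
  rw [e]
  refine hS.measurableSet.inter (MeasurableSet.iInter fun m => MeasurableSet.iUnion fun j =>
    IsClosed.measurableSet (isClosed_biInter fun t ht => ?_))
  exact isClosed_le (continuous_const.mul (continuous_measureReal_inter_ball _ ht.1.le))
    (continuous_measureReal_inter_ball _ ht.1.le)

end Trace

/-! ### The flux of the cutoffs through the lateral surfaces -/

section Flux

variable {n : ℕ} {R : EReal} {S : Set (Space n)} {r : Space n → ℝ} {p : Space n}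
  {A : Space n ≃ₗᵢ[ℝ] Space n} {ε ρ : ℝ}

lemma deriv_step_eq_zero {t : ℝ} (ht : t < 1 / 2 ∨ 1 < t) : deriv step t = 0 := by
  rcases ht with ht | ht
  · have : step =ᶠ[𝓝 t] fun _ => (0 : ℝ) := by
      filter_upwards [gt_mem_nhds ht] with s hs using step_of_le hs.le
    rw [this.deriv_eq, deriv_const]
  · have : step =ᶠ[𝓝 t] fun _ => (1 : ℝ) := by
      filter_upwards [lt_mem_nhds ht] with s hs using step_of_ge hs.le
    rw [this.deriv_eq, deriv_const]

lemma continuous_deriv_step : Continuous (deriv step) :=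
  contDiff_step.continuous_deriv (by simp)

lemma exists_deriv_step_le : ∃ M > 0, ∀ t, deriv step t ≤ M := by
  obtain ⟨M, hM⟩ := (isCompact_Icc (a := (0 : ℝ)) (b := 2)).exists_bound_of_continuousOn
    continuous_deriv_step.continuousOn
  refine ⟨max M 1, by positivity, fun t => ?_⟩
  by_cases ht : t ∈ Icc (0 : ℝ) 2
  · exact ((le_abs_self _).trans (hM t ht)).trans (le_max_left _ _)
  · rw [deriv_step_eq_zero]
    · positivity
    · by_contra! h
      exact ht ⟨by linarith, by linarith⟩

/-- The derivative of the cutoff `step (k r)` in the direction of the inward normal at the centre of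
the chart. -/
def wallFlux {n : ℕ} (r : Space n → ℝ) (A : Space n ≃ₗᵢ[ℝ] Space n) (k : ℕ) (q : Space n) : ℝ :=
  k * deriv step (k * r q) * fderiv ℝ r q (A.symm ez)

lemma WallChart.continuous_wallFlux (h : WallChart R S r p A ε ρ) (k : ℕ) :
    Continuous (wallFlux r A k) := by
  have h1 := h.smooth.continuous
  have h2 : Continuous fun q => fderiv ℝ r q (A.symm ez) :=
    (h.smooth.continuous_fderiv (by simp)).clm_apply continuous_const
  exact (continuous_const.mul (continuous_deriv_step.comp (continuous_const.mul h1))).mul h2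

lemma WallChart.wallFlux_nonneg (h : WallChart R S r p A ε ρ) (k : ℕ) {q : Space n}
    (hq : q ∈ ball p ρ) : 0 ≤ wallFlux r A k q := by
  have := (h.fderiv_frame_pos hq).1
  have h2 := h.eps_le
  exact mul_nonneg (mul_nonneg k.cast_nonneg (deriv_step_nonneg _)) (by linarith)

lemma wallFlux_support {k : ℕ} {q : Space n} (hq : wallFlux r A k q ≠ 0) :
    0 < r q ∧ r q ≤ 1 / k := by
  have h0 : deriv step (k * r q) ≠ 0 := fun h => hq (by simp [wallFlux, h])
  have hk : (k : ℝ) ≠ 0 := fun h => hq (by simp [wallFlux, h])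
  have hk0 : (0 : ℝ) < k := lt_of_le_of_ne k.cast_nonneg hk.symm
  have h1 : 1 / 2 ≤ k * r q ∧ k * r q ≤ 1 := by
    by_contra! h
    refine h0 (deriv_step_eq_zero ?_)
    by_cases h' : k * r q < 1 / 2
    · exact Or.inl h'
    · exact Or.inr (h (not_lt.1 h'))
  refine ⟨?_, by rw [le_div_iff₀ hk0]; linarith [h1.2]⟩
  by_contra! h
  nlinarith [h1.1]

lemma norm_framePoint_sub_lt {a : ℝ} {t : Horiz n × ℝ} (ht : ‖t.1‖ < a) (ht' : |t.2| ≤ a) :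
    ‖framePoint A p t - p‖ < 2 * a := by
  have h0 : 0 < a := (norm_nonneg _).trans_lt ht
  have e : ‖framePoint A p t - p‖ ^ 2 = ‖t.1‖ ^ 2 + t.2 ^ 2 := by
    rw [framePoint, add_sub_cancel_left, A.symm.norm_map, norm_join_sq]
  have h1 : ‖t.1‖ ^ 2 < a ^ 2 := pow_lt_pow_left₀ ht (norm_nonneg _) two_ne_zero
  have h2 : t.2 ^ 2 ≤ a ^ 2 := by rw [← sq_abs]; exact pow_le_pow_left₀ (abs_nonneg _) ht' 2
  refine lt_of_pow_lt_pow_left₀ 2 (by positivity) ?_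
  nlinarith

lemma WallChart.framePoint_bounds (h : WallChart R S r p A ε ρ) {a : ℝ} (haρ : 2 * a ≤ ρ)
    {t : Horiz n × ℝ} (ht : ‖t.1‖ < a) (ht' : |t.2| ≤ a) :
    framePoint A p t ∈ ball p ρ ∧ |r (framePoint A p t) - t.2| ≤ a / 2 := by
  have h1 := norm_framePoint_sub_lt (A := A) (p := p) ht ht'
  have h2 : framePoint A p t ∈ ball p ρ := mem_ball_iff_norm.2 (h1.trans_le haρ)
  have h3 := h.approx _ h2 p (mem_ball_self h.radius_pos)
  rw [h.center, sub_zero, height_framePoint] at h3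
  refine ⟨h2, h3.trans ?_⟩
  have h4 := h.eps_le
  have h5 := h.eps_pos
  nlinarith [norm_nonneg (framePoint A p t - p)]

lemma hasDerivAt_framePoint (τ : Horiz n) (s : ℝ) :
    HasDerivAt (fun s => framePoint A p (τ, s)) (A.symm ez) s := by
  have e : (fun s => framePoint A p (τ, s)) = fun s => framePoint A p (τ, 0) + s • A.symm ez := by
    ext1 s
    have : (join τ s : Space n) = join τ 0 + s • ez := by
      rw [← join_horiz_height (join τ 0 + s • ez)]
      simp
    rw [framePoint, framePoint, this, map_add, map_smul, add_assoc]
  rw [e]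
  simpa using ((hasDerivAt_id s).smul_const (A.symm ez)).const_add (framePoint A p (τ, 0))

/-- Along each normal line the flux of the cutoff integrates to one. -/
lemma WallChart.lintegral_line (h : WallChart R S r p A ε ρ) {a : ℝ} (ha : 0 < a)
    (haρ : 2 * a ≤ ρ) {k : ℕ} (hk : 2 / a ≤ k) {τ : Horiz n} (hτ : ‖τ‖ < a) :
    ∫⁻ s in Ioc (-a) a, ENNReal.ofReal (wallFlux r A k (framePoint A p (τ, s))) = 1 := by
  have hder : ∀ s, HasDerivAt (fun s => step (k * r (framePoint A p (τ, s))))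
      (wallFlux r A k (framePoint A p (τ, s))) s := by
    intro s
    have h1 := ((h.smooth.differentiable (by simp)
      (framePoint A p (τ, s))).hasFDerivAt.comp_hasDerivAt s
        (hasDerivAt_framePoint τ s)).const_mul (k : ℝ)
    have h2 := (contDiff_step.differentiable (by simp)
      (k * r (framePoint A p (τ, s)))).hasDerivAt.comp s h1
    exact h2.congr_deriv (by simp only [wallFlux]; ring)
  have hc : Continuous fun s => wallFlux r A k (framePoint A p (τ, s)) :=
    (h.continuous_wallFlux k).comp ((continuous_framePoint A p).comp (by fun_prop))
  have hI := intervalIntegral.integral_eq_sub_of_hasDerivAt (a := -a) (b := a)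
    (fun s _ => hder s) (hc.intervalIntegrable _ _)
  have hka : 2 ≤ k * a := by rwa [div_le_iff₀ ha] at hk
  have b1 := abs_le.1 (h.framePoint_bounds haρ (t := (τ, a)) hτ (abs_of_pos ha).le).2
  have b2 := abs_le.1 (h.framePoint_bounds haρ (t := (τ, -a)) hτ
    (by rw [abs_neg]; exact (abs_of_pos ha).le)).2
  simp only at b1 b2
  rw [step_of_ge (t := k * r (framePoint A p (τ, a))) (by
      nlinarith [mul_le_mul_of_nonneg_left b1.1 k.cast_nonneg (α := ℝ)]),
    step_of_le (t := k * r (framePoint A p (τ, -a))) (by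
      nlinarith [mul_le_mul_of_nonneg_left b2.2 k.cast_nonneg (α := ℝ)]), sub_zero,
    intervalIntegral.integral_of_le (by linarith)] at hI
  rw [← ofReal_integral_eq_lintegral_ofReal, hI, ENNReal.ofReal_one]
  · exact hc.integrableOn_Ioc
  · refine (ae_restrict_iff' measurableSet_Ioc).2 (.of_forall fun s hs => ?_)
    exact h.wallFlux_nonneg k (h.framePoint_bounds haρ (t := (τ, s)) hτ
      (abs_le.2 ⟨hs.1.le, hs.2⟩)).1

/-- The part of a cylinder in the frame `A` between heights `-a` and `a`. -/
def frameBox (A : Space n ≃ₗᵢ[ℝ] Space n) (p : Space n) (a : ℝ) (β : Set (Horiz n)) :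
    Set (Space n) := {q | frameProj A p q ∈ β ∧ height (A (q - p)) ∈ Ioc (-a) a}

lemma measurableSet_frameBox {a : ℝ} {β : Set (Horiz n)} (hβ : MeasurableSet β) :
    MeasurableSet (frameBox A p a β) :=
  ((continuous_frameProj A p).measurable hβ).inter
    ((continuous_height.comp (A.continuous.comp (continuous_id.sub continuous_const))).measurable
      measurableSet_Ioc)

lemma lintegral_frame {F : Space n → ℝ≥0∞} (hF : Measurable F) :
    ∫⁻ q, F q = ∫⁻ τ : Horiz n, ∫⁻ s : ℝ, F (framePoint A p (τ, s)) := by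
  have hm : Measurable fun t => F (framePoint A p t) :=
    hF.comp (continuous_framePoint A p).measurable
  rw [← (volume_preserving_framePoint A p).lintegral_comp hF, Measure.volume_eq_prod,
    lintegral_prod _ hm.aemeasurable]

lemma WallChart.lintegral_frameBox (h : WallChart R S r p A ε ρ) {a : ℝ} (ha : 0 < a)
    (haρ : 2 * a ≤ ρ) {k : ℕ} (hk : 2 / a ≤ k) {β : Set (Horiz n)} (hβ : MeasurableSet β)
    (hβa : β ⊆ ball 0 a) :
    ∫⁻ q in frameBox A p a β, ENNReal.ofReal (wallFlux r A k q) = volume β := by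
  have hm : Measurable fun q => ENNReal.ofReal (wallFlux r A k q) :=
    (h.continuous_wallFlux k).measurable.ennreal_ofReal
  rw [← lintegral_indicator (measurableSet_frameBox hβ),
    lintegral_frame (A := A) (p := p) (hm.indicator (measurableSet_frameBox hβ)),
    ← lintegral_indicator_one hβ]
  refine lintegral_congr fun τ => ?_
  by_cases hτ : τ ∈ β
  · rw [indicator_of_mem hτ, Pi.one_apply,
      ← h.lintegral_line ha haρ hk (mem_ball_zero_iff.1 (hβa hτ)),
      ← lintegral_indicator measurableSet_Ioc]
    refine lintegral_congr fun s => ?_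
    by_cases hs : s ∈ Ioc (-a) a
    · rw [indicator_of_mem hs, indicator_of_mem]
      exact ⟨by simpa using hτ, by rw [height_framePoint]; exact hs⟩
    · rw [indicator_of_notMem hs, indicator_of_notMem]
      exact fun hc => hs (by have := hc.2; rwa [height_framePoint] at this)
  · rw [indicator_of_notMem hτ]
    refine (lintegral_congr fun s => ?_).trans lintegral_zero
    rw [indicator_of_notMem]
    exact fun hc => hτ (by simpa using hc.1)

/-- In a thin cylinder around a normal line the flux is concentrated near the lateral surface, so
sets of density zero do not contribute. -/
lemma WallChart.tendsto_flux_of_hasZeroDensity (h : WallChart R S r p A ε ρ) {a : ℝ}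
    (haρ : 2 * a ≤ ρ) {y : Space n} (hyS : y ∈ S ∩ ball p ρ)
    (hya : ‖frameProj A p y‖ < a) {E : Set (Space n)} (hE : HasZeroDensity E y) :
    Tendsto (fun k : ℕ => (volume (ball (0 : Horiz n) (1 / (k : ℝ))))⁻¹ *
      ∫⁻ q in E ∩ frameBox A p a (ball (frameProj A p y) (1 / (k : ℝ))),
        ENNReal.ofReal (wallFlux r A k q)) atTop (𝓝 0) := by
  obtain ⟨M, hM, hMle⟩ := exists_deriv_step_le
  set v := volume (ball (0 : Horiz n) 1) with hv
  have hv0 : 0 < v.toReal := ENNReal.toReal_pos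
    (isOpen_ball.measure_pos volume ⟨0, mem_ball_self one_pos⟩).ne'
    measure_ball_lt_top.ne
  refine ENNReal.tendsto_nhds_zero.2 fun δ hδ => ?_
  by_cases hδt : δ = ⊤
  · simp [hδt]
  have hδr : 0 < δ.toReal := ENNReal.toReal_pos hδ.ne' hδt
  set η : ℝ := δ.toReal * v.toReal / (2 * M * 4 ^ (n + 1)) with hη
  have hη0 : 0 < η := by positivity
  have hev := hE η hη0
  have hlim : Tendsto (fun k : ℕ => 4 / (k : ℝ)) atTop (𝓝[>] 0) := by
    refine tendsto_nhdsWithin_iff.2 ⟨tendsto_const_div_atTop_nhds_zero_nat 4, ?_⟩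
    filter_upwards [eventually_gt_atTop 0] with k hk
    have : (0 : ℝ) < k := by exact_mod_cast hk
    exact div_pos four_pos this
  have hsmall : ∀ᶠ k : ℕ in atTop, 1 / (k : ℝ) < a - ‖frameProj A p y‖ :=
    (tendsto_const_div_atTop_nhds_zero_nat 1).eventually (gt_mem_nhds (sub_pos.2 hya))
  filter_upwards [hlim.eventually hev, hsmall, eventually_gt_atTop 0] with k hk hka hk0
  have hk0 : (0 : ℝ) < k := by exact_mod_cast hk0
  set β := ball (frameProj A p y) (1 / (k : ℝ)) with hβ
  have hbound : ∀ q ∈ E ∩ frameBox A p a β, ENNReal.ofReal (wallFlux r A k q)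
      ≤ (ball y (4 / (k : ℝ))).indicator (fun _ => ENNReal.ofReal (2 * M * k)) q := by
    intro q hq
    by_cases h0 : wallFlux r A k q = 0
    · rw [h0, ENNReal.ofReal_zero]; exact zero_le
    obtain ⟨h1, h2⟩ := wallFlux_support h0
    have hπ : ‖frameProj A p q - frameProj A p y‖ < 1 / k := mem_ball_iff_norm.1 hq.2.1
    have hqa : ‖frameProj A p q‖ < a := by
      have := norm_le_norm_add_norm_sub' (frameProj A p q) (frameProj A p y)
      linarith
    have hqρ : q ∈ ball p ρ := by
      rw [← framePoint_frameProj A p q]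
      exact (h.framePoint_bounds haρ (t := (frameProj A p q, height (A (q - p)))) hqa
        (abs_le.2 ⟨hq.2.2.1.le, hq.2.2.2⟩)).1
    have h3 := h.norm_sub_le hqρ hyS.2
    rw [(h.wall_iff y hyS.2).1 hyS.1, sub_zero, abs_of_pos h1] at h3
    have hqy : q ∈ ball y (4 / (k : ℝ)) := by
      rw [mem_ball_iff_norm]
      have h5 : (3 / 4 : ℝ) * ‖q - y‖ ≤ (1 - ε) * ‖q - y‖ :=
        mul_le_mul_of_nonneg_right (by linarith [h.eps_le]) (norm_nonneg _)
      have h6 : (4 : ℝ) / k = 4 * (1 / k) := by ring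
      have h7 : 0 < 1 / (k : ℝ) := by positivity
      rw [h6]
      linarith
    rw [indicator_of_mem hqy]
    refine ENNReal.ofReal_le_ofReal ?_
    have h8 := h.fderiv_frame_pos hqρ
    rw [wallFlux]
    calc _ ≤ k * M * 2 := by
          refine mul_le_mul (mul_le_mul_of_nonneg_left (hMle _) hk0.le) ?_ ?_ (by positivity)
          · linarith [h8.2, h.eps_le]
          · linarith [h8.1, h.eps_le]
      _ = _ := by ring
  have hint : ∫⁻ q in E ∩ frameBox A p a β, ENNReal.ofReal (wallFlux r A k q)
      ≤ ENNReal.ofReal (2 * M * k) * ENNReal.ofReal (η * (4 / k) ^ (n + 1)) := by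
    calc _ ≤ ∫⁻ q in E ∩ frameBox A p a β,
          (ball y (4 / (k : ℝ))).indicator (fun _ => ENNReal.ofReal (2 * M * k)) q :=
          setLIntegral_mono (measurable_const.indicator measurableSet_ball) hbound
      _ ≤ ∫⁻ q in E, (ball y (4 / (k : ℝ))).indicator
            (fun _ => ENNReal.ofReal (2 * M * k)) q := lintegral_mono_set inter_subset_left
      _ = ENNReal.ofReal (2 * M * k) * volume (E ∩ ball y (4 / (k : ℝ))) := by
          rw [lintegral_indicator_const measurableSet_ball, Measure.restrict_apply
            measurableSet_ball, inter_comm]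
      _ ≤ _ := by
          gcongr
          rw [← ENNReal.ofReal_toReal (((measure_mono inter_subset_right).trans_lt
            measure_ball_lt_top).ne : volume (E ∩ ball y (4 / (k : ℝ))) ≠ ⊤)]
          exact ENNReal.ofReal_le_ofReal hk
  have hV : volume (ball (0 : Horiz n) (1 / (k : ℝ)))
      = ENNReal.ofReal ((1 / (k : ℝ)) ^ n * v.toReal) := by
    rw [Measure.addHaar_ball_of_pos _ _ (by positivity), finrank_euclideanSpace_fin,
      ENNReal.ofReal_mul (by positivity), ENNReal.ofReal_toReal measure_ball_lt_top.ne]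
  rw [hV, mul_comm, ← div_eq_mul_inv]
  refine ENNReal.div_le_of_le_mul (hint.trans ?_)
  rw [← ENNReal.ofReal_mul (by positivity), ← ENNReal.ofReal_toReal hδt,
    ← ENNReal.ofReal_mul hδr.le]
  refine ENNReal.ofReal_le_ofReal (le_of_eq ?_)
  have e1 : (4 / (k : ℝ)) ^ (n + 1) = 4 ^ (n + 1) * ((1 / (k : ℝ)) ^ n * (1 / (k : ℝ))) := by
    rw [← pow_succ, ← mul_pow]; congr 1; ring
  rw [hη, e1]
  generalize (1 / (k : ℝ)) ^ n = x
  field_simp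

/-- Every point of the projected chart lies under a point of the lateral surface. -/
lemma WallChart.exists_wall_point (h : WallChart R S r p A ε ρ) {a : ℝ}
    (haρ : 2 * a ≤ ρ) {τ : Horiz n} (hτ : ‖τ‖ < a) :
    ∃ y ∈ S ∩ ball p ρ, frameProj A p y = τ := by
  have ha : 0 < a := (norm_nonneg _).trans_lt hτ
  have b1 := abs_le.1 (h.framePoint_bounds haρ (t := (τ, a)) hτ (abs_of_pos ha).le).2
  have b2 := abs_le.1 (h.framePoint_bounds haρ (t := (τ, -a)) hτ
    (by rw [abs_neg]; exact (abs_of_pos ha).le)).2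
  simp only at b1 b2
  have hc : Continuous fun s => r (framePoint A p (τ, s)) :=
    h.smooth.continuous.comp ((continuous_framePoint A p).comp (by fun_prop))
  obtain ⟨s, hs, hs0⟩ := intermediate_value_Icc (by linarith : -a ≤ a) hc.continuousOn
    (show (0 : ℝ) ∈ Icc _ _ from ⟨by linarith, by linarith⟩)
  have hb := (h.framePoint_bounds haρ (t := (τ, s)) hτ (abs_le.2 ⟨hs.1, hs.2⟩)).1
  exact ⟨_, ⟨(h.wall_iff _ hb).2 hs0, hb⟩, by simp⟩

/-- The average of `F` over the part of `D` in the cylinder of radius `δ` around the line over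
`τ`. -/
def cylAverage (π : Space n → Horiz n) (F : Space n → ℝ≥0∞) (D : Set (Space n)) (δ : ℝ)
    (τ : Horiz n) : ℝ≥0∞ :=
  (volume (ball (0 : Horiz n) δ))⁻¹ * ∫⁻ q in D ∩ π ⁻¹' (ball τ δ), F q

section CylAverage

variable {π : Space n → Horiz n} {F : Space n → ℝ≥0∞} {D : Set (Space n)} {δ : ℝ}

lemma measurableSet_cyl (hπ : Measurable π) :
    MeasurableSet {z : Horiz n × Space n | π z.2 ∈ ball z.1 δ} := by
  have : {z : Horiz n × Space n | π z.2 ∈ ball z.1 δ}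
      = {z : Horiz n × Space n | dist (π z.2) z.1 < δ} := rfl
  rw [this]
  exact measurableSet_lt ((hπ.comp measurable_snd).dist measurable_fst) measurable_const

lemma lintegral_cyl (hπ : Measurable π) (τ : Horiz n) :
    ∫⁻ q in D ∩ π ⁻¹' (ball τ δ), F q = ∫⁻ q in D,
      {z : Horiz n × Space n | π z.2 ∈ ball z.1 δ}.indicator (fun z => F z.2) (τ, q) := by
  rw [inter_comm, ← Measure.restrict_restrict (hπ measurableSet_ball),
    ← lintegral_indicator (hπ measurableSet_ball)]
  rfl

lemma measurable_cylAverage (hπ : Measurable π) (hF : Measurable F) :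
    Measurable (cylAverage π F D δ) := by
  refine Measurable.const_mul ?_ _
  simp_rw [lintegral_cyl hπ]
  exact ((hF.comp measurable_snd).indicator (measurableSet_cyl hπ)).lintegral_prod_right'

/-- Averaging over thin cylinders does not change the integral. -/
lemma lintegral_cylAverage (hπ : Measurable π) (hF : Measurable F) (hδ : 0 < δ) :
    ∫⁻ τ, cylAverage π F D δ τ = ∫⁻ q in D, F q := by
  set V := volume (ball (0 : Horiz n) δ) with hV
  have hV0 : V ≠ 0 := (isOpen_ball.measure_pos volume ⟨0, mem_ball_self hδ⟩).ne'
  have hVt : V ≠ ⊤ := measure_ball_lt_top.ne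
  set K : Horiz n → Space n → ℝ≥0∞ := fun τ q =>
    {z : Horiz n × Space n | π z.2 ∈ ball z.1 δ}.indicator (fun z => F z.2) (τ, q) with hK
  have hKm : Measurable (Function.uncurry K) :=
    (hF.comp measurable_snd).indicator (measurableSet_cyl hπ)
  have e2 : ∀ q, ∫⁻ τ, K τ q = V * F q := by
    intro q
    have : (fun τ => K τ q) = (ball (π q) δ).indicator fun _ => F q := by
      ext τ
      simp only [hK, indicator, mem_ofPred_eq, mem_ball, dist_comm]
    rw [this, lintegral_indicator_const measurableSet_ball, Measure.addHaar_ball_center, mul_comm]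
  simp_rw [cylAverage, lintegral_cyl hπ]
  rw [lintegral_const_mul' _ _ (ENNReal.inv_ne_top.2 hV0)]
  change V⁻¹ * ∫⁻ τ, ∫⁻ q in D, K τ q = _
  rw [lintegral_lintegral_swap hKm.aemeasurable]
  simp_rw [e2]
  rw [lintegral_const_mul' _ _ hVt, ← mul_assoc, ENNReal.inv_mul_cancel hV0 hVt, one_mul]

end CylAverage

variable {a : ℝ} {D W : Set (Space n)}

lemma norm_frameProj_le (q : Space n) : ‖frameProj A p q‖ ≤ ‖q - p‖ :=
  (norm_horiz_le _).trans (A.norm_map _).le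

lemma inter_preimage_ball_eq (hDa : ∀ q ∈ D, ‖q - p‖ < a / 2) (β : Set (Horiz n)) :
    D ∩ frameProj A p ⁻¹' β = D ∩ frameBox A p a β := by
  ext q
  refine ⟨fun hq => ⟨hq.1, hq.2, ?_⟩, fun hq => ⟨hq.1, hq.2.1⟩⟩
  have h1 := (abs_height_le (A (q - p))).trans_lt ((A.norm_map (q - p)).trans_lt (hDa q hq.1))
  have h2 := abs_lt.1 h1
  constructor <;> linarith [h2.1, h2.2]

lemma cylAverage_eq_zero {F : Space n → ℝ≥0∞} (hDa : ∀ q ∈ D, ‖q - p‖ < a / 2) {δ : ℝ}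
    (hδ : δ < a / 4) {τ : Horiz n} (hτ : 3 / 4 * a ≤ ‖τ‖) :
    cylAverage (frameProj A p) F D δ τ = 0 := by
  have : D ∩ frameProj A p ⁻¹' (ball τ δ) = ∅ := by
    ext q
    simp only [mem_inter_iff, mem_preimage, mem_empty_iff_false, iff_false, not_and]
    intro hq hc
    have h1 := (norm_frameProj_le (A := A) (p := p) q).trans_lt (hDa q hq)
    have h2 : ‖frameProj A p q - τ‖ < δ := mem_ball_iff_norm.1 hc
    have h3 := norm_le_norm_add_norm_sub (frameProj A p q) τ
    linarith
  simp [cylAverage, this]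

lemma WallChart.average_frameBox (h : WallChart R S r p A ε ρ) (ha : 0 < a) (haρ : 2 * a ≤ ρ)
    {k : ℕ} (hk0 : 0 < k) (hk1 : 1 / (k : ℝ) < a / 4) (hk2 : 2 / a ≤ (k : ℝ)) {τ : Horiz n}
    (hτ : ‖τ‖ < 3 / 4 * a) :
    (volume (ball (0 : Horiz n) (1 / (k : ℝ))))⁻¹ *
      ∫⁻ q in frameBox A p a (ball τ (1 / (k : ℝ))), ENNReal.ofReal (wallFlux r A k q)
        = 1 := by
  have hk : (0 : ℝ) < k := by exact_mod_cast hk0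
  rw [h.lintegral_frameBox ha haρ hk2 measurableSet_ball, Measure.addHaar_ball_center volume τ,
    ENNReal.inv_mul_cancel (isOpen_ball.measure_pos volume
      ⟨0, mem_ball_self (by positivity)⟩).ne' measure_ball_lt_top.ne]
  intro x hx
  have h1 : ‖x - τ‖ < 1 / k := mem_ball_iff_norm.1 hx
  rw [mem_ball_zero_iff]
  linarith [norm_le_norm_add_norm_sub' x τ]

lemma WallChart.cylAverage_le (h : WallChart R S r p A ε ρ) (ha : 0 < a) (haρ : 2 * a ≤ ρ)
    (hDa : ∀ q ∈ D, ‖q - p‖ < a / 2) {k : ℕ} (hk0 : 0 < k) (hk1 : 1 / (k : ℝ) < a / 4)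
    (hk2 : 2 / a ≤ (k : ℝ)) (τ : Horiz n) :
    cylAverage (frameProj A p) (fun q => ENNReal.ofReal (wallFlux r A k q)) D (1 / (k : ℝ)) τ
      ≤ (ball (0 : Horiz n) a).indicator 1 τ := by
  by_cases hτ : ‖τ‖ < 3 / 4 * a
  · rw [indicator_of_mem (mem_ball_zero_iff.2 (by linarith)), Pi.one_apply,
      ← h.average_frameBox ha haρ hk0 hk1 hk2 hτ, cylAverage, inter_preimage_ball_eq hDa]
    gcongr
    exact inter_subset_right
  · rw [cylAverage_eq_zero hDa hk1 (not_lt.1 hτ)]; exact zero_le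

/-- The flux comes from inside the region only. -/
lemma WallChart.lintegral_frameBox_sdiff_region (h : WallChart R S r p A ε ρ) (haρ : 2 * a ≤ ρ)
    {k : ℕ} {β : Set (Horiz n)} (hβ : MeasurableSet β) (hβa : β ⊆ ball 0 a) :
    ∫⁻ q in frameBox A p a β \ region R, ENNReal.ofReal (wallFlux r A k q) = 0 := by
  rw [← lintegral_zero (μ := volume.restrict (frameBox A p a β \ region R))]
  refine setLIntegral_congr_fun ((measurableSet_frameBox hβ).diff (measurableSet_region R))
    fun q hq => ?_
  by_contra hne
  have hne' : wallFlux r A k q ≠ 0 := fun h0 => hne (by simp [h0])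
  have hqρ : q ∈ ball p ρ := by
    rw [← framePoint_frameProj A p q]
    exact (h.framePoint_bounds haρ (t := (frameProj A p q, height (A (q - p))))
      (mem_ball_zero_iff.1 (hβa hq.1.1)) (abs_le.2 ⟨hq.1.2.1.le, hq.1.2.2⟩)).1
  exact hq.2 ((h.region_iff q hqρ).2 (wallFlux_support hne').1)

lemma WallChart.tendsto_cylAverage_one (h : WallChart R S r p A ε ρ) (ha : 0 < a)
    (haρ : 2 * a ≤ ρ) (hD : MeasurableSet D) (hDR : D ⊆ region R)
    (hDa : ∀ q ∈ D, ‖q - p‖ < a / 2) {y : Space n} (hy : y ∈ S ∩ ball p ρ)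
    (hya : ‖frameProj A p y‖ < 3 / 4 * a) (hz : HasZeroDensity (region R \ D) y) :
    Tendsto (fun k : ℕ => cylAverage (frameProj A p)
      (fun q => ENNReal.ofReal (wallFlux r A k q)) D (1 / (k : ℝ)) (frameProj A p y))
      atTop (𝓝 1) := by
  have herr := h.tendsto_flux_of_hasZeroDensity haρ hy (by linarith) hz
  have hsub := ENNReal.Tendsto.sub (tendsto_const_nhds (x := (1 : ℝ≥0∞))) herr (by simp)
  rw [tsub_zero] at hsub
  have hsmall : ∀ᶠ k : ℕ in atTop, 1 / (k : ℝ) < a / 4 :=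
    (tendsto_const_div_atTop_nhds_zero_nat 1).eventually (gt_mem_nhds (by positivity))
  have hbig : ∀ᶠ k : ℕ in atTop, 2 / a ≤ (k : ℝ) :=
    tendsto_natCast_atTop_atTop.eventually_ge_atTop _
  refine hsub.congr' ?_
  filter_upwards [hsmall, hbig, eventually_gt_atTop 0,
    (ENNReal.tendsto_nhds_zero.1 herr) 1 one_pos] with k hk1 hk2 hk0 hle
  refine ENNReal.sub_eq_of_eq_add (hle.trans_lt ENNReal.one_lt_top).ne ?_
  rw [← h.average_frameBox ha haρ hk0 hk1 hk2 hya, cylAverage, inter_preimage_ball_eq hDa,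
    ← mul_add]
  congr 1
  set Q := frameBox A p a (ball (frameProj A p y) (1 / (k : ℝ))) with hQ
  have hQm : MeasurableSet Q := measurableSet_frameBox measurableSet_ball
  rw [← lintegral_inter_add_sdiff _ Q hD, inter_comm Q D]
  congr 1
  have hsplit : Q \ D = ((region R \ D) ∩ Q) ∪ (Q \ region R) := by
    ext q
    have := @hDR q
    simp only [Set.mem_sdiff, mem_union, mem_inter_iff]
    tauto
  rw [hsplit, lintegral_union (hQm.diff (measurableSet_region R))
    (disjoint_left.2 fun q hq hq' => hq'.2 hq.1.1), h.lintegral_frameBox_sdiff_region haρ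
    measurableSet_ball, add_zero]
  intro x hx
  have h1 : ‖x - frameProj A p y‖ < 1 / k := mem_ball_iff_norm.1 hx
  rw [mem_ball_zero_iff]
  linarith [norm_le_norm_add_norm_sub' x (frameProj A p y)]

/-- The flux of the cutoffs through the part of the lateral surface wetted by `D` converges to the
area of the projection of that part: averages of the flux over thin cylinders converge to `1` over
points of density one and to `0` over points of density zero. -/
lemma WallChart.tendsto_lintegral_wallFlux (h : WallChart R S r p A ε ρ) (ha : 0 < a)
    (haρ : 2 * a ≤ ρ) (hD : MeasurableSet D)
    (hDR : D ⊆ region R) (hDa : ∀ q ∈ D, ‖q - p‖ < a / 2)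
    (hWS : W ⊆ S ∩ ball p ρ) (hWa : ∀ q ∈ W, ‖q - p‖ ≤ a / 2)
    (hae : ∀ᵐ y ∂(μHE[n] : Measure (Space n)).restrict (S ∩ ball p ρ),
      (y ∈ W ∧ HasZeroDensity (region R \ D) y) ∨ (y ∉ W ∧ HasZeroDensity D y)) :
    Tendsto (fun k : ℕ => ∫⁻ q in D, ENNReal.ofReal (wallFlux r A k q)) atTop
      (𝓝 (volume (frameProj A p '' W))) := by
  have hm : ∀ k, Measurable fun q => ENNReal.ofReal (wallFlux r A k q) := fun k =>
    (h.continuous_wallFlux k).measurable.ennreal_ofReal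
  have hπm := (continuous_frameProj A p).measurable
  set H : ℕ → Horiz n → ℝ≥0∞ := fun k => cylAverage (frameProj A p)
    (fun q => ENNReal.ofReal (wallFlux r A k q)) D (1 / (k : ℝ)) with hH
  have hHmeas : ∀ k, Measurable (H k) := fun k => measurable_cylAverage hπm (hm k)
  have hsmall : ∀ᶠ k : ℕ in atTop, 1 / (k : ℝ) < a / 4 :=
    (tendsto_const_div_atTop_nhds_zero_nat 1).eventually (gt_mem_nhds (by positivity))
  have hbig : ∀ᶠ k : ℕ in atTop, 2 / a ≤ (k : ℝ) :=
    tendsto_natCast_atTop_atTop.eventually_ge_atTop _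
  have hpt : ∀ᵐ τ : Horiz n, Tendsto (fun k => H k τ) atTop
      (𝓝 ((frameProj A p '' W).indicator 1 τ)) := by
    rw [ae_restrict_iff' h.isClosed_relative, ae_iff] at hae
    have hnull := le_antisymm ((volume_image_frameProj_le A p _).trans hae.le) zero_le
    have hnull' : ∀ᵐ τ : Horiz n, τ ∉ frameProj A p '' {y | ¬(y ∈ S ∩ ball p ρ →
        (y ∈ W ∧ HasZeroDensity (region R \ D) y) ∨ (y ∉ W ∧ HasZeroDensity D y))} := by
      rw [ae_iff]
      simpa only [not_not, ofPred_mem_eq] using hnull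
    filter_upwards [hnull'] with τ hτ
    by_cases hτa : ‖τ‖ < 3 / 4 * a
    · obtain ⟨y, hy, rfl⟩ := h.exists_wall_point haρ (by linarith : ‖τ‖ < a)
      have hy2 : (y ∈ W ∧ HasZeroDensity (region R \ D) y) ∨ (y ∉ W ∧ HasZeroDensity D y) := by
        by_contra hc
        exact hτ ⟨y, fun h' => hc (h' hy), rfl⟩
      rcases hy2 with ⟨hyW, hz⟩ | ⟨hyW, hz⟩
      · rw [indicator_of_mem (mem_image_of_mem _ hyW), Pi.one_apply]
        exact h.tendsto_cylAverage_one ha haρ hD hDR hDa hy hτa hz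
      · rw [indicator_of_notMem]
        · refine (h.tendsto_flux_of_hasZeroDensity haρ hy (by linarith) hz).congr fun k => ?_
          simp only [hH]
          rw [cylAverage, inter_preimage_ball_eq hDa]
        · rintro ⟨y', hy', he⟩
          exact hyW (h.injOn (hWS hy') hy he ▸ hy')
    · rw [indicator_of_notMem]
      · refine tendsto_const_nhds.congr' ?_
        filter_upwards [hsmall] with k hk
        exact (cylAverage_eq_zero hDa hk (not_lt.1 hτa)).symm
      · rintro ⟨y', hy', rfl⟩
        have := norm_frameProj_le (A := A) (p := p) y'
        have := hWa y' hy'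
        exact hτa (by linarith)
  have hlim := tendsto_lintegral_filter_of_dominated_convergence (μ := volume)
    ((ball (0 : Horiz n) a).indicator 1) (.of_forall fun k => hHmeas k)
    (by
      filter_upwards [hsmall, hbig, eventually_gt_atTop 0] with k hk1 hk2 hk0
      exact .of_forall fun τ => h.cylAverage_le ha haρ hDa hk0 hk1 hk2 τ)
    (by rw [lintegral_indicator_one measurableSet_ball]; exact measure_ball_lt_top.ne) hpt
  have hWn : NullMeasurableSet (frameProj A p '' W) := by
    have h1 : AEMeasurable ((frameProj A p '' W).indicator (1 : Horiz n → ℝ≥0∞)) :=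
      aemeasurable_of_tendsto_metrizable_ae' (fun k => (hHmeas k).aemeasurable) hpt
    have h2 := h1.nullMeasurable (measurableSet_singleton (1 : ℝ≥0∞))
    have e : frameProj A p '' W
        = (frameProj A p '' W).indicator (1 : Horiz n → ℝ≥0∞) ⁻¹' {1} := by
      ext τ
      by_cases hτ : τ ∈ frameProj A p '' W <;> simp [hτ]
    rwa [e]
  rw [lintegral_indicator_one₀ hWn] at hlim
  refine hlim.congr' ?_
  filter_upwards [eventually_gt_atTop 0] with k hk
  have hk' : (0 : ℝ) < k := by exact_mod_cast hk
  exact lintegral_cylAverage hπm (hm k) (by positivity)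

end Flux

/-! ### Sets of finite perimeter as limits of smooth functions -/

section BVLimit

variable {n : ℕ}

/-- The smooth functions `w j` converge to the indicator of `D`, with locally bounded variation. -/
structure IsBVLimit (w : ℕ → Space n → ℝ) (D : Set (Space n)) : Prop where
  contDiff : ∀ j, ContDiff ℝ 1 (w j)
  mem_Icc : ∀ j x, w j x ∈ Icc (0 : ℝ) 1
  tendsto : ∀ x, Tendsto (fun j => w j x) atTop (𝓝 (D.indicator 1 x))
  bounded : ∀ η : Space n → ℝ, ContDiff ℝ 1 η → HasCompactSupport η → (∀ x, 0 ≤ η x) →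
    ∃ C, ∀ᶠ j in atTop, ∫ x, η x * ‖fderiv ℝ (w j) x‖ ≤ C

variable {w w' : ℕ → Space n → ℝ} {D D' : Set (Space n)}

lemma integral_mul_divergence {f : Space n → ℝ} (hf : ContDiff ℝ 1 f) {φ : Space n → Space n}
    (hφ : ContDiff ℝ 1 φ) (hc : HasCompactSupport φ) :
    ∫ x, f x * divergence φ x = -∫ x, fderiv ℝ f x (φ x) := by
  have h0 := integral_divergence_eq_zero (hf.smul hφ) (hc.smul_left (f := f))
  have e : ∀ x, divergence (fun y => f y • φ y) x = f x * divergence φ x + fderiv ℝ f x (φ x) :=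
    fun x => divergence_smul (hf.differentiable one_ne_zero x) (hφ.differentiable one_ne_zero x)
  have i1 : Integrable fun x => f x * divergence φ x :=
    (hf.continuous.mul (continuous_divergence hφ)).integrable_of_hasCompactSupport
      (hasCompactSupport_divergence hc).mul_left
  have i2 : Integrable fun x => fderiv ℝ f x (φ x) := by
    refine ((hf.continuous_fderiv one_ne_zero).clm_apply
      hφ.continuous).integrable_of_hasCompactSupport (hc.mono fun x hx h0 => hx (by simp [h0]))
  have h1 : ∫ x, (f x * divergence φ x + fderiv ℝ f x (φ x)) = 0 := by
    rw [← h0]; exact integral_congr_ae (.of_forall fun x => (e x).symm)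
  rw [integral_add i1 i2] at h1
  linarith

lemma IsBVLimit.measurableSet (h : IsBVLimit w D) : MeasurableSet D := by
  have h1 : Measurable (D.indicator (1 : Space n → ℝ)) :=
    measurable_of_tendsto_metrizable (fun j => (h.contDiff j).continuous.measurable)
      (tendsto_pi_nhds.2 h.tendsto)
  have e : D = D.indicator (1 : Space n → ℝ) ⁻¹' {1} := by
    ext x
    by_cases hx : x ∈ D <;> simp [hx]
  rw [e]
  exact h1 (measurableSet_singleton 1)

lemma IsBVLimit.locallyCaccioppoli (h : IsBVLimit w D) : LocallyCaccioppoli D univ := by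
  intro V _ hVc _
  obtain ⟨η, hη, hηc, -, h01, hη1⟩ := exists_cutoff hVc isOpen_univ (subset_univ _)
  have hη' : ContDiff ℝ 1 η := hη.of_le (by norm_cast)
  obtain ⟨C, hC⟩ := h.bounded η hη' hηc fun x => (h01 x).1
  refine lt_of_le_of_lt (perimeter_le (B := C) fun φ hφ h1 => ?_) ENNReal.ofReal_lt_top
  have hle : ∀ x, ‖φ x‖ ≤ η x := fun x => by
    by_cases hx : x ∈ tsupport φ
    · rw [hη1.self_of_nhdsSet x (subset_closure (hφ.3 hx))]; exact h1 x
    · rw [image_eq_zero_of_notMem_tsupport hx, norm_zero]; exact (h01 x).1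
  have hlim : Tendsto (fun j => ∫ x, w j x * divergence φ x) atTop
      (𝓝 (∫ x, D.indicator 1 x * divergence φ x)) := by
    refine tendsto_integral_of_dominated_convergence (fun x => ‖divergence φ x‖)
      (fun j => ((h.contDiff j).continuous.mul
        (continuous_divergence hφ.1)).aestronglyMeasurable) hφ.integrable_div.norm
      (fun j => .of_forall fun x => ?_) (.of_forall fun x =>
        (h.tendsto x).mul_const _)
    rw [norm_mul, Real.norm_of_nonneg (h.mem_Icc j x).1]
    exact mul_le_of_le_one_left (norm_nonneg _) (h.mem_Icc j x).2
  have e : ∫ x in D, divergence φ x = ∫ x, D.indicator 1 x * divergence φ x := by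
    rw [← integral_indicator h.measurableSet]
    refine integral_congr_ae (.of_forall fun x => ?_)
    by_cases hx : x ∈ D <;> simp [hx]
  rw [e]
  refine le_of_tendsto hlim (hC.mono fun j hj => ?_)
  rw [integral_mul_divergence (h.contDiff j) hφ.1 hφ.2, ← integral_neg]
  refine le_trans (integral_mono ?_ ?_ fun x => ?_) hj
  · exact (((h.contDiff j).continuous_fderiv one_ne_zero).clm_apply
      hφ.1.continuous).neg.integrable_of_hasCompactSupport
      (hφ.2.mono fun x hx h0 => hx (by simp [h0]))
  · exact (hη.continuous.mul ((h.contDiff j).continuous_fderiv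
      one_ne_zero).norm).integrable_of_hasCompactSupport hηc.mul_right
  · calc -(fderiv ℝ (w j) x (φ x)) ≤ ‖fderiv ℝ (w j) x‖ * ‖φ x‖ :=
          (neg_le_abs _).trans ((fderiv ℝ (w j) x).le_opNorm _)
      _ ≤ _ := by
          rw [mul_comm]; exact mul_le_mul_of_nonneg_right (hle x) (norm_nonneg _)

lemma IsBVLimit.inter (h : IsBVLimit w D) (h' : IsBVLimit w' D') :
    IsBVLimit (fun j x => w j x * w' j x) (D ∩ D') := by
  refine ⟨fun j => (h.contDiff j).mul (h'.contDiff j), fun j x =>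
    ⟨mul_nonneg (h.mem_Icc j x).1 (h'.mem_Icc j x).1,
      mul_le_one₀ (h.mem_Icc j x).2 (h'.mem_Icc j x).1 (h'.mem_Icc j x).2⟩, fun x => ?_, ?_⟩
  · have := (h.tendsto x).mul (h'.tendsto x)
    convert this using 2
    by_cases h1 : x ∈ D <;> by_cases h2 : x ∈ D' <;> simp [h1, h2]
  · intro η hη hηc hη0
    obtain ⟨C, hC⟩ := h.bounded η hη hηc hη0
    obtain ⟨C', hC'⟩ := h'.bounded η hη hηc hη0
    refine ⟨C + C', ?_⟩
    filter_upwards [hC, hC'] with j h1 h2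
    have int : ∀ f : Space n → ℝ, ContDiff ℝ 1 f → Integrable fun x => η x * ‖fderiv ℝ f x‖ :=
      fun f hf => (hη.continuous.mul (hf.continuous_fderiv
        one_ne_zero).norm).integrable_of_hasCompactSupport hηc.mul_right
    refine le_trans ?_ (add_le_add h1 h2)
    rw [← integral_add (int _ (h.contDiff j)) (int _ (h'.contDiff j))]
    refine integral_mono (int _ ((h.contDiff j).mul (h'.contDiff j)))
      ((int _ (h.contDiff j)).add (int _ (h'.contDiff j))) fun x => ?_
    simp only
    rw [← mul_add]
    refine mul_le_mul_of_nonneg_left ?_ (hη0 x)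
    rw [fderiv_fun_mul ((h.contDiff j).differentiable one_ne_zero x)
      ((h'.contDiff j).differentiable one_ne_zero x)]
    refine (norm_add_le _ _).trans ?_
    rw [norm_smul, norm_smul, Real.norm_of_nonneg (h.mem_Icc j x).1,
      Real.norm_of_nonneg (h'.mem_Icc j x).1, add_comm]
    exact add_le_add (mul_le_of_le_one_left (norm_nonneg _) (h'.mem_Icc j x).2)
      (mul_le_of_le_one_left (norm_nonneg _) (h.mem_Icc j x).2)

lemma IsBVLimit.compl (h : IsBVLimit w D) : IsBVLimit (fun j x => 1 - w j x) Dᶜ := by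
  refine ⟨fun j => contDiff_const.sub (h.contDiff j), fun j x =>
    ⟨by linarith [(h.mem_Icc j x).2], by linarith [(h.mem_Icc j x).1]⟩, fun x => ?_, ?_⟩
  · convert (h.tendsto x).const_sub 1 using 2
    by_cases hx : x ∈ D <;> simp [hx]
  · intro η hη hηc hη0
    obtain ⟨C, hC⟩ := h.bounded η hη hηc hη0
    refine ⟨C, hC.mono fun j hj => ?_⟩
    simpa [fderiv_const_sub] using hj

lemma tendsto_step_mul (r : ℝ) :
    Tendsto (fun j : ℕ => step (j * r)) atTop (𝓝 (if 0 < r then 1 else 0)) := by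
  split_ifs with hr
  · refine tendsto_const_nhds.congr' ?_
    filter_upwards [(tendsto_mul_atTop hr).eventually_ge_atTop 1] with j hj
    exact (step_of_ge hj).symm
  · refine tendsto_const_nhds.congr fun j => (step_of_le ?_).symm
    have := mul_nonpos_of_nonneg_of_nonpos (α := ℝ) j.cast_nonneg (not_lt.1 hr)
    linarith

lemma fderiv_step_mul {r : Space n → ℝ} (hr : ContDiff ℝ 1 r) (j : ℕ) (x : Space n) :
    fderiv ℝ (fun x => step (j * r x)) x = (j * deriv step (j * r x)) • fderiv ℝ r x := by
  have h1 := ((hr.differentiable one_ne_zero x).hasFDerivAt.const_mul (j : ℝ))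
  have h2 := ((contDiff_step.differentiable (by simp) (j * r x)).hasDerivAt).comp_hasFDerivAt x h1
  have h3 : HasFDerivAt (fun x => step (j * r x)) _ x := h2
  rw [h3.fderiv, smul_smul, mul_comm]

/-- Superlevel sets of functions with a transversal field are of locally finite perimeter. -/
lemma isBVLimit_superlevel {r : Space n → ℝ} (hr : ContDiff ℝ 1 r) {X : Space n → Space n}
    (hX : ContDiff ℝ 1 X) (h : ∀ᶠ j : ℕ in atTop, ∀ x, 0 < j * r x → j * r x ≤ 1 →
      ‖fderiv ℝ r x‖ ≤ fderiv ℝ r x (X x)) :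
    IsBVLimit (fun j x => step (j * r x)) {x | 0 < r x} := by
  have hw : ∀ j : ℕ, ContDiff ℝ 1 fun x => step (j * r x) := fun j =>
    (contDiff_step.of_le (by norm_cast)).comp (contDiff_const.mul hr)
  refine ⟨hw, fun j x => step_mem_Icc _, fun x => ?_, fun η hη hηc hη0 => ?_⟩
  · convert tendsto_step_mul (r x) using 2
    simp [indicator]
  · have hηX : ContDiff ℝ 1 fun y => η y • X y := hη.smul hX
    have hηXc : HasCompactSupport fun y => η y • X y := hηc.smul_right
    refine ⟨∫ x, ‖divergence (fun y => η y • X y) x‖, h.mono fun j hj => ?_⟩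
    have hpt : ∀ x, ‖fderiv ℝ (fun x => step (j * r x)) x‖
        ≤ fderiv ℝ (fun x => step (j * r x)) x (X x) := by
      intro x
      rw [fderiv_step_mul hr, norm_smul, smul_apply, smul_eq_mul]
      by_cases h0 : deriv step (j * r x) = 0
      · simp [h0]
      have hst : 1 / 2 ≤ j * r x ∧ j * r x ≤ 1 := by
        by_contra! hc
        refine h0 (deriv_step_eq_zero ?_)
        by_cases h' : j * r x < 1 / 2
        · exact Or.inl h'
        · exact Or.inr (hc (not_lt.1 h'))
      have hnn : 0 ≤ (j : ℝ) * deriv step (j * r x) :=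
        mul_nonneg j.cast_nonneg (deriv_step_nonneg _)
      rw [Real.norm_of_nonneg hnn]
      exact mul_le_mul_of_nonneg_left (hj x (by linarith [hst.1]) hst.2) hnn
    calc ∫ x, η x * ‖fderiv ℝ (fun x => step (j * r x)) x‖
        ≤ ∫ x, fderiv ℝ (fun x => step (j * r x)) x (η x • X x) := by
          refine integral_mono ?_ ?_ fun x => ?_
          · exact (hη.continuous.mul ((hw j).continuous_fderiv
              one_ne_zero).norm).integrable_of_hasCompactSupport hηc.mul_right
          · exact (((hw j).continuous_fderiv one_ne_zero).clm_apply
              hηX.continuous).integrable_of_hasCompactSupport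
              (hηXc.mono fun x hx h0 => hx (by simp only [h0, map_zero]))
          · simp only [map_smul, smul_eq_mul]
            exact mul_le_mul_of_nonneg_left (hpt x) (hη0 x)
      _ = ∫ x, -(step (j * r x) * divergence (fun y => η y • X y) x) := by
          rw [integral_neg, integral_mul_divergence (hw j) hηX hηXc, neg_neg]
      _ ≤ ∫ x, ‖divergence (fun y => η y • X y) x‖ := by
          refine integral_mono ?_ (integrable_divergence hηX hηXc).norm fun x => ?_
          · exact (((hw j).continuous.mul
              (continuous_divergence hηX)).neg).integrable_of_hasCompactSupport
              (HasCompactSupport.neg (hasCompactSupport_divergence hηXc).mul_left)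
          · refine (neg_le_abs _).trans ?_
            rw [abs_mul, abs_of_nonneg (step_mem_Icc _).1]
            exact mul_le_of_le_one_left (abs_nonneg _) (step_mem_Icc _).2

lemma norm_fderiv_plateFun_le (q : Space n) : ‖fderiv ℝ plateFun q‖ ≤ ‖horiz q‖ :=
  ContinuousLinearMap.opNorm_le_bound _ (norm_nonneg _) fun v => by
    rw [fderiv_plateFun]
    exact (norm_inner_le_norm _ _).trans
      (mul_le_mul_of_nonneg_left (norm_horiz_le v) (norm_nonneg _))

lemma norm_fderiv_containerFun_le {R : EReal} (hR : 1 < R) (hT : R ≠ ⊤) (q : Space n) :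
    ‖fderiv ℝ (containerFun R) q‖ ≤ ‖horiz q‖ / R.toReal := by
  have h1 := toReal_gt_one hR hT
  refine ContinuousLinearMap.opNorm_le_bound _ (by positivity) fun v => ?_
  rw [fderiv_containerFun hT, norm_neg, norm_div, Real.norm_of_nonneg (by linarith : 0 ≤ R.toReal),
    div_mul_eq_mul_div]
  gcongr
  exact (norm_inner_le_norm _ _).trans
    (mul_le_mul_of_nonneg_left (norm_horiz_le v) (norm_nonneg _))

lemma contDiff_horizField (c : ℝ) :
    ContDiff ℝ 1 fun q : Space n => c • (q - height q • ez) := by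
  have h : ContDiff ℝ 1 fun q : Space n => q - height q • ez :=
    contDiff_id.sub ((contDiff_height (n := n)).smul (contDiff_const (c := (ez : Space n))))
  exact h.const_smul c

/-- The region is of locally finite perimeter. -/
lemma exists_isBVLimit_region {R : EReal} (hR : 1 < R) :
    ∃ w, IsBVLimit w (region R : Set (Space n)) := by
  have h1 : IsBVLimit (fun j x => step (j * plateFun x)) {x : Space n | 0 < plateFun x} := by
    refine isBVLimit_superlevel contDiff_plateFun (contDiff_horizField 1)
      (.of_forall fun j x h0 _ => ?_)
    have hx : 1 < ‖horiz x‖ := (plateFun_pos_iff x).1 (pos_of_mul_pos_right h0 j.cast_nonneg)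
    refine (norm_fderiv_plateFun_le x).trans ?_
    rw [fderiv_plateFun]
    simp only [one_smul, horiz_sub, horiz_smul, horiz_ez, smul_zero, sub_zero,
      real_inner_self_eq_norm_sq]
    nlinarith
  have h2 : IsBVLimit (fun j x => step (j * containerFun R x))
      {x : Space n | 0 < containerFun R x} := by
    by_cases hT : R = ⊤
    · refine isBVLimit_superlevel contDiff_containerFun contDiff_const (X := fun _ => 0)
        (.of_forall fun j x h0 _ => ?_)
      have : containerFun R = fun _ : Space n => (1 : ℝ) := by ext q; simp [containerFun, hT]
      simp [this]
    · have hR1 := toReal_gt_one hR hT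
      refine isBVLimit_superlevel contDiff_containerFun (contDiff_horizField (-2)) ?_
      filter_upwards [tendsto_natCast_atTop_atTop.eventually_ge_atTop (4 * R.toReal)]
        with j hj' x _ hle
      -- the layer `containerFun R ≤ 1 / (4 R)` stays away from the axis
      have hx : containerFun R x * (4 * R.toReal) ≤ 1 := by
        by_contra! hc
        have h0 : 0 < containerFun R x := by
          by_contra! h
          nlinarith
        nlinarith
      have hx2 : 1 / 2 ≤ ‖horiz x‖ := by
        rw [containerFun, if_neg hT] at hx
        have e : (R.toReal ^ 2 - ‖horiz x‖ ^ 2) / (2 * R.toReal) * (4 * R.toReal)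
            = 2 * (R.toReal ^ 2 - ‖horiz x‖ ^ 2) := by field_simp; ring
        rw [e] at hx
        by_contra! hc
        nlinarith [norm_nonneg (horiz x)]
      refine (norm_fderiv_containerFun_le hR hT x).trans ?_
      rw [fderiv_containerFun hT, ← neg_div]
      gcongr
      simp only [horiz_sub, horiz_smul, horiz_ez, smul_zero, sub_zero,
        real_inner_self_eq_norm_sq, inner_smul_right]
      nlinarith
  refine ⟨fun j x => step (j * plateFun x) * step (j * containerFun R x), ?_⟩
  convert h1.inter h2 using 1
  ext q
  exact mem_region_iff hR q

end BVLimit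

/-! ### The lateral surfaces as null sets of finite area -/

section Walls

variable {n : ℕ} {R : EReal} {S : Set (Space n)}

/-- A lateral surface of the region: a closed set with charts at all of its points. Both the plate
and the container (empty if `R = ∞`) are lateral surfaces. -/
structure IsWall (R : EReal) (S : Set (Space n)) : Prop where
  closed : IsClosed S
  wallPoint : ∀ p ∈ S, ∃ r A e, IsWallPoint R S r p A e

lemma isClosed_thinCyl (R : EReal) : IsClosed (thinCyl R : Set (Space n)) :=
  isClosed_eq (continuous_coe_real_ereal.comp (continuous_norm.comp continuous_horiz))
    continuous_const

lemma isWall_plate (hR : 1 < R) : IsWall R (thinCyl 1 : Set (Space n)) :=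
  ⟨isClosed_thinCyl 1, fun _ hp =>
    let ⟨A, h⟩ := exists_isWallPoint_plate hR hp
    ⟨_, A, _, h⟩⟩

lemma isWall_container (hR : 1 < R) : IsWall R (thinCyl R : Set (Space n)) := by
  refine ⟨isClosed_thinCyl R, fun p hp => ?_⟩
  have hT : R ≠ ⊤ := by
    rintro rfl
    simp [thinCyl_top] at hp
  obtain ⟨A, h⟩ := exists_isWallPoint_container hR hT hp
  exact ⟨_, A, _, h⟩

lemma IsWall.exists_chart (h : IsWall R S) {p : Space n} (hp : p ∈ S) :
    ∃ r A ε ρ, WallChart R S r p A ε ρ := by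
  obtain ⟨r, A, e, h⟩ := h.wallPoint p hp
  obtain ⟨ρ, -, hρ⟩ := h.exists_chart (1 / 4) (by norm_num) le_rfl univ univ_mem
  exact ⟨r, A, _, ρ, hρ⟩

lemma IsWall.lower_density (h : IsWall R S) {y : Space n} (hy : y ∈ S) :
    ∃ c > 0, ∀ᶠ t in 𝓝[>] (0 : ℝ), c * t ^ (n + 1) ≤ volume.real (region R ∩ ball y t) := by
  obtain ⟨r, A, ε, ρ, hc⟩ := h.exists_chart hy
  obtain ⟨h1, h2, h3, h4⟩ := hc.boundary_data ⟨hy, mem_ball_self hc.radius_pos⟩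
  exact exists_lower_density h1 h2 h3 h4

lemma IsWall.subset_closure (h : IsWall R S) : S ⊆ closure (region R) := by
  intro y hy
  obtain ⟨c, hc, hlow⟩ := h.lower_density hy
  refine Metric.mem_closure_iff.2 fun ε hε => ?_
  obtain ⟨t, ht, ht0, htε⟩ := (hlow.and (Ioo_mem_nhdsGT hε)).exists
  have hne : (region R ∩ ball y t).Nonempty := by
    by_contra hem
    rw [not_nonempty_iff_eq_empty.1 hem, measureReal_empty] at ht
    have : 0 < c * t ^ (n + 1) := by positivity
    linarith
  obtain ⟨q, hq, hqt⟩ := hne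
  exact ⟨q, hq, by rw [dist_comm]; exact (mem_ball.1 hqt).trans htε⟩

lemma IsWall.area_inter_lt_top (h : IsWall R S) {K : Set (Space n)} (hK : IsCompact K) :
    area (S ∩ K) < ⊤ := by
  have e : S ∩ K = S ∩ (S ∩ K) := by rw [← inter_assoc, inter_self]
  rw [e]
  exact area_lt_top_of_isCompact (hK.inter_left h.closed) fun p hp => h.exists_chart hp.1

lemma IsWall.volume_eq_zero (h : IsWall R S) : volume S = 0 := by
  have hk : ∀ k : ℕ, volume (S ∩ closedBall 0 (k : ℝ)) = 0 := fun k => by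
    have h1 := h.area_inter_lt_top (isCompact_closedBall (0 : Space n) (k : ℝ))
    rw [← EuclideanSpace.euclideanHausdorffMeasure_eq_volume]
    exact (MeasureTheory.Measure.euclideanHausdorffMeasure_zero_or_top
      (Nat.lt_succ_self n) _).resolve_right h1.ne
  have e : S = ⋃ k : ℕ, S ∩ closedBall 0 (k : ℝ) := by
    rw [← inter_iUnion, iUnion_closedBall_nat, inter_univ]
  rw [e]
  exact measure_iUnion_null hk

lemma closure_region_subset :
    closure (region R : Set (Space n)) ⊆ region R ∪ (thinCyl 1 ∪ thinCyl R) := by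
  have hcl : IsClosed {q : Space n | 1 ≤ ‖horiz q‖ ∧ ((‖horiz q‖ : ℝ) : EReal) ≤ R} :=
    (isClosed_le continuous_const (continuous_norm.comp continuous_horiz)).inter
      (isClosed_le (continuous_coe_real_ereal.comp (continuous_norm.comp continuous_horiz))
        continuous_const)
  intro q hq
  have hsub : (region R : Set (Space n)) ⊆
      {q : Space n | 1 ≤ ‖horiz q‖ ∧ ((‖horiz q‖ : ℝ) : EReal) ≤ R} :=
    fun q hq => ⟨hq.1.le, hq.2.le⟩
  have h := closure_minimal hsub hcl hq
  rcases h.1.eq_or_lt with h1 | h1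
  · exact Or.inr (Or.inl (mem_thinCyl_one_iff.2 h1.symm))
  · rcases h.2.eq_or_lt with h2 | h2
    · exact Or.inr (Or.inr h2)
    · exact Or.inl ⟨h1, h2⟩

lemma volume_closure_region_sdiff (hR : 1 < R) :
    volume (closure (region R : Set (Space n)) \ region R) = 0 := by
  refine measure_mono_null (fun q hq => ?_) (measure_union_null
    (isWall_plate (n := n) hR).volume_eq_zero (isWall_container (n := n) hR).volume_eq_zero)
  exact (closure_region_subset hq.1).resolve_left hq.2

lemma IsWall.mem_trace_region (h : IsWall R S) {y : Space n} (hy : y ∈ S) :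
    y ∈ trace R S (region R) := by
  refine ⟨hy, tendsto_const_nhds.congr' ?_⟩
  filter_upwards [self_mem_nhdsWithin] with t ht
  have hpos : 0 < volume (region R ∩ ball y t) := by
    rw [inter_comm]
    exact (isOpen_ball.inter (isOpen_region R)).measure_pos _
      (mem_closure_iff_nhds.1 (h.subset_closure hy) _ (ball_mem_nhds y ht))
  rw [inter_self, ENNReal.div_self hpos.ne'
    ((measure_mono inter_subset_right).trans_lt measure_ball_lt_top).ne]

lemma notMem_trace_empty {y : Space n} : y ∉ trace R S ∅ := by
  rintro ⟨-, h⟩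
  simp only [empty_inter, measure_empty, ENNReal.zero_div] at h
  exact zero_ne_one (tendsto_nhds_unique tendsto_const_nhds h)

lemma trace_subset_closure (L : Set (Space n)) : trace R S L ⊆ closure L := by
  intro y hy
  by_contra hc
  obtain ⟨t, ht, hb⟩ := isOpen_iff.1 isClosed_closure.isOpen_compl y hc
  refine notMem_trace_empty ((mem_trace_congr (M := ∅) ht ?_).1 hy)
  have : L ∩ region R ∩ ball y t = ∅ := by
    ext q
    simp only [mem_inter_iff, mem_empty_iff_false, iff_false]
    exact fun hq => hb hq.2 (_root_.subset_closure hq.1.1)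
  rw [this]
  simp

end Walls

/-! ### The flat profile -/

section Flat

variable {n : ℕ} {R : EReal} {S : Set (Space n)} {F : ℝ}

lemma norm_fderiv_height (q : Space n) : ‖fderiv ℝ (height : Space n → ℝ) q‖ = 1 := by
  refine le_antisymm (ContinuousLinearMap.opNorm_le_bound _ zero_le_one fun v => ?_) ?_
  · rw [fderiv_height, one_mul]; exact abs_height_le v
  · have := (fderiv ℝ (height : Space n → ℝ) q).le_opNorm ez
    rwa [fderiv_height, height_ez, norm_ez, mul_one, norm_one] at this

lemma fderiv_height_sub (F : ℝ) (q : Space n) :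
    fderiv ℝ (fun q : Space n => height q - F) q = fderiv ℝ height q :=
  fderiv_sub_const F

lemma contDiff_height_sub (F : ℝ) : ContDiff ℝ 1 fun q : Space n => height q - F :=
  contDiff_height.sub contDiff_const

lemma isBVLimit_height (F : ℝ) :
    IsBVLimit (fun j x => step (j * (height x - F))) {x : Space n | 0 < height x - F} := by
  refine isBVLimit_superlevel (contDiff_height_sub F) contDiff_const (X := fun _ => ez)
    (.of_forall fun j x _ _ => ?_)
  rw [fderiv_height_sub, norm_fderiv_height, fderiv_height, height_ez]

lemma regionBelow_eq : (regionBelow R F : Set (Space n)) = region R \ {x | 0 < height x - F} := by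
  ext q
  simp [regionBelow, not_lt]

lemma locallyCaccioppoli_regionBelow (hR : 1 < R) :
    LocallyCaccioppoli (regionBelow R F : Set (Space n)) univ := by
  obtain ⟨w, hw⟩ := exists_isBVLimit_region (n := n) hR
  rw [regionBelow_eq, sdiff_eq_compl_inter, inter_comm]
  exact (hw.inter (isBVLimit_height F).compl).locallyCaccioppoli

lemma LocallyCaccioppoli.mono {L U V : Set (Space n)} (h : LocallyCaccioppoli L V) (hUV : U ⊆ V) :
    LocallyCaccioppoli L U :=
  fun W hW hc hs => h W hW hc (hs.trans hUV)

lemma IsWall.trace_regionBelow (h : IsWall R S) {y : Space n} (hy : y ∈ S) :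
    (height y < F → y ∈ trace R S (regionBelow R F)) ∧
      (F < height y → y ∉ trace R S (regionBelow R F)) := by
  constructor
  · intro hlt
    obtain ⟨t, ht, hb⟩ := isOpen_iff.1
      (isOpen_lt continuous_height continuous_const) y hlt
    have e : regionBelow R F ∩ region R ∩ ball y t
        = region R ∩ region R ∩ ball y t := by
      ext q
      exact ⟨fun hq => ⟨⟨hq.1.2, hq.1.2⟩, hq.2⟩,
        fun hq => ⟨⟨⟨hq.1.2, le_of_lt (hb hq.2)⟩, hq.1.2⟩, hq.2⟩⟩
    exact (mem_trace_congr ht (.of_forall fun q => congrFun e q)).2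
      (h.mem_trace_region hy)
  · intro hlt hmem
    obtain ⟨t, ht, hb⟩ := isOpen_iff.1
      (isOpen_lt continuous_const continuous_height) y hlt
    have e : regionBelow R F ∩ region R ∩ ball y t = ∅ ∩ region R ∩ ball y t := by
      ext q
      exact ⟨fun hq => absurd hq.1.1.2 (not_le.2 (hb hq.2)), fun hq => hq.1.1.elim⟩
    exact notMem_trace_empty
      ((mem_trace_congr ht (.of_forall fun q => congrFun e q)).1 hmem)

lemma area_thinCyl_lt_top (hS : IsWall R S) {r : ℝ} (hr : ∀ q ∈ S, ‖horiz q‖ ≤ r) (a b : ℝ)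
    {E : Set (Space n)} (hE : ∀ q ∈ E, q ∈ S ∧ a ≤ height q ∧ height q ≤ b) : area E < ⊤ := by
  have hsub : E ⊆ S ∩ closedBall (0 : Space n) (|r| + (|a| + |b|)) := by
    intro q hq
    refine ⟨(hE q hq).1, ?_⟩
    rw [mem_closedBall_zero_iff]
    have h1 := norm_sq_space q
    have h2 : |height q| ≤ |a| + |b| := by
      have := (hE q hq).2
      rw [abs_le]
      constructor
      · linarith [neg_abs_le a, abs_nonneg b]
      · linarith [le_abs_self b, abs_nonneg a]
    have h3 : ‖horiz q‖ ≤ |r| := (hr q (hE q hq).1).trans (le_abs_self r)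
    have h4 : height q ^ 2 ≤ (|a| + |b|) ^ 2 := sq_le_sq' (abs_le.1 h2).1 (abs_le.1 h2).2
    have h5 := mul_nonneg (abs_nonneg r) ((abs_nonneg _).trans h2)
    refine abs_le_of_sq_le_sq' ?_ (by positivity) |>.2
    nlinarith [norm_nonneg (horiz q)]
  exact (measure_mono hsub).trans_lt (hS.area_inter_lt_top (isCompact_closedBall _ _))

lemma area_trace_regionBelow (hS : IsWall R S) {r : ℝ} (hr : ∀ q ∈ S, ‖horiz q‖ ≤ r) (a : ℝ) :
    area (trace R S (regionBelow R F) \ {p | p ∈ S ∧ height p ≤ a}) < ⊤ ∧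
      area ({p | p ∈ S ∧ height p ≤ a} \ trace R S (regionBelow R F)) < ⊤ := by
  constructor
  · refine area_thinCyl_lt_top hS hr a F fun q hq => ⟨hq.1.1, ?_, ?_⟩
    · by_contra! h
      exact hq.2 ⟨hq.1.1, h.le⟩
    · by_contra! h
      exact (hS.trace_regionBelow hq.1.1).2 h hq.1
  · refine area_thinCyl_lt_top hS hr F a fun q hq => ⟨hq.1.1, ?_, hq.1.2⟩
    by_contra! h
    exact hq.2 ((hS.trace_regionBelow hq.1.1).1 h)

lemma norm_horiz_le_of_mem_thinCyl {q : Space n} (hq : q ∈ thinCyl R) : ‖horiz q‖ ≤ R.toReal := by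
  have : ((‖horiz q‖ : ℝ) : EReal) = R := hq
  rw [← this, EReal.toReal_coe]

/-- The flat profile is admissible. -/
lemma admissible_regionBelow (hR : 1 < R) : Admissible R F (regionBelow R F : Set (Space n)) where
  measurable := (measurableSet_regionBelow R F).nullMeasurableSet
  subset := fun _ hq => subset_closure hq.1
  caccioppoli _ := locallyCaccioppoli_regionBelow hR
  caccioppoli_top _ := (locallyCaccioppoli_regionBelow hR).mono (subset_univ _)
  volume_finite _ := by simp
  volume_constraint _ := rfl
  plate_above := (area_trace_regionBelow (isWall_plate hR)
    (fun _ => norm_horiz_le_of_mem_thinCyl) 0).1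
  plate_below := (area_trace_regionBelow (isWall_plate hR)
    (fun _ => norm_horiz_le_of_mem_thinCyl) 0).2
  container_above := (area_trace_regionBelow (isWall_container hR)
    (fun _ => norm_horiz_le_of_mem_thinCyl) F).1
  container_below := (area_trace_regionBelow (isWall_container hR)
    (fun _ => norm_horiz_le_of_mem_thinCyl) F).2

lemma gravityEnergy_regionBelow (g : ℝ) :
    gravityEnergy g R F (regionBelow R F : Set (Space n)) = 0 := by
  simp [gravityEnergy]

/-- Calibration of the flat profile by the field `χ(z) e_z`. -/
lemma integral_div_regionBelow_le {X : Space n → Space n} (hX : ContDiff ℝ 1 X)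
    (hX1 : ∀ x, ‖X x‖ ≤ 1) (hXF : ∀ x : Space n, 0 < height x - F → height x - F ≤ 1 → X x = ez)
    {η : Space n → ℝ} (hη : ContDiff ℝ 1 η) (hηc : HasCompactSupport η)
    (hηs : tsupport η ⊆ region R) (hη0 : ∀ x, 0 ≤ η x)
    {φ : Space n → Space n} (hφ : ContDiff ℝ 1 φ) (hle : ∀ x, ‖φ x‖ ≤ η x) :
    ∫ x in regionBelow R F, divergence φ x
      ≤ -∫ x in {x | 0 < height x - F}, divergence (fun y => η y • X y) x := by
  have hsupp : ∀ ψ : Space n → Space n, (∀ x, ‖ψ x‖ ≤ η x) → tsupport ψ ⊆ tsupport η :=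
    fun ψ h => closure_mono fun x hx => by
      have := norm_pos_iff.2 hx
      exact (this.trans_le (h x)).ne'
  have hcs : ∀ ψ : Space n → Space n, (∀ x, ‖ψ x‖ ≤ η x) → HasCompactSupport ψ := fun ψ h =>
    hηc.mono' (subset_closure.trans (hsupp ψ h))
  have hD : MeasurableSet {x : Space n | 0 < height x - F} := (isBVLimit_height F).measurableSet
  have h := integral_div_diff_le (N := univ) (B := 0) MeasurableSet.univ hD (subset_univ _)
    (isBVLimit_height F).contDiff (isBVLimit_height F).mem_Icc hX (fun _ x _ => hX1 x) ?_
    (fun x _ => (isBVLimit_height F).tendsto x) hη hηc hη0 ?_ hφ hle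
  · rw [zero_sub] at h
    refine le_trans (le_of_eq ?_) h
    rw [regionBelow_eq]
    refine (setIntegral_eq_of_subset_of_forall_sdiff_eq_zero (MeasurableSet.univ.diff hD)
      (fun x hx => ⟨trivial, hx.2⟩) fun x hx => divergence_eq_zero_of_notMem fun hxs => ?_).symm
    exact hx.2 ⟨hηs (hsupp φ hle hxs), hx.1.2⟩
  · filter_upwards [eventually_ge_atTop 1] with j hj x _
    rw [fderiv_step_mul (contDiff_height_sub F), norm_smul, smul_apply,
      fderiv_height_sub, norm_fderiv_height, mul_one, fderiv_height, smul_eq_mul]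
    rw [Real.norm_of_nonneg (mul_nonneg j.cast_nonneg (deriv_step_nonneg _))]
    by_cases h0 : deriv step (j * (height x - F)) = 0
    · simp [h0]
    have hst : 1 / 2 ≤ j * (height x - F) ∧ j * (height x - F) ≤ 1 := by
      by_contra hc
      refine h0 (deriv_step_eq_zero ?_)
      by_contra! h'
      exact hc h'
    have hj' : (1 : ℝ) ≤ j := by exact_mod_cast hj
    rw [hXF x (by by_contra! h; nlinarith) (by by_contra! h; nlinarith), height_ez, mul_one]
  · intro ψ hψ h
    rw [setIntegral_univ, integral_divergence_eq_zero hψ (hcs ψ h)]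

/-- The flat profile has finite surface energy. -/
lemma surfaceEnergy_regionBelow_lt_top (hR : 1 < R) :
    surfaceEnergy R (regionBelow R F : Set (Space n)) < ⊤ := by
  have hLC := (locallyCaccioppoli_regionBelow (n := n) (F := F) hR).mono (subset_univ (region R))
  have hex := isExhaustion_cutoff (n := n) hR
  have hms := measurableSet_regionBelow (n := n) R F
  have hD : MeasurableSet {x : Space n | 0 < height x - F} := (isBVLimit_height F).measurableSet
  by_cases hT : R = ⊤
  · refine lt_of_le_of_lt (surfaceEnergy_le hms hLC hex (B := 0)
      (.of_forall fun k φ hφ hle => ?_)) ENNReal.ofReal_lt_top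
    have h := integral_div_regionBelow_le (R := R) (F := F) contDiff_const (X := fun _ => ez)
      (fun _ => norm_ez.le) (fun _ _ _ => rfl) (hex.contDiff k) (hex.compact k) (hex.supp k)
      (fun x => (hex.mem_Icc k x).1) hφ hle
    have hint : Integrable fun x => fderiv ℝ (cutoff R k) x (ez : Space n) :=
      (((hex.contDiff k).continuous_fderiv one_ne_zero).clm_apply
        continuous_const).integrable_of_hasCompactSupport
        ((hex.compact k).fderiv_apply (𝕜 := ℝ) ez)
    have e1 : ∫ x in {x | 0 < height x - F}, divergence (fun y => cutoff R k y • (ez : Space n)) x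
        = ∫ x in {x | 0 < height x - F}, fderiv ℝ (cutoff R k) x (ez : Space n) :=
      integral_congr_ae (.of_forall fun x =>
        divergence_smul_const ((hex.contDiff k).differentiable one_ne_zero x) ez)
    have e2 : ∫ x in {x | 0 < height x - F}ᶜ, fderiv ℝ (cutoff R k) x (ez : Space n)
        = ∫ x in regionBelow R F, fderiv ℝ (cutoff R k) x (ez : Space n) := by
      refine setIntegral_eq_of_subset_of_forall_sdiff_eq_zero hD.compl
        (fun x hx => by rw [regionBelow_eq] at hx; exact hx.2) fun x hx => ?_
      have hxs : x ∉ tsupport (cutoff R k) := fun h' => hx.2 (by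
        rw [regionBelow_eq]; exact ⟨hex.supp k h', hx.1⟩)
      have : fderiv ℝ (cutoff R k) x = 0 := by
        by_contra hne
        exact hxs (support_fderiv_subset ℝ hne)
      rw [this]; rfl
    have e3 := integral_add_compl hD hint
    rw [integral_fderiv_eq_zero (hex.contDiff k) (hex.compact k)] at e3
    rw [hT, fluxCoeff_top, ← hT, one_mul]
    linarith
  · set χ : Space n → ℝ := fun x => step (2 + (height x - F)) * step (3 - (height x - F)) with hχ
    have hχs : ContDiff ℝ 1 χ := by
      have hs : ContDiff ℝ 1 step := contDiff_step.of_le (by norm_cast)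
      exact (hs.comp (contDiff_const.add (contDiff_height_sub F))).mul
        (hs.comp (contDiff_const.sub (contDiff_height_sub F)))
    have hχ01 : ∀ x, χ x ∈ Icc (0 : ℝ) 1 := fun x =>
      ⟨mul_nonneg (step_mem_Icc _).1 (step_mem_Icc _).1,
        mul_le_one₀ (step_mem_Icc _).2 (step_mem_Icc _).1 (step_mem_Icc _).2⟩
    have hχ0 : ∀ x, x ∈ tsupport χ → |height x - F| ≤ 3 := fun x hx => by
      have hcl : IsClosed {x : Space n | |height x - F| ≤ 3} :=
        isClosed_le (continuous_height.sub continuous_const).abs continuous_const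
      refine closure_minimal (fun y hy => ?_) hcl hx
      by_contra hc
      refine hy ?_
      rw [mem_ofPred_eq, not_le, lt_abs] at hc
      rcases hc with hc | hc
      · simp [hχ, step_of_le (show 3 - (height y - F) ≤ 1 / 2 by linarith)]
      · simp [hχ, step_of_le (show 2 + (height y - F) ≤ 1 / 2 by linarith)]
    set M : ℝ := R.toReal + |F| + 3 with hM
    have hMb : ∀ x ∈ region R, x ∈ tsupport χ → ‖x‖ < M + 1 := fun x hx hxχ => by
      have h1 : ‖horiz x‖ < R.toReal := (coe_lt_iff hR hT _).1 hx.2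
      have h2 : |height x| ≤ |F| + 3 := by
        have := hχ0 x hxχ
        have h3 := abs_add_le (height x - F) F
        rw [sub_add_cancel] at h3
        linarith
      have h3 := norm_sq_space x
      rw [← sq_abs (height x)] at h3
      have := abs_nonneg (height x)
      have := norm_nonneg (horiz x)
      have := abs_nonneg F
      by_contra! hc
      nlinarith [mul_nonneg (norm_nonneg (horiz x)) (abs_nonneg (height x))]
    have hcont : Continuous fun x : Space n => fderiv ℝ χ x ez :=
      (hχs.continuous_fderiv one_ne_zero).clm_apply continuous_const
    obtain ⟨C, hC⟩ := (isCompact_closedBall (0 : Space n) (M + 1)).exists_bound_of_continuousOn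
      hcont.continuousOn
    have hC0 : 0 ≤ C := (norm_nonneg _).trans (hC 0 (mem_closedBall_self (by
      have := toReal_gt_one hR hT; positivity)))
    refine lt_of_le_of_lt (surfaceEnergy_le hms hLC hex
      (B := C * volume.real (closedBall (0 : Space n) (M + 1))) ?_) ENNReal.ofReal_lt_top
    filter_upwards [eventually_gt_atTop ⌈M + 1⌉₊] with k hk φ hφ hle
    have hkM : M + 1 < k := (Nat.le_ceil _).trans_lt (by exact_mod_cast hk)
    rw [fluxCoeff_of_ne hT, zero_mul, sub_zero]
    refine (integral_div_regionBelow_le (R := R) (F := F) (X := fun x => χ x • (ez : Space n))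
      (hχs.smul contDiff_const)
      (fun x => by rw [norm_smul, norm_ez, mul_one, Real.norm_of_nonneg (hχ01 x).1];
                   exact (hχ01 x).2)
      (fun x h1 h2 => ?_) (hex.contDiff k) (hex.compact k) (hex.supp k)
      (fun x => (hex.mem_Icc k x).1) hφ hle).trans ?_
    · rw [hχ]
      simp only
      rw [step_of_ge (by linarith), step_of_ge (by linarith), mul_one, one_smul]
    · have hpt : ∀ x, divergence (fun y => cutoff R k y • (χ y • (ez : Space n))) x
          = cutoff R k x * fderiv ℝ χ x ez := fun x => by
        rw [divergence_smul ((hex.contDiff k).differentiable one_ne_zero x)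
          ((hχs.differentiable one_ne_zero x).smul_const _),
          divergence_smul_const (hχs.differentiable one_ne_zero x), map_smul, smul_eq_mul]
        by_cases hx : x ∈ region R ∧ x ∈ tsupport χ
        · rw [fderiv_cutoff_ez ((hMb x hx.1 hx.2).trans hkM)]; ring
        · by_cases hx1 : x ∈ tsupport χ
          · have hxs : x ∉ tsupport (cutoff R k) := fun h' => hx ⟨hex.supp k h', hx1⟩
            have : fderiv ℝ (cutoff R k) x = 0 := by
              by_contra hne
              exact hxs (support_fderiv_subset ℝ hne)
            rw [this]; simp
          · rw [image_eq_zero_of_notMem_tsupport hx1]; simp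
      have hz : ∀ x, x ∉ closedBall (0 : Space n) (M + 1) →
          cutoff R k x * fderiv ℝ χ x ez = 0 := fun x hx => by
        by_contra hne
        have h1 : x ∈ region R := hex.supp k (subset_tsupport _ (left_ne_zero_of_mul hne))
        have h2 : x ∈ tsupport χ := by
          refine support_fderiv_subset ℝ fun h0 => hne ?_
          rw [h0]; simp
        exact hx (mem_closedBall_zero_iff.2 (hMb x h1 h2).le)
      rw [← integral_neg]
      refine (le_abs_self _).trans ?_
      rw [← Real.norm_eq_abs]
      have e : ∫ x in {x | 0 < height x - F},
          -divergence (fun y => cutoff R k y • (χ y • (ez : Space n))) x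
          = ∫ x in {x | 0 < height x - F} ∩ closedBall (0 : Space n) (M + 1),
            -(cutoff R k x * fderiv ℝ χ x ez) := by
        simp only [hpt]
        exact setIntegral_eq_of_subset_of_forall_sdiff_eq_zero hD inter_subset_left fun x hx => by
          rw [hz x fun h' => hx.2 ⟨hx.1, h'⟩, neg_zero]
      rw [e]
      have hfin : volume (closedBall (0 : Space n) (M + 1)) < ⊤ := measure_closedBall_lt_top
      refine (norm_setIntegral_le_of_norm_le_const
        ((measure_mono inter_subset_right).trans_lt hfin) (C := C) fun x hx => ?_).trans ?_
      · rw [norm_neg, norm_mul, Real.norm_of_nonneg (hex.mem_Icc k x).1]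
        exact (mul_le_of_le_one_left (norm_nonneg _) (hex.mem_Icc k x).2).trans (hC x hx.2)
      · exact mul_le_mul_of_nonneg_left (measureReal_mono inter_subset_right hfin.ne) hC0

end Flat

/-! ### Global stability as an inequality between real numbers -/

section Stability

variable {n : ℕ} {P : Parameters} {R : EReal} {F : ℝ} {L M : Set (Space n)}
  {σ : Measure (Space n)} {ν : Space n → Space n}

/-- Relative areas are finite differences, although the areas may be infinite. -/
lemma relArea_sub {W W' T : Set (Space n)} (hW : MeasurableSet W) (hW' : MeasurableSet W')
    (hT : MeasurableSet T) (h1 : area (W \ T) < ⊤) (h2 : area (T \ W) < ⊤)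
    (h3 : area (W' \ T) < ⊤) (h4 : area (T \ W') < ⊤) :
    relArea W' T - relArea W T = (area (W' \ W)).toReal - (area (W \ W')).toReal := by
  have h5 : area (W' \ W) < ⊤ := lt_of_le_of_lt (measure_mono fun q hq => by
    by_cases hqT : q ∈ T
    exacts [Or.inr ⟨hqT, hq.2⟩, Or.inl ⟨hq.1, hqT⟩]) ((measure_union_le _ _).trans_lt
      (ENNReal.add_lt_top.2 ⟨h3, h2⟩))
  have h6 : area (W \ W') < ⊤ := lt_of_le_of_lt (measure_mono fun q hq => by
    by_cases hqT : q ∈ T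
    exacts [Or.inr ⟨hqT, hq.2⟩, Or.inl ⟨hq.1, hqT⟩]) ((measure_union_le _ _).trans_lt
      (ENNReal.add_lt_top.2 ⟨h1, h4⟩))
  have e1 := measureReal_inter_add_sdiff (μ := (μHE[n] : Measure (Space n)))
    (s := W' \ T) hW h3.ne
  have e2 := measureReal_inter_add_sdiff (μ := (μHE[n] : Measure (Space n)))
    (s := W \ T) hW' h1.ne
  have e3 := measureReal_inter_add_sdiff (μ := (μHE[n] : Measure (Space n)))
    (s := T \ W) hW' h2.ne
  have e4 := measureReal_inter_add_sdiff (μ := (μHE[n] : Measure (Space n)))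
    (s := T \ W') hW h4.ne
  have e5 := measureReal_inter_add_sdiff (μ := (μHE[n] : Measure (Space n)))
    (s := W' \ W) hT h5.ne
  have e6 := measureReal_inter_add_sdiff (μ := (μHE[n] : Measure (Space n)))
    (s := W \ W') hT h6.ne
  have s1 : (W' \ T) ∩ W = (W \ T) ∩ W' := by ext q; simp; tauto
  have s2 : (T \ W) \ W' = (T \ W') \ W := by ext q; simp; tauto
  have s3 : (W' \ W) ∩ T = (T \ W) ∩ W' := by ext q; simp; tauto
  have s4 : (W' \ W) \ T = (W' \ T) \ W := by ext q; simp; tauto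
  have s5 : (W \ W') ∩ T = (T \ W') ∩ W := by ext q; simp; tauto
  have s6 : (W \ W') \ T = (W \ T) \ W' := by ext q; simp; tauto
  rw [s1] at e1
  rw [s2] at e3
  rw [s3, s4] at e5
  rw [s5, s6] at e6
  simp only [relArea, area] at *
  simp only [Measure.real] at e1 e2 e3 e4 e5 e6
  linarith

lemma surfaceEnergy_congr (h : L =ᵐ[volume] M) : surfaceEnergy R L = surfaceEnergy R M := by
  unfold surfaceEnergy
  split_ifs with hT
  · refine iInf_congr fun σ => iInf_congr fun ν => ?_
    exact iInf_congr_Prop ⟨isGaussGreen_congr h, isGaussGreen_congr h.symm⟩ fun _ => rfl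
  · exact perimeter_congr h

lemma gravityEnergy_congr {g : ℝ} (h : L =ᵐ[volume] M) :
    gravityEnergy g R F L = gravityEnergy g R F M :=
  setLIntegral_congr (by
    have h1 := h.diff (ae_eq_refl (regionBelow R F))
    have h2 := (ae_eq_refl (μ := volume) (regionBelow R F)).diff h
    exact h1.union h2)

lemma LocallyCaccioppoli.congr {U : Set (Space n)} (h : L =ᵐ[volume] M)
    (hL : LocallyCaccioppoli L U) : LocallyCaccioppoli M U :=
  fun V hV hc hs => by rw [← perimeter_congr h]; exact hL V hV hc hs

lemma Admissible.congr (hL : Admissible R F L) (h : L =ᵐ[volume] M) (hM : M ⊆ closure (region R)) :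
    Admissible R F M := by
  have e1 : volume (M \ regionBelow R F) = volume (L \ regionBelow R F) :=
    measure_congr (h.symm.diff (ae_eq_refl _))
  have e2 : volume (regionBelow R F \ M) = volume (regionBelow R F \ L) :=
    measure_congr ((ae_eq_refl _).diff h.symm)
  have t1 : plateContact R M = plateContact R L := trace_congr h.symm
  have t2 : containerContact R M = containerContact R L := trace_congr h.symm
  exact
    { measurable := hL.measurable.congr h
      subset := hM
      caccioppoli := fun hT => (hL.caccioppoli hT).congr h
      caccioppoli_top := fun hT => (hL.caccioppoli_top hT).congr h
      volume_finite := fun hT => e1 ▸ hL.volume_finite hT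
      volume_constraint := fun hT => by rw [e1, e2]; exact hL.volume_constraint hT
      plate_above := t1 ▸ hL.plate_above
      plate_below := t1 ▸ hL.plate_below
      container_above := t2 ▸ hL.container_above
      container_below := t2 ▸ hL.container_below }

lemma GloballyStable.congr (hL : GloballyStable P R F L) (h : L =ᵐ[volume] M)
    (hM : M ⊆ closure (region R)) : GloballyStable P R F M := by
  refine ⟨hL.1.congr h hM, fun L' hL' => ?_⟩
  have h1 := hL.2 L' hL'
  have t1 : plateContact R M = plateContact R L := trace_congr h.symm
  have t2 : containerContact R M = containerContact R L := trace_congr h.symm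
  unfold energy dissipation at *
  rwa [surfaceEnergy_congr h, gravityEnergy_congr h, ← t1, ← t2] at h1

/-- A globally stable profile which is a Borel subset of the open region, together with the surface
measure and the normal of its free surface. -/
structure IsStable (P : Parameters) (R : EReal) (F : ℝ) (L : Set (Space n))
    (σ : Measure (Space n)) (ν : Space n → Space n) : Prop where
  elliptic : P.Elliptic
  radius : 1 < R
  measurable : MeasurableSet L
  subset : L ⊆ region R
  stable : GloballyStable P R F L
  gaussGreen : IsGaussGreen L (region R) σ ν
  surface_ne_top : surfaceEnergy R L ≠ ⊤
  gravity_ne_top : gravityEnergy P.g R F L ≠ ⊤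

lemma area_sdiff_lt_top {W W' T : Set (Space n)} (h1 : area (W \ T) < ⊤)
    (h2 : area (T \ W') < ⊤) : area (W \ W') < ⊤ :=
  lt_of_le_of_lt (measure_mono fun q hq => by
    by_cases hqT : q ∈ T
    exacts [Or.inr ⟨hqT, hq.2⟩, Or.inl ⟨hq.1, hqT⟩]) ((measure_union_le _ _).trans_lt
      (ENNReal.add_lt_top.2 ⟨h1, h2⟩))

/-- A stable profile has a Borel representative, and its energy is finite, as is seen by comparison
with the flat profile. -/
lemma exists_isStable (hP : P.Elliptic) (hR : 1 < R) (hL : GloballyStable P R F L) :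
    ∃ L₀ σ ν, L₀ ⊆ L ∩ region R ∧ L₀ =ᵐ[volume] L ∧ IsStable P R F L₀ σ ν := by
  have hreg : (L ∩ region R : Set (Space n)) =ᵐ[volume] L := by
    refine (ae_eq_set.2 ⟨?_, ?_⟩)
    · rw [sdiff_eq_empty.2 inter_subset_left, measure_empty]
    · refine measure_mono_null (fun q hq => ?_) (volume_closure_region_sdiff (n := n) hR)
      exact ⟨hL.1.subset hq.1, fun h => hq.2 ⟨hq.1, h⟩⟩
  have hnm : NullMeasurableSet (L ∩ region R) volume :=
    hL.1.measurable.inter (measurableSet_region R).nullMeasurableSet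
  obtain ⟨L₀, hsub, hm, hae⟩ := hnm.exists_measurable_subset_ae_eq
  have hL0 : L₀ =ᵐ[volume] L := hae.trans hreg
  have hst : GloballyStable P R F L₀ :=
    hL.congr hL0.symm ((hsub.trans inter_subset_right).trans subset_closure)
  have hLC : LocallyCaccioppoli L₀ (region R) := by
    by_cases hT : R = ⊤
    · exact hst.1.caccioppoli_top hT
    · exact (hst.1.caccioppoli hT).mono (subset_univ _)
  obtain ⟨σ, ν, hG⟩ := hLC.exists_isGaussGreen (isOpen_region R) hm
  have hfin : surfaceEnergy R L₀ + gravityEnergy P.g R F L₀ ≠ ⊤ := by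
    intro htop
    have hflat := admissible_regionBelow (n := n) (F := F) hR
    have h := hst.2 _ hflat
    have hd : dissipation P R L₀ (regionBelow R F) ≠ ⊤ := by
      refine ENNReal.add_ne_top.2 ⟨ENNReal.mul_ne_top ENNReal.ofReal_ne_top ?_,
        ENNReal.mul_ne_top ENNReal.ofReal_ne_top ?_⟩
      · exact (area_sdiff_lt_top hflat.plate_above hst.1.plate_below).ne
      · exact (area_sdiff_lt_top hst.1.plate_above hflat.plate_below).ne
    have hs := (surfaceEnergy_regionBelow_lt_top (n := n) (F := F) hR).ne
    unfold energy at h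
    rw [htop, gravityEnergy_regionBelow, add_zero, EReal.coe_ennreal_top, EReal.top_add_coe,
      ← EReal.coe_ennreal_toReal hs, ← EReal.coe_ennreal_toReal hd, ← EReal.coe_add,
      ← EReal.coe_add] at h
    exact absurd h (not_le.2 (EReal.coe_lt_top _))
  exact ⟨L₀, σ, ν, hsub, hL0, hP, hR, hm, hsub.trans inter_subset_right, hst, hG,
    (ENNReal.add_ne_top.1 hfin).1, (ENNReal.add_ne_top.1 hfin).2⟩

lemma measurableSet_thinCylBelow (a : ℝ) : MeasurableSet (thinCylBelow R a : Set (Space n)) :=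
  ((isClosed_thinCyl R).inter (isClosed_le continuous_height continuous_const)).measurableSet

/-- The change of the wetting energy plus the dissipation in passing from `L` to `M`. -/
def wallCost (P : Parameters) (R : EReal) (L M : Set (Space n)) : ℝ :=
  ((P.muPlus - P.cosYp) * (area (plateContact R M \ plateContact R L)).toReal
      + (P.muMinus + P.cosYp) * (area (plateContact R L \ plateContact R M)).toReal)
    - P.cosYc * ((area (containerContact R M \ containerContact R L)).toReal
      - (area (containerContact R L \ containerContact R M)).toReal)

lemma wallCost_congr {K M' : Set (Space n)} (hK : IsClosed K) (hKR : K ⊆ region R)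
    (h : M \ K = M' \ K) : wallCost P R L M = wallCost P R L M' := by
  have htr : ∀ S : Set (Space n), (∀ y ∈ S, y ∉ region R) → trace R S M = trace R S M' := by
    intro S hSR
    ext y
    by_cases hy : y ∈ S
    · exact mem_trace_iff_of_diff_eq hK (fun hc => hSR y hy (hKR hc)) h
    · exact ⟨fun h => absurd h.1 hy, fun h => absurd h.1 hy⟩
  have t1 : plateContact R M = plateContact R M' :=
    htr _ fun y hy => notMem_region_of_mem_thinCyl_one hy
  have t2 : containerContact R M = containerContact R M' :=
    htr _ fun y hy => notMem_region_of_mem_thinCyl hy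
  rw [wallCost, wallCost, t1, t2]

/-- Global stability in terms of finite quantities; the sign of the wetting energy of the plate and
the dissipation combine to `wallCost`. -/
lemma IsStable.energy_le (h : IsStable P R F L σ ν)
    (hA : Admissible R F M) (hS : surfaceEnergy R M ≠ ⊤) (hG : gravityEnergy P.g R F M ≠ ⊤) :
    (surfaceEnergy R L).toReal + (gravityEnergy P.g R F L).toReal
      ≤ (surfaceEnergy R M).toReal + (gravityEnergy P.g R F M).toReal
        + wallCost P R L M := by
  unfold wallCost
  have hw1 := isWall_plate (n := n) h.radius
  have hw2 := isWall_container (n := n) h.radius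
  have hL := h.stable.1
  have a1 := area_sdiff_lt_top hA.plate_above hL.plate_below
  have a2 := area_sdiff_lt_top hL.plate_above hA.plate_below
  have h1 := relArea_sub (measurableSet_trace hw1.closed hw1.subset_closure)
    (measurableSet_trace hw1.closed hw1.subset_closure) (measurableSet_thinCylBelow 0)
    hL.plate_above hL.plate_below hA.plate_above hA.plate_below
  have h2 := relArea_sub (measurableSet_trace hw2.closed hw2.subset_closure)
    (measurableSet_trace hw2.closed hw2.subset_closure) (measurableSet_thinCylBelow F)
    hL.container_above hL.container_below hA.container_above hA.container_below
  change relArea (plateContact R M) _ - relArea (plateContact R L) _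
    = (area (plateContact R M \ plateContact R L)).toReal
      - (area (plateContact R L \ plateContact R M)).toReal at h1
  change relArea (containerContact R M) _ - relArea (containerContact R L) _
    = (area (containerContact R M \ containerContact R L)).toReal
      - (area (containerContact R L \ containerContact R M)).toReal at h2
  have hd : dissipation P R L M ≠ ⊤ :=
    ENNReal.add_ne_top.2 ⟨ENNReal.mul_ne_top ENNReal.ofReal_ne_top a1.ne,
      ENNReal.mul_ne_top ENNReal.ofReal_ne_top a2.ne⟩
  have hdr : (dissipation P R L M).toReal
      = P.muPlus * (area (plateContact R M \ plateContact R L)).toReal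
        + P.muMinus * (area (plateContact R L \ plateContact R M)).toReal := by
    unfold dissipation
    rw [ENNReal.toReal_add (ENNReal.mul_ne_top ENNReal.ofReal_ne_top a1.ne)
      (ENNReal.mul_ne_top ENNReal.ofReal_ne_top a2.ne), ENNReal.toReal_mul, ENNReal.toReal_mul,
      ENNReal.toReal_ofReal h.elliptic.muPlus_nonneg,
      ENNReal.toReal_ofReal h.elliptic.muMinus_nonneg]
  have h3 := h.stable.2 M hA
  unfold energy at h3
  rw [← EReal.coe_ennreal_toReal hd,
    ← EReal.coe_ennreal_toReal (ENNReal.add_ne_top.2 ⟨h.surface_ne_top, h.gravity_ne_top⟩),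
    ← EReal.coe_ennreal_toReal (ENNReal.add_ne_top.2 ⟨hS, hG⟩), ← EReal.coe_add, ← EReal.coe_add,
    ← EReal.coe_add, EReal.coe_le_coe_iff, ENNReal.toReal_add hS hG,
    ENNReal.toReal_add h.surface_ne_top h.gravity_ne_top, hdr] at h3
  set x := relArea (plateContact R M) (thinCylBelow 1 0)
  set y := relArea (plateContact R L) (thinCylBelow 1 0)
  set x' := relArea (containerContact R M) (thinCylBelow R F)
  set y' := relArea (containerContact R L) (thinCylBelow R F)
  have e1 : P.cosYp * x = P.cosYp * y + P.cosYp *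
    ((area (plateContact R M \ plateContact R L)).toReal
      - (area (plateContact R L \ plateContact R M)).toReal) := by rw [← h1]; ring
  rw [← h2]
  linarith

/-- Comparison of a stable profile with a profile `M` that differs from it in a compact set and
whose surface energy is larger by at most `β`. -/
lemma IsStable.comparison (h : IsStable P R F L σ ν) {K : Set (Space n)} (hM : MeasurableSet M)
    (hMR : M ⊆ region R) (hK : IsCompact K) (hMK : M \ K = L \ K)
    (hLC : ∀ U, IsOpen U → region R ⊆ U → LocallyCaccioppoli L U → LocallyCaccioppoli M U)
    (hvol : R ≠ ⊤ → volume (M ∩ K) = volume (L ∩ K)) {β : ℝ}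
    (hβ : ∀ θ > 0, ∀ᶠ k in atTop, ∀ φ : Space n → Space n, ContDiff ℝ 1 φ →
      (∀ x, ‖φ x‖ ≤ cutoff R k x) → ∫ x in M, divergence φ x ≤ ∫ x, cutoff R k x ∂σ + β + θ) :
    0 ≤ β + ((∫ x in M ∩ K, P.g * (height x - F)) - ∫ x in L ∩ K, P.g * (height x - F))
        + wallCost P R L M := by
  have hex := isExhaustion_cutoff (n := n) h.radius
  have hw1 := isWall_plate (n := n) h.radius
  have hw2 := isWall_container (n := n) h.radius
  have hL := h.stable.1
  have hLCM : LocallyCaccioppoli M (region R) := by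
    by_cases hT : R = ⊤
    · exact hLC _ (isOpen_region R) subset_rfl (hL.caccioppoli_top hT)
    · exact hLC _ (isOpen_region R) subset_rfl ((hL.caccioppoli hT).mono (subset_univ _))
  have htr : ∀ S : Set (Space n), ∀ y, y ∉ K → (y ∈ trace R S M ↔ y ∈ trace R S L) :=
    fun S y hy => mem_trace_iff_of_diff_eq hK.isClosed hy hMK
  have hfinite : ∀ S : Set (Space n), IsWall R S → area (trace R S M \ trace R S L) < ⊤ ∧
      area (trace R S L \ trace R S M) < ⊤ := by
    intro S hS
    have hA := hS.area_inter_lt_top hK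
    have s1 : trace R S M \ trace R S L ⊆ S ∩ K := fun y hy => by
      refine ⟨hy.1.1, ?_⟩
      by_contra hc
      exact hy.2 ((htr S y hc).1 hy.1)
    have s2 : trace R S L \ trace R S M ⊆ S ∩ K := fun y hy => by
      refine ⟨hy.1.1, ?_⟩
      by_contra hc
      exact hy.2 ((htr S y hc).2 hy.1)
    exact ⟨(measure_mono s1).trans_lt hA, (measure_mono s2).trans_lt hA⟩
  have hvolM : R ≠ ⊤ → volume (M \ regionBelow R F) < ⊤ ∧
      volume (M \ regionBelow R F) = volume (regionBelow R F \ M) := fun hT =>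
    volume_modify h.measurable hM (measurableSet_regionBelow R F) hK hMK (hvol hT)
      (hL.volume_finite hT) (hL.volume_constraint hT)
  have hA : Admissible R F M :=
    { measurable := hM.nullMeasurableSet
      subset := hMR.trans subset_closure
      caccioppoli := fun hT => hLC _ isOpen_univ (subset_univ _) (hL.caccioppoli hT)
      caccioppoli_top := fun _ => hLCM
      volume_finite := fun hT => (hvolM hT).1
      volume_constraint := fun hT => (hvolM hT).2
      plate_above := area_sdiff_lt_top (W' := thinCylBelow 1 0) (hfinite _ hw1).1 hL.plate_above
      plate_below := area_sdiff_lt_top (W' := plateContact R M) hL.plate_below (hfinite _ hw1).2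
      container_above :=
        area_sdiff_lt_top (W' := thinCylBelow R F) (hfinite _ hw2).1 hL.container_above
      container_below :=
        area_sdiff_lt_top (W' := containerContact R M) hL.container_below (hfinite _ hw2).2 }
  obtain ⟨hGM, hGe⟩ := gravityEnergy_modify (F := F) h.elliptic.g_pos.le h.measurable hM h.subset
    hMR hK hMK h.gravity_ne_top
  -- the flux of the cutoff functions does not see compact modifications
  obtain ⟨ρ, hρ⟩ := hK.isBounded.subset_ball (0 : Space n)
  have hflux : ∀ᶠ k in atTop, ∫ x in M, fderiv ℝ (cutoff R k) x (ez : Space n)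
      = ∫ x in L, fderiv ℝ (cutoff R k) x (ez : Space n) := by
    filter_upwards [eventually_gt_atTop ⌈ρ⌉₊] with k hk
    have hkρ : ρ < k := (Nat.le_ceil _).trans_lt (by exact_mod_cast hk)
    have hz : ∀ x ∈ K, fderiv ℝ (cutoff R k) x (ez : Space n) = 0 := fun x hx =>
      fderiv_cutoff_ez ((mem_ball_zero_iff.1 (hρ hx)).trans hkρ)
    have e : ∀ A : Set (Space n), MeasurableSet A →
        ∫ x in A, fderiv ℝ (cutoff R k) x (ez : Space n)
          = ∫ x in A \ K, fderiv ℝ (cutoff R k) x (ez : Space n) := fun A hA =>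
      setIntegral_eq_of_subset_of_forall_sdiff_eq_zero hA sdiff_subset fun x hx => by
        refine hz x ?_
        by_contra hc
        exact hx.2 ⟨hx.1, hc⟩
    rw [e M hM, e L h.measurable, hMK]
  have hsurf : ∀ θ > 0, surfaceEnergy R M ≠ ⊤ ∧
      (surfaceEnergy R M).toReal ≤ (surfaceEnergy R L).toReal + β + θ := by
    intro θ hθ
    have hev : ∀ᶠ k in atTop, ∀ φ : Space n → Space n, ContDiff ℝ 1 φ →
        (∀ x, ‖φ x‖ ≤ cutoff R k x) →
        (∫ x in M, divergence φ x) - fluxCoeff R * (∫ x in M, fderiv ℝ (cutoff R k) x ez)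
          ≤ (surfaceEnergy R L).toReal + β + θ := by
      filter_upwards [hβ θ hθ, hflux] with k h1 h2 φ hφ hle
      have h3 := h1 φ hφ hle
      have h4 := integral_le_surfaceEnergy h.gaussGreen h.surface_ne_top (hex.contDiff k)
        (hex.compact k) (hex.supp k) (hex.mem_Icc k)
      rw [h2]
      linarith
    have hle := surfaceEnergy_le hM hLCM hex hev
    refine ⟨(hle.trans_lt ENNReal.ofReal_lt_top).ne, ?_⟩
    refine ENNReal.toReal_le_of_le_ofReal ?_ hle
    obtain ⟨k, hk⟩ := hev.exists
    have h5 := hk (fun x => cutoff R k x • (fluxCoeff R • ez))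
      ((hex.contDiff k).smul contDiff_const) fun x => by
        rw [norm_smul, norm_smul, norm_ez, mul_one, Real.norm_of_nonneg (hex.mem_Icc k x).1,
          Real.norm_of_nonneg fluxCoeff_nonneg]
        exact mul_le_of_le_one_right (hex.mem_Icc k x).1 fluxCoeff_le_one
    have e : ∫ x in M, divergence (fun x => cutoff R k x • (fluxCoeff R • (ez : Space n))) x
        = fluxCoeff R * ∫ x in M, fderiv ℝ (cutoff R k) x ez := by
      rw [← integral_const_mul]
      refine integral_congr_ae (.of_forall fun x => ?_)
      simp only
      rw [divergence_smul_const ((hex.contDiff k).differentiable one_ne_zero x), map_smul,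
        smul_eq_mul]
    rw [e, sub_self] at h5
    exact h5
  refine le_of_forall_pos_le_add fun θ hθ => ?_
  obtain ⟨hS, hle⟩ := hsurf θ hθ
  have := h.energy_le hA hS hGM
  linarith

end Stability

/-! ### The first variation and the Lagrange multiplier -/

section FirstVariation

variable {n : ℕ} {P : Parameters} {R : EReal} {F : ℝ} {L : Set (Space n)}
  {σ : Measure (Space n)} {ν : Space n → Space n} {f f' : Space n → ℝ} {e e' : Space n} {g : ℝ}

/-- The integrand of the first variation of the energy in the direction `f e`. -/
def varDensity (g F : ℝ) (f : Space n → ℝ) (e : Space n) (ν : Space n → Space n) (x : Space n) :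
    ℝ :=
  areaDensity f e ν x + g * (height x - F) * f x * ⟪e, ν x⟫

/-- A smooth function with compact support in `U`. -/
structure IsBump (U : Set (Space n)) (f : Space n → ℝ) : Prop where
  smooth : ContDiff ℝ ∞ f
  compact : HasCompactSupport f
  supp : tsupport f ⊆ U

lemma isBump_zero {U : Set (Space n)} : IsBump U fun _ => 0 :=
  ⟨contDiff_const, HasCompactSupport.zero,
    (tsupport_eq_empty_iff.2 rfl).le.trans (empty_subset _)⟩

lemma IsBump.contDiff {U : Set (Space n)} (h : IsBump U f) : ContDiff ℝ 1 f :=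
  h.smooth.of_le (by norm_cast)

lemma IsBump.add_mul {U : Set (Space n)} (h : IsBump U f) (h' : IsBump U f') (c : ℝ) :
    IsBump U fun x => f x + c * f' x := by
  have hs : tsupport (fun x => f x + c * f' x) ⊆ tsupport f ∪ tsupport f' :=
    closure_minimal (fun x hx => by
      by_contra hc
      rw [mem_union, not_or] at hc
      refine hx ?_
      simp only
      rw [image_eq_zero_of_notMem_tsupport hc.1, image_eq_zero_of_notMem_tsupport hc.2]
      simp) ((isClosed_tsupport f).union (isClosed_tsupport f'))
  exact ⟨h.smooth.add (contDiff_const.mul h'.smooth),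
    (h.compact.isCompact.union h'.compact.isCompact).of_isClosed_subset (isClosed_tsupport _) hs,
    hs.trans (union_subset h.supp h'.supp)⟩

lemma IsGaussGreen.integrable_flux (hG : IsGaussGreen L (region R) σ ν) (hf : IsBump (region R) f)
    (e : Space n) : Integrable (fun x => f x * ⟪e, ν x⟫) σ := by
  have h := hG.integrable_inner (IsTest.of_smul hf.contDiff hf.compact hf.supp
    (contDiff_const (c := e)))
  simpa only [real_inner_smul_left] using h

lemma IsGaussGreen.integrable_varDensity (hG : IsGaussGreen L (region R) σ ν)
    (hf : IsBump (region R) f) (e : Space n) (g F : ℝ) :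
    Integrable (varDensity g F f e ν) σ := by
  have h1 : ContDiff ℝ 1 fun x : Space n => (g * (height x - F)) • e :=
    (contDiff_const.mul (contDiff_height.sub contDiff_const)).smul contDiff_const
  have h := hG.integrable_inner (IsTest.of_smul hf.contDiff hf.compact hf.supp h1)
  refine (hG.integrable_areaDensity hf.contDiff hf.compact hf.supp).add (h.congr ?_)
  refine .of_forall fun x => ?_
  simp only [real_inner_smul_left]
  ring

/-- The first variation of the energy in the direction `f e`. -/
def firstVar (g F : ℝ) (σ : Measure (Space n)) (ν : Space n → Space n) (f : Space n → ℝ)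
    (e : Space n) : ℝ :=
  ∫ x, varDensity g F f e ν x ∂σ

/-- The first variation of the volume in the direction `f e`. -/
def volVar (σ : Measure (Space n)) (ν : Space n → Space n) (f : Space n → ℝ) (e : Space n) : ℝ :=
  ∫ x, f x * ⟪e, ν x⟫ ∂σ

lemma areaDensity_add_smul (c : ℝ) (x : Space n) :
    areaDensity f (e + c • e') ν x = areaDensity f e ν x + c * areaDensity f e' ν x := by
  simp only [areaDensity, map_add, map_smul, inner_add_right, real_inner_smul_right, smul_eq_mul]
  ring

lemma areaDensity_add_mul (hf : Differentiable ℝ f) (hf' : Differentiable ℝ f') (c : ℝ)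
    (x : Space n) : areaDensity (fun x => f x + c * f' x) e ν x
      = areaDensity f e ν x + c * areaDensity f' e ν x := by
  have h : fderiv ℝ (fun x => f x + c * f' x) x = fderiv ℝ f x + c • fderiv ℝ f' x :=
    ((hf x).hasFDerivAt.add ((hf' x).hasFDerivAt.const_mul c)).fderiv
  simp only [areaDensity, h, add_apply, smul_apply,
    smul_eq_mul]
  ring

lemma firstVar_add_smul (hG : IsGaussGreen L (region R) σ ν) (hf : IsBump (region R) f) (c : ℝ) :
    firstVar g F σ ν f (e + c • e') = firstVar g F σ ν f e + c * firstVar g F σ ν f e' := by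
  unfold firstVar
  rw [← integral_const_mul, ← integral_add (hG.integrable_varDensity hf e g F)
    ((hG.integrable_varDensity hf e' g F).const_mul c)]
  refine integral_congr_ae (.of_forall fun x => ?_)
  simp only [varDensity, areaDensity_add_smul, inner_add_left, real_inner_smul_left]
  ring

lemma firstVar_add_mul (hG : IsGaussGreen L (region R) σ ν) (hf : IsBump (region R) f)
    (hf' : IsBump (region R) f') (c : ℝ) :
    firstVar g F σ ν (fun x => f x + c * f' x) e
      = firstVar g F σ ν f e + c * firstVar g F σ ν f' e := by
  unfold firstVar
  rw [← integral_const_mul, ← integral_add (hG.integrable_varDensity hf e g F)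
    ((hG.integrable_varDensity hf' e g F).const_mul c)]
  refine integral_congr_ae (.of_forall fun x => ?_)
  simp only [varDensity, areaDensity_add_mul (hf.contDiff.differentiable one_ne_zero)
    (hf'.contDiff.differentiable one_ne_zero)]
  ring

lemma volVar_add_smul (hG : IsGaussGreen L (region R) σ ν) (hf : IsBump (region R) f) (c : ℝ) :
    volVar σ ν f (e + c • e') = volVar σ ν f e + c * volVar σ ν f e' := by
  unfold volVar
  rw [← integral_const_mul, ← integral_add (hG.integrable_flux hf e)
    ((hG.integrable_flux hf e').const_mul c)]
  refine integral_congr_ae (.of_forall fun x => ?_)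
  simp only [inner_add_left, real_inner_smul_left]
  ring

lemma volVar_add_mul (hG : IsGaussGreen L (region R) σ ν) (hf : IsBump (region R) f)
    (hf' : IsBump (region R) f') (c : ℝ) :
    volVar σ ν (fun x => f x + c * f' x) e = volVar σ ν f e + c * volVar σ ν f' e := by
  unfold volVar
  rw [← integral_const_mul, ← integral_add (hG.integrable_flux hf e)
    ((hG.integrable_flux hf' e).const_mul c)]
  refine integral_congr_ae (.of_forall fun x => ?_)
  simp only
  ring

lemma exists_norm_fderiv_le (hf : ContDiff ℝ 1 f) (hc : HasCompactSupport f) (e : Space n) :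
    ∃ K, ∀ x, ‖fderiv ℝ f x‖ * ‖e‖ ≤ K := by
  obtain ⟨C, hC⟩ := (hf.continuous_fderiv one_ne_zero).bounded_above_of_compact_support
    (hc.fderiv ℝ)
  exact ⟨C * ‖e‖, fun x => mul_le_mul_of_nonneg_right (hC x) (norm_nonneg _)⟩

lemma eq_zero_of_forall_small {A C s₀ : ℝ} (hs₀ : 0 < s₀)
    (h : ∀ s, |s| ≤ s₀ → 0 ≤ s * A + C * s ^ 2) : A = 0 := by
  have hle : ∀ t, 0 < t → t ≤ s₀ → |A| ≤ C * t := by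
    intro t ht hts
    have h1 := h t (by rwa [abs_of_pos ht])
    have h2 := h (-t) (by rwa [abs_neg, abs_of_pos ht])
    refine abs_le.2 ⟨?_, ?_⟩
    · by_contra! hc
      nlinarith
    · by_contra! hc
      nlinarith
  have hlim : Tendsto (fun t : ℝ => C * t) (𝓝[>] 0) (𝓝 0) := by
    have : Tendsto (fun t : ℝ => C * t) (𝓝 0) (𝓝 (C * 0)) := tendsto_id.const_mul C
    rw [mul_zero] at this
    exact this.mono_left nhdsWithin_le_nhds
  have : |A| ≤ 0 := ge_of_tendsto hlim (by
    filter_upwards [Ioc_mem_nhdsGT hs₀] with t ht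
    exact hle t ht.1 ht.2)
  exact abs_eq_zero.1 (le_antisymm this (abs_nonneg A))

lemma image_shear_sdiff {s : ℝ} (h : IsShear f e s) :
    shear f e s '' L \ tsupport f = L \ tsupport f := by
  rw [sdiff_eq, sdiff_eq]
  exact h.image_diff fun x hx hc => hc (subset_tsupport f hx)

lemma firstVar_eq (hG : IsGaussGreen L (region R) σ ν) (hf : IsBump (region R) f) :
    firstVar g F σ ν f e = (∫ x, areaDensity f e ν x ∂σ)
      + ∫ x, g * (height x - F) * f x * ⟪e, ν x⟫ ∂σ := by
  have i1 := hG.integrable_areaDensity (e := e) hf.contDiff hf.compact hf.supp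
  have i2 : Integrable (fun x => g * (height x - F) * f x * ⟪e, ν x⟫) σ := by
    refine ((hG.integrable_varDensity hf e g F).sub i1).congr (.of_forall fun x => ?_)
    simp [varDensity]
  rw [← integral_add i1 i2]
  rfl

/-- The first variation vanishes along fields that preserve the volume (along all fields if
`R = ∞`). -/
lemma IsStable.firstVar_eq_zero (h : IsStable P R F L σ ν) (hf : IsBump (region R) f)
    (hV : R ≠ ⊤ → volVar σ ν f e = 0) : firstVar P.g F σ ν f e = 0 := by
  have hG := h.gaussGreen
  have hex := isExhaustion_cutoff (n := n) h.radius
  obtain ⟨s₀, hs₀, hsh⟩ := exists_isShear e hf.smooth hf.compact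
  obtain ⟨K, hK⟩ := exists_norm_fderiv_le hf.contDiff hf.compact e
  set C₁ := 2 * K ^ 2 * σ.real (tsupport f)
  set C₂ := ∫ x in L ∩ tsupport f, P.g * (f x * fderiv ℝ f x e * height e)
  refine eq_zero_of_forall_small (C := C₁ + C₂) hs₀ fun s hs => ?_
  have hS := hsh s hs
  have hcomp := h.comparison (K := tsupport f) (hS.measurableSet_image h.measurable)
    (hS.image_subset h.subset fun x hx => hf.supp (subset_tsupport f hx)) hf.compact.isCompact
    (image_shear_sdiff hS)
    (fun U hU hRU hLC => hS.locallyCaccioppoli hU h.measurable (hf.supp.trans hRU) hLC)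
    (fun hT => by
      have h1 := hS.measureReal_image h.measurable
      rw [hG.integral_fderiv hf.contDiff hf.compact hf.supp e] at h1
      have h2 := hV hT
      unfold volVar at h2
      rw [h2, mul_zero, add_zero] at h1
      exact (measureReal_eq_measureReal_iff
        (measure_lt_top_of_subset inter_subset_right hf.compact.isCompact.measure_lt_top.ne).ne
        (measure_lt_top_of_subset inter_subset_right hf.compact.isCompact.measure_lt_top.ne).ne).1
        h1)
    (β := s * (∫ x, areaDensity f e ν x ∂σ) + C₁ * s ^ 2)
    (fun θ hθ => by
      filter_upwards [hex.eventually_one _ hf.compact.isCompact hf.supp] with k hk φ hφ hle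
      have := hS.integral_image_divergence_le hG h.measurable hf.supp hK
        (hex.contDiff k).continuous (hex.compact k) (hex.supp k) (hex.mem_Icc k) hk hφ hle
      linarith)
  rw [wallCost_congr (isClosed_tsupport f) hf.supp (image_shear_sdiff hS),
    hS.integral_gravity_image hG h.measurable hf.supp] at hcomp
  simp only [wallCost, sdiff_self, area, measure_empty, ENNReal.toReal_zero,
    mul_zero, add_zero, sub_zero] at hcomp
  rw [firstVar_eq hG hf]
  linarith

end FirstVariation

/-! ### Vertical fields of unit flux -/

section UnitFlux

variable {n : ℕ} {R : EReal} {F : ℝ} {L : Set (Space n)}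

lemma tendsto_setIntegral_escape {E : Set (Space n)} (hE : volume E < ⊤)
    {G : ℕ → Space n → ℝ} (hG : ∀ N, Continuous (G N)) {C : ℝ} (hC : ∀ N x, |G N x| ≤ C)
    (h0 : ∀ x, ∀ᶠ N in atTop, G N x = 0) :
    Tendsto (fun N => ∫ x in E, G N x) atTop (𝓝 0) := by
  have hfin : IsFiniteMeasure (volume.restrict E) := ⟨by rwa [Measure.restrict_apply_univ]⟩
  have h := tendsto_integral_of_dominated_convergence (μ := volume.restrict E) (fun _ => C)
    (F := G) (f := fun _ => 0) (fun N => (hG N).aestronglyMeasurable) (integrable_const C)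
    (fun N => .of_forall fun x => hC N x)
    (.of_forall fun x => tendsto_const_nhds.congr' ((h0 x).mono fun N h => h.symm))
  simpa using h

lemma exists_annulus_point (hn : 1 ≤ n) (hR : 1 < R) (hT : R ≠ ⊤) (x₁ : Horiz n) :
    ∃ x₀ : Horiz n, x₀ ≠ x₁ ∧ 1 < ‖x₀‖ ∧ ‖x₀‖ < R.toReal := by
  have h1 := toReal_gt_one hR hT
  set m := (1 + R.toReal) / 2
  have hm : 1 < m ∧ m < R.toReal := ⟨by simp only [m]; linarith, by simp only [m]; linarith⟩
  set u : Horiz n := EuclideanSpace.single ⟨0, hn⟩ m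
  have hu : ‖u‖ = m := by
    rw [PiLp.norm_single, Real.norm_of_nonneg (by linarith)]
  by_cases hx : u = x₁
  · refine ⟨-u, fun h => ?_, by rw [norm_neg, hu]; exact hm.1, by rw [norm_neg, hu]; exact hm.2⟩
    have h0 := congrArg (fun v : Horiz n => v ⟨0, hn⟩) (hx.trans h.symm)
    simp [u] at h0
    linarith
  · exact ⟨u, hx, by rw [hu]; exact hm.1, by rw [hu]; exact hm.2⟩

/-- There is a vertical field of unit flux, supported away from a given vertical line. It lifts the
liquid over a small disc, deep inside of it. -/
lemma exists_unit_flux (hn : 1 ≤ n) (hR : 1 < R) (hT : R ≠ ⊤) (hL : MeasurableSet L)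
    (h1 : volume (L \ regionBelow R F) < ⊤)
    (h2 : volume (regionBelow R F \ L) < ⊤) (x₁ : Horiz n) :
    ∃ f : Space n → ℝ, IsBump (region R) f ∧ ∫ x in L, fderiv ℝ f x ez = 1 ∧
      ∃ ρ > 0, ∀ x ∈ tsupport f, ρ ≤ ‖horiz x - x₁‖ := by
  obtain ⟨x₀, hne, hx1, hxR⟩ := exists_annulus_point hn hR hT x₁
  have hd : 0 < ‖x₀ - x₁‖ := norm_pos_iff.2 (sub_ne_zero.2 hne)
  obtain ⟨r, hr0, hra, hrb, hrc⟩ : ∃ r > 0, r < ‖x₀‖ - 1 ∧ r < R.toReal - ‖x₀‖ ∧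
      r < ‖x₀ - x₁‖ := by
    obtain ⟨r, hr0, hr⟩ := exists_between (lt_min (lt_min (sub_pos.2 hx1) (sub_pos.2 hxR)) hd)
    exact ⟨r, hr0, (hr.trans_le (min_le_left _ _)).trans_le (min_le_left _ _),
      (hr.trans_le (min_le_left _ _)).trans_le (min_le_right _ _), hr.trans_le (min_le_right _ _)⟩
  let b : ContDiffBump x₀ := ⟨r / 2, r, by linarith, by linarith⟩
  set a : Space n → ℝ := fun x => b (horiz x) with ha
  have has : ContDiff ℝ ∞ a := b.contDiff.comp contDiff_horiz
  have ha0 : ∀ x, 0 ≤ a x := fun x => b.nonneg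
  have ha1 : ∀ x, a x ≤ 1 := fun x => b.le_one
  have hasupp : ∀ x, a x ≠ 0 → ‖horiz x - x₀‖ ≤ r := fun x hx => by
    have : horiz x ∈ Function.support b := hx
    rw [b.support_eq, mem_ball_iff_norm] at this
    exact this.le
  have hareg : ∀ x, ‖horiz x - x₀‖ ≤ r → x ∈ region R := fun x hx => by
    have e1 := norm_sub_norm_le x₀ (horiz x)
    have e2 := norm_sub_norm_le (horiz x) x₀
    rw [norm_sub_rev] at e1
    exact ⟨by linarith, (coe_lt_iff hR hT _).2 (by linarith)⟩
  -- the lower and the upper end of the long cylinder carry the derivatives `G₁` and `-G₂`; as `N`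
  -- grows, the air below `F` does not see `G₁` and the liquid above `F` does not see `G₂`
  obtain ⟨Ms, hMs, hMs'⟩ := exists_deriv_step_le
  have hds : Continuous (deriv step) := continuous_deriv_step
  set f : ℕ → Space n → ℝ := fun N x => a x * (step (N + height x) * step (N - height x)) with hf
  set G₁ : ℕ → Space n → ℝ := fun N x => a x * deriv step (N + height x) with hG1
  set G₂ : ℕ → Space n → ℝ := fun N x => a x * deriv step (N - height x) with hG2
  have hG1c : ∀ N, Continuous (G₁ N) := fun N =>
    has.continuous.mul (hds.comp (continuous_const.add continuous_height))
  have hG2c : ∀ N, Continuous (G₂ N) := fun N =>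
    has.continuous.mul (hds.comp (continuous_const.sub continuous_height))
  have hbd : ∀ x t, |a x * deriv step t| ≤ Ms := fun x t => by
    rw [abs_of_nonneg (mul_nonneg (ha0 x) (deriv_step_nonneg t))]
    exact (mul_le_of_le_one_left (deriv_step_nonneg t) (ha1 x)).trans (hMs' t)
  have hevN : ∀ c : ℝ, ∀ᶠ N : ℕ in atTop, c < N := fun c =>
    tendsto_natCast_atTop_atTop.eventually_gt_atTop c
  have hGz : ∀ x t, a x * deriv step t ≠ 0 → ‖horiz x - x₀‖ ≤ r ∧ t ≤ 1 ∧ 1 / 2 ≤ t :=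
    fun x t hx => by
      refine ⟨hasupp x (left_ne_zero_of_mul hx), ?_, ?_⟩ <;>
      · by_contra! hc
        exact right_ne_zero_of_mul hx (deriv_step_eq_zero
          (by first | exact Or.inr hc | exact Or.inl hc))
  have hcompact : ∀ M : ℝ, IsCompact {x : Space n | ‖horiz x - x₀‖ ≤ r ∧ |height x| ≤ M} := by
    intro M
    refine isCompact_of_isClosed_isBounded ?_ ?_
    · exact (isClosed_le (continuous_horiz.sub continuous_const).norm continuous_const).inter
        (isClosed_le continuous_height.abs continuous_const)
    · refine (isBounded_closedBall (x := (0 : Space n)) (r := ‖x₀‖ + r + |M|)).subset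
        fun x hx => mem_closedBall_zero_iff.2 ?_
      have e1 := norm_sq_space x
      have e2 : ‖horiz x‖ ≤ ‖x₀‖ + r := by
        have := norm_sub_norm_le (horiz x) x₀
        linarith [hx.1]
      have e3 : |height x| ≤ |M| := hx.2.trans (le_abs_self M)
      rw [← sq_abs (height x)] at e1
      by_contra! hc
      have := abs_nonneg (height x)
      have := norm_nonneg (horiz x)
      nlinarith [mul_nonneg (norm_nonneg (horiz x)) (abs_nonneg (height x))]
  -- the supports of `f N` lie in compact cylinders over the disc
  have hfsupp : ∀ N : ℕ, tsupport (f N) ⊆ {x : Space n | ‖horiz x - x₀‖ ≤ r ∧ |height x| ≤ N} :=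
    fun N => closure_minimal (fun x hx => by
      refine ⟨hasupp x (left_ne_zero_of_mul hx), ?_⟩
      have hx' := right_ne_zero_of_mul hx
      rw [abs_le]
      constructor
      · by_contra! hc
        exact left_ne_zero_of_mul hx' (step_of_le (by linarith))
      · by_contra! hc
        exact right_ne_zero_of_mul hx' (step_of_le (by linarith))) (hcompact N).isClosed
  have hfb : ∀ N, IsBump (region R) (f N) := fun N => by
    refine ⟨has.mul ?_, (hcompact N).of_isClosed_subset (isClosed_tsupport _) (hfsupp N),
      fun x hx => hareg x (hfsupp N hx).1⟩
    exact (contDiff_step.comp (contDiff_const.add contDiff_height)).mul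
      (contDiff_step.comp (contDiff_const.sub contDiff_height))
  have hG1i : ∀ N, Integrable (G₁ N) := fun N => by
    refine (hG1c N).integrable_of_hasCompactSupport
      (HasCompactSupport.of_support_subset_isCompact (hcompact (N + 1)) fun x hx => ?_)
    have := hGz x _ hx
    exact ⟨this.1, abs_le.2 ⟨by linarith, by linarith [(Nat.cast_nonneg N : (0 : ℝ) ≤ N)]⟩⟩
  have hG2i : ∀ N, Integrable (G₂ N) := fun N => by
    refine (hG2c N).integrable_of_hasCompactSupport
      (HasCompactSupport.of_support_subset_isCompact (hcompact (N + 1)) fun x hx => ?_)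
    have := hGz x _ hx
    exact ⟨this.1, abs_le.2 ⟨by linarith [(Nat.cast_nonneg N : (0 : ℝ) ≤ N)], by linarith⟩⟩
  have hderiv : ∀ N : ℕ, 1 ≤ N → ∀ x, fderiv ℝ (f N) x ez = G₁ N x - G₂ N x := by
    intro N hN x
    have hN' : (1 : ℝ) ≤ N := by exact_mod_cast hN
    have hh : HasFDerivAt (height : Space n → ℝ) (fderiv ℝ height x) x :=
      ((contDiff_height (k := 1)).differentiable one_ne_zero x).hasFDerivAt
    have hs : Differentiable ℝ step := contDiff_step.differentiable (by simp)
    have d1 := (hs (N + height x)).hasDerivAt.comp_hasFDerivAt x (hh.const_add (N : ℝ))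
    have d2 := (hs (N - height x)).hasDerivAt.comp_hasFDerivAt x (hh.const_sub (N : ℝ))
    have d0 := ((has.differentiable (by simp)) x).hasFDerivAt
    have d := d0.mul (d1.mul d2)
    have haz : fderiv ℝ a x ez = 0 := fderiv_eq_zero_of_invariant (has.differentiable (by simp) x)
      fun t => by simp only [ha, horiz_add, horiz_smul, horiz_ez, smul_zero, add_zero]
    have e := congrArg (fun A => A (ez : Space n)) d.fderiv
    refine (show fderiv ℝ (f N) x ez = _ from e).trans ?_
    simp only [add_apply, smul_apply, smul_eq_mul, haz,
      neg_apply, fderiv_height, height_ez, mul_one, mul_zero, add_zero,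
      Function.comp, hG1, hG2]
    have k : ∀ t, deriv step (N + t) * step (N - t) = deriv step (N + t) := fun t => by
      by_cases hz : N + t ≤ 1
      · rw [step_of_ge (by linarith), mul_one]
      · rw [deriv_step_eq_zero (Or.inr (not_le.1 hz)), zero_mul]
    have k2 := k (-height x)
    rw [sub_neg_eq_add, ← sub_eq_add_neg] at k2
    linear_combination a x * k (height x) - a x * k2
  set c := ∫ x, G₁ 0 x with hc
  have hcpos : 0 < c := by
    obtain ⟨t, ht⟩ : ∃ t, deriv step t ≠ 0 := by
      by_contra! h0
      have := is_const_of_deriv_eq_zero (contDiff_step.differentiable (by simp)) h0 0 1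
      rw [step_of_le (by norm_num), step_of_ge le_rfl] at this
      exact zero_ne_one this
    refine (hG1c 0).integral_pos_of_hasCompactSupport_nonneg_nonzero (x := join x₀ t)
      (HasCompactSupport.of_support_subset_isCompact (hcompact 1) fun x hx => ?_)
      (fun x => mul_nonneg (ha0 x) (deriv_step_nonneg _)) ?_
    · have := hGz x _ hx
      simp only [Nat.cast_zero, zero_add] at this
      exact ⟨this.1, abs_le.2 ⟨by linarith, by linarith⟩⟩
    · simp only [hG1, ha, horiz_join, height_join, Nat.cast_zero, zero_add]
      refine mul_ne_zero ?_ ht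
      rw [b.one_of_mem_closedBall (mem_closedBall_self b.rIn_pos.le)]
      exact one_ne_zero
  have hcN : ∀ N, ∫ x, G₁ N x = c := by
    intro N
    rw [hc, ← integral_add_right_eq_self (G₁ 0) ((N : ℝ) • (ez : Space n))]
    refine integral_congr_ae (.of_forall fun x => ?_)
    simp only [hG1, ha, horiz_add, horiz_smul, horiz_ez, smul_zero, add_zero, height_add,
      height_smul, height_ez, mul_one, Nat.cast_zero, add_comm]
  have lim1 := tendsto_setIntegral_escape h2 hG1c (fun N x => hbd x _) fun x => by
    filter_upwards [hevN (1 - height x)] with N hN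
    by_contra h0
    linarith [(hGz x _ h0).2.1]
  have lim2 := tendsto_setIntegral_escape h1 hG2c (fun N x => hbd x _) fun x => by
    filter_upwards [hevN (1 + height x)] with N hN
    by_contra h0
    linarith [(hGz x _ h0).2.1]
  have hval : ∀ᶠ N : ℕ in atTop, ∫ x in L, fderiv ℝ (f N) x ez
      = c - (∫ x in regionBelow R F \ L, G₁ N x) - ∫ x in L \ regionBelow R F, G₂ N x := by
    filter_upwards [hevN (1 - F), hevN (1 + F), eventually_ge_atTop 1] with N hN1 hN2 hN3
    have e0 : ∫ x in L, fderiv ℝ (f N) x ez = (∫ x in L, G₁ N x) - ∫ x in L, G₂ N x := by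
      rw [← integral_sub (hG1i N).integrableOn (hG2i N).integrableOn]
      exact integral_congr_ae (.of_forall fun x => hderiv N hN3 x)
    have e1 : ∫ x in L, G₂ N x = ∫ x in L \ regionBelow R F, G₂ N x :=
      setIntegral_eq_of_subset_of_forall_sdiff_eq_zero hL sdiff_subset fun x hx => by
        by_contra h0
        have hb : x ∈ regionBelow R F := by
          by_contra hc'
          exact hx.2 ⟨hx.1, hc'⟩
        linarith [(hGz x _ h0).2.1, hb.2]
    have e2 : ∫ x in Lᶜ, G₁ N x = ∫ x in regionBelow R F \ L, G₁ N x :=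
      setIntegral_eq_of_subset_of_forall_sdiff_eq_zero hL.compl (fun x hx => hx.2) fun x hx => by
        by_contra h0
        have hz := hGz x _ h0
        exact hx.2 ⟨⟨hareg x hz.1, by linarith⟩, hx.1⟩
    have e3 := integral_add_compl hL (hG1i N)
    rw [hcN N] at e3
    rw [e0, e1, ← e2]
    linarith
  have hlim : Tendsto (fun N : ℕ => ∫ x in L, fderiv ℝ (f N) x ez) atTop (𝓝 c) := by
    have := (tendsto_const_nhds (x := c)).sub lim1 |>.sub lim2
    rw [sub_zero, sub_zero] at this
    exact this.congr' (hval.mono fun N h => h.symm)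
  obtain ⟨N, hN⟩ := (hlim.eventually (lt_mem_nhds hcpos)).exists
  set v := ∫ x in L, fderiv ℝ (f N) x ez
  have hb : IsBump (region R) fun x => 0 + v⁻¹ * f N x :=
    isBump_zero.add_mul (hfb N) v⁻¹
  simp only [zero_add] at hb
  refine ⟨_, hb, ?_, ‖x₀ - x₁‖ - r, by linarith, fun x hx => ?_⟩
  · have : ∀ x, fderiv ℝ (fun x => v⁻¹ * f N x) x ez = v⁻¹ * fderiv ℝ (f N) x ez := fun x => by
      rw [fderiv_const_mul ((hfb N).contDiff.differentiable one_ne_zero x)]; rfl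
    simp only [this]
    rw [integral_const_mul]
    exact inv_mul_cancel₀ hN.ne'
  · have hx' : x ∈ tsupport (f N) := closure_mono (fun y hy => right_ne_zero_of_mul hy) hx
    have e1 := (hfsupp N hx').1
    have e2 := norm_sub_le_norm_sub_add_norm_sub x₀ (horiz x) x₁
    rw [norm_sub_rev x₀ (horiz x)] at e2
    linarith

end UnitFlux

/-! ### Existence of the multiplier -/

section Multiplier

variable {n : ℕ} {P : Parameters} {R : EReal} {F : ℝ} {L : Set (Space n)}
  {σ : Measure (Space n)} {ν : Space n → Space n} {f f₀ : Space n → ℝ}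

lemma IsStable.firstVar_eq_mul_of_ne (h : IsStable P R F L σ ν) (hf₀ : IsBump (region R) f₀)
    (h₀ : volVar σ ν f₀ ez = 1) (hf : IsBump (region R) f) (hV : volVar σ ν f ez ≠ 0)
    (e : Space n) :
    firstVar P.g F σ ν f e = firstVar P.g F σ ν f₀ ez * volVar σ ν f e := by
  have hG := h.gaussGreen
  have h1 : firstVar P.g F σ ν (fun x => f x + -volVar σ ν f ez * f₀ x) ez = 0 :=
    h.firstVar_eq_zero (hf.add_mul hf₀ _) fun _ => by
      rw [volVar_add_mul hG hf hf₀, h₀]; ring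
  rw [firstVar_add_mul hG hf hf₀] at h1
  have h2 : firstVar P.g F σ ν f (e + -(volVar σ ν f e / volVar σ ν f ez) • ez) = 0 :=
    h.firstVar_eq_zero hf fun _ => by
      rw [volVar_add_smul hG hf]
      field_simp
      ring
  rw [firstVar_add_smul hG hf] at h2
  have h3 : firstVar P.g F σ ν f ez = volVar σ ν f ez * firstVar P.g F σ ν f₀ ez := by linarith
  rw [h3] at h2
  field_simp at h2
  linarith

/-- The first variation is a multiple of the variation of the volume. -/
lemma IsStable.firstVar_eq_mul (h : IsStable P R F L σ ν) (hf₀ : IsBump (region R) f₀)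
    (h₀ : volVar σ ν f₀ ez = 1) (hf : IsBump (region R) f) (e : Space n) :
    firstVar P.g F σ ν f e = firstVar P.g F σ ν f₀ ez * volVar σ ν f e := by
  by_cases hV : volVar σ ν f ez = 0
  · have hG := h.gaussGreen
    have h1 := h.firstVar_eq_mul_of_ne hf₀ h₀ (hf.add_mul hf₀ 1)
      (by rw [volVar_add_mul hG hf hf₀, hV, h₀]; norm_num) e
    have h2 := h.firstVar_eq_mul_of_ne hf₀ h₀ hf₀ (by rw [h₀]; exact one_ne_zero) e
    rw [firstVar_add_mul hG hf hf₀, volVar_add_mul hG hf hf₀] at h1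
    linarith
  · exact h.firstVar_eq_mul_of_ne hf₀ h₀ hf hV e

/-- A linear relation between the first variations along fields `f e` extends to all fields. -/
lemma isLagrangeMultiplier_of_forall (hG : IsGaussGreen L (region R) σ ν) {lam : ℝ}
    (h : ∀ f, IsBump (region R) f → ∀ e, firstVar P.g F σ ν f e = lam * volVar σ ν f e) :
    IsLagrangeMultiplier P R F L lam := by
  refine ⟨σ, ν, hG, fun ξ hξ hc hs => ?_⟩
  have hb : ∀ i, IsBump (region R) fun x => ξ x i := fun i => by
    have hsup : tsupport (fun x => ξ x i) ⊆ tsupport ξ := closure_mono fun x hx h0 => hx (by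
      simp only [h0, PiLp.zero_apply])
    exact ⟨(contDiff_euclidean.1 hξ i), hc.mono' (subset_closure.trans hsup), hsup.trans hs⟩
  have hd : ∀ x v i, fderiv ℝ (fun x => ξ x i) x v = fderiv ℝ ξ x v i := fun x v i => by
    have h1 := (hξ.differentiable (by simp) x).hasFDerivAt
    have h2 : HasFDerivAt (fun x => ξ x i)
        ((EuclideanSpace.proj i : Space n →L[ℝ] ℝ).comp (fderiv ℝ ξ x)) x :=
      (EuclideanSpace.proj i : Space n →L[ℝ] ℝ).hasFDerivAt.comp x h1
    rw [h2.fderiv]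
    rfl
  have hinner : ∀ x y : Space n, ⟪x, y⟫ = ∑ i, x i * ⟪EuclideanSpace.single i (1 : ℝ), y⟫ := by
    intro x y
    rw [PiLp.inner_apply]
    refine Finset.sum_congr rfl fun i _ => ?_
    rw [EuclideanSpace.inner_single_left]
    simp [mul_comm]
  have e1 : ∀ x, divergence ξ x - ⟪ν x, fderiv ℝ ξ x (ν x)⟫ + P.g * (height x - F) * ⟪ξ x, ν x⟫
      = ∑ i, varDensity P.g F (fun x => ξ x i) (EuclideanSpace.single i 1) ν x := by
    intro x
    simp only [varDensity, areaDensity, hd, Finset.sum_add_distrib, Finset.sum_sub_distrib]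
    congr 1
    · congr 1
      rw [real_inner_comm, hinner]
      refine Finset.sum_congr rfl fun i _ => ?_
      rw [real_inner_comm]; ring
    · rw [hinner, Finset.mul_sum]
      exact Finset.sum_congr rfl fun i _ => by ring
  have e2 : ∀ x, ⟪ξ x, ν x⟫ = ∑ i, ξ x i * ⟪EuclideanSpace.single i (1 : ℝ), ν x⟫ :=
    fun x => hinner _ _
  refine (integral_congr_ae (.of_forall e1)).trans ?_
  rw [integral_congr_ae (.of_forall e2),
    integral_finsetSum _ fun i _ => hG.integrable_varDensity (hb i) _ P.g F,
    integral_finsetSum _ fun i _ => hG.integrable_flux (hb i) _, Finset.mul_sum]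
  exact Finset.sum_congr rfl fun i _ => h _ (hb i) _

/-- The multiplier, with the property of it that is used in the comparison arguments: near any given
vertical line the volume can be changed at a rate whose cost in energy is `lam`. -/
lemma IsStable.exists_multiplier (hn : 1 ≤ n) (h : IsStable P R F L σ ν) :
    ∃ lam : ℝ, (R = ⊤ → lam = 0) ∧ IsLagrangeMultiplier P R F L lam ∧
      (R ≠ ⊤ → ∀ x₁ : Horiz n, ∃ f : Space n → ℝ, IsBump (region R) f ∧
        ∫ x in L, fderiv ℝ f x ez = 1 ∧ firstVar P.g F σ ν f ez = lam ∧
        ∃ ρ > 0, ∀ x ∈ tsupport f, ρ ≤ ‖horiz x - x₁‖) := by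
  have hG := h.gaussGreen
  by_cases hT : R = ⊤
  · refine ⟨0, fun _ => rfl, isLagrangeMultiplier_of_forall hG fun f hf e => ?_,
      fun hT' => absurd hT hT'⟩
    rw [zero_mul]
    exact h.firstVar_eq_zero hf fun hT' => absurd hT hT'
  · have h1 := h.stable.1.volume_finite hT
    have h2 : volume (regionBelow R F \ L) < ⊤ := h.stable.1.volume_constraint hT ▸ h1
    have hflux : ∀ f, IsBump (region R) f → volVar σ ν f ez = ∫ x in L, fderiv ℝ f x ez :=
      fun f hf => (hG.integral_fderiv hf.contDiff hf.compact hf.supp ez).symm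
    obtain ⟨f₀, hf₀, hv₀, -⟩ := exists_unit_flux hn h.radius hT h.measurable h1 h2 0
    rw [← hflux f₀ hf₀] at hv₀
    have hmul : ∀ f, IsBump (region R) f → ∀ e,
        firstVar P.g F σ ν f e = firstVar P.g F σ ν f₀ ez * volVar σ ν f e :=
      fun f hf e => h.firstVar_eq_mul hf₀ hv₀ hf e
    refine ⟨firstVar P.g F σ ν f₀ ez, fun hT' => absurd hT' hT,
      isLagrangeMultiplier_of_forall hG hmul, fun _ x₁ => ?_⟩
    obtain ⟨f, hf, hv, hρ⟩ := exists_unit_flux hn h.radius hT h.measurable h1 h2 x₁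
    exact ⟨f, hf, hv, by rw [hmul f hf, hflux f hf, hv, mul_one], hρ⟩

end Multiplier

/-! ### Passing to the complement in the region -/

section Side

variable {n : ℕ} {R : EReal} {A B K M D : Set (Space n)} {t : Bool}

/-- The liquid (`t = true`) or the air (`t = false`): removing a piece of the air amounts to adding
it to the liquid. -/
def side (R : EReal) (t : Bool) (A : Set (Space n)) : Set (Space n) :=
  bif t then A else region R \ A

/-- The sign of the contribution of a side to the divergence theorem. -/
def sideSign (t : Bool) : ℝ := bif t then 1 else -1

@[simp] lemma side_true : side R true A = A := rfl

@[simp] lemma side_false : side R false A = region R \ A := rfl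

@[simp] lemma sideSign_true : sideSign true = 1 := rfl

@[simp] lemma sideSign_false : sideSign false = -1 := rfl

lemma abs_sideSign : |sideSign t| = 1 := by cases t <;> simp

lemma measurableSet_side (hA : MeasurableSet A) : MeasurableSet (side R t A) := by
  cases t
  · exact (measurableSet_region R).diff hA
  · exact hA

lemma side_subset (hA : A ⊆ region R) : side R t A ⊆ region R := by
  cases t
  · exact sdiff_subset
  · exact hA

lemma side_inter_congr (h : A ∩ K = B ∩ K) : side R t A ∩ K = side R t B ∩ K := by
  cases t
  · ext q
    have := Set.ext_iff.1 h q
    simp only [mem_inter_iff, side_false, Set.mem_sdiff] at this ⊢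
    tauto
  · exact h

lemma mem_side_side_sdiff (hM : M ⊆ region R) {q : Space n} (hq : q ∉ D) :
    q ∈ side R t (side R t M \ D) ↔ q ∈ M := by
  cases t
  · simp only [side_false, Set.mem_sdiff]
    have := @hM q
    tauto
  · simp [hq]

lemma integral_side_divergence (hA : MeasurableSet A) (hAR : A ⊆ region R)
    {φ : Space n → Space n} (hφ : IsTest (region R) φ) :
    ∫ x in side R t A, divergence φ x = sideSign t * ∫ x in A, divergence φ x := by
  cases t
  · have h0 : ∫ x in region R, divergence φ x = 0 := by
      rw [setIntegral_eq_integral_of_forall_compl_eq_zero fun x hx =>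
        divergence_eq_zero_of_notMem fun h => hx (hφ.supp h)]
      exact integral_divergence_eq_zero hφ.contDiff hφ.compact
    rw [side_false, setIntegral_sdiff hA hφ.integrable_div.integrableOn hAR, h0]
    simp
  · simp

lemma LocallyCaccioppoli.sdiff {U : Set (Space n)} (hB : MeasurableSet B) (hBA : B ⊆ A)
    (h : LocallyCaccioppoli A U) (h' : LocallyCaccioppoli B U) : LocallyCaccioppoli (A \ B) U := by
  intro V hV hc hs
  have h1 := (h V hV hc hs).ne
  have h2 := (h' V hV hc hs).ne
  refine (perimeter_le (B := (perimeter A V).toReal + (perimeter B V).toReal)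
    fun φ hφ hφ1 => ?_).trans_lt ENNReal.ofReal_lt_top
  have e1 := integral_div_le_perimeter hφ hφ1 h1
  have e2 := integral_div_le_perimeter hφ.neg (fun x => by rw [norm_neg]; exact hφ1 x) h2
  simp only [divergence_neg] at e2
  rw [integral_neg] at e2
  rw [setIntegral_sdiff hB hφ.integrable_div.integrableOn hBA]
  linarith

lemma locallyCaccioppoli_side (hR : 1 < R) {U : Set (Space n)} (hA : MeasurableSet A)
    (hAR : A ⊆ region R) (h : LocallyCaccioppoli A U) : LocallyCaccioppoli (side R t A) U := by
  cases t
  · obtain ⟨w, hw⟩ := exists_isBVLimit_region (n := n) hR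
    exact LocallyCaccioppoli.sdiff hA hAR (hw.locallyCaccioppoli.mono (subset_univ _)) h
  · exact h

lemma integral_side_sdiff (hMR : M ⊆ region R) (hD : MeasurableSet D)
    (hDM : D ⊆ side R t M) (hDK : D ⊆ K) {h : Space n → ℝ}
    (hint : IntegrableOn h K) :
    ∫ x in side R t (side R t M \ D) ∩ K, h x
      = (∫ x in M ∩ K, h x) - sideSign t * ∫ x in D, h x := by
  cases t
  · have e : side R false (side R false M \ D) ∩ K = (M ∩ K) ∪ D := by
      ext q
      have h1 := @hMR q
      have h2 := @hDM q
      have h3 := @hDK q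
      simp only [side_false, mem_inter_iff, Set.mem_sdiff, mem_union] at h2 ⊢
      tauto
    have hdisj : Disjoint (M ∩ K) D :=
      Set.disjoint_left.2 fun q hq hqD => (hDM hqD).2 hq.1
    rw [e, setIntegral_union hdisj hD (hint.mono_set inter_subset_right) (hint.mono_set hDK)]
    simp
  · have e : side R true (side R true M \ D) ∩ K = (M ∩ K) \ D := by
      ext q
      simp only [side_true, mem_inter_iff, Set.mem_sdiff]
      tauto
    have hDMK : D ⊆ M ∩ K := fun q hq => ⟨hDM hq, hDK hq⟩
    rw [e, setIntegral_sdiff hD (hint.mono_set inter_subset_right) hDMK]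
    simp

lemma integral_inter_modify {L T : Set (Space n)} (hM : MeasurableSet M) (hL : MeasurableSet L)
    (hT : MeasurableSet T) (hTK : T ⊆ K) (hK : MeasurableSet K) (h : M \ T = L \ T)
    {f : Space n → ℝ} (hint : IntegrableOn f K) :
    (∫ x in M ∩ K, f x) - ∫ x in L ∩ K, f x = (∫ x in M ∩ T, f x) - ∫ x in L ∩ T, f x := by
  have e : ∀ E : Set (Space n), MeasurableSet E →
      ∫ x in E ∩ K, f x = (∫ x in E ∩ T, f x) + ∫ x in (E \ T) ∩ K, f x := fun E hE => by
    have e0 : E ∩ K = (E ∩ T) ∪ ((E \ T) ∩ K) := by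
      ext q
      have := @hTK q
      simp only [mem_inter_iff, mem_union, Set.mem_sdiff]
      tauto
    have hdisj : Disjoint (E ∩ T) ((E \ T) ∩ K) :=
      Set.disjoint_left.2 fun q hq hq' => hq'.1.2 hq.2
    conv_lhs => rw [e0]
    exact setIntegral_union hdisj ((hE.diff hT).inter hK)
      (hint.mono_set (inter_subset_right.trans hTK)) (hint.mono_set inter_subset_right)
  rw [e M hM, e L hL, h]
  ring

end Side

/-! ### Cutting off a cap -/

section Cap

variable {n : ℕ} {N N' : Set (Space n)} {p : Space n} {u : Space n → ℝ} {X : Space n → Space n}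
  {ρ ρ' δ : ℝ}

/-- The set `N` lies strictly below the level surface `{u = 0}` near its point `p`, and `X` is the
normal field of the level surfaces of `u`. -/
structure IsTouching (N : Set (Space n)) (p : Space n) (u : Space n → ℝ) (X : Space n → Space n)
    (ρ : ℝ) : Prop where
  radius_pos : 0 < ρ
  contDiff : ContDiff ℝ 1 u
  contDiff_field : ContDiff ℝ 1 X
  norm_field : ∀ q ∈ ball p ρ, ‖X q‖ ≤ 1
  grad : ∀ q ∈ ball p ρ, fderiv ℝ u q (X q) = ‖fderiv ℝ u q‖
  center : u p = 0
  below : ∀ q ∈ N ∩ ball p ρ, u q ≤ -‖q - p‖ ^ 4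

/-- The cap of `N` above the level `-δ`. -/
def cap (N : Set (Space n)) (u : Space n → ℝ) (p : Space n) (ρ δ : ℝ) : Set (Space n) :=
  N ∩ (ball p ρ ∩ {q | -δ < u q})

lemma IsTouching.mono (h : IsTouching N p u X ρ) (h0 : 0 < ρ') (hle : ρ' ≤ ρ)
    (hN : N' ∩ ball p ρ' = N ∩ ball p ρ') : IsTouching N' p u X ρ' where
  radius_pos := h0
  contDiff := h.contDiff
  contDiff_field := h.contDiff_field
  norm_field q hq := h.norm_field q (ball_subset_ball hle hq)
  grad q hq := h.grad q (ball_subset_ball hle hq)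
  center := h.center
  below q hq := h.below q (by
    rw [hN] at hq
    exact ⟨hq.1, ball_subset_ball hle hq.2⟩)

lemma IsTouching.measurableSet_cap (h : IsTouching N p u X ρ) (hN : MeasurableSet N) :
    MeasurableSet (cap N u p ρ δ) :=
  hN.inter (isOpen_ball.measurableSet.inter
    (isOpen_lt continuous_const h.contDiff.continuous).measurableSet)

lemma IsTouching.norm_sub_lt (h : IsTouching N p u X ρ) {r : ℝ} (hr : 0 ≤ r) (hδ : δ ≤ r ^ 4)
    {q : Space n} (hq : q ∈ cap N u p ρ δ) : ‖q - p‖ < r := by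
  have h1 := h.below q ⟨hq.1, hq.2.1⟩
  have h2 : -δ < u q := hq.2.2
  exact lt_of_pow_lt_pow_left₀ 4 hr (by linarith)

lemma IsTouching.cap_eq (h : IsTouching N p u X ρ) (h0 : 0 < ρ') (hle : ρ' ≤ ρ)
    (hN : N' ∩ ball p ρ' = N ∩ ball p ρ') (hδ : δ ≤ ρ' ^ 4) :
    cap N' u p ρ' δ = cap N u p ρ δ := by
  ext q
  constructor
  · rintro ⟨h1, h2, h3⟩
    have : q ∈ N ∩ ball p ρ' := hN ▸ ⟨h1, h2⟩
    exact ⟨this.1, ball_subset_ball hle h2, h3⟩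
  · intro hq
    have hb : q ∈ ball p ρ' := mem_ball_iff_norm.2 (h.norm_sub_lt h0.le hδ hq)
    have : q ∈ N' ∩ ball p ρ' := hN ▸ ⟨hq.1, hb⟩
    exact ⟨this.1, hb, hq.2.2⟩

/-- Removing a cap decreases the area by at least the flux through the cap of the normal field
of the level surfaces. -/
lemma IsTouching.integral_div_sdiff_cap_le (h : IsTouching N p u X ρ) (hN : MeasurableSet N)
    (hδ : δ < (ρ / 2) ^ 4) {η : Space n → ℝ} (hη : ContDiff ℝ 1 η) (hηc : HasCompactSupport η)
    (hη0 : ∀ x, 0 ≤ η x) {B : ℝ}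
    (hB : ∀ φ, ContDiff ℝ 1 φ → (∀ x, ‖φ x‖ ≤ η x) → ∫ x in N, divergence φ x ≤ B)
    {φ : Space n → Space n} (hφ : ContDiff ℝ 1 φ) (hle : ∀ x, ‖φ x‖ ≤ η x) :
    ∫ x in N \ cap N u p ρ δ, divergence φ x
      ≤ B - ∫ x in cap N u p ρ δ, divergence (fun y => η y • X y) x := by
  have hρ := h.radius_pos
  obtain ⟨χ, hχ, -, hχs, hχ01, hχ1⟩ := exists_cutoff (isCompact_closedBall p (ρ / 2))
    isOpen_ball (closedBall_subset_ball (show ρ / 2 < ρ by linarith))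
  have hχ' : ContDiff ℝ 1 χ := hχ.of_le (by norm_cast)
  have hu : ContDiff ℝ 1 fun x => u x + δ := h.contDiff.add contDiff_const
  have hst : ∀ j : ℕ, ContDiff ℝ 1 fun x => step (j * (u x + δ)) := fun j =>
    (contDiff_step.of_le (by norm_cast)).comp (contDiff_const.mul hu)
  have hχnhds : ∀ x ∈ closedBall p (ρ / 2), ∀ᶠ y in 𝓝 x, χ y = 1 := fun x hx =>
    eventually_nhdsSet_iff_forall.1 hχ1 x hx
  -- outside of the smaller ball, `N` lies below the level `-δ`
  have hout : ∀ x ∈ N, x ∈ ball p ρ → x ∉ closedBall p (ρ / 2) → u x + δ < 0 := by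
    intro x hxN hxb hx
    have h1 := h.below x ⟨hxN, hxb⟩
    rw [mem_closedBall_iff_norm, not_le] at hx
    have h2 : (ρ / 2) ^ 4 < ‖x - p‖ ^ 4 := by gcongr
    linarith
  refine integral_div_diff_le hN (h.measurableSet_cap hN) inter_subset_left
    (w := fun j x => step (j * (u x + δ)) * χ x) (fun j => (hst j).mul hχ')
    (fun j x => ⟨mul_nonneg (step_mem_Icc _).1 (hχ01 x).1,
      mul_le_one₀ (step_mem_Icc _).2 (hχ01 x).1 (hχ01 x).2⟩) h.contDiff_field
    (fun j x hx => h.norm_field x (hχs (subset_tsupport _ (right_ne_zero_of_mul hx))))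
    (.of_forall fun j x hxN => ?_) (fun x hxN => ?_) hη hηc hη0 hB hφ hle
  · by_cases hx : x ∈ closedBall p (ρ / 2)
    · have hxb : x ∈ ball p ρ :=
        closedBall_subset_ball (show ρ / 2 < ρ by linarith) hx
      have e : (fun x => step (j * (u x + δ)) * χ x) =ᶠ[𝓝 x] fun x => step (j * (u x + δ)) := by
        filter_upwards [hχnhds x hx] with y hy
        rw [hy, mul_one]
      rw [e.fderiv_eq, fderiv_step_mul hu, fderiv_add_const, norm_smul,
        smul_apply, smul_eq_mul, h.grad x hxb,
        Real.norm_of_nonneg (mul_nonneg j.cast_nonneg (deriv_step_nonneg _))]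
    · have e : (fun x => step (j * (u x + δ)) * χ x) =ᶠ[𝓝 x] fun _ => 0 := by
        by_cases hxb : x ∈ ball p ρ
        · have := hout x hxN hxb hx
          filter_upwards [hu.continuous.continuousAt.eventually_lt continuousAt_const this]
            with y hy
          rw [step_of_le, zero_mul]
          have := mul_nonpos_of_nonneg_of_nonpos (α := ℝ) j.cast_nonneg (le_of_lt hy)
          linarith
        · have hxs : x ∉ tsupport χ := fun hc => hxb (hχs hc)
          filter_upwards [notMem_tsupport_iff_eventuallyEq.1 hxs] with y hy
          rw [hy]; simp
      rw [e.fderiv_eq]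
      simp
  · by_cases hx : x ∈ closedBall p (ρ / 2)
    · have hxb : x ∈ ball p ρ :=
        closedBall_subset_ball (show ρ / 2 < ρ by linarith) hx
      simp only [(hχnhds x hx).self_of_nhds, mul_one]
      convert tendsto_step_mul (u x + δ) using 2
      by_cases hpos : 0 < u x + δ
      · have hxc : x ∈ cap N u p ρ δ := ⟨hxN, hxb, show -δ < u x by linarith⟩
        rw [if_pos hpos, indicator_of_mem hxc]; rfl
      · rw [if_neg hpos, indicator_of_notMem]
        rintro ⟨-, -, hc⟩
        rw [mem_ofPred_eq] at hc
        linarith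
    · have hx0 : (cap N u p ρ δ).indicator (1 : Space n → ℝ) x = 0 := by
        refine indicator_of_notMem (fun hc : x ∈ N ∩ (ball p ρ ∩ {q | -δ < u q}) => ?_) _
        have := hout x hxN hc.2.1 hx
        have h3 : -δ < u x := hc.2.2
        linarith
      rw [hx0]
      refine tendsto_const_nhds.congr fun j => ?_
      by_cases hxb : x ∈ ball p ρ
      · have := hout x hxN hxb hx
        rw [step_of_le, zero_mul]
        have := mul_nonpos_of_nonneg_of_nonpos (α := ℝ) j.cast_nonneg (le_of_lt this)
        linarith
      · rw [image_eq_zero_of_notMem_tsupport fun hc => hxb (hχs hc), mul_zero]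

lemma IsTouching.locallyCaccioppoli (h : IsTouching N p u X ρ) (hN : MeasurableSet N)
    (hδ : δ < (ρ / 2) ^ 4) {U : Set (Space n)} (hU : IsOpen U) (hC : LocallyCaccioppoli N U) :
    LocallyCaccioppoli (N \ cap N u p ρ δ) U := by
  intro V _ hVc hVU
  obtain ⟨η, hη, hηc, hηU, h01, hη1⟩ := exists_cutoff hVc hU hVU
  have hη' : ContDiff ℝ 1 η := hη.of_le (by norm_cast)
  obtain ⟨W, hW, hηW, hWU, hWc⟩ := exists_open_between_and_isCompact_closure hηc.isCompact hU hηU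
  have hfin := (hC W hW hWc hWU).ne
  refine lt_of_le_of_lt (perimeter_le fun φ hφ h1 => h.integral_div_sdiff_cap_le hN hδ hη' hηc
    (fun x => (h01 x).1) (B := (perimeter N W).toReal) (fun ψ hψ hle => ?_) hφ.1 fun x => ?_)
    ENNReal.ofReal_lt_top
  · have hs : tsupport ψ ⊆ tsupport η := closure_mono fun x hx =>
      ((norm_pos_iff.2 hx).trans_le (hle x)).ne'
    exact integral_div_le_perimeter ⟨hψ, hηc.mono' (subset_closure.trans hs), hs.trans hηW⟩
      (fun x => (hle x).trans (h01 x).2) hfin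
  · by_cases hx : x ∈ tsupport φ
    · rw [hη1.self_of_nhdsSet x (subset_closure (hφ.3 hx))]; exact h1 x
    · rw [image_eq_zero_of_notMem_tsupport hx, norm_zero]; exact (h01 x).1

end Cap

/-! ### No strict touching of a stable profile -/

section Core

variable {n : ℕ} {P : Parameters} {R : EReal} {F : ℝ} {L M D : Set (Space n)}
  {σ : Measure (Space n)} {ν : Space n → Space n} {p : Space n} {u : Space n → ℝ}
  {X : Space n → Space n} {ρ δ : ℝ} {t : Bool}

lemma tendsto_integral_cutoff_mul (hR : 1 < R) (hD : MeasurableSet D) (hDR : D ⊆ region R)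
    {G : Space n → ℝ} (hG : IntegrableOn G D) :
    Tendsto (fun k => ∫ x in D, cutoff R k x * G x) atTop (𝓝 (∫ x in D, G x)) := by
  have hex := isExhaustion_cutoff (n := n) hR
  refine tendsto_integral_of_dominated_convergence (fun x => ‖G x‖)
    (fun k => (hex.contDiff k).continuous.aestronglyMeasurable.mul hG.aestronglyMeasurable)
    hG.norm (fun k => .of_forall fun x => ?_) ?_
  · rw [norm_mul, Real.norm_of_nonneg (hex.mem_Icc k x).1]
    exact mul_le_of_le_one_left (norm_nonneg _) (hex.mem_Icc k x).2
  · rw [ae_restrict_iff' hD]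
    refine .of_forall fun x hx => tendsto_const_nhds.congr' ?_
    filter_upwards [hex.eventually_one {x} isCompact_singleton (singleton_subset_iff.2 (hDR hx))]
      with k hk
    rw [hk x rfl, one_mul]

lemma continuous_fderiv_cutoff (hR : 1 < R) (hX : Continuous X) (k : ℕ) :
    Continuous fun x => fderiv ℝ (cutoff R k) x (X x) :=
  (((isExhaustion_cutoff (n := n) hR).contDiff k).continuous_fderiv one_ne_zero).clm_apply hX

/-- The area gained by cutting off a cap `D` of a side of the sheared profile. -/
lemma IsTouching.eventually_integral_le (hR : 1 < R) {f : Space n → ℝ} {e : Space n} {s : ℝ}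
    (hS : IsShear f e s) (hf : IsBump (region R) f) (hG : IsGaussGreen L (region R) σ ν)
    (hL : MeasurableSet L) (hLR : L ⊆ region R)
    (h : IsTouching (side R t (shear f e s '' L)) p u X ρ) (hδ : δ < (ρ / 2) ^ 4) {K : ℝ}
    (hK : ∀ x, ‖fderiv ℝ f x‖ * ‖e‖ ≤ K) (hD : D = cap (side R t (shear f e s '' L)) u p ρ δ)
    {κ θ : ℝ} (hθ : 0 < θ)
    (hκ : ∀ θ > 0, ∀ᶠ k in atTop, κ - θ ≤ ∫ x in D, fderiv ℝ (cutoff R k) x (X x)) :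
    ∀ᶠ k in atTop, ∀ φ : Space n → Space n, ContDiff ℝ 1 φ → (∀ x, ‖φ x‖ ≤ cutoff R k x) →
      ∫ x in side R t (side R t (shear f e s '' L) \ D), divergence φ x
        ≤ ∫ x, cutoff R k x ∂σ + (s * (∫ x, areaDensity f e ν x ∂σ)
          + 2 * K ^ 2 * σ.real (tsupport f) * s ^ 2 - (∫ x in D, divergence X x) - κ) + θ := by
  have hex := isExhaustion_cutoff (n := n) hR
  have hMm : MeasurableSet (shear f e s '' L) := hS.measurableSet_image hL
  have hMR : shear f e s '' L ⊆ region R :=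
    hS.image_subset hLR fun x hx => hf.supp (subset_tsupport f hx)
  have hDm : MeasurableSet D := hD ▸ h.measurableSet_cap (measurableSet_side hMm)
  have hDR : D ⊆ region R := by
    rw [hD]; exact inter_subset_left.trans (side_subset hMR)
  have hDb : D ⊆ closedBall p ρ := by
    rw [hD]
    exact fun q hq => ball_subset_closedBall hq.2.1
  have hint : ∀ G : Space n → ℝ, Continuous G → IntegrableOn G D := fun G hG =>
    (hG.continuousOn.integrableOn_compact (isCompact_closedBall p ρ)).mono_set hDb
  have hdiv := hint _ (continuous_divergence h.contDiff_field)
  have hlim := tendsto_integral_cutoff_mul hR hDm hDR hdiv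
  filter_upwards [hex.eventually_one _ hf.compact.isCompact hf.supp, hκ (θ / 2) (by linarith),
    hlim.eventually (lt_mem_nhds (sub_lt_self _ (half_pos hθ)))] with k hk1 hk2 hk3 φ hφ hle
  have hsupp : ∀ ψ : Space n → Space n, ContDiff ℝ 1 ψ → (∀ x, ‖ψ x‖ ≤ cutoff R k x) →
      IsTest (region R) ψ := fun ψ hψ hle => by
    have hs : tsupport ψ ⊆ tsupport (cutoff R k) := closure_mono fun x hx =>
      ((norm_pos_iff.2 hx).trans_le (hle x)).ne'
    exact ⟨hψ, (hex.compact k).mono' (subset_closure.trans hs), hs.trans (hex.supp k)⟩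
  have hsgn : ∀ ψ : Space n → Space n, ContDiff ℝ 1 ψ → (∀ x, ‖ψ x‖ ≤ cutoff R k x) →
      ∀ A : Set (Space n), sideSign t * ∫ x in A, divergence ψ x
        = ∫ x in A, divergence (fun y => sideSign t • ψ y) x := fun ψ hψ _ A => by
    rw [← integral_const_mul]
    exact integral_congr_ae (.of_forall fun x =>
      (divergence_const_smul _ (hψ.differentiable one_ne_zero x)).symm)
  have hnorm : ∀ ψ : Space n → Space n, (∀ x, ‖ψ x‖ ≤ cutoff R k x) →
      ∀ x, ‖sideSign t • ψ x‖ ≤ cutoff R k x := fun ψ hle x => by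
    rw [norm_smul, Real.norm_eq_abs, abs_sideSign, one_mul]; exact hle x
  rw [integral_side_divergence ((measurableSet_side hMm).diff hDm)
    (sdiff_subset.trans (side_subset hMR)) (hsupp φ hφ hle), hsgn φ hφ hle, hD]
  refine (h.integral_div_sdiff_cap_le (measurableSet_side hMm) hδ (hex.contDiff k) (hex.compact k)
    (fun x => (hex.mem_Icc k x).1) (B := ∫ x, cutoff R k x ∂σ
      + s * (∫ x, areaDensity f e ν x ∂σ) + 2 * K ^ 2 * s ^ 2 * σ.real (tsupport f))
    (fun ψ hψ hψle => ?_) (hφ.const_smul _) (hnorm φ hle)).trans ?_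
  · rw [integral_side_divergence hMm hMR (hsupp ψ hψ hψle), hsgn ψ hψ hψle]
    exact hS.integral_image_divergence_le hG hL hf.supp hK (hex.contDiff k).continuous
      (hex.compact k) (hex.supp k) (hex.mem_Icc k) hk1 (hψ.const_smul _) (hnorm ψ hψle)
  · have e : ∫ x in D, divergence (fun y => cutoff R k y • X y) x
        = (∫ x in D, cutoff R k x * divergence X x)
          + ∫ x in D, fderiv ℝ (cutoff R k) x (X x) := by
      rw [← integral_add (f := fun x => cutoff R k x * divergence X x)
        (hint _ ((hex.contDiff k).continuous.mul
        (continuous_divergence h.contDiff_field)))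
        (hint _ (continuous_fderiv_cutoff hR h.contDiff_field.continuous k))]
      exact integral_congr_ae (.of_forall fun x =>
        divergence_smul ((hex.contDiff k).differentiable one_ne_zero x)
          (h.contDiff_field.differentiable one_ne_zero x))
    rw [← hD, e]
    linarith

lemma exists_ball_volume_lt (p : Space n) {c : ℝ} (hc : 0 < c) :
    ∃ r > 0, volume.real (ball p r) < c := by
  have h : Tendsto (fun r : ℝ => r ^ (n + 1) * volume.real (ball (0 : Space n) 1)) (𝓝[>] 0)
      (𝓝 0) := by
    have : Tendsto (fun r : ℝ => r ^ (n + 1) * volume.real (ball (0 : Space n) 1)) (𝓝 0)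
        (𝓝 (0 ^ (n + 1) * volume.real (ball (0 : Space n) 1))) :=
      ((continuous_pow (n + 1)).mul continuous_const).tendsto 0
    rw [zero_pow (Nat.succ_ne_zero n), zero_mul] at this
    exact this.mono_left nhdsWithin_le_nhds
  obtain ⟨r, hr, hr0⟩ := ((h.eventually (gt_mem_nhds hc)).and self_mem_nhdsWithin).exists
  exact ⟨r, hr0, by rwa [volume_real_ball p (le_of_lt hr0)]⟩

set_option maxHeartbeats 1000000 in
/-- A stable profile is not touched strictly: cutting off a small cap and restoring the volume by a
vertical field far away would decrease the energy. The gain `κ` of the flux at the walls is assumed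
to compensate for the wetting energy and for the dissipation. -/
lemma IsStable.false_of_touching (h : IsStable P R F L σ ν) {lam : ℝ}
    (hmult : ∃ f : Space n → ℝ, IsBump (region R) f ∧ (R ≠ ⊤ → ∫ x in L, fderiv ℝ f x ez = 1) ∧
      firstVar P.g F σ ν f ez = lam ∧ ∃ ρ > 0, ∀ x ∈ tsupport f, ρ ≤ ‖x - p‖)
    (ht : IsTouching (side R t L) p u X ρ)
    (hpos : ∀ r > 0, 0 < volume (side R t L ∩ ball p r))
    (hpde : sideSign t * lam < divergence X p + sideSign t * (P.g * (height p - F)))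
    (hgain : ∃ᶠ δ in 𝓝[>] (0 : ℝ), ∃ κ, (∀ θ > 0, ∀ᶠ k in atTop,
        κ - θ ≤ ∫ x in cap (side R t L) u p ρ δ, fderiv ℝ (cutoff R k) x (X x)) ∧
      wallCost P R L (side R t (side R t L \ cap (side R t L) u p ρ δ)) ≤ κ) : False := by
  have hG := h.gaussGreen
  obtain ⟨f, hf, hV, hA, ρ₁, hρ₁, hfar⟩ := hmult
  obtain ⟨s₀, hs₀, hsh⟩ := exists_isShear (ez : Space n) hf.smooth hf.compact
  obtain ⟨K, hK⟩ := exists_norm_fderiv_le hf.contDiff hf.compact (ez : Space n)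
  set C₁ := 2 * K ^ 2 * σ.real (tsupport f) with hC₁
  set C₂ := ∫ x in L ∩ tsupport f, P.g * (f x * fderiv ℝ f x ez * height (ez : Space n)) with hC₂
  set E : Space n → ℝ := fun x => divergence X x + sideSign t * (P.g * (height x - F)) with hE
  have hEc : Continuous E := (continuous_divergence ht.contDiff_field).add
    (continuous_const.mul (continuous_const.mul (continuous_height.sub continuous_const)))
  obtain ⟨c, hc0, hc⟩ : ∃ c > 0, sideSign t * lam + c < E p :=
    ⟨(E p - sideSign t * lam) / 2, half_pos (sub_pos.2 hpde), by
      have : sideSign t * lam < E p := hpde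
      linarith⟩
  obtain ⟨ρ₂, hρ₂, hρ₂E⟩ := isOpen_iff.1 (isOpen_lt continuous_const hEc) p hc
  set r := min ρ (min ρ₁ ρ₂) with hr
  have hr0 : 0 < r := lt_min ht.radius_pos (lt_min hρ₁ hρ₂)
  have hrρ : r ≤ ρ := min_le_left _ _
  have hr1 : r ≤ ρ₁ := (min_le_right _ _).trans (min_le_left _ _)
  have hr2 : r ≤ ρ₂ := (min_le_right _ _).trans (min_le_right _ _)
  -- caps in the ball of radius `r'` are so small that the quadratic error terms are negligible
  obtain ⟨r', hr'0, hr'⟩ := exists_ball_volume_lt p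
    (lt_min hs₀ (div_pos hc0 (show 0 < |C₁ + C₂| + 1 by positivity)))
  have hsmall : ∀ᶠ δ in 𝓝[>] (0 : ℝ), 0 < δ ∧ δ < (r / 2) ^ 4 ∧ δ < r' ^ 4 := by
    filter_upwards [Ioo_mem_nhdsGT (show 0 < min ((r / 2) ^ 4) (r' ^ 4) from
      lt_min (by positivity) (by positivity))] with δ hδ
    exact ⟨hδ.1, hδ.2.trans_le (min_le_left _ _), hδ.2.trans_le (min_le_right _ _)⟩
  obtain ⟨δ, ⟨κ, hκ, hcost⟩, hδ0, hδr, hδr'⟩ := (hgain.and_eventually hsmall).exists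
  set D := cap (side R t L) u p ρ δ with hD
  have hDm : MeasurableSet D := ht.measurableSet_cap (measurableSet_side h.measurable)
  have hDr : D ⊆ ball p (r / 2) := fun q hq =>
    mem_ball_iff_norm.2 (ht.norm_sub_lt (by positivity) hδr.le hq)
  have hDr' : D ⊆ ball p r' := fun q hq =>
    mem_ball_iff_norm.2 (ht.norm_sub_lt hr'0.le hδr'.le hq)
  have hDr2 : D ⊆ ball p r := hDr.trans (ball_subset_ball (by linarith))
  have hDfin : volume D < ⊤ := (measure_mono hDr').trans_lt measure_ball_lt_top
  set v := volume.real D with hv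
  have hv0 : 0 < v := by
    obtain ⟨a, ha, hab⟩ := isOpen_iff.1
      (isOpen_lt continuous_const ht.contDiff.continuous) p
      (show -δ < u p by rw [ht.center]; linarith)
    refine ENNReal.toReal_pos (ne_of_gt ((hpos (min a ρ) (lt_min ha ht.radius_pos)).trans_le
      (measure_mono fun q hq => ?_))) hDfin.ne
    exact ⟨hq.1, ball_subset_ball (min_le_right _ _) hq.2,
      hab (ball_subset_ball (min_le_left _ _) hq.2)⟩
  have hvr : v < min s₀ (c / (|C₁ + C₂| + 1)) :=
    (measureReal_mono hDr' measure_ball_lt_top.ne).trans_lt hr'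
  -- the shear restores the volume
  set s := sideSign t * v with hs
  have hsabs : |s| = v := by rw [hs, abs_mul, abs_sideSign, one_mul, abs_of_pos hv0]
  have hS : IsShear f ez s := hsh s (by rw [hsabs]; exact (hvr.trans_le (min_le_left _ _)).le)
  have hMm : MeasurableSet (shear f ez s '' L) := hS.measurableSet_image h.measurable
  have hMR : shear f ez s '' L ⊆ region R :=
    hS.image_subset h.subset fun x hx => hf.supp (subset_tsupport f hx)
  have hfball : ∀ x ∈ ball p r, x ∉ tsupport f := fun x hx hxf => by
    have := hfar x hxf
    rw [mem_ball_iff_norm] at hx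
    linarith
  have hMball : side R t (shear f ez s '' L) ∩ ball p r = side R t L ∩ ball p r :=
    side_inter_congr (hS.image_diff fun x hx hxb => hfball x hxb (subset_tsupport f hx))
  have htM : IsTouching (side R t (shear f ez s '' L)) p u X r := ht.mono hr0 hrρ hMball
  have hcap : D = cap (side R t (shear f ez s '' L)) u p r δ :=
    (ht.cap_eq hr0 hrρ hMball (hδr.le.trans (by gcongr; linarith))).symm
  have hDM : D ⊆ side R t (shear f ez s '' L) := by rw [hcap]; exact inter_subset_left
  set M' := side R t (side R t (shear f ez s '' L) \ D) with hM'
  have hM'm : MeasurableSet M' := measurableSet_side ((measurableSet_side hMm).diff hDm)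
  have hM'R : M' ⊆ region R := side_subset (sdiff_subset.trans (side_subset hMR))
  set Q := tsupport f ∪ closedBall p r with hQ
  have hQc : IsCompact Q := hf.compact.isCompact.union (isCompact_closedBall p r)
  have hDQ : D ⊆ Q := fun q hq => Or.inr (ball_subset_closedBall (hDr2 hq))
  have hshear := image_shear_sdiff (L := L) hS
  have hM'Q : M' \ Q = L \ Q := by
    ext q
    have h1 := Set.ext_iff.1 hshear q
    simp only [Set.mem_sdiff] at h1 ⊢
    refine and_congr_left fun hq => ?_
    rw [mem_side_side_sdiff hMR fun hqD => hq (hDQ hqD)]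
    have hqf : q ∉ tsupport f := fun hc => hq (Or.inl hc)
    tauto
  -- the changes of volume and of the gravitational energy
  have hchange : ∀ G : Space n → ℝ, Continuous G →
      (∫ x in M' ∩ Q, G x) - ∫ x in L ∩ Q, G x
        = ((∫ x in shear f ez s '' L ∩ tsupport f, G x) - ∫ x in L ∩ tsupport f, G x)
          - sideSign t * ∫ x in D, G x := fun G hGc => by
    have hint : IntegrableOn G Q := hGc.continuousOn.integrableOn_compact hQc
    rw [hM', integral_side_sdiff hMR hDm hDM hDQ hint,
      ← integral_inter_modify hMm h.measurable (isClosed_tsupport f).measurableSet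
        subset_union_left hQc.measurableSet hshear hint]
    ring
  have hfinQ : ∀ A : Set (Space n), volume (A ∩ Q) ≠ ⊤ := fun A =>
    (measure_lt_top_of_subset inter_subset_right hQc.measure_lt_top.ne).ne
  have hvol : R ≠ ⊤ → volume (M' ∩ Q) = volume (L ∩ Q) := fun hT => by
    have h1 := hchange (fun _ => 1) continuous_const
    have h2 := hS.measureReal_image h.measurable
    simp only [setIntegral_const, smul_eq_mul, mul_one] at h1
    rw [hV hT] at h2
    refine (measureReal_eq_measureReal_iff (hfinQ _) (hfinQ _)).1 ?_
    rw [← hv] at h1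
    linarith
  have hcomp := h.comparison (K := Q) hM'm hM'R hQc hM'Q
    (fun U hU hRU hLC => by
      have h1 := hS.locallyCaccioppoli hU h.measurable (hf.supp.trans hRU) hLC
      have h2 := locallyCaccioppoli_side (t := t) h.radius hMm hMR h1
      have h3 := htM.locallyCaccioppoli (measurableSet_side hMm) hδr hU h2
      rw [← hcap] at h3
      exact locallyCaccioppoli_side h.radius ((measurableSet_side hMm).diff hDm)
        (sdiff_subset.trans (side_subset hMR)) h3)
    hvol
    (fun θ hθ => htM.eventually_integral_le h.radius hS hf hG h.measurable h.subset hδr hK hcap hθ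
      hκ)
  -- the traces on the walls do not see the shear
  have hcost' : wallCost P R L M' ≤ κ := by
    refine le_trans (le_of_eq (wallCost_congr (isClosed_tsupport f) hf.supp ?_)) hcost
    ext q
    have h1 := Set.ext_iff.1 hshear q
    simp only [Set.mem_sdiff] at h1 ⊢
    refine and_congr_left fun hq => ?_
    have hLM : q ∈ shear f ez s '' L ↔ q ∈ L := by tauto
    have hsd : q ∈ side R t (shear f ez s '' L) ↔ q ∈ side R t L := by
      cases t
      · simp only [side_false, Set.mem_sdiff, hLM]
      · simpa using hLM
    rw [hM']
    cases t
    · simp only [side_false, Set.mem_sdiff] at hsd ⊢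
      rw [hsd]
    · simp only [side_true, Set.mem_sdiff] at hsd ⊢
      rw [hsd]
  have hgr := hchange (fun x => P.g * (height x - F))
    (continuous_const.mul (continuous_height.sub continuous_const))
  rw [hS.integral_gravity_image hG h.measurable hf.supp, ← hC₂] at hgr
  rw [firstVar_eq hG hf] at hA
  have hint1 : IntegrableOn (divergence X) D :=
    ((continuous_divergence ht.contDiff_field).continuousOn.integrableOn_compact
      (isCompact_closedBall p r)).mono_set (hDr2.trans ball_subset_closedBall)
  have hint2 : IntegrableOn (fun x => P.g * (height x - F)) D :=
    ((continuous_const.mul (continuous_height.sub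
      continuous_const)).continuousOn.integrableOn_compact (isCompact_closedBall p r)).mono_set
      (hDr2.trans ball_subset_closedBall)
  have hEint : ∫ x in D, E x = (∫ x in D, divergence X x)
      + sideSign t * ∫ x in D, P.g * (height x - F) := by
    rw [← integral_const_mul, ← integral_add hint1 (hint2.const_mul _)]
  have hElow : (sideSign t * lam + c) * v ≤ ∫ x in D, E x := by
    have h1 : ∫ _ in D, (sideSign t * lam + c) = (sideSign t * lam + c) * v := by
      rw [setIntegral_const, smul_eq_mul, mul_comm]
    rw [← h1]
    refine setIntegral_mono_on (integrableOn_const hDfin.ne) (hint1.add (hint2.const_mul _)) hDm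
      fun x hx => ?_
    exact le_of_lt (hρ₂E (ball_subset_ball hr2 (hDr2 hx)))
  have hs2 : s ^ 2 = v ^ 2 := by rw [← hsabs, sq_abs]
  have hslam : s * (∫ x, areaDensity f ez ν x ∂σ)
      + s * ∫ x, P.g * (height x - F) * f x * ⟪ez, ν x⟫ ∂σ = sideSign t * lam * v := by
    rw [← mul_add, hA, hs]; ring
  rw [hs2] at hcomp hgr
  have hfinal : c * v ≤ (C₁ + C₂) * v ^ 2 := by
    linear_combination hcomp + hcost' + hElow + hgr + hEint + hslam - v ^ 2 * hC₁
  have h1 : c ≤ (C₁ + C₂) * v := by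
    by_contra! hcon
    nlinarith
  have h2 : (C₁ + C₂) * v ≤ |C₁ + C₂| * v := by gcongr; exact le_abs_self _
  have h3 : v < c / (|C₁ + C₂| + 1) := hvr.trans_le (min_le_right _ _)
  rw [lt_div_iff₀ (by positivity)] at h3
  nlinarith

end Core

/-! ### The gain at a wall -/

section WallGain

variable {n : ℕ} {P : Parameters} {R : EReal} {F : ℝ} {S L D : Set (Space n)}
  {σ : Measure (Space n)} {ν : Space n → Space n} {p e : Space n} {u r : Space n → ℝ}
  {A : Space n ≃ₗᵢ[ℝ] Space n} {X : Space n → Space n} {ρ ρ' δ ε : ℝ} {t : Bool}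

/-- The flux of `X` through the part of the wall wetted by `D` is more than `a` times its area, if
`X` makes an angle of cosine more than `a` with the normal of the wall. -/
lemma IsWallPoint.exists_chart_gain (h : IsWallPoint R S r p A e) (hX : ContDiff ℝ 1 X) {a : ℝ}
    (hX1 : ∀ᶠ q in 𝓝 p, ‖X q‖ ≤ 1) (hR : 1 < R) (ha : a < ⟪e, X p⟫) {U : Set (Space n)}
    (hU : U ∈ 𝓝 p) :
    ∃ ε ρ, ball p ρ ⊆ U ∧ WallChart R S r p A ε ρ ∧ ∀ D W : Set (Space n),
      MeasurableSet D → D ⊆ region R → (∀ q ∈ D, ‖q - p‖ < ρ / 4) →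
      W ⊆ S ∩ ball p ρ → (∀ q ∈ W, ‖q - p‖ ≤ ρ / 4) →
      (∀ᵐ y ∂(μHE[n] : Measure (Space n)).restrict (S ∩ ball p ρ),
        (y ∈ W ∧ HasZeroDensity (region R \ D) y) ∨ (y ∉ W ∧ HasZeroDensity D y)) →
      ∀ θ > 0, ∀ᶠ k in atTop,
        a * (area W).toReal - θ ≤ ∫ x in D, fderiv ℝ (cutoff R k) x (X x) := by
  obtain ⟨b, hab, hbm⟩ := exists_between ha
  obtain ⟨m', hbm', hm'⟩ := exists_between hbm
  have hpow : Tendsto (fun ε : ℝ => b * (1 - ε) ^ n) (𝓝[>] 0) (𝓝 b) := by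
    have : Tendsto (fun ε : ℝ => b * (1 - ε) ^ n) (𝓝 0) (𝓝 (b * (1 - 0) ^ n)) :=
      (continuous_const.mul ((continuous_const.sub continuous_id).pow n)).tendsto 0
    rw [sub_zero, one_pow, mul_one] at this
    exact this.mono_left nhdsWithin_le_nhds
  have hlin : Tendsto (fun ε : ℝ => (|b| + 1) * ε) (𝓝[>] 0) (𝓝 0) := by
    have : Tendsto (fun ε : ℝ => (|b| + 1) * ε) (𝓝 0) (𝓝 ((|b| + 1) * 0)) :=
      tendsto_id.const_mul _
    rw [mul_zero] at this
    exact this.mono_left nhdsWithin_le_nhds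
  obtain ⟨ε, hε1, hε2, hε0, hε4⟩ := ((hpow.eventually (lt_mem_nhds hab)).and
    ((hlin.eventually (gt_mem_nhds (sub_pos.2 hbm'))).and
      (Ioo_mem_nhdsGT (show (0 : ℝ) < 1 / 4 by norm_num)))).exists
  have hXe : ∀ᶠ q in 𝓝 p, m' < ⟪e, X q⟫ :=
    (continuous_const.inner hX.continuous).continuousAt.eventually (lt_mem_nhds hm')
  obtain ⟨ρ, hρU, hc⟩ := h.exists_chart ε hε0 hε4.le _ (inter_mem hU (inter_mem hX1 hXe))
  have hρ := hc.radius_pos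
  refine ⟨ε, ρ, hρU.trans inter_subset_left, hc, fun D W hD hDR hDp hWS hWp hae θ hθ => ?_⟩
  have hDb : D ⊆ ball p ρ := fun q hq => mem_ball_iff_norm.2 (by linarith [hDp q hq])
  have hint : ∀ G : Space n → ℝ, Continuous G → IntegrableOn G D := fun G hG =>
    (hG.continuousOn.integrableOn_compact (isCompact_closedBall p ρ)).mono_set
      (hDb.trans ball_subset_closedBall)
  have hlim := hc.tendsto_lintegral_wallFlux (a := ρ / 2) (by positivity) (by linarith) hD hDR
    (fun q hq => by linarith [hDp q hq]) hWS (fun q hq => by linarith [hWp q hq]) hae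
  have hWfin : area W < ⊤ := (measure_mono hWS).trans_lt hc.area_lt_top
  have hπ := volume_image_frameProj_le A p W
  have hlim' : Tendsto (fun k : ℕ => ∫ q in D, wallFlux r A k q) atTop
      (𝓝 (volume.real (frameProj A p '' W))) := by
    refine ((ENNReal.tendsto_toReal (hπ.trans_lt hWfin).ne).comp hlim).congr fun k => ?_
    refine (integral_eq_lintegral_of_nonneg_ae ?_
      (hc.continuous_wallFlux k).aestronglyMeasurable).symm
    rw [EventuallyLE, ae_restrict_iff' hD]
    exact .of_forall fun q hq => hc.wallFlux_nonneg k (hDb hq)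
  have hfinal : a * (area W).toReal ≤ b * volume.real (frameProj A p '' W) := by
    rcases lt_or_ge a 0 with ha0 | ha0
    · have h1 : volume.real (frameProj A p '' W) ≤ (area W).toReal :=
        ENNReal.toReal_mono hWfin.ne hπ
      have h2 : (0 : ℝ) ≤ volume.real (frameProj A p '' W) := measureReal_nonneg
      nlinarith
    · have hpos : 0 < (1 - ε) ^ n := pow_pos (by linarith) n
      have h1 : (area W).toReal ≤ (1 - ε)⁻¹ ^ n * volume.real (frameProj A p '' W) := by
        have := ENNReal.toReal_mono (ENNReal.mul_ne_top ENNReal.ofReal_ne_top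
          (hπ.trans_lt hWfin).ne) (hc.area_le hWS)
        rwa [ENNReal.toReal_mul, ENNReal.toReal_ofReal (by
          rw [inv_pow]; exact (inv_pos.2 hpos).le)] at this
      have h2 : (0 : ℝ) ≤ volume.real (frameProj A p '' W) := measureReal_nonneg
      calc a * (area W).toReal
          ≤ (b * (1 - ε) ^ n) * ((1 - ε)⁻¹ ^ n * volume.real (frameProj A p '' W)) :=
            mul_le_mul hε1.le h1 ENNReal.toReal_nonneg (by linarith)
        _ = b * volume.real (frameProj A p '' W) := by
            rw [inv_pow]; field_simp
  filter_upwards [hc.cutoff_eq, (hlim'.const_mul b).eventually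
    (lt_mem_nhds (sub_lt_self _ hθ))] with k hk1 hk2
  refine (by linarith : a * (area W).toReal - θ ≤ b * ∫ q in D, wallFlux r A k q).trans ?_
  rw [← integral_const_mul]
  refine setIntegral_mono_on ((hint _ (hc.continuous_wallFlux k)).const_mul b)
    (hint _ (continuous_fderiv_cutoff hR hX.continuous k)) hD fun q hq => ?_
  have hqb := hDb hq
  have hev : cutoff R k =ᶠ[𝓝 q] fun q => step (k * r q) := by
    filter_upwards [isOpen_ball.mem_nhds hqb] with y hy
    exact hk1 y hy
  rw [hev.fderiv_eq, fderiv_step_mul (hc.smooth.of_le (by norm_cast)),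
    smul_apply, smul_eq_mul, wallFlux]
  obtain ⟨-, hX1q, hXeq⟩ := hρU hqb
  rw [mem_ofPred_eq] at hX1q hXeq
  have h1 := hc.norm_fderiv_sub_le hqb (X q)
  rw [h.height_frame, abs_le] at h1
  have h2 := hc.fderiv_frame_pos hqb
  have h3 : b * fderiv ℝ r q (A.symm ez) ≤ b + |b| * ε := by
    have : b * (fderiv ℝ r q (A.symm ez) - 1) ≤ |b| * ε := by
      refine (le_abs_self _).trans ?_
      rw [abs_mul]
      gcongr
      rw [abs_le]
      exact ⟨by linarith [h2.1], by linarith [h2.2]⟩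
    linarith
  have h4 : ε * ‖X q‖ ≤ ε := mul_le_of_le_one_right hε0.le hX1q
  have h5 : b * fderiv ℝ r q (A.symm ez) ≤ fderiv ℝ r q (X q) := by linarith [h1.1]
  have h6 : 0 ≤ (k : ℝ) * deriv step (k * r q) :=
    mul_nonneg k.cast_nonneg (deriv_step_nonneg _)
  calc b * (k * deriv step (k * r q) * fderiv ℝ r q (A.symm ez))
      = k * deriv step (k * r q) * (b * fderiv ℝ r q (A.symm ez)) := by ring
    _ ≤ _ := mul_le_mul_of_nonneg_left h5 h6

lemma HasZeroDensity.union {E E' : Set (Space n)} {y : Space n} (h : HasZeroDensity E y)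
    (h' : HasZeroDensity E' y) : HasZeroDensity (E ∪ E') y := fun δ hδ => by
  filter_upwards [h (δ / 2) (half_pos hδ), h' (δ / 2) (half_pos hδ)] with t h1 h2
  rw [union_inter_distrib_right]
  refine (measureReal_union_le _ _).trans ?_
  linarith

lemma HasZeroDensity.subset {E E' : Set (Space n)} {y : Space n} (h : HasZeroDensity E y)
    (hE : E' ⊆ E) : HasZeroDensity E' y :=
  h.mono one_pos (inter_subset_left.trans hE)

lemma hasZeroDensity_empty (y : Space n) : HasZeroDensity ∅ y := fun δ hδ => by
  filter_upwards [self_mem_nhdsWithin] with t ht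
  rw [empty_inter, measureReal_empty]
  exact mul_nonneg hδ.le (pow_nonneg (le_of_lt ht) _)

/-- At almost every point of the wall the cap has a trace, and the traces of the profile and of the
cap determine the trace of the modified profile. -/
lemma WallChart.ae_trace_cap (h : WallChart R S r p A ε ρ') (hS : IsWall R S)
    (hL : MeasurableSet L) (hLR : L ⊆ region R) (hG : IsGaussGreen L (region R) σ ν)
    (hσ : σ (ball p ρ') < ⊤) (ht : IsTouching (side R t L) p u X ρ)
    (hρ : ball p ρ' ⊆ ball p ρ)
    (hδ : (μHE[n] : Measure (Space n)).restrict (S ∩ ball p ρ') {q | u q = -δ} = 0)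
    (hD : D = cap (side R t L) u p ρ δ) :
    ∀ᵐ y ∂(μHE[n] : Measure (Space n)).restrict (S ∩ ball p ρ'),
      ((y ∈ trace R S D ∧ HasZeroDensity (region R \ D) y) ∨
        (y ∉ trace R S D ∧ HasZeroDensity D y)) ∧
      (y ∈ trace R S D ↔ (y ∈ trace R S L ∧ y ∉ trace R S (side R t (side R t L \ D)) ∧ t = true) ∨
        (y ∉ trace R S L ∧ y ∈ trace R S (side R t (side R t L \ D)) ∧ t = false)) ∧
      (y ∉ trace R S D → (y ∈ trace R S (side R t (side R t L \ D)) ↔ y ∈ trace R S L)) := by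
  have hDm : MeasurableSet D := hD ▸ ht.measurableSet_cap (measurableSet_side hL)
  have hDN : D ⊆ side R t L := by rw [hD]; exact inter_subset_left
  have hDR : D ⊆ region R := hDN.trans (side_subset hLR)
  have hM : MeasurableSet (side R t (side R t L \ D)) :=
    measurableSet_side ((measurableSet_side hL).diff hDm)
  have hmS : MeasurableSet (S ∩ ball p ρ') := h.isClosed_relative
  have hae : ∀ᵐ y ∂(μHE[n] : Measure (Space n)).restrict (S ∩ ball p ρ'), u y ≠ -δ := by
    rw [ae_iff]; simpa using hδ
  filter_upwards [h.ae_trace hL hLR hG hσ, hae, ae_restrict_mem hmS] with y hy hyu hyS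
  obtain ⟨c, hc, hlow⟩ := hS.lower_density hyS.1
  have hin : ∀ E : Set (Space n), MeasurableSet E → HasZeroDensity (region R \ E) y →
      y ∈ trace R S E := fun E hE hz => mem_trace_of_hasZeroDensity hyS.1 hE hc hlow hz
  have hout : ∀ E : Set (Space n), HasZeroDensity E y → y ∉ trace R S E := fun E hz =>
    notMem_trace_of_hasZeroDensity hc hlow (hz.subset inter_subset_left)
  have hLcase : HasZeroDensity (region R \ L) y ∧ y ∈ trace R S L ∨
      HasZeroDensity L y ∧ y ∉ trace R S L := by tauto
  -- off the level set, the cap agrees with the side near `y`, or is empty there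
  have hDcase : HasZeroDensity D y ∨
      (HasZeroDensity (region R \ D) y ∧ HasZeroDensity (region R \ side R t L) y) := by
    rcases lt_or_gt_of_ne hyu with hlt | hgt
    · obtain ⟨s, hs, hb⟩ := isOpen_iff.1
        (isOpen_lt ht.contDiff.continuous continuous_const) y hlt
      refine Or.inl ((hasZeroDensity_empty y).mono hs fun q hq => ?_)
      have h1 : u q < -δ := hb hq.2
      have h2 : q ∈ cap (side R t L) u p ρ δ := hD ▸ hq.1
      have h3 : -δ < u q := h2.2.2
      exact absurd h1 (not_lt.2 h3.le)
    · obtain ⟨s, hs, hb⟩ := isOpen_iff.1 (isOpen_ball.inter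
        (isOpen_lt continuous_const ht.contDiff.continuous)) y
        ⟨hρ hyS.2, hgt⟩
      have hsub : ∀ q ∈ ball y s, q ∈ side R t L → q ∈ D := fun q hq hqN => by
        rw [hD]; exact ⟨hqN, hb hq⟩
      have hNcase : HasZeroDensity (side R t L) y ∨ HasZeroDensity (region R \ side R t L) y := by
        cases t
        · rw [side_false, Set.sdiff_sdiff_right_self, inter_eq_self_of_subset_right hLR]
          tauto
        · rw [side_true]; tauto
      refine hNcase.imp (fun h => h.subset hDN) fun h => ⟨h.mono hs fun q hq => ?_, h⟩
      exact ⟨hq.1.1, fun hqN => hq.1.2 (hsub q hq.2 hqN)⟩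
  cases t
  · have e : side R false (side R false L \ D) = L ∪ D := by
      ext q
      have h1 := @hLR q
      have h2 := @hDR q
      simp only [side_false, Set.mem_sdiff, mem_union]
      tauto
    rw [e] at hM ⊢
    rcases hDcase with hz | ⟨hz, hzN⟩
    · have h1 := hout D hz
      rcases hLcase with ⟨hl, hm⟩ | ⟨hl, hm⟩
      · have h2 := hin _ hM (hl.subset (sdiff_subset_sdiff_right subset_union_left))
        tauto
      · have h2 := hout _ (hl.union hz)
        tauto
    · have h1 := hin D hDm hz
      have h2 := hin _ hM (hz.subset (sdiff_subset_sdiff_right subset_union_right))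
      have h3 : y ∉ trace R S L :=
        hout L (hz.subset fun q hq => ⟨hLR hq, fun hqD => (hDN hqD).2 hq⟩)
      tauto
  · simp only [side_true] at hM hDN hDcase ⊢
    rcases hDcase with hz | ⟨hz, hzN⟩
    · have h1 := hout D hz
      rcases hLcase with ⟨hl, hm⟩ | ⟨hl, hm⟩
      · have h2 := hin _ hM ((hl.union hz).subset fun q hq => by
          by_cases hqL : q ∈ L
          · exact Or.inr (by_contra fun hqD => hq.2 ⟨hqL, hqD⟩)
          · exact Or.inl ⟨hq.1, hqL⟩)
        tauto
      · have h2 := hout (L \ D) (hl.subset Set.sdiff_subset)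
        tauto
    · have h1 := hin D hDm hz
      have h2 := hin L hL hzN
      have h3 : y ∉ trace R S (L \ D) := hout _ (hz.subset (sdiff_subset_sdiff_left hLR))
      tauto

lemma and_not_iff_of_iff {a b c : Prop} (h : a ↔ ¬b ∧ c) (h' : ¬a → (c ↔ b)) :
    (c ∧ ¬b ↔ a) ∧ ¬(b ∧ ¬c) := by tauto

set_option maxHeartbeats 800000 in
/-- Cutting off arbitrarily small caps at a point of a wall: the wetted area changes by the trace of
the cap, and the flux at the wall gains at least `c` times this area. -/
lemma IsStable.frequently_gain (h : IsStable P R F L σ ν) (hS : IsWall R S)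
    (hp : IsWallPoint R S r p A e) (ht : IsTouching (side R t L) p u X ρ) {c : ℝ}
    (hc : c < ⟪e, X p⟫) {U : Set (Space n)} (hU : U ∈ 𝓝 p) :
    ∃ᶠ δ in 𝓝[>] (0 : ℝ), ∃ a : ℝ, (∀ θ > 0, ∀ᶠ k in atTop,
        c * a - θ ≤ ∫ x in cap (side R t L) u p ρ δ, fderiv ℝ (cutoff R k) x (X x)) ∧
      (area (trace R S (side R t (side R t L \ cap (side R t L) u p ρ δ)) \ trace R S L)).toReal
        = (bif t then 0 else a) ∧
      (area (trace R S L \ trace R S (side R t (side R t L \ cap (side R t L) u p ρ δ)))).toReal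
        = (bif t then a else 0) ∧
      ∀ S' : Set (Space n), Disjoint S' U →
        trace R S' (side R t (side R t L \ cap (side R t L) u p ρ δ)) = trace R S' L := by
  have hX1 : ∀ᶠ q in 𝓝 p, ‖X q‖ ≤ 1 := by
    filter_upwards [ball_mem_nhds p ht.radius_pos] with q hq
    exact ht.norm_field q hq
  obtain ⟨ε, ρ', hρU, hch, hgain⟩ := hp.exists_chart_gain ht.contDiff_field hX1 h.radius hc
    (inter_mem hU (ball_mem_nhds p ht.radius_pos))
  have hρ' := hch.radius_pos
  set μS := (μHE[n] : Measure (Space n)).restrict (S ∩ ball p ρ') with hμS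
  have hfinS : IsFiniteMeasure μS :=
    ⟨by rw [hμS, Measure.restrict_apply_univ]; exact hch.area_lt_top⟩
  -- almost every level set of `u` is null on the wall
  have hcount : {δ : ℝ | 0 < μS {q | u q = -δ}}.Countable :=
    (Measure.countable_meas_level_set_pos (μ := μS)
      ht.contDiff.continuous.measurable).preimage neg_injective
  have hfreq : ∃ᶠ δ in 𝓝[>] (0 : ℝ), μS {q | u q = -δ} = 0 := by
    rw [frequently_iff]
    intro V hV
    obtain ⟨b, hb, hsub⟩ := mem_nhdsGT_iff_exists_Ioo_subset.1 hV
    obtain ⟨δ, hδ, h1, h2⟩ := (hcount.dense_compl ℝ).exists_between hb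
    exact ⟨δ, hsub ⟨h1, h2⟩, by simpa using hδ⟩
  have hsmall : ∀ᶠ δ in 𝓝[>] (0 : ℝ), δ ≤ (ρ' / 4) ^ 4 := by
    filter_upwards [Ioo_mem_nhdsGT (show 0 < (ρ' / 4) ^ 4 by positivity)] with δ hδ
    exact hδ.2.le
  refine (hfreq.and_eventually hsmall).mono fun δ ⟨hδ0, hδ⟩ => ?_
  set D := cap (side R t L) u p ρ δ with hD
  set M := side R t (side R t L \ D) with hM
  have hDm : MeasurableSet D := ht.measurableSet_cap (measurableSet_side h.measurable)
  have hDp : ∀ q ∈ D, ‖q - p‖ < ρ' / 4 := fun q hq => ht.norm_sub_lt (by positivity) hδ hq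
  have hDR : D ⊆ region R := inter_subset_left.trans (side_subset h.subset)
  have hσ : σ (ball p ρ') < ⊤ := by
    refine (measure_mono fun q hq => ?_).trans_lt (h.gaussGreen.measure_closedBall_lt_top h.radius
      h.surface_ne_top (‖p‖ + ρ'))
    rw [mem_closedBall_zero_iff]
    have := norm_le_norm_add_norm_sub' q p
    rw [mem_ball_iff_norm] at hq
    linarith
  have hae := hch.ae_trace_cap hS h.measurable h.subset h.gaussGreen hσ ht
    (hρU.trans inter_subset_right) hδ0 hD
  have hcl : closure D ⊆ closedBall p (ρ' / 4) :=
    closure_minimal (fun q hq => mem_closedBall_iff_norm.2 (hDp q hq).le) isClosed_closedBall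
  have hKb : closedBall p (ρ' / 4) ⊆ ball p ρ' :=
    closedBall_subset_ball (by linarith)
  have hMK : M \ closedBall p (ρ' / 4) = L \ closedBall p (ρ' / 4) := by
    ext q
    refine and_congr_left fun hq => mem_side_side_sdiff h.subset fun hqD => ?_
    exact hq (hcl (subset_closure hqD))
  have htr : ∀ S' : Set (Space n), ∀ y, y ∉ closedBall p (ρ' / 4) →
      (y ∈ trace R S' M ↔ y ∈ trace R S' L) := fun S' y hy =>
    mem_trace_iff_of_diff_eq isClosed_closedBall hy hMK
  have hWS : trace R S D ⊆ S ∩ ball p ρ' := fun y hy =>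
    ⟨hy.1, hKb (hcl (trace_subset_closure D hy))⟩
  have hcongr : ∀ E E' : Set (Space n), E ⊆ S ∩ ball p ρ' → E' ⊆ S ∩ ball p ρ' →
      (∀ᵐ y ∂μS, y ∈ E ↔ y ∈ E') → (area E).toReal = (area E').toReal := by
    intro E E' hE hE' hEE
    have h1 : μS E = μS E' := measure_congr (hEE.mono fun y hy => propext hy)
    rw [hμS, Measure.restrict_eq_self _ hE, Measure.restrict_eq_self _ hE'] at h1
    rw [area, area, h1]
  have hs1 : trace R S M \ trace R S L ⊆ S ∩ ball p ρ' := fun y hy =>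
    ⟨hy.1.1, hKb (by_contra fun hc => hy.2 ((htr S y hc).1 hy.1))⟩
  have hs2 : trace R S L \ trace R S M ⊆ S ∩ ball p ρ' := fun y hy =>
    ⟨hy.1.1, hKb (by_contra fun hc => hy.2 ((htr S y hc).2 hy.1))⟩
  have h0 : (area (∅ : Set (Space n))).toReal = 0 := by simp [area]
  refine ⟨(area (trace R S D)).toReal, hgain D (trace R S D) hDm hDR hDp hWS
    (fun q hq => mem_closedBall_iff_norm.1 (hcl (trace_subset_closure D hq)))
    (hae.mono fun y hy => hy.1), ?_, ?_, fun S' hS' => ?_⟩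
  · cases t
    · refine hcongr _ _ hs1 hWS (hae.mono fun y ⟨_, h2, h3⟩ => ?_)
      simp only [Bool.false_eq_true, and_false, and_true, false_or] at h2
      exact (and_not_iff_of_iff h2 h3).1
    · refine (hcongr _ ∅ hs1 (empty_subset _) (hae.mono fun y ⟨_, h2, h3⟩ => ?_)).trans h0
      simp only [Bool.true_eq_false, and_false, and_true, or_false] at h2
      exact iff_of_false (and_not_iff_of_iff (h2.trans and_comm) fun h => (h3 h).symm).2 id
  · cases t
    · refine (hcongr _ ∅ hs2 (empty_subset _) (hae.mono fun y ⟨_, h2, h3⟩ => ?_)).trans h0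
      simp only [Bool.false_eq_true, and_false, and_true, false_or] at h2
      exact iff_of_false (and_not_iff_of_iff h2 h3).2 id
    · refine hcongr _ _ hs2 hWS (hae.mono fun y ⟨_, h2, h3⟩ => ?_)
      simp only [Bool.true_eq_false, and_false, and_true, or_false] at h2
      exact (and_not_iff_of_iff (h2.trans and_comm) fun h => (h3 h).symm).1
  · ext y
    by_cases hy : y ∈ S'
    · refine htr S' y fun hc => ?_
      exact Set.disjoint_left.1 hS' hy (hρU (hKb hc)).1
    · exact ⟨fun h => absurd h.1 hy, fun h => absurd h.1 hy⟩

/-- The hypothesis on the gain in `IsStable.false_of_touching`. -/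
def HasGain (P : Parameters) (R : EReal) (t : Bool) (L : Set (Space n)) (p : Space n)
    (u : Space n → ℝ) (X : Space n → Space n) (ρ : ℝ) : Prop :=
  ∃ᶠ δ in 𝓝[>] (0 : ℝ), ∃ κ, (∀ θ > 0, ∀ᶠ k in atTop,
      κ - θ ≤ ∫ x in cap (side R t L) u p ρ δ, fderiv ℝ (cutoff R k) x (X x)) ∧
    wallCost P R L (side R t (side R t L \ cap (side R t L) u p ρ δ)) ≤ κ

lemma disjoint_thinCyl (hR : 1 < R) : Disjoint (thinCyl R : Set (Space n)) (thinCyl 1) :=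
  Set.disjoint_left.2 fun q h1 h2 => by
    have e1 : ((‖horiz q‖ : ℝ) : EReal) = R := h1
    have e2 : ((‖horiz q‖ : ℝ) : EReal) = 1 := h2
    exact hR.ne (e2.symm.trans e1)

lemma IsStable.hasGain_interior (h : IsStable P R F L σ ν) (ht : IsTouching (side R t L) p u X ρ)
    (hp : p ∈ region R) : HasGain P R t L p u X ρ := by
  obtain ⟨s, hs, hb⟩ := isOpen_iff.1 (isOpen_region R) p hp
  have hK : closedBall p (s / 2) ⊆ region R :=
    (closedBall_subset_ball (by linarith)).trans hb
  have hsmall : ∀ᶠ δ in 𝓝[>] (0 : ℝ), δ ≤ (s / 2) ^ 4 := by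
    filter_upwards [Ioo_mem_nhdsGT (show 0 < (s / 2) ^ 4 by positivity)] with δ hδ
    exact hδ.2.le
  refine (hsmall.mono fun δ hδ => ⟨0, fun θ hθ => ?_, le_of_eq ?_⟩).frequently
  · filter_upwards [(isExhaustion_cutoff h.radius).eventually_one _ (isCompact_closedBall p (s / 2))
      hK] with k hk
    rw [setIntegral_eq_zero_of_forall_eq_zero fun x hx => ?_]
    · linarith
    · have hev : cutoff R k =ᶠ[𝓝 x] fun _ => 1 := by
        filter_upwards [isOpen_ball.mem_nhds
          (mem_ball_iff_norm.2 (ht.norm_sub_lt (by positivity) hδ hx))] with y hy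
        exact hk y (ball_subset_closedBall hy)
      rw [hev.fderiv_eq]
      simp
  · rw [wallCost_congr (M' := L) isClosed_closedBall hK]
    · simp [wallCost, area]
    · ext q
      refine and_congr_left fun hq => mem_side_side_sdiff h.subset fun hqD => ?_
      exact hq (mem_closedBall_iff_norm.2 (ht.norm_sub_lt (by positivity) hδ hqD).le)

lemma IsStable.hasGain_plate (h : IsStable P R F L σ ν) (ht : IsTouching (side R t L) p u X ρ)
    (hp : p ∈ thinCyl 1)
    (hc : (bif t then P.muMinus + P.cosYp else P.muPlus - P.cosYp) < ⟪radial p, X p⟫) :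
    HasGain P R t L p u X ρ := by
  obtain ⟨A, hA⟩ := exists_isWallPoint_plate h.radius hp
  have hU : (thinCyl R : Set (Space n))ᶜ ∈ 𝓝 p :=
    (isClosed_thinCyl R).isOpen_compl.mem_nhds
      fun hc => Set.disjoint_left.1 (disjoint_thinCyl h.radius) hc hp
  refine (h.frequently_gain (isWall_plate h.radius) hA ht hc hU).mono
    fun δ ⟨a, h1, h2, h3, h4⟩ => ⟨_, h1, le_of_eq ?_⟩
  have h5 := h4 (thinCyl R) disjoint_compl_right
  simp only [wallCost, plateContact, containerContact, h5, h2, h3]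
  cases t <;> simp [area]

lemma IsStable.hasGain_container (h : IsStable P R F L σ ν) (ht : IsTouching (side R t L) p u X ρ)
    (hp : p ∈ thinCyl R) (hc : sideSign t * P.cosYc < ⟪-radial p, X p⟫) :
    HasGain P R t L p u X ρ := by
  have hT : R ≠ ⊤ := by
    rintro rfl
    simp [thinCyl_top] at hp
  obtain ⟨A, hA⟩ := exists_isWallPoint_container h.radius hT hp
  have hU : (thinCyl 1 : Set (Space n))ᶜ ∈ 𝓝 p :=
    (isClosed_thinCyl 1).isOpen_compl.mem_nhds
      fun hc => Set.disjoint_left.1 (disjoint_thinCyl h.radius) hp hc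
  refine (h.frequently_gain (isWall_container h.radius) hA ht hc hU).mono
    fun δ ⟨a, h1, h2, h3, h4⟩ => ⟨_, h1, le_of_eq ?_⟩
  have h5 := h4 (thinCyl 1) disjoint_compl_right
  simp only [wallCost, plateContact, containerContact, h5, h2, h3]
  cases t <;> simp [area]

end WallGain

/-! ### Normal fields of test regions -/

section UnitField

variable {E : Type*} [NormedAddCommGroup E] [InnerProductSpace ℝ E]

/-- A smooth odd field on the whole space which is `v / ‖v‖` for `‖v‖ ≥ 1 / 2`. -/
def unitField (v : E) : E := (1 / √(1 + step (4 * ‖v‖ ^ 2) * (‖v‖ ^ 2 - 1))) • v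

lemma contDiff_unitField {k : ℕ∞} : ContDiff ℝ k (unitField : E → E) := by
  have hs : ContDiff ℝ k fun v : E => 1 + step (4 * ‖v‖ ^ 2) * (‖v‖ ^ 2 - 1) :=
    contDiff_const.add (((contDiff_step.of_le (by exact_mod_cast le_top)).comp
      (contDiff_const.mul (contDiff_norm_sq ℝ))).mul ((contDiff_norm_sq ℝ).sub contDiff_const))
  have hpos : ∀ v : E, 0 < 1 + step (4 * ‖v‖ ^ 2) * (‖v‖ ^ 2 - 1) := fun v => by
    have h := step_mem_Icc (4 * ‖v‖ ^ 2)
    by_cases hv : 4 * ‖v‖ ^ 2 ≤ 1 / 2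
    · rw [step_of_le hv]
      norm_num
    · nlinarith [h.1, h.2]
  exact (contDiff_const.div (hs.sqrt fun v => (hpos v).ne')
    fun v => (Real.sqrt_pos.2 (hpos v)).ne').smul contDiff_id

lemma unitField_of_le {v : E} (hv : 1 / 2 ≤ ‖v‖) : unitField v = (1 / ‖v‖) • v := by
  rw [unitField, step_of_ge (by nlinarith)]
  simp

lemma unitField_smul {c : ℝ} (hc : |c| = 1) (v : E) : unitField (c • v) = c • unitField v := by
  simp only [unitField, norm_smul, Real.norm_eq_abs, hc, one_mul]
  rw [smul_comm]

end UnitField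

section Coordinates

variable {n m : ℕ}

lemma hasFDerivAt_isometry (e : Space n ≃ᵃⁱ[ℝ] Space n) (p : Space n) :
    HasFDerivAt e (e.linearIsometryEquiv.toContinuousLinearEquiv : Space n →L[ℝ] Space n) p :=
  (e.linearIsometryEquiv.toContinuousLinearEquiv.hasFDerivAt.add_const
    (e 0)).congr_of_eventuallyEq (.of_forall fun q => by simpa using e.map_vadd 0 q)

lemma divergence_isometry (e : Space n ≃ᵃⁱ[ℝ] Space n) {Z : Space n → Space n} {p : Space n}
    (hZ : DifferentiableAt ℝ Z (e p)) :
    divergence (fun q => e.linearIsometryEquiv.symm (Z (e q))) p = divergence Z (e p) := by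
  set B := e.linearIsometryEquiv with hB
  have h1 := hasFDerivAt_isometry e p
  have h2 := (B.symm.toContinuousLinearEquiv.hasFDerivAt).comp p (hZ.hasFDerivAt.comp p h1)
  have h3 : HasFDerivAt (fun q => B.symm (Z (e q))) _ p := h2
  rw [divergence_eq_trace, divergence_eq_trace, h3.fderiv,
    ← LinearMap.trace_conj' (fderiv ℝ Z (e p) : Space n →ₗ[ℝ] Space n) B.symm.toLinearEquiv]
  congr 1

lemma contDiff_join {k : WithTop ℕ∞} {E : Type*} [NormedAddCommGroup E] [NormedSpace ℝ E]
    {f : E → Horiz n} {h : E → ℝ} (hf : ContDiff ℝ k f) (hh : ContDiff ℝ k h) :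
    ContDiff ℝ k fun x => join (f x) (h x) := by
  rw [contDiff_euclidean] at hf ⊢
  refine Fin.lastCases ?_ fun i => ?_
  · simpa [join] using hh
  · simpa [join] using hf i

/-- The divergence of a field which does not depend on the height. -/
lemma divergence_join {V : Horiz n → Horiz n} {w : Horiz n → ℝ} (hV : ContDiff ℝ 1 V)
    (hw : ContDiff ℝ 1 w) (y : Space n) :
    divergence (fun y => join (V (horiz y)) (w (horiz y))) y = divergence V (horiz y) := by
  obtain ⟨A, hA, hAv⟩ := hasFDerivAt_horiz y
  have hZ : DifferentiableAt ℝ (fun y => join (V (horiz y)) (w (horiz y))) y :=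
    (contDiff_join (hV.comp contDiff_horiz) (hw.comp contDiff_horiz)).differentiable one_ne_zero y
  have hVd := hV.differentiable one_ne_zero (horiz y)
  rw [divergence, Fin.sum_univ_castSucc, divergence, ← fderiv_coord hZ]
  have hl : (fun x : Space n => join (V (horiz x)) (w (horiz x)) (Fin.last n))
      = fun x => w (horiz x) := by
    funext x
    simp [join]
  have h0 : fderiv ℝ (fun x : Space n => w (horiz x)) y (EuclideanSpace.single (Fin.last n) 1)
      = 0 := by
    have h : HasFDerivAt (fun x : Space n => w (horiz x)) _ y :=
      (hw.differentiable one_ne_zero (horiz y)).hasFDerivAt.comp y hA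
    rw [h.fderiv, ContinuousLinearMap.comp_apply, hAv]
    change fderiv ℝ w (horiz y) (horiz (ez : Space n)) = 0
    simp
  rw [hl, h0, add_zero]
  refine Finset.sum_congr rfl fun i _ => ?_
  rw [← fderiv_coord hZ]
  have hi : (fun x : Space n => join (V (horiz x)) (w (horiz x)) i.castSucc)
      = fun x => V (horiz x) i := by
    funext x
    simp [join]
  have h : HasFDerivAt (fun x : Space n => V (horiz x)) _ y := hVd.hasFDerivAt.comp y hA
  have h' : HasFDerivAt (fun x : Space n => V (horiz x) i) _ y :=
    (EuclideanSpace.proj i : Horiz n →L[ℝ] ℝ).hasFDerivAt.comp y h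
  rw [hi, h'.fderiv]
  simp only [ContinuousLinearMap.comp_apply, hAv]
  have : horiz (EuclideanSpace.single i.castSucc (1 : ℝ) : Space n)
      = EuclideanSpace.single i 1 := by
    ext j
    simp [horiz]
  rw [this]
  rfl

end Coordinates

section Level

variable {n : ℕ} (Φ : TestRegion n) {p : Space n} {τ : ℝ}

/-- The defining function of a test region, negative inside. -/
def TestRegion.level (q : Space n) : ℝ := height (Φ.chart q) - Φ.graph (horiz (Φ.chart q))

/-- The vector `(-∇φ, 1)` in the coordinates of the graph. -/
def TestRegion.graphGrad (y : Space n) : Space n := join (-gradient Φ.graph (horiz y)) 1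

/-- The gradient of the defining function. -/
def TestRegion.levelGrad (q : Space n) : Space n :=
  Φ.chart.linearIsometryEquiv.symm (Φ.graphGrad (Φ.chart q))

/-- The gradient of `τ * level - ‖· - p‖ ^ 4`. -/
def TestRegion.bentGrad (p : Space n) (τ : ℝ) (q : Space n) : Space n :=
  τ • Φ.levelGrad q - (4 * ‖q - p‖ ^ 2) • (q - p)

lemma contDiff_gradient {φ : Horiz n → ℝ} (h : ContDiff ℝ ∞ φ) : ContDiff ℝ 1 (gradient φ) :=
  (InnerProductSpace.toDual ℝ (Horiz n)).symm.toContinuousLinearEquiv.contDiff.comp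
    (h.fderiv_right (m := 1) (by norm_cast))

lemma TestRegion.contDiff_chart : ContDiff ℝ 1 Φ.chart := by
  have hA : ∀ q, Φ.chart q = Φ.chart.linearIsometryEquiv q + Φ.chart 0 := fun q => by
    simpa using Φ.chart.map_vadd 0 q
  rw [show (Φ.chart : Space n → Space n) = _ from funext hA]
  exact Φ.chart.linearIsometryEquiv.toContinuousLinearEquiv.contDiff.add contDiff_const

lemma TestRegion.contDiff_graphGrad : ContDiff ℝ 1 Φ.graphGrad :=
  contDiff_join (((contDiff_gradient Φ.smooth).comp contDiff_horiz).neg) contDiff_const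

lemma TestRegion.contDiff_levelGrad : ContDiff ℝ 1 Φ.levelGrad :=
  Φ.chart.linearIsometryEquiv.symm.toContinuousLinearEquiv.contDiff.comp
    (Φ.contDiff_graphGrad.comp Φ.contDiff_chart)

lemma TestRegion.contDiff_level : ContDiff ℝ 1 Φ.level :=
  (contDiff_height.comp Φ.contDiff_chart).sub
    ((Φ.smooth.of_le (by norm_cast)).comp (contDiff_horiz.comp Φ.contDiff_chart))

lemma TestRegion.norm_graphGrad (y : Space n) :
    ‖Φ.graphGrad y‖ = √(1 + ‖gradient Φ.graph (horiz y)‖ ^ 2) := by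
  rw [← Real.sqrt_sq (norm_nonneg (Φ.graphGrad y)), norm_sq_space, graphGrad, horiz_join,
    height_join, norm_neg]
  congr 1
  ring

lemma TestRegion.one_le_norm_levelGrad (q : Space n) : 1 ≤ ‖Φ.levelGrad q‖ := by
  rw [levelGrad, LinearIsometryEquiv.norm_map, norm_graphGrad]
  exact Real.one_le_sqrt.2 (by nlinarith [sq_nonneg ‖gradient Φ.graph (horiz (Φ.chart q))‖])

lemma TestRegion.unitField_levelGrad (q : Space n) :
    unitField (Φ.levelGrad q) = Φ.chart.linearIsometryEquiv.symm
      ((1 / √(1 + ‖gradient Φ.graph (horiz (Φ.chart q))‖ ^ 2)) • Φ.graphGrad (Φ.chart q)) := by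
  rw [unitField_of_le (by linarith [Φ.one_le_norm_levelGrad q]), map_smul, levelGrad,
    LinearIsometryEquiv.norm_map, norm_graphGrad]

lemma TestRegion.unitField_levelGrad_eq_normal (q : Space n) :
    unitField (Φ.levelGrad q) = Φ.normal q := Φ.unitField_levelGrad q

lemma TestRegion.divergence_unitField_levelGrad (p : Space n) :
    divergence (fun q => unitField (Φ.levelGrad q)) p = -Φ.meanCurvature p := by
  have hg := contDiff_gradient Φ.smooth
  set w : Horiz n → ℝ := fun x => 1 / √(1 + ‖gradient Φ.graph x‖ ^ 2) with hw
  have hpos : ∀ x, 0 < 1 + ‖gradient Φ.graph x‖ ^ 2 := fun x => by positivity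
  have hwc : ContDiff ℝ 1 w := contDiff_const.div
    ((contDiff_const.add (hg.norm_sq ℝ)).sqrt fun x => (hpos x).ne')
    fun x => (Real.sqrt_pos.2 (hpos x)).ne'
  have hVc : ContDiff ℝ 1 fun x => -(w x • gradient Φ.graph x) := (hwc.smul hg).neg
  have hZ : ∀ y, w (horiz y) • Φ.graphGrad y
      = join (-(w (horiz y) • gradient Φ.graph (horiz y))) (w (horiz y)) := fun y => by
    rw [← join_horiz_height (w (horiz y) • Φ.graphGrad y)]
    simp [graphGrad]
  have hZd := (contDiff_join (hVc.comp contDiff_horiz) (hwc.comp (contDiff_horiz (n := n)))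
    ).differentiable one_ne_zero (Φ.chart p)
  simp only [Φ.unitField_levelGrad]
  change divergence (fun q => Φ.chart.linearIsometryEquiv.symm
    (w (horiz (Φ.chart q)) • Φ.graphGrad (Φ.chart q))) p = _
  simp only [hZ]
  exact (divergence_isometry Φ.chart hZd).trans
    ((divergence_join hVc hwc (Φ.chart p)).trans (divergence_neg _ _))

lemma TestRegion.fderiv_level (q v : Space n) : fderiv ℝ Φ.level q v = ⟪Φ.levelGrad q, v⟫ := by
  set B := Φ.chart.linearIsometryEquiv with hB
  have h1 := hasFDerivAt_isometry Φ.chart q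
  obtain ⟨D, hD, hDv⟩ := hasFDerivAt_horiz (Φ.chart q)
  have h2 := (((contDiff_height (k := 1)).differentiable one_ne_zero
    (Φ.chart q)).hasFDerivAt).comp q h1
  have h3 := ((Φ.smooth.differentiable (by simp) (horiz (Φ.chart q))).hasFDerivAt).comp q
    (hD.comp q h1)
  have h4 : HasFDerivAt Φ.level _ q := h2.sub h3
  rw [h4.fderiv, levelGrad, ← hB, LinearIsometryEquiv.inner_map_eq_flip, B.symm_symm,
    inner_space, graphGrad, horiz_join, height_join, inner_neg_left, gradient,
    InnerProductSpace.toDual_symm_apply]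
  simp only [sub_apply, ContinuousLinearMap.comp_apply, fderiv_height, hDv]
  change height (B v) - fderiv ℝ Φ.graph (horiz (Φ.chart q)) (horiz (B v)) = _
  ring

lemma TestRegion.fderiv_bent (q v : Space n) :
    fderiv ℝ (fun q => τ * Φ.level q - ‖q - p‖ ^ 4) q v = ⟪Φ.bentGrad p τ q, v⟫ := by
  have h1 : HasFDerivAt (fun q => ‖q - p‖ ^ 2) (2 • (innerSL ℝ (q - p)).comp
      (ContinuousLinearMap.id ℝ (Space n))) q := ((hasFDerivAt_id q).sub_const p).norm_sq
  have h2 := ((Φ.contDiff_level.differentiable one_ne_zero q).hasFDerivAt.const_mul τ).sub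
    (h1.pow 2)
  have h3 : HasFDerivAt (fun q => τ * Φ.level q - ‖q - p‖ ^ 4) _ q :=
    h2.congr_of_eventuallyEq (.of_forall fun q => by simp only [Pi.sub_apply]; ring)
  rw [h3.fderiv]
  simp only [sub_apply, smul_apply, Φ.fderiv_level,
    bentGrad, inner_sub_left, inner_smul_left, ContinuousLinearMap.comp_apply, innerSL_apply_apply]
  simp
  ring

/-- A set lying on one side of a test region is touched strictly by a level surface of a bent
defining function, whose normal field has the divergence of the normal of the test region. -/
lemma TestRegion.exists_isTouching (hp : Φ.level p = 0) (hτ : |τ| = 1) {N : Set (Space n)} {r : ℝ}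
    (hr : 0 < r) (hN : ∀ q ∈ N ∩ ball p r, τ * Φ.level q ≤ 0) :
    ∃ u X ρ, IsTouching N p u X ρ ∧ X p = τ • Φ.normal p ∧
      divergence X p = -(τ * Φ.meanCurvature p) := by
  have hQ : ContDiff ℝ 1 fun q : Space n => (4 * ‖q - p‖ ^ 2) • (q - p) :=
    (contDiff_const.mul ((contDiff_id.sub contDiff_const).norm_sq ℝ)).smul
      (contDiff_id.sub contDiff_const)
  have hb : ContDiff ℝ 1 (Φ.bentGrad p τ) := (Φ.contDiff_levelGrad.const_smul τ).sub hQ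
  have hbp : Φ.bentGrad p τ p = τ • Φ.levelGrad p := by simp [bentGrad]
  have hU : ContDiff ℝ 1 (unitField : Space n → Space n) := contDiff_unitField
  have hnp : 1 / 2 < ‖Φ.bentGrad p τ p‖ := by
    rw [hbp, norm_smul, Real.norm_eq_abs, hτ]
    linarith [Φ.one_le_norm_levelGrad p]
  obtain ⟨s, hs, hsb⟩ := isOpen_iff.1
    (isOpen_lt continuous_const hb.continuous.norm) p hnp
  have hX : ∀ q ∈ ball p (min r s),
      unitField (Φ.bentGrad p τ q) = (1 / ‖Φ.bentGrad p τ q‖) • Φ.bentGrad p τ q ∧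
        0 < ‖Φ.bentGrad p τ q‖ := fun q hq => by
    have h : 1 / 2 < ‖Φ.bentGrad p τ q‖ := hsb (ball_subset_ball (min_le_right _ _) hq)
    exact ⟨unitField_of_le h.le, by linarith⟩
  -- the quartic term makes the touching strict and has no second derivative at `p`
  refine ⟨fun q => τ * Φ.level q - ‖q - p‖ ^ 4, fun q => unitField (Φ.bentGrad p τ q), min r s,
    ⟨lt_min hr hs, ?_, hU.comp hb, fun q hq => ?_, fun q hq => ?_, by simp [hp], fun q hq => ?_⟩,
    ?_, ?_⟩
  · have : ContDiff ℝ 1 fun q : Space n => τ * Φ.level q - (‖q - p‖ ^ 2) ^ 2 :=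
      (contDiff_const.mul Φ.contDiff_level).sub
        (((contDiff_id.sub contDiff_const).norm_sq ℝ).pow 2)
    simpa only [← pow_mul] using this
  · obtain ⟨h1, h2⟩ := hX q hq
    rw [h1, norm_smul, norm_div, norm_one, norm_norm, one_div, inv_mul_cancel₀ h2.ne']
  · obtain ⟨h1, h2⟩ := hX q hq
    have e : fderiv ℝ (fun q => τ * Φ.level q - ‖q - p‖ ^ 4) q = innerSL ℝ (Φ.bentGrad p τ q) :=
      ContinuousLinearMap.ext fun v => by rw [Φ.fderiv_bent, innerSL_apply_apply]
    rw [e, h1, innerSL_apply_norm, innerSL_apply_apply, inner_smul_right,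
      real_inner_self_eq_norm_sq]
    field_simp
  · linarith [hN q ⟨hq.1, ball_subset_ball (min_le_left _ _) hq.2⟩]
  · beta_reduce
    rw [hbp, unitField_smul hτ, Φ.unitField_levelGrad_eq_normal]
  · -- the bending does not contribute to the first derivative of the normal field at `p`
    have hQ0 : HasFDerivAt (fun q : Space n => (4 * ‖q - p‖ ^ 2) • (q - p))
        (0 : Space n →L[ℝ] Space n) p := by
      have hcd : ContDiff ℝ 1 fun q : Space n => 4 * ‖q - p‖ ^ 2 :=
        contDiff_const.mul ((contDiff_id.sub contDiff_const).norm_sq ℝ)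
      have hc := (hcd.differentiable one_ne_zero p).hasFDerivAt
      refine (hc.smul ((hasFDerivAt_id p).sub_const p)).congr_fderiv ?_
      ext v
      simp
    have h1 := ((Φ.contDiff_levelGrad.const_smul τ).differentiable one_ne_zero p).hasFDerivAt
    have h2 : HasFDerivAt (Φ.bentGrad p τ) _ p := h1.sub hQ0
    rw [sub_zero] at h2
    have hUd := (hU.differentiable one_ne_zero (τ • Φ.levelGrad p)).hasFDerivAt
    have h3 := hUd.comp p h1
    rw [← hbp] at hUd
    have h4 := hUd.comp p h2
    rw [hbp] at h4
    have e : fderiv ℝ (fun q => unitField (Φ.bentGrad p τ q)) p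
        = fderiv ℝ (fun q => unitField (τ • Φ.levelGrad q)) p := h4.fderiv.trans h3.fderiv.symm
    have e2 : divergence (fun q => unitField (Φ.bentGrad p τ q)) p
        = divergence (fun q => unitField (τ • Φ.levelGrad q)) p := by
      simp only [divergence, e]
    rw [e2]
    simp only [unitField_smul hτ]
    have hd : DifferentiableAt ℝ (fun q => unitField (Φ.levelGrad q)) p :=
      (hU.comp Φ.contDiff_levelGrad).differentiable one_ne_zero p
    rw [divergence_const_smul τ hd, Φ.divergence_unitField_levelGrad]
    ring

end Level

/-! ### Viscosity solutions -/

section Viscosity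

variable {n : ℕ} {P : Parameters} {R : EReal} {F lam : ℝ} {L L₀ M : Set (Space n)}
  {σ : Measure (Space n)} {ν : Space n → Space n} {Φ : TestRegion n} {p : Space n} {t : Bool}

lemma IsStable.congr (h : IsStable P R F L σ ν) (he : L =ᵐ[volume] M) (hM : MeasurableSet M)
    (hMR : M ⊆ region R) : IsStable P R F M σ ν where
  elliptic := h.elliptic
  radius := h.radius
  measurable := hM
  subset := hMR
  stable := h.stable.congr he (hMR.trans subset_closure)
  gaussGreen := isGaussGreen_congr he h.gaussGreen
  surface_ne_top := surfaceEnergy_congr he ▸ h.surface_ne_top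
  gravity_ne_top := gravityEnergy_congr he ▸ h.gravity_ne_top

/-- The number `lam` is the multiplier of the profile, as seen by some vertical field away from `p`
with unit flux; the flux is not prescribed if `R = ∞`. -/
def IsMultiplierAway (P : Parameters) (R : EReal) (F : ℝ) (L : Set (Space n))
    (σ : Measure (Space n)) (ν : Space n → Space n) (lam : ℝ) (p : Space n) : Prop :=
  ∃ f : Space n → ℝ, IsBump (region R) f ∧ (R ≠ ⊤ → ∫ x in L, fderiv ℝ f x ez = 1) ∧
    firstVar P.g F σ ν f ez = lam ∧ ∃ ρ > 0, ∀ x ∈ tsupport f, ρ ≤ ‖x - p‖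

lemma IsMultiplierAway.congr (h : IsMultiplierAway P R F L σ ν lam p) (he : L =ᵐ[volume] M) :
    IsMultiplierAway P R F M σ ν lam p := by
  obtain ⟨f, h1, h2, h3⟩ := h
  exact ⟨f, h1, fun hT => by rw [← setIntegral_congr_set he]; exact h2 hT, h3⟩

/-- The touching criterion in terms of the test region, for both sides at once. -/
lemma IsStable.viscosity (h : IsStable P R F L σ ν) (hm : IsMultiplierAway P R F L σ ν lam p)
    (hΦ : Φ.level p = 0) (hpR : p ∈ closure (region R)) {r : ℝ} (hr : 0 < r)
    (hN : ∀ q ∈ side R t L ∩ ball p r, sideSign t * Φ.level q ≤ 0)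
    (hpos : ∀ r > 0, 0 < volume (side R t L ∩ ball p r)) :
    sideSign t * (-Φ.meanCurvature p + P.g * (height p - F)) ≤ sideSign t * lam ∨
      (p ∈ thinCyl 1 ∧ sideSign t * Φ.cosPlate p
        ≤ bif t then P.muMinus + P.cosYp else P.muPlus - P.cosYp) ∨
      (p ∈ thinCyl R ∧ sideSign t * Φ.cosContainer p ≤ sideSign t * P.cosYc) := by
  by_contra! hcon
  obtain ⟨h1, h2, h3⟩ := hcon
  obtain ⟨u, X, ρ, ht, hXp, hdiv⟩ := Φ.exists_isTouching hΦ abs_sideSign hr hN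
  refine h.false_of_touching hm ht hpos (by rw [hdiv]; linarith) ?_
  rcases closure_region_subset hpR with hp | hp | hp
  · exact h.hasGain_interior ht hp
  · refine h.hasGain_plate ht hp ((h2 hp).trans_eq ?_)
    rw [hXp, inner_smul_right, TestRegion.cosPlate, inner_neg_right, neg_neg, real_inner_comm]
  · refine h.hasGain_container ht hp ((h3 hp).trans_eq ?_)
    rw [hXp, inner_smul_right, TestRegion.cosContainer, inner_neg_left, real_inner_comm]

lemma TestRegion.level_nonpos_of_mem_closure {q : Space n} (hq : q ∈ closure Φ.carrier) :
    Φ.level q ≤ 0 :=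
  closure_minimal (t := {q | Φ.level q ≤ 0})
    (fun q (hq : height (Φ.chart q) < _) => (sub_neg.2 hq).le)
    (isClosed_le Φ.contDiff_level.continuous continuous_const) hq

lemma TestRegion.level_eq_zero (hp : p ∈ frontier Φ.carrier) : Φ.level p = 0 := by
  have ho : IsOpen Φ.carrier := isOpen_lt (continuous_height.comp Φ.contDiff_chart.continuous)
    (Φ.smooth.continuous.comp (continuous_horiz.comp Φ.contDiff_chart.continuous))
  rw [ho.frontier_eq] at hp
  refine le_antisymm (level_nonpos_of_mem_closure hp.1) (not_lt.1 fun hlt => hp.2 ?_)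
  exact sub_neg.1 hlt

lemma IsStable.isViscositySubsolution (h : IsStable P R F L₀ σ ν) (hL : L₀ ⊆ L ∩ region R)
    (he : L₀ =ᵐ[volume] L) (hnorm : IsNormalized R L)
    (hm : ∀ p, IsMultiplierAway P R F L₀ σ ν lam p) : IsViscositySubsolution P R F lam L := by
  rintro Φ p ⟨hp, hpL, -, r, hr, hsub⟩
  have hae : (L ∩ region R : Set (Space n)) =ᵐ[volume] L₀ := by
    have := he.symm.inter (ae_eq_refl (μ := volume) (region R))
    rwa [inter_eq_left.2 h.subset] at this
  have h1 := h.viscosity (t := true) (hm p) (Φ.level_eq_zero hp)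
    (closure_mono inter_subset_right hpL) hr (fun q hq => by
      rw [sideSign_true, one_mul]
      exact TestRegion.level_nonpos_of_mem_closure (hsub ⟨subset_closure (hL hq.1), hq.2⟩))
    fun s hs => (hnorm.1 p hpL s hs).trans_eq (measure_congr (hae.inter (ae_eq_refl _)))
  simpa [add_comm P.muMinus] using h1

lemma IsStable.isViscositySupersolution (h : IsStable P R F L₀ σ ν)
    (he : L₀ =ᵐ[volume] L) (hnorm : IsNormalized R L)
    (hm : ∀ p, IsMultiplierAway P R F L₀ σ ν lam p) : IsViscositySupersolution P R F lam L := by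
  rintro Φ p ⟨hp, hpc, hpn, r, hr, hsub⟩
  -- a Borel representative of the air inside the complement of `L`
  obtain ⟨N, hNs, hN, hNe⟩ := ((measurableSet_region (n := n) R).nullMeasurableSet.diff
    (h.measurable.nullMeasurableSet.congr he)).exists_measurable_subset_ae_eq
  have hNR : N ⊆ region R := hNs.trans sdiff_subset
  have heq : L₀ =ᵐ[volume] (region R \ N : Set (Space n)) := by
    have h1 : (region R \ N : Set (Space n)) =ᵐ[volume] (region R \ (region R \ L₀) : Set _) :=
      (ae_eq_refl _).diff (hNe.trans ((ae_eq_refl _).diff he.symm))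
    rw [Set.sdiff_sdiff_right_self, inter_eq_right.2 h.subset] at h1
    exact h1.symm
  have hside : side R false (region R \ N) = N := by
    rw [side_false, Set.sdiff_sdiff_right_self, inter_eq_right.2 hNR]
  have hpR : p ∈ closure (region R) := closure_minimal sdiff_subset isClosed_closure hpc
  have hpA : p ∈ closure (region R \ L) := by
    by_contra hcon
    exact hpn ⟨hpR, hcon⟩
  have h1 := (h.congr heq ((measurableSet_region R).diff hN) sdiff_subset).viscosity (t := false)
    ((hm p).congr heq) (Φ.level_eq_zero hp) hpR hr (fun q hq => by
      rw [hside] at hq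
      rw [sideSign_false, neg_one_mul, neg_nonpos]
      by_contra! hlt
      exact (hsub ⟨⟨sub_neg.1 hlt, subset_closure (hNR hq.1)⟩, hq.2⟩).2
        (subset_closure (hNs hq.1)))
    fun s hs => by
      rw [hside]
      exact (hnorm.2 p hpA s hs).trans_eq (measure_congr (hNe.symm.inter (ae_eq_refl _)))
  rw [sideSign_false] at h1
  rcases h1 with h1 | ⟨hp1, h1⟩ | ⟨hp1, h1⟩
  · exact Or.inl (by linarith)
  · exact Or.inr (Or.inl ⟨hp1, by simp only [cond_false] at h1; linarith⟩)
  · exact Or.inr (Or.inr ⟨hp1, by linarith⟩)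

/-- Stability passes to a Borel representative, and the conclusions pass back to `L`. -/
lemma GloballyStable.exists_multiplier_isViscositySolution (hn : 1 ≤ n) (hP : P.Elliptic)
    (hR : 1 < R) (hL : GloballyStable P R F L) (hnorm : IsNormalized R L) :
    ∃ lam : ℝ, (R = ⊤ → lam = 0) ∧ IsLagrangeMultiplier P R F L lam ∧
      IsViscositySolution P R F lam L := by
  obtain ⟨L₀, σ, ν, hsub, he, h⟩ := exists_isStable hP hR hL
  obtain ⟨lam, h0, ⟨σ', ν', hG, hlam⟩, hm⟩ := h.exists_multiplier hn
  have haway : ∀ p, IsMultiplierAway P R F L₀ σ ν lam p := fun p => by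
    by_cases hT : R = ⊤
    · refine ⟨fun _ => 0, isBump_zero, fun hT' => absurd hT hT', ?_, 1, one_pos, ?_⟩
      · simp [h0 hT, firstVar, varDensity, areaDensity]
      · exact fun x hx => absurd hx ((isBump_zero (U := (∅ : Set (Space n)))).supp ·)
    · obtain ⟨f, h1, h2, h3, ρ, hρ, h4⟩ := hm hT (horiz p)
      refine ⟨f, h1, fun _ => h2, h3, ρ, hρ, fun x hx => (h4 x hx).trans ?_⟩
      rw [← horiz_sub]
      exact norm_horiz_le _
  exact ⟨lam, h0, ⟨σ', ν', isGaussGreen_congr he hG, hlam⟩,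
    h.isViscositySubsolution hsub he hnorm haway, h.isViscositySupersolution he hnorm haway⟩

end Viscosity

end

end Capillary

theorem theorem3p5 (n : ℕ) (hn : 1 ≤ n) (P : Capillary.Parameters) (hP : P.Elliptic)
    (R : EReal) (hR : 1 < R) (F : ℝ) (L : Set (Capillary.Space n))
    (hL : Capillary.GloballyStable P R F L) (hnorm : Capillary.IsNormalized R L) :
    ∃ lam : ℝ, (R = ⊤ → lam = 0) ∧
      Capillary.IsLagrangeMultiplier P R F L lam ∧
      Capillary.IsViscositySolution P R F lam L :=
  hL.exists_multiplier_isViscositySolution hn hP hR hnorm
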